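/- **Setting.** Let $\mathcal R$ be a commutative ring with $1$ (with decidable equality), let $n,T,D$ be natural numbers, and let $f\in\mathcal R[x_1,\dots,x_n]$ be given by a straight-line program with $L\ge 1$ instructions (each loads a constant of $\mathcal R$ or a variable, or adds, subtracts or multiplies two earlier results; $f$ is the last result). Assume $\#f\le T$, where $\#f$ is the number of terms, and $\deg f<D$. **The algorithm UIPoly** has as input $T\ge \#g$, $D>\deg g$ and a univariate polynomial $g$ that can be probed, i.e. $g \bmod (x^m-1)$ can be computed for every $m\ge 1$. 1. Put $N_1=\max\{1,\lceil (T-1)\log_2 D\rceil\}$, $N_2=\lceil T\log_2 D\rceil$, $N=\max\{4N_1,N_1+N_2-1\}$. Find the first $N$ primes $p_1,\dots,p_N$ and the least $K$ with $p_1\cdots p_K\ge D$. Let $g_j=g\bmod(x^{p_j}-1)$ for $j\le N$, and $h=0$. 2. Let $j_0$ be the least index for which the number of terms of $g_{j_0}$ is maximal. If this number is $0$, return $h$. Put $p=p_{j_0}$. 3. Let $G_k=(g-h)\bmod(x^{pp_k}-1)$ for $k\le K$. For each term $ax^d$ of $g_{j_0}$ such that every $G_k$ has exactly one term whose exponent $b_k$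 is $\equiv d \pmod p$, find by Chinese remaindering the $\beta$ with $0\le\beta<p_1\cdots p_K$ and $\beta\equiv b_k\pmod{p_k}$ for all $k\le K$; if $\beta<D$, put $ax^\beta$ into the set $U$. 4. Let $s$ be the sum of those $u\in U$ for which at least $N_2$ of the indices $j\le N_1+N_2-1$ satisfy $\#(g_j-u \bmod (x^{p_j}-1))<\#g_j$. Replace $h$ by $h+s$ and $T$ by $T-\#s$, recompute $N_1,N_2,N$, replace $g_j$ by $g_j-s\bmod(x^{p_j}-1)$ for $j\le N$, and go to 2. **The algorithm MPolySIKron** applies UIPoly to $f(x,x^D,\dots,x^{D^{n-1}})$ with the bounds $T$ and $D^n$, and replaces each term $ax^d$ of the result by $a\,x_1^{e_1}\cdots x_n^{e_n}$, where $d=e_1+e_2D+\dots+e_nD^{n-1}$ is the $D$-adic expansion. A probe modulo $x^m-1$ is made by carrying out the straight-line program in $\mathcal R[x]/(x^m-1)$ with $x^{D^{i-1}\bmod m}$ in place of $x_i$. **Costs.** Additions, subtractions, multiplications and equality tests in $\mathcal R$ are ring operations; loading, adding or subtracting elements of $\mathcal R[x]/(x^m-1)$ counts as $m$ ring operations, and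 a multiplication there as the number of operations of the routine used, a straight-line program depending only on $m$. Arithmetic operations and comparisons of natural numbers (exponents, primes, counters) are charged the number of gates of Boolean circuits that carry them out, and writing an exponent or addressing a coefficient by its exponent is charged its bit length. $\varphi\in O^\sim(\psi)$ means $\varphi\le C\,\psi\,(\log_2(3+\psi))^k$ for some constants $C,k$. **Theorem.** With suitable routines for the multiplication modulo $x^m-1$ (one for each $m$, valid over every commutative ring) and for integer arithmetic (one circuit for each operation and bit length), the algorithm MPolySIKron returns exactly the list of all terms of $f$ (exponent vectors and nonzero coefficients, each term once). If $n\ge1$, $T\ge1$ and $D\ge2$, it uses $$O^\sim\big(Ln^2T^2\log^2 D+Ln^3T\log^3 D\big)$$ ring operations in $\mathcal R$ and, besides these, $$O^\sim\big(n^2T\log^2 D+nT^2\log D\big)$$ bit operations. The routines and the constants in $O^\sim$ are absolute: they do not depend on $\mathcal R$, $n$, $T$, $D$ or the straight-line program. -/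

import Mathlib

universe u v w

namespace SLPInterp

/-! ### Straight-line programs -/

/-- An instruction over `n` inputs with constants in `K`: load a constant, load an input, or combine
the results of two earlier instructions, referred to by their positions `0, 1, 2, …`. -/
inductive Instr (K : Type u) (n : ℕ) : Type u
  | const (c : K)
  | var (i : Fin n)
  | add (j k : ℕ)
  | sub (j k : ℕ)
  | mul (j k : ℕ)

namespace Instr

variable {K : Type u} {n : ℕ} {A : Type v} [CommRing A]

/-- All references of the instruction point to positions before `l`. -/
def RefsBelow (l : ℕ) : Instr K n → Prop
  | const _ => True
  | var _ => True
  | add j k => j < l ∧ k < l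
  | sub j k => j < l ∧ k < l
  | mul j k => j < l ∧ k < l

/-- The value of an instruction, given the list `mem` of earlier results. -/
def eval (κ : K → A) (x : Fin n → A) (mem : List A) : Instr K n → A
  | const c => κ c
  | var i => x i
  | add j k => mem.getD j 0 + mem.getD k 0
  | sub j k => mem.getD j 0 - mem.getD k 0
  | mul j k => mem.getD j 0 * mem.getD k 0

/-- The list of the results of all instructions. -/
def run (κ : K → A) (x : Fin n → A) (code : List (Instr K n)) : List A :=
  code.foldl (fun mem I => mem ++ [I.eval κ x mem]) []

end Instr

/-- A straight-line program over `R` in `n` variables. -/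
structure SLP (R : Type u) (n : ℕ) where
  code : List (Instr R n)
  code_ne_nil : code ≠ []
  wf : ∀ (l : ℕ) (h : l < code.length), (code[l]'h).RefsBelow l

/-- The size (number of instructions) `L` of a straight-line program. -/
def SLP.size {R : Type u} {n : ℕ} (S : SLP R n) : ℕ := S.code.length

/-- The polynomial given by a straight-line program: the result of its last instruction. -/
noncomputable def SLP.poly {R : Type u} [CommRing R] {n : ℕ} (S : SLP R n) :
    MvPolynomial (Fin n) R :=
  (Instr.run MvPolynomial.C MvPolynomial.X S.code).getLastD 0

/-! ### Arithmetic routines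

Multiplication in `A[x]/(x^m - 1)` and integer arithmetic are carried out by programs made of single
operations; their cost is the number of instructions. -/

/-- A program with `n` inputs, the constants `0` and `1`, and a list of output positions.  It can be
run in every commutative ring; run in `ZMod 2` it is a Boolean circuit (`add` and `sub` are XOR
gates, `mul` is an AND gate).  A reference to a position that does not exist is read as `0`. -/
structure Program (n : ℕ) where
  code : List (Instr Bool n)
  out : List ℕ

/-- The list of output values of a program. -/
def Program.eval {n : ℕ} (P : Program n) {A : Type v} [CommRing A] (x : Fin n → A) : List A :=
  P.out.map fun j => (Instr.run (fun b : Bool => if b then (1 : A) else 0) x P.code).getD j 0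

/-- The number of operations of a program. -/
def Program.cost {n : ℕ} (P : Program n) : ℕ := P.code.length

/-- The binary digits of `a`, least significant first, as `w` bits. -/
def toBits (w a : ℕ) : Fin w → ZMod 2 := fun i => ((a / 2 ^ (i : ℕ) : ℕ) : ZMod 2)

/-- The number with the given binary digits, least significant first. -/
def ofBits : List (ZMod 2) → ℕ
  | [] => 0
  | b :: l => b.val + 2 * ofBits l

/-- The operations on natural numbers. -/
inductive NatOp
  | add | sub | mul | div | mod | lt | eq

/-- The meaning of the operations (comparisons return `1` for true and `0` for false). -/
def NatOp.fn : NatOp → ℕ → ℕ → ℕ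
  | add, a, b => a + b
  | sub, a, b => a - b
  | mul, a, b => a * b
  | div, a, b => a / b
  | mod, a, b => a % b
  | lt, a, b => if a < b then 1 else 0
  | eq, a, b => if a = b then 1 else 0

/-- A choice of arithmetic routines: for each `m` a program for the multiplication modulo `x^m - 1`,
and for each operation on natural numbers and each width `w` a circuit for operands of `w` bits.
Neither may depend on the coefficient ring or on the input of the interpolation. -/
structure Arith where
  conv : (m : ℕ) → Program (m + m)
  circ : NatOp → (w : ℕ) → Program (w + w)

/-- The routines compute what they should: in every commutative ring, `conv m` maps two coefficient
vectors to that of the product modulo `x^m - 1`, and the circuits are correct. -/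
structure Arith.Correct (𝔸 : Arith) : Prop where
  conv_eval : ∀ (A : Type u) [CommRing A] (m : ℕ), 0 < m → ∀ a b : Fin m → A,
    (𝔸.conv m).eval (Fin.append a b) =
      List.ofFn fun k : Fin m => ∑ i : Fin m, ∑ j : Fin m,
        if ((i : ℕ) + (j : ℕ)) % m = (k : ℕ) then a i * b j else 0
  circ_eval : ∀ (op : NatOp) (w a b : ℕ), a < 2 ^ w → b < 2 ^ w →
    ((op = NatOp.div ∨ op = NatOp.mod) → b ≠ 0) →
    ofBits ((𝔸.circ op w).eval (Fin.append (toBits w a) (toBits w b))) = op.fn a b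

/-! ### Computations with counted operations -/

/-- A result together with the numbers of ring operations and of bit operations spent on it. -/
structure Timed (α : Type u) where
  val : α
  ringOps : ℕ
  bitOps : ℕ

namespace Timed

variable {α : Type u} {β : Type v}

def pure (a : α) : Timed α := ⟨a, 0, 0⟩

def bind (x : Timed α) (f : α → Timed β) : Timed β :=
  ⟨(f x.val).val, x.ringOps + (f x.val).ringOps, x.bitOps + (f x.val).bitOps⟩

def mapL (f : α → Timed β) : List α → Timed (List β)
  | [] => pure []
  | a :: l => (f a).bind fun b => (mapL f l).bind fun bs => pure (b :: bs)

def foldL (f : β → α → Timed β) : β → List α → Timed β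
  | b, [] => pure b
  | b, a :: l => (f b a).bind fun b' => foldL f b' l

def filterL (f : α → Timed Bool) : List α → Timed (List α)
  | [] => pure []
  | a :: l => (f a).bind fun t => (filterL f l).bind fun as =>
      pure (if t then a :: as else as)

end Timed

open Timed

/-- An operation on natural numbers: the bit cost is the number of gates of the circuit whose width
is the larger of the bit lengths of the operands. -/
def natOp (𝔸 : Arith) (op : NatOp) (a b : ℕ) : Timed ℕ :=
  ⟨op.fn a b, 0, (𝔸.circ op (max a.size b.size)).cost⟩

/-- A comparison, returned as a Boolean. -/
def natTest (𝔸 : Arith) (op : NatOp) (a b : ℕ) : Timed Bool :=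
  (natOp 𝔸 op a b).bind fun t => pure (decide (t = 1))

/-- `b ^ k` by repeated multiplication. -/
def powNat (𝔸 : Arith) (b : ℕ) : ℕ → Timed ℕ
  | 0 => pure 1
  | k + 1 => (powNat 𝔸 b k).bind fun x => natOp 𝔸 .mul x b

/-- `⌈log₂ x⌉`, read off from the binary digits of `x`. -/
def ceilLog (x : ℕ) : Timed ℕ := ⟨Nat.clog 2 x, 0, x.size⟩

/-! ### Prime numbers -/

/-- Trial division of `m` by `d, d + 1, …`, as long as the square of the divisor is at most `m`.
The first argument bounds the number of divisions. -/
def trialDivision (𝔸 : Arith) (m : ℕ) : ℕ → ℕ → Timed Bool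
  | 0, _ => pure true
  | fuel + 1, d =>
    (natOp 𝔸 .mul d d).bind fun s =>
    (natTest 𝔸 .lt m s).bind fun large =>
    if large then pure true else
    (natOp 𝔸 .mod m d).bind fun r =>
    (natTest 𝔸 .eq r 0).bind fun divides =>
    if divides then pure false else
    (natOp 𝔸 .add d 1).bind fun d' => trialDivision 𝔸 m fuel d'

/-- The least prime `≥ m` (for `m ≥ 2`); there is one among the first `m` candidates. -/
def nextPrime (𝔸 : Arith) : ℕ → ℕ → Timed ℕ
  | 0, m => pure m
  | fuel + 1, m =>
    (trialDivision 𝔸 m m 2).bind fun t =>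
    if t then pure m else
    (natOp 𝔸 .add m 1).bind fun m' => nextPrime 𝔸 fuel m'

/-- The first `N` primes that are `≥ m`. -/
def primesFrom (𝔸 : Arith) : ℕ → ℕ → Timed (List ℕ)
  | 0, _ => pure []
  | N + 1, m =>
    (nextPrime 𝔸 m m).bind fun p =>
    (natOp 𝔸 .add p 1).bind fun m' =>
    (primesFrom 𝔸 N m').bind fun ps => pure (p :: ps)

/-- The shortest initial segment of a list of primes whose product, times `acc`, is `≥ D`. -/
def primesUpTo (𝔸 : Arith) (D : ℕ) : ℕ → List ℕ → Timed (List ℕ)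
  | _, [] => pure []
  | acc, p :: ps =>
    (natTest 𝔸 .lt acc D).bind fun t =>
    if t then
      (natOp 𝔸 .mul acc p).bind fun acc' =>
      (primesUpTo 𝔸 D acc' ps).bind fun qs => pure (p :: qs)
    else pure []

/-- Product of a list by halving it `depth` times. -/
def prodTree (𝔸 : Arith) : ℕ → List ℕ → Timed ℕ
  | 0, ps => foldL (fun x p => natOp 𝔸 .mul x p) 1 ps
  | depth + 1, ps =>
    (prodTree 𝔸 depth (ps.take (ps.length / 2))).bind fun x =>
    (prodTree 𝔸 depth (ps.drop (ps.length / 2))).bind fun y => natOp 𝔸 .mul x y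

/-- The residues of `e` modulo all members of a list, by a remainder tree of the given depth. -/
def remTree (𝔸 : Arith) : ℕ → ℕ → List ℕ → Timed (List ℕ)
  | 0, e, ps => mapL (fun p => natOp 𝔸 .mod e p) ps
  | depth + 1, e, ps =>
    (prodTree 𝔸 (depth + 1) ps).bind fun P =>
    (natOp 𝔸 .mod e P).bind fun r =>
    (remTree 𝔸 depth r (ps.take (ps.length / 2))).bind fun l₁ =>
    (remTree 𝔸 depth r (ps.drop (ps.length / 2))).bind fun l₂ => pure (l₁ ++ l₂)

/-- The residues of `e` modulo all members of `ps`. -/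
def residues (𝔸 : Arith) (e : ℕ) (ps : List ℕ) : Timed (List ℕ) :=
  remTree 𝔸 ps.length.size e ps

/-! ### Chinese remaindering -/

/-- The least `t' ≥ t` with `x + M * t' ≡ e` modulo `q`, by search over `fuel` values. -/
def findDigit (𝔸 : Arith) (x M e q : ℕ) : ℕ → ℕ → Timed ℕ
  | 0, t => pure t
  | fuel + 1, t =>
    (natOp 𝔸 .mul M t).bind fun y =>
    (natOp 𝔸 .add x y).bind fun z =>
    (natOp 𝔸 .mod z q).bind fun r =>
    (natTest 𝔸 .eq r e).bind fun found =>
    if found then pure t else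
    (natOp 𝔸 .add t 1).bind fun t' => findDigit 𝔸 x M e q fuel t'

/-- Chinese remaindering: extends a solution `x` modulo `M` by the congruences `≡ e` modulo `q`, for
all pairs `(e, q)` of the list, one mixed radix digit at a time. -/
def chineseRem (𝔸 : Arith) : List (ℕ × ℕ) → ℕ → ℕ → Timed ℕ
  | [], x, _ => pure x
  | (e, q) :: l, x, M =>
    (natOp 𝔸 .mod x q).bind fun xr =>
    (natOp 𝔸 .mod M q).bind fun Mr =>
    (findDigit 𝔸 xr Mr e q q 0).bind fun t =>
    (natOp 𝔸 .mul M t).bind fun y =>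
    (natOp 𝔸 .add x y).bind fun x' =>
    (natOp 𝔸 .mul M q).bind fun M' => chineseRem 𝔸 l x' M'

section Interpolation

variable {R : Type u} [CommRing R] [DecidableEq R]

/-! ### Univariate polynomials

An element of `R[x]/(x^m - 1)` is given by the list of its `m` coefficients.  A univariate term
`a x^e` is the pair `(e, a)`. -/

/-- The coefficients of `c x^e`, for `e < m`. -/
def monomialVec (m e : ℕ) (c : R) : List R :=
  (List.range m).map fun i => if i = e then c else 0

/-- The number of nonzero coefficients: one zero test for each coefficient. -/
def countTerms (𝔸 : Arith) (v : List R) : Timed ℕ :=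
  foldL (fun (k : ℕ) (a : R) =>
    Timed.bind ⟨decide (a = 0), 1, 0⟩ fun (z : Bool) =>
    if z then pure k else natOp 𝔸 .add k 1) 0 v

/-- The terms, in increasing order of the exponents: one zero test for each coefficient, and the
bits of the exponents that are written. -/
def sparse (v : List R) : Timed (List (ℕ × R)) :=
  let l := (v.zipIdx.filter fun t => decide (t.1 ≠ 0)).map fun t => (t.2, t.1)
  ⟨l, v.length, (l.map fun t => t.1.size).sum⟩

/-- Subtraction of `a x^r`, for an exponent `r` smaller than the length: one ring subtraction, and
the bits of the address `r`. -/
def subAt (v : List R) (r : ℕ) (a : R) : Timed (List R) :=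
  ⟨v.modify r (fun c => c - a), 1, r.size⟩

/-- Does subtracting `a x^r` lower the number of terms?  This only depends on the coefficient at
`x^r`: one subtraction, two zero tests, and the bits of the address `r`. -/
def lowersCount (v : List R) (r : ℕ) (a : R) : Timed Bool :=
  let c := v.getD r 0
  ⟨decide ((if c - a = 0 then 0 else 1) < (if c = 0 then 0 else 1)), 3, r.size⟩

/-- Equality of terms: the coefficients are only compared if the exponents agree. -/
def termEq (𝔸 : Arith) (t t' : ℕ × R) : Timed Bool :=
  (natTest 𝔸 .eq t.1 t'.1).bind fun b =>
  if b then ⟨decide (t.2 = t'.2), 1, 0⟩ else pure false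

/-- `U ∪ {t}` for sets of terms given by lists without repetition. -/
def insertTerm (𝔸 : Arith) (U : List (ℕ × R)) (t : ℕ × R) : Timed (List (ℕ × R)) :=
  (filterL (termEq 𝔸 t) U).bind fun l => pure (if l.isEmpty then U ++ [t] else U)

/-! ### Probes -/

/-- One instruction of a straight-line program, carried out modulo `x^m - 1` with the `i`-th variable
replaced by `x^(es i)`: `m` ring operations, or a run of the multiplication program. -/
def probeStep (𝔸 : Arith) {n : ℕ} (m : ℕ) (es : List ℕ) (mem : List (List R)) :
    Instr R n → Timed (List R)
  | .const c => ⟨monomialVec m 0 c, m, 0⟩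
  | .var i => ⟨monomialVec m (es.getD i 0) 1, m, 0⟩
  | .add j k => ⟨List.zipWith (· + ·) (mem.getD j []) (mem.getD k []), m, 0⟩
  | .sub j k => ⟨List.zipWith (· - ·) (mem.getD j []) (mem.getD k []), m, 0⟩
  | .mul j k =>
    ⟨(𝔸.conv m).eval fun i => (mem.getD j [] ++ mem.getD k []).getD i 0, (𝔸.conv m).cost, 0⟩

/-- `[r, r d, r d², …]` modulo `m`, with `k` entries. -/
def powersMod (𝔸 : Arith) (d m : ℕ) : ℕ → ℕ → Timed (List ℕ)
  | 0, _ => pure []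
  | k + 1, r =>
    (natOp 𝔸 .mul r d).bind fun s =>
    (natOp 𝔸 .mod s m).bind fun r' =>
    (powersMod 𝔸 d m k r').bind fun l => pure (r :: l)

/-- The probe `f(x, x^D, …, x^(D^(n-1))) mod (x^m - 1)` of the polynomial `f` of the program `S`. -/
def kroneckerProbe (𝔸 : Arith) {n : ℕ} (S : SLP R n) (D m : ℕ) : Timed (List R) :=
  (natOp 𝔸 .mod D m).bind fun d =>
  (natOp 𝔸 .mod 1 m).bind fun r =>
  (powersMod 𝔸 d m n r).bind fun es =>
  (foldL (fun mem I => (probeStep 𝔸 m es mem I).bind fun v => pure (mem ++ [v]))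
    ([] : List (List R)) S.code).bind fun mem =>
  pure (mem.getLastD [])

/-- Given the probe of `f` modulo `x^m - 1`, the probe of `f - h`. -/
def subPoly (𝔸 : Arith) (m : ℕ) (v : List R) (h : List (ℕ × R)) : Timed (List R) :=
  foldL (fun v t => (natOp 𝔸 .mod t.1 m).bind fun r => subAt v r t.2) v h

/-! ### The algorithm UTerms -/

/-- For the exponent `d` and the polynomials `g` modulo `x^(p q)` that belong to the primes `q`: if
every `g` has exactly one term `x^b` with `b ≡ d` modulo `p`, the list of all `(b mod q, q)`. -/
def liftResidues (𝔸 : Arith) (p d : ℕ) :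
    List (ℕ × List (ℕ × R)) → Timed (Option (List (ℕ × ℕ)))
  | [] => pure (some [])
  | (q, g) :: gs =>
    (filterL (fun t : ℕ × R =>
      (natOp 𝔸 .mod t.1 p).bind fun r => natTest 𝔸 .eq r d) g).bind fun l =>
    match l with
    | [t] =>
      (natOp 𝔸 .mod t.1 q).bind fun e =>
      (liftResidues 𝔸 p d gs).bind fun o => pure (o.map fun es => (e, q) :: es)
    | _ => pure none

/-- UTerms: the candidate terms that the terms of `f mod (x^p - 1)` lift to. -/
def uTerms (𝔸 : Arith) (f : List (ℕ × R)) (gs : List (ℕ × List (ℕ × R))) (p D : ℕ) :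
    Timed (List (ℕ × R)) :=
  foldL (fun U t =>
    (liftResidues 𝔸 p t.1 gs).bind fun o =>
    match o with
    | none => pure U
    | some es =>
      (chineseRem 𝔸 es 0 1).bind fun β =>
      (natTest 𝔸 .lt β D).bind fun b =>
      if b then insertTerm 𝔸 U (β, t.2) else pure U) [] f

/-! ### The algorithm UIPoly -/

/-- `(N₁, N₂, N)` with `N₁ = max {1, ⌈(T-1) log₂ D⌉}`, `N₂ = ⌈T log₂ D⌉` and
`N = max {4 N₁, N₁ + N₂ - 1}`. -/
def bounds (𝔸 : Arith) (T D : ℕ) : Timed (ℕ × ℕ × ℕ) :=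
  (natOp 𝔸 .sub T 1).bind fun T' =>
  (powNat 𝔸 D T').bind fun x₁ =>
  (powNat 𝔸 D T).bind fun x₂ =>
  (ceilLog x₁).bind fun c₁ =>
  (ceilLog x₂).bind fun N₂ =>
  (natTest 𝔸 .lt c₁ 1).bind fun b₁ =>
  let N₁ := if b₁ then 1 else c₁
  (natOp 𝔸 .mul 4 N₁).bind fun M₁ =>
  (natOp 𝔸 .add N₁ N₂).bind fun s =>
  (natOp 𝔸 .sub s 1).bind fun M₂ =>
  (natTest 𝔸 .lt M₁ M₂).bind fun b₂ =>
  pure (N₁, N₂, if b₂ then M₂ else M₁)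

/-- From the list of all `(p_j, f_j)`: the largest number `α` of terms of an `f_j`, and the first
pair for which it is attained. -/
def selectMax (𝔸 : Arith) (fs : List (ℕ × List R)) : Timed (ℕ × ℕ × List R) :=
  foldL (fun best pf =>
    (countTerms 𝔸 pf.2).bind fun c =>
    (natTest 𝔸 .lt best.1 c).bind fun b => pure (if b then (c, pf) else best))
    ((0, 0, []) : ℕ × ℕ × List R) fs

/-- The test whether at least `N₂` of the `f_j` lose a term when the candidate is subtracted. -/
def testTerm (𝔸 : Arith) (fs : List (ℕ × List R)) (N₂ : ℕ) (c : (ℕ × R) × List ℕ) : Timed Bool :=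
  (foldL (fun (k : ℕ) (x : (ℕ × List R) × ℕ) =>
    (lowersCount x.1.2 x.2 c.1.2).bind fun b =>
    if b then natOp 𝔸 .add k 1 else pure k) 0 (fs.zip c.2)).bind fun k =>
  (natTest 𝔸 .lt k N₂).bind fun b => pure (!b)

/-- The loop of UIPoly.  `probe m` is the probe modulo `x^m - 1`, `qs` is the list `p_1, …, p_(K_D)`,
`fs` the list of all pairs `(p_j, (f - h) mod (x^(p_j) - 1))`, `j = 1, …, N`, and `h` the sum of the
terms found so far.  The number of passes is bounded by the first argument. -/
def uiLoop (𝔸 : Arith) (probe : ℕ → Timed (List R)) (D : ℕ) (qs : List ℕ) :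
    ℕ → (T N₁ N₂ : ℕ) → (fs : List (ℕ × List R)) → (h : List (ℕ × R)) → Timed (List (ℕ × R))
  | 0, _, _, _, _, h => pure h
  | fuel + 1, T, N₁, N₂, fs, h =>
    (selectMax 𝔸 fs).bind fun best =>
    (natTest 𝔸 .eq best.1 0).bind fun done =>
    if done then pure h else
    let p := best.2.1
    (mapL (fun q =>
      (natOp 𝔸 .mul p q).bind fun m =>
      (probe m).bind fun v =>
      (subPoly 𝔸 m v h).bind fun v' =>
      (sparse v').bind fun g => pure (q, g)) qs).bind fun gs =>
    (sparse best.2.2).bind fun f₀ =>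
    (uTerms 𝔸 f₀ gs p D).bind fun U =>
    (mapL (fun t => (residues 𝔸 t.1 (fs.map Prod.fst)).bind fun rs => pure (t, rs)) U).bind
      fun cands =>
    (filterL (testTerm 𝔸 (fs.take (N₁ + N₂ - 1)) N₂) cands).bind fun s =>
    (natOp 𝔸 .sub T s.length).bind fun T' =>
    (bounds 𝔸 T' D).bind fun N =>
    (foldL (fun (fs : List (ℕ × List R)) (c : (ℕ × R) × List ℕ) =>
      mapL (fun x : (ℕ × List R) × ℕ =>
        (subAt x.1.2 x.2 c.1.2).bind fun v => pure (x.1.1, v)) (fs.zip c.2))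
      (fs.take N.2.2) s).bind fun fs' =>
    uiLoop 𝔸 probe D qs fuel T' N.1 N.2.1 fs' (h ++ s.map Prod.fst)

/-- UIPoly: the terms of a univariate polynomial with at most `T` terms and of degree smaller than
`D`, given by its probes.  Each pass of the loop finds a new term, so `T` passes suffice. -/
def uiPoly (𝔸 : Arith) (probe : ℕ → Timed (List R)) (T D : ℕ) : Timed (List (ℕ × R)) :=
  (bounds 𝔸 T D).bind fun N =>
  (primesFrom 𝔸 N.2.2 2).bind fun ps =>
  (primesUpTo 𝔸 D 1 ps).bind fun qs =>
  (mapL (fun p => (probe p).bind fun v => pure (p, v)) ps).bind fun fs =>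
  uiLoop 𝔸 probe D qs T T N.1 N.2.1 fs []

/-! ### The algorithm MPolySIKron -/

/-- The `k` lowest digits of `d` in base `D`. -/
def expand (𝔸 : Arith) (D : ℕ) : ℕ → ℕ → Timed (List ℕ)
  | 0, _ => pure []
  | k + 1, d =>
    (natOp 𝔸 .mod d D).bind fun e =>
    (natOp 𝔸 .div d D).bind fun d' =>
    (expand 𝔸 D k d').bind fun es => pure (e :: es)

/-- MPolySIKron: UIPoly for `f(x, x^D, …, x^(D^(n-1)))`, whose degree is smaller than `D^n`, followed
by the `D`-adic expansion of the exponents.  The result is a list of terms, each given by its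
exponent vector and its coefficient. -/
def mPolySIKron (𝔸 : Arith) {n : ℕ} (S : SLP R n) (T D : ℕ) : Timed (List ((Fin n → ℕ) × R)) :=
  (powNat 𝔸 D n).bind fun D' =>
  (uiPoly 𝔸 (kroneckerProbe 𝔸 S D) T D').bind fun g =>
  mapL (fun t => (expand 𝔸 D n t.1).bind fun es =>
    pure ((fun i : Fin n => es.getD i 0), t.2)) g

/-- `l` lists the terms of `f`, each of them exactly once. -/
def ListsTerms {n : ℕ} (l : List ((Fin n → ℕ) × R)) (f : MvPolynomial (Fin n) R) : Prop :=
  l.Nodup ∧ ∀ (e : Fin n →₀ ℕ) (c : R), ((e : Fin n → ℕ), c) ∈ l ↔ f.coeff e = c ∧ c ≠ 0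

end Interpolation

/-- `g (log₂ (3 + g))^k`: a function is in soft-Oh of `g` if it is bounded by a constant multiple of
this, for some `k`. -/
noncomputable def softOh (k : ℕ) (g : ℝ) : ℝ := g * Real.logb 2 (3 + g) ^ k

end SLPInterp

/-!
Correctness. The Kronecker substitution `x_i ↦ x ^ (D ^ (i - 1))` maps the terms of `f` injectively
to those of a univariate polynomial `g` of degree less than `D ^ n`, and the digits in base `D` undo
it (`IsTermList.listsTerms`). For the univariate interpolation, two exponents below `D` can only
collide modulo primes that divide their difference, and the product of the differences of one
exponent and all others has fewer than `N₁` prime factors (`card_colliding_primes_lt`). Three facts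
follow. Among the first `4 N₁` primes there is one modulo which fewer than a quarter of the
exponents collide, and hence more than half of the exponents are isolated modulo the prime with the
largest number of terms (`card_support_lt_two_mul_card_isolated`). An isolated exponent is recovered
by Chinese remaindering (`candidate_of_isolated`). A term of `g` gets at least `N₂` of the
`N₁ + N₂ - 1` votes (`le_card_votes_of_term`), and a wrong candidate gets fewer
(`card_votes_lt_of_not_term`). So each pass accepts nothing but terms and more than half of those
that are left (`accepted_terms`), and about `log₂ T` passes suffice (`costs_uiLoop`).

Routines. The multiplication modulo `x ^ m - 1` over an arbitrary ring follows Schönhage, Cantor and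
Kaltofen: for `s = 2` and `s = 3` a fast Fourier transform over `P[X] / (X ^ (s ^ k) - 1)`, in which
`X` is the root of unity, yields the product times a power of `s` (`exists_convCost`), and the two
results are combined by Bézout's identity (`exists_cost_cyclicConv`). Circuits for the product of
integers are the simulation of this computation over `ZMod (2 ^ k)` (`exists_cost_natMul`), and
division is reduced to multiplication by Newton's iteration (`exists_cost_natDivMod`). Computations
are described by the relation `Cost S c T`: the elements of `T` can be obtained from those of `S` by
`c` ring operations. A circuit is such a computation in a ring of functions with values in `ZMod 2`,
and a program valid over all rings is such a computation with indeterminates (`exists_arith`).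

Costs. `Costs x a r b` bounds the two counters of a computation together with its result, and is
compositional. Explicit bounds for all parts of the algorithm, with a bound of Chebyshev type for
the primes (`nth_prime_le_mul_size`) and a remainder tree for the residues of the candidates
(`remTree_bitOps_le`), add up to `costs_mPolySIKron`. The sum is simplified by the calculus of the
relation `Soft`, domination up to logarithmic factors (`soft_total`). With `M = n log D` and `w = T
M` there are about `w` primes of size about `w`, and `M` primes for Chinese remaindering of size
about `M`. The probes modulo the former take `L w ^ 2` ring operations and those modulo their
products with the latter `L w M ^ 2`; the bit operations are dominated by `w` numbers of `M` bits
and by `T` votes for each of the primes.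
-/

namespace SLPInterp

/-! ### Runs of straight-line programs -/

namespace Instr

variable {K : Type u} {n : ℕ} {A : Type v} [CommRing A] {B : Type w} [CommRing B]

theorem run_append_singleton (κ : K → A) (x : Fin n → A) (code : List (Instr K n))
    (I : Instr K n) :
    run κ x (code ++ [I]) = run κ x code ++ [I.eval κ x (run κ x code)] := by
  simp [run]

theorem length_run (κ : K → A) (x : Fin n → A) (code : List (Instr K n)) :
    (run κ x code).length = code.length := by
  induction code using List.reverseRecOn with
  | nil => rfl
  | append_singleton l I ih => rw [run_append_singleton]; simp [ih]

theorem map_eval (φ : A →+* B) (κ : K → A) (x : Fin n → A) (mem : List A) (I : Instr K n) :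
    φ (I.eval κ x mem) = I.eval (fun c => φ (κ c)) (fun i => φ (x i)) (mem.map φ) := by
  have h : ∀ j : ℕ, (mem.map φ).getD j 0 = φ (mem.getD j 0) := by
    intro j
    simp only [List.getD_eq_getElem?_getD, List.getElem?_map]
    cases mem[j]? <;> simp
  cases I <;> simp only [eval, map_add, map_sub, map_mul, h]

theorem map_run (φ : A →+* B) (κ : K → A) (x : Fin n → A) (code : List (Instr K n)) :
    (run κ x code).map φ = run (fun c => φ (κ c)) (fun i => φ (x i)) code := by
  induction code using List.reverseRecOn with
  | nil => rfl
  | append_singleton l I ih =>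
    rw [run_append_singleton, run_append_singleton, List.map_append, ih, List.map_singleton,
      map_eval, ih]

end Instr

theorem Program.map_eval {n : ℕ} (p : Program n) {A : Type v} [CommRing A] {B : Type w}
    [CommRing B] (φ : A →+* B) (x : Fin n → A) :
    (p.eval x).map φ = p.eval fun i => φ (x i) := by
  unfold Program.eval
  rw [List.map_map]
  refine List.map_congr_left fun j _ => ?_
  have h := Instr.map_run φ (fun b : Bool => if b then (1 : A) else 0) x p.code
  have h2 : (fun c : Bool => φ (if c = true then (1 : A) else 0)) =
      fun c : Bool => if c = true then (1 : B) else 0 := by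
    funext c; cases c <;> simp
  rw [h2] at h
  rw [← h]
  simp only [Function.comp, List.getD_eq_getElem?_getD, List.getElem?_map]
  cases (Instr.run (fun b : Bool => if b = true then (1 : A) else 0) x p.code)[j]? <;> simp

/-! ### The number of operations needed to compute a set of ring elements -/

section Cost

variable {P : Type u} [CommRing P]

/-- `x` is `0`, `1`, or the result of one ring operation on elements of `S`. -/
def OneOp (S : Set P) (x : P) : Prop :=
  x = 0 ∨ x = 1 ∨ ∃ a ∈ S, ∃ b ∈ S, x = a + b ∨ x = a - b ∨ x = a * b

/-- `F` arises from `S` by adjoining `c` elements in turn, each obtained by one operation. -/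
inductive Reach : ℕ → Set P → Set P → Prop
  | refl (S : Set P) : Reach 0 S S
  | step {c : ℕ} {S F : Set P} {x : P} : Reach c S F → OneOp F x → Reach (c + 1) S (insert x F)

/-- All elements of `T` can be computed from those of `S` with at most `c` ring operations.
Working with sets of elements rather than with positions in a program makes copying and permuting
intermediate results free of charge and free of notation. -/
def Cost (S : Set P) (c : ℕ) (T : Set P) : Prop := ∃ d ≤ c, ∃ F, Reach d S F ∧ T ⊆ F

theorem OneOp.mono {S T : Set P} (h : S ⊆ T) {x : P} (hx : OneOp S x) : OneOp T x := by
  rcases hx with h0 | h1 | ⟨a, ha, b, hb, hab⟩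
  · exact Or.inl h0
  · exact Or.inr (Or.inl h1)
  · exact Or.inr (Or.inr ⟨a, h ha, b, h hb, hab⟩)

theorem Reach.union {c : ℕ} {S F : Set P} (h : Reach c S F) (U : Set P) :
    Reach c (S ∪ U) (F ∪ U) := by
  induction h with
  | refl S => exact Reach.refl _
  | step _ hx ih =>
    rw [Set.insert_union]
    exact ih.step (hx.mono Set.subset_union_left)

theorem Reach.trans {c d : ℕ} {S F G : Set P} (h : Reach c S F) (h' : Reach d F G) :
    Reach (c + d) S G := by
  induction h' with
  | refl S => exact h
  | step _ hx ih => exact (ih h).step hx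

theorem Reach.subset {c : ℕ} {S F : Set P} (h : Reach c S F) : S ⊆ F := by
  induction h with
  | refl S => exact subset_rfl
  | step _ _ ih => exact ih.trans (Set.subset_insert _ _)

theorem Cost.of_subset {S T : Set P} (h : T ⊆ S) (c : ℕ) : Cost S c T :=
  ⟨0, Nat.zero_le _, S, Reach.refl S, h⟩

theorem Cost.mono {S S' T T' : Set P} {c c' : ℕ} (h : Cost S c T) (hS : S ⊆ S') (hc : c ≤ c')
    (hT : T' ⊆ T) : Cost S' c' T' := by
  obtain ⟨d, hd, F, hF, hTF⟩ := h
  refine ⟨d, hd.trans hc, F ∪ S', ?_, hT.trans (hTF.trans Set.subset_union_left)⟩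
  have := hF.union S'
  rwa [Set.union_eq_self_of_subset_left hS] at this

theorem Cost.mono_left {S S' T : Set P} {c : ℕ} (h : Cost S c T) (hS : S ⊆ S') : Cost S' c T :=
  h.mono hS le_rfl subset_rfl

theorem Cost.mono_right {S T T' : Set P} {c : ℕ} (h : Cost S c T) (hT : T' ⊆ T) : Cost S c T' :=
  h.mono subset_rfl le_rfl hT

theorem Cost.le {S T : Set P} {c c' : ℕ} (h : Cost S c T) (hc : c ≤ c') : Cost S c' T :=
  h.mono subset_rfl hc subset_rfl

/-- The sources remain available after a computation. -/
theorem Cost.keep {S T : Set P} {c : ℕ} (h : Cost S c T) : Cost S c (S ∪ T) := by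
  obtain ⟨d, hd, F, hF, hTF⟩ := h
  exact ⟨d, hd, F, hF, Set.union_subset hF.subset hTF⟩

theorem Cost.trans {S T U : Set P} {c d : ℕ} (h : Cost S c T) (h' : Cost T d U) :
    Cost S (c + d) U := by
  obtain ⟨c₁, hc, F, hF, hTF⟩ := h
  obtain ⟨d₁, hd, G, hG, hUG⟩ := h'
  refine ⟨c₁ + d₁, by omega, G ∪ F, hF.trans ?_, hUG.trans Set.subset_union_left⟩
  have := hG.union F
  rwa [Set.union_eq_self_of_subset_left hTF] at this

theorem Cost.then {S T U : Set P} {c d : ℕ} (h : Cost S c T) (h' : Cost (S ∪ T) d U) :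
    Cost S (c + d) U :=
  h.keep.trans h'

theorem Cost.union {S T U : Set P} {c d : ℕ} (h : Cost S c T) (h' : Cost S d U) :
    Cost S (c + d) (T ∪ U) := by
  have h2 : Cost (S ∪ T) d (T ∪ U) :=
    (h'.mono_left (Set.subset_union_left (t := T))).keep.mono_right
      (Set.union_subset_union_left _ Set.subset_union_right)
  exact h.then h2

theorem Cost.biUnion {ι : Type v} (s : Finset ι) {S : Set P} {c : ι → ℕ} {T : ι → Set P}
    (h : ∀ i ∈ s, Cost S (c i) (T i)) : Cost S (∑ i ∈ s, c i) (⋃ i ∈ s, T i) := by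
  classical
  induction s using Finset.induction_on with
  | empty => exact Cost.of_subset (by simp) _
  | insert a s ha ih =>
    rw [Finset.sum_insert ha, Finset.set_biUnion_insert]
    exact (h a (Finset.mem_insert_self _ _)).union
      (ih fun i hi => h i (Finset.mem_insert_of_mem hi))

theorem Cost.biUnion_const {ι : Type v} (s : Finset ι) {S : Set P} {c : ℕ} {T : ι → Set P}
    (h : ∀ i ∈ s, Cost S c (T i)) : Cost S (s.card * c) (⋃ i ∈ s, T i) := by
  simpa using Cost.biUnion s h

theorem Cost.of_oneOp {S : Set P} {x : P} (h : OneOp S x) : Cost S 1 {x} :=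
  ⟨1, le_rfl, _, (Reach.refl S).step h, by simp⟩

theorem Cost.zero (S : Set P) : Cost S 1 {0} := Cost.of_oneOp (Or.inl rfl)

theorem Cost.one (S : Set P) : Cost S 1 {1} := Cost.of_oneOp (Or.inr (Or.inl rfl))

theorem Cost.add {S : Set P} {a b : P} (ha : a ∈ S) (hb : b ∈ S) : Cost S 1 {a + b} :=
  Cost.of_oneOp (Or.inr (Or.inr ⟨a, ha, b, hb, Or.inl rfl⟩))

theorem Cost.sub {S : Set P} {a b : P} (ha : a ∈ S) (hb : b ∈ S) : Cost S 1 {a - b} :=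
  Cost.of_oneOp (Or.inr (Or.inr ⟨a, ha, b, hb, Or.inr (Or.inl rfl)⟩))

theorem Cost.mul {S : Set P} {a b : P} (ha : a ∈ S) (hb : b ∈ S) : Cost S 1 {a * b} :=
  Cost.of_oneOp (Or.inr (Or.inr ⟨a, ha, b, hb, Or.inr (Or.inr rfl)⟩))

theorem Cost.add' {S : Set P} {a b : P} {c d : ℕ} (ha : Cost S c {a}) (hb : Cost S d {b}) :
    Cost S (c + d + 1) {a + b} :=
  (ha.union hb).trans (Cost.add (by simp) (by simp))

theorem Cost.sub' {S : Set P} {a b : P} {c d : ℕ} (ha : Cost S c {a}) (hb : Cost S d {b}) :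
    Cost S (c + d + 1) {a - b} :=
  (ha.union hb).trans (Cost.sub (by simp) (by simp))

theorem Cost.mul' {S : Set P} {a b : P} {c d : ℕ} (ha : Cost S c {a}) (hb : Cost S d {b}) :
    Cost S (c + d + 1) {a * b} :=
  (ha.union hb).trans (Cost.mul (by simp) (by simp))

theorem Cost.mem {S : Set P} {a : P} (ha : a ∈ S) : Cost S 0 {a} :=
  Cost.of_subset (by simpa using ha) _

theorem Cost.sum {ι : Type v} (s : Finset ι) {S : Set P} (f : ι → P) (h : ∀ i ∈ s, f i ∈ S) :
    Cost S (s.card + 1) {∑ i ∈ s, f i} := by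
  classical
  induction s using Finset.induction_on with
  | empty => simpa using Cost.zero S
  | insert a s ha ih =>
    rw [Finset.sum_insert ha, Finset.card_insert_of_notMem ha]
    have := Cost.add' (Cost.mem (h a (Finset.mem_insert_self _ _)))
      (ih fun i hi => h i (Finset.mem_insert_of_mem hi))
    exact this.le (by omega)

/-- A natural number, as a ring element, is obtained from its binary digits by doubling. -/
theorem Cost.natCast (S : Set P) (n : ℕ) : Cost S (3 * n.size + 1) {(n : P)} := by
  induction n using Nat.binaryRec with
  | zero => simpa using Cost.zero S
  | bit b n ih =>
    rcases Nat.eq_zero_or_pos (Nat.bit b n) with h | h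
    · rw [h]; simpa using Cost.zero S
    · rw [Nat.size_bit h.ne']
      have h2 : Cost S (3 * n.size + 1 + 1) {(n : P) + n} :=
        ih.trans (Cost.add (by simp) (by simp))
      cases b with
      | false =>
        have : ((Nat.bit false n : ℕ) : P) = n + n := by
          simp [Nat.bit_val, two_mul]
        rw [this]; exact h2.le (by simp only [Nat.succ_eq_add_one]; omega)
      | true =>
        have : ((Nat.bit true n : ℕ) : P) = n + n + 1 := by
          simp [Nat.bit_val, two_mul]
        rw [this]; exact (h2.add' (Cost.one S)).le (by simp only [Nat.succ_eq_add_one]; omega)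

/-- A simulation of the operations of one ring by those of another one: the element `a` is
represented by the set `φ a`. -/
theorem Cost.simulate {Q : Type v} [CommRing Q] (φ : P → Set Q) (k : ℕ)
    (h0 : Cost ∅ k (φ 0)) (h1 : Cost ∅ k (φ 1))
    (hadd : ∀ a b, Cost (φ a ∪ φ b) k (φ (a + b)))
    (hsub : ∀ a b, Cost (φ a ∪ φ b) k (φ (a - b)))
    (hmul : ∀ a b, Cost (φ a ∪ φ b) k (φ (a * b)))
    {S T : Set P} {c : ℕ} (h : Cost S c T) :
    Cost (⋃ a ∈ S, φ a) (c * k) (⋃ a ∈ T, φ a) := by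
  obtain ⟨d, hd, F, hF, hTF⟩ := h
  suffices H : Cost (⋃ a ∈ S, φ a) (d * k) (⋃ a ∈ F, φ a) from
    H.mono subset_rfl (Nat.mul_le_mul_right k hd) (Set.biUnion_subset_biUnion_left hTF)
  clear hTF hd
  induction hF with
  | refl S => exact Cost.of_subset subset_rfl _
  | @step c S F x _ hx ih =>
    rw [Set.biUnion_insert, Set.union_comm, Nat.succ_mul]
    have h2 : Cost (⋃ a ∈ F, φ a) k (φ x) := by
      rcases hx with rfl | rfl | ⟨a, ha, b, hb, hab⟩
      · exact h0.mono_left (Set.empty_subset _)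
      · exact h1.mono_left (Set.empty_subset _)
      · have hs : φ a ∪ φ b ⊆ ⋃ a ∈ F, φ a :=
          Set.union_subset (Set.subset_biUnion_of_mem ha) (Set.subset_biUnion_of_mem hb)
        rcases hab with rfl | rfl | rfl
        · exact (hadd a b).mono_left hs
        · exact (hsub a b).mono_left hs
        · exact (hmul a b).mono_left hs
    exact ih.trans h2.keep

/-! ### From computations to programs -/

theorem exists_getD_of_mem {l : List P} {a : P} (h : a ∈ l) : ∃ j, l.getD j 0 = a := by
  obtain ⟨j, hj, rfl⟩ := List.getElem_of_mem h
  exact ⟨j, by simp [List.getD_eq_getElem?_getD, hj]⟩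

theorem Reach.exists_code {n : ℕ} (x : Fin n → P) {c : ℕ} {F : Set P}
    (h : Reach c (Set.range x) F) :
    ∃ code : List (Instr Bool n), code.length = n + c ∧
      ∀ a ∈ F, a ∈ Instr.run (fun b : Bool => if b then (1 : P) else 0) x code := by
  generalize hS : Set.range x = S at h
  induction h with
  | refl S =>
    subst hS
    suffices H : ∀ l : List (Fin n),
        Instr.run (fun b : Bool => if b then (1 : P) else 0) x (l.map Instr.var) = l.map x by
      refine ⟨(List.finRange n).map Instr.var, by simp, ?_⟩
      rintro _ ⟨i, rfl⟩
      rw [H]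
      exact List.mem_map.2 ⟨i, List.mem_finRange i, rfl⟩
    intro l
    induction l using List.reverseRecOn with
    | nil => rfl
    | append_singleton l i ih =>
      rw [List.map_append, List.map_singleton, Instr.run_append_singleton, ih]
      simp [Instr.eval]
  | @step c S F y _ hy ih =>
    obtain ⟨code, hlen, hF⟩ := ih hS
    suffices H : ∃ I : Instr Bool n, I.eval (fun b : Bool => if b then (1 : P) else 0) x
        (Instr.run (fun b : Bool => if b then (1 : P) else 0) x code) = y by
      obtain ⟨I, hI⟩ := H
      refine ⟨code ++ [I], by simp [hlen, add_assoc], ?_⟩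
      rw [Instr.run_append_singleton, hI]
      intro a ha
      rcases Set.mem_insert_iff.1 ha with rfl | ha
      · simp
      · exact List.mem_append_left _ (hF a ha)
    rcases hy with rfl | rfl | ⟨a, ha, b, hb, hab⟩
    · exact ⟨Instr.const false, by simp [Instr.eval]⟩
    · exact ⟨Instr.const true, by simp [Instr.eval]⟩
    · obtain ⟨j, hj⟩ := exists_getD_of_mem (hF a ha)
      obtain ⟨k, hk⟩ := exists_getD_of_mem (hF b hb)
      rcases hab with rfl | rfl | rfl
      · exact ⟨Instr.add j k, by simp only [Instr.eval, hj, hk]⟩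
      · exact ⟨Instr.sub j k, by simp only [Instr.eval, hj, hk]⟩
      · exact ⟨Instr.mul j k, by simp only [Instr.eval, hj, hk]⟩

/-- A computation from the inputs `x` yields a program whose length is the number of inputs, which
are loaded at the start, plus the number of operations. -/
theorem Cost.exists_program {n q : ℕ} {x : Fin n → P} {c : ℕ} {f : Fin q → P}
    (h : Cost (Set.range x) c (Set.range f)) :
    ∃ p : Program n, p.cost ≤ n + c ∧ p.eval x = List.ofFn f := by
  obtain ⟨d, hd, F, hF, hTF⟩ := h
  obtain ⟨code, hlen, hcode⟩ := hF.exists_code x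
  choose o ho using fun j : Fin q => exists_getD_of_mem (hcode (f j) (hTF ⟨j, rfl⟩))
  refine ⟨⟨code, List.ofFn o⟩, ?_, ?_⟩
  · simp only [Program.cost, hlen]; omega
  · simp only [Program.eval, List.map_ofFn]
    congr 1
    funext j
    exact ho j

end Cost

end SLPInterp

namespace SLPInterp

open Polynomial

/-! ### Polynomials modulo `X ^ N - 1` -/

section Wrap

variable {R : Type u} [CommRing R]

/-- The coefficient at `X ^ i` of the remainder modulo `X ^ N - 1`, for an index `i` that is read
modulo `N`. -/
noncomputable def wrap (N i : ℕ) : R[X] →ₗ[R] R :=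
  Polynomial.lsum fun d => if d % N = i % N then LinearMap.id else 0

theorem wrap_monomial (N i d : ℕ) (c : R) :
    wrap N i (monomial d c) = if d % N = i % N then c else 0 := by
  unfold wrap
  rw [lsum_apply, sum_monomial_index]
  · split_ifs <;> simp
  · split_ifs <;> simp

theorem wrap_congr {N i j : ℕ} (h : i % N = j % N) : (wrap N i : R[X] →ₗ[R] R) = wrap N j := by
  unfold wrap; rw [h]

theorem wrap_mod (N i : ℕ) : (wrap N (i % N) : R[X] →ₗ[R] R) = wrap N i :=
  wrap_congr (Nat.mod_mod _ _)

theorem wrap_mul_X_pow (N i j : ℕ) (f : R[X]) : wrap N (i + j) (f * X ^ j) = wrap N i f := by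
  induction f using Polynomial.induction_on' with
  | add p q hp hq => rw [add_mul, map_add, map_add, hp, hq]
  | monomial d c =>
    rw [monomial_mul_X_pow, wrap_monomial, wrap_monomial]
    have : (d + j) % N = (i + j) % N ↔ d % N = i % N :=
      ⟨fun h => Nat.ModEq.add_right_cancel' j h, fun h => Nat.ModEq.add_right j h⟩
    simp only [this]

theorem wrap_mul_X_pow_congr {N j j' : ℕ} (h : j % N = j' % N) (i : ℕ) (f : R[X]) :
    wrap N i (f * X ^ j) = wrap N i (f * X ^ j') := by
  induction f using Polynomial.induction_on' with
  | add p q hp hq => rw [add_mul, add_mul, map_add, map_add, hp, hq]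
  | monomial d c =>
    rw [monomial_mul_X_pow, wrap_monomial, monomial_mul_X_pow, wrap_monomial]
    have : (d + j) % N = (d + j') % N := Nat.ModEq.add_left d h
    rw [this]

theorem wrap_eq_sum {n : ℕ} {f : R[X]} (hf : f.natDegree < n) (N i : ℕ) :
    wrap N i f = ∑ d ∈ Finset.range n, if d % N = i % N then f.coeff d else 0 := by
  conv_lhs => rw [f.as_sum_range' n hf]
  rw [map_sum]
  exact Finset.sum_congr rfl fun d _ => wrap_monomial _ _ _ _

theorem wrap_eq_coeff {N i : ℕ} {f : R[X]} (hf : f.natDegree < N) (hi : i < N) :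
    wrap N i f = f.coeff i := by
  rw [wrap_eq_sum hf, Finset.sum_eq_single i]
  · simp
  · intro d hd hdi
    rw [Nat.mod_eq_of_lt (Finset.mem_range.1 hd), Nat.mod_eq_of_lt hi, if_neg hdi]
  · intro h; exact absurd (Finset.mem_range.2 hi) h

theorem wrap_mul {N : ℕ} (hN : 0 < N) (k : ℕ) (f g : R[X]) :
    wrap N k (f * g) = ∑ i ∈ Finset.range N, ∑ j ∈ Finset.range N,
      if (i + j) % N = k % N then wrap N i f * wrap N j g else 0 := by
  induction f using Polynomial.induction_on' with
  | add p q hp hq =>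
    rw [add_mul, map_add, hp, hq, ← Finset.sum_add_distrib]
    refine Finset.sum_congr rfl fun i _ => ?_
    rw [← Finset.sum_add_distrib]
    refine Finset.sum_congr rfl fun j _ => ?_
    split_ifs <;> simp [add_mul]
  | monomial d c =>
    induction g using Polynomial.induction_on' with
    | add p q hp hq =>
      rw [mul_add, map_add, hp, hq, ← Finset.sum_add_distrib]
      refine Finset.sum_congr rfl fun i _ => ?_
      rw [← Finset.sum_add_distrib]
      refine Finset.sum_congr rfl fun j _ => ?_
      split_ifs <;> simp [mul_add]
    | monomial e b =>
      rw [monomial_mul_monomial, wrap_monomial, Finset.sum_eq_single (d % N),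
        Finset.sum_eq_single (e % N)]
      · simp only [wrap_monomial, Nat.mod_mod, if_true, ← Nat.add_mod]
      · intro j hj hje
        simp only [wrap_monomial]
        rw [Nat.mod_eq_of_lt (Finset.mem_range.1 hj), if_neg (Ne.symm hje), mul_zero]
        simp
      · intro h; exact absurd (Finset.mem_range.2 (Nat.mod_lt _ hN)) h
      · intro i hi hid
        refine Finset.sum_eq_zero fun j _ => ?_
        simp only [wrap_monomial]
        rw [Nat.mod_eq_of_lt (Finset.mem_range.1 hi), if_neg (Ne.symm hid), zero_mul]
        simp
      · intro h; exact absurd (Finset.mem_range.2 (Nat.mod_lt _ hN)) h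

end Wrap

theorem sum_range_mul {M : Type u} [AddCommMonoid M] (F : ℕ → M) (a b : ℕ) :
    ∑ n ∈ Finset.range (a * b), F n =
      ∑ i ∈ Finset.range a, ∑ l ∈ Finset.range b, F (i * b + l) := by
  induction a with
  | zero => simp
  | succ a ih => rw [Nat.succ_mul, Finset.sum_range_add, ih, Finset.sum_range_succ]

/-! ### The fast Fourier transform -/

section FFT

variable {P : Type u} [CommRing P]

/-- The coefficients of the remainder modulo `X ^ N - 1`. -/
def coeffs (N : ℕ) (f : P[X]) : Set P := Set.range fun i => wrap N i f

theorem wrap_mem_coeffs (N i : ℕ) (f : P[X]) : wrap N i f ∈ coeffs N f := ⟨i, rfl⟩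

theorem wrap_mul_X_pow_mem {N : ℕ} (hN : 0 < N) (i j : ℕ) (f : P[X]) :
    wrap N i (f * X ^ j) ∈ coeffs N f := by
  have h : i % N = (i + (N - 1) * j + j) % N := by
    obtain ⟨m, rfl⟩ : ∃ m, N = m + 1 := ⟨N - 1, by omega⟩
    rw [show i + (m + 1 - 1) * j + j = i + (m + 1) * j by simp; ring, Nat.add_mul_mod_self_left]
  rw [wrap_congr h, wrap_mul_X_pow]
  exact wrap_mem_coeffs _ _ _

theorem coeffs_eq_biUnion {N : ℕ} (hN : 0 < N) (f : P[X]) :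
    coeffs N f ⊆ ⋃ i ∈ Finset.range N, {wrap N i f} := by
  rintro _ ⟨i, rfl⟩
  simp only [Set.mem_iUnion]
  exact ⟨i % N, Finset.mem_range.2 (Nat.mod_lt _ hN), by simp [wrap_mod]⟩

/-- The sum `∑ X ^ (j i t) v_i` over `i < s ^ r`: the discrete Fourier transform of length `s ^ r`
over `P[X] / (X ^ N - 1)` if `X ^ j` is a root of unity of this order. -/
noncomputable def dft (s r j : ℕ) (v : ℕ → P[X]) (t : ℕ) : P[X] :=
  ∑ i ∈ Finset.range (s ^ r), v i * X ^ (j * i * t)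

/-- Decimation: the transform is composed of those of the subsequences `v_l, v_(s+l), v_(2s+l), …`.
-/
theorem dft_succ (s r j : ℕ) (v : ℕ → P[X]) (t : ℕ) :
    dft s (r + 1) j v t =
      ∑ l ∈ Finset.range s, dft s r (j * s) (fun i => v (i * s + l)) t * X ^ (j * l * t) := by
  unfold dft
  rw [pow_succ, sum_range_mul, Finset.sum_comm]
  refine Finset.sum_congr rfl fun l _ => ?_
  rw [Finset.sum_mul]
  refine Finset.sum_congr rfl fun i _ => ?_
  rw [mul_assoc (v _), ← pow_add]
  congr 2
  ring

theorem wrap_dft_mod {N s r j : ℕ} (h : N ∣ j * s ^ r) (v : ℕ → P[X]) (t m : ℕ) :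
    wrap N m (dft s r j v (t % s ^ r)) = wrap N m (dft s r j v t) := by
  unfold dft
  rw [map_sum, map_sum]
  refine Finset.sum_congr rfl fun i _ => wrap_mul_X_pow_congr ?_ _ _
  obtain ⟨c, hc⟩ := h
  conv_rhs => rw [← Nat.mod_add_div t (s ^ r)]
  rw [mul_add, show j * i * (s ^ r * (t / s ^ r)) = N * (c * i * (t / s ^ r)) by
    rw [show j * i * (s ^ r * (t / s ^ r)) = (j * s ^ r) * i * (t / s ^ r) by ring, hc]; ring,
    Nat.add_mul_mod_self_left]

/-- The fast transform: a transform of length `s ^ r` is `r` times split into `s` transforms of the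
`s`-th part of its length, and each of these levels takes `2 s N` operations per point. -/
theorem cost_dft {N s : ℕ} (hN : 0 < N) (hs : 0 < s) (r j : ℕ) (v : ℕ → P[X])
    (h : N ∣ j * s ^ r) :
    Cost (⋃ i ∈ Finset.range (s ^ r), coeffs N (v i)) (r * (s ^ r * (2 * s * N)))
      (⋃ t, coeffs N (dft s r j v t)) := by
  induction r generalizing j v with
  | zero =>
    refine Cost.of_subset (Set.iUnion_subset fun t => ?_) _
    simp [dft]
  | succ r ih =>
    have h1 : Cost (⋃ i ∈ Finset.range (s ^ (r + 1)), coeffs N (v i))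
        (s * (r * (s ^ r * (2 * s * N))))
        (⋃ l ∈ Finset.range s, ⋃ t, coeffs N (dft s r (j * s) (fun i => v (i * s + l)) t)) := by
      have := Cost.biUnion_const (Finset.range s)
        (S := ⋃ i ∈ Finset.range (s ^ (r + 1)), coeffs N (v i)) (c := r * (s ^ r * (2 * s * N)))
        (T := fun l => ⋃ t, coeffs N (dft s r (j * s) (fun i => v (i * s + l)) t)) (fun l hl => by
          refine (ih (j * s) (fun i => v (i * s + l)) ?_).mono_left ?_
          · rw [mul_assoc, ← pow_succ']; exact h
          · refine Set.iUnion₂_subset fun i hi => ?_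
            refine Set.subset_biUnion_of_mem (u := fun i => coeffs N (v i)) ?_
            simp only [Finset.coe_range, Set.mem_Iio, Finset.mem_range] at *
            calc i * s + l < i * s + s := by omega
              _ = (i + 1) * s := by ring
              _ ≤ s ^ r * s := Nat.mul_le_mul_right _ hi
              _ = s ^ (r + 1) := by ring)
      rwa [Finset.card_range] at this
    have h2 : Cost (⋃ l ∈ Finset.range s, ⋃ t, coeffs N
        (dft s r (j * s) (fun i => v (i * s + l)) t)) (s ^ (r + 1) * (N * (2 * s)))
        (⋃ t ∈ Finset.range (s ^ (r + 1)), ⋃ m ∈ Finset.range N,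
          {wrap N m (dft s (r + 1) j v t)}) := by
      have := Cost.biUnion_const (Finset.range (s ^ (r + 1)))
        (S := ⋃ l ∈ Finset.range s, ⋃ t, coeffs N (dft s r (j * s) (fun i => v (i * s + l)) t))
        (c := N * (2 * s))
        (T := fun t => ⋃ m ∈ Finset.range N, {wrap N m (dft s (r + 1) j v t)}) (fun t _ => by
          have := Cost.biUnion_const (Finset.range N)
            (S := ⋃ l ∈ Finset.range s, ⋃ t, coeffs N (dft s r (j * s) (fun i => v (i * s + l)) t))
            (c := 2 * s)
            (T := fun m => {wrap N m (dft s (r + 1) j v t)}) (fun m _ => by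
              rw [dft_succ, map_sum]
              refine (Cost.sum (Finset.range s) _ fun l hl => ?_).le
                (by rw [Finset.card_range]; omega)
              simp only [Set.mem_iUnion]
              exact ⟨l, hl, t, wrap_mul_X_pow_mem hN _ _ _⟩)
          rwa [Finset.card_range] at this)
      rwa [Finset.card_range] at this
    refine (h1.trans h2).mono subset_rfl (le_of_eq ?_) ?_
    · ring
    · refine Set.iUnion_subset fun t => ?_
      rintro _ ⟨m, rfl⟩
      simp only [Set.mem_iUnion]
      refine ⟨t % s ^ (r + 1), Finset.mem_range.2 (Nat.mod_lt _ (pow_pos hs _)), m % N,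
        Finset.mem_range.2 (Nat.mod_lt _ hN), ?_⟩
      simp only [Set.mem_singleton_iff]
      rw [wrap_mod, wrap_dft_mod h]

end FFT

end SLPInterp

namespace SLPInterp

open Polynomial

/-! ### Convolution modulo a cyclotomic polynomial -/

section Cyclic

variable {P : Type u} [CommRing P]

theorem sum_range_shift {M : Type v} [AddCommMonoid M] {N : ℕ} {F : ℕ → M}
    (hF : ∀ t, F (t + N) = F t) (k : ℕ) :
    ∑ t ∈ Finset.range N, F (t + k) = ∑ t ∈ Finset.range N, F t := by
  induction k with
  | zero => rfl
  | succ k ih =>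
    rw [← ih]
    rcases N with _ | N
    · rfl
    · rw [Finset.sum_range_succ, Finset.sum_range_succ']
      congr 1
      · exact Finset.sum_congr rfl fun t _ => by congr 1; ring
      · rw [show N + (k + 1) = k + (N + 1) by ring, hF, zero_add]

/-- A geometric sum of a nontrivial power of a root of unity of prime power order is invariant under
multiplication by the root of unity of prime order. -/
theorem wrap_geom_sum_add {s : ℕ} (hs : s.Prime) (κ d : ℕ) (hd : ¬ s ^ (κ + 1) ∣ d) (m : ℕ)
    (y : P[X]) :
    wrap (s ^ (κ + 1)) (m + s ^ κ) (∑ t ∈ Finset.range (s ^ (κ + 1)), y * X ^ (t * d)) =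
      wrap (s ^ (κ + 1)) m (∑ t ∈ Finset.range (s ^ (κ + 1)), y * X ^ (t * d)) := by
  have hlt : s ^ κ < s ^ (κ + 1) := Nat.pow_lt_pow_right hs.one_lt (Nat.lt_succ_self _)
  obtain ⟨j, hj, hgcd⟩ := (Nat.dvd_prime_pow hs).1 (Nat.gcd_dvd_right d (s ^ (κ + 1)))
  have hjκ : j ≤ κ := by
    by_contra hcon
    have : j = κ + 1 := by omega
    rw [this] at hgcd
    exact hd (hgcd ▸ Nat.gcd_dvd_left _ _)
  have hg : d.gcd (s ^ (κ + 1)) < s ^ (κ + 1) := by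
    rw [hgcd]; exact (Nat.pow_le_pow_right hs.pos hjκ).trans_lt hlt
  obtain ⟨t₁, -, ht₁⟩ := Nat.exists_mul_mod_eq_gcd hg
  -- Shifting the index `t` by `t₀` multiplies all summands by `X ^ (s ^ κ)`.
  have ht₀ : (s ^ (κ - j) * t₁ * d) % s ^ (κ + 1) = s ^ κ % s ^ (κ + 1) := by
    have h1 : d * t₁ ≡ s ^ j [MOD s ^ (κ + 1)] := by
      rw [← hgcd, ← ht₁]; exact (Nat.mod_modEq _ _).symm
    have h2 := h1.mul_left (s ^ (κ - j))
    rw [← pow_add, Nat.sub_add_cancel hjκ] at h2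
    have h3 : s ^ (κ - j) * t₁ * d = s ^ (κ - j) * (d * t₁) := by ring
    rw [h3]; exact h2
  set t₀ := s ^ (κ - j) * t₁
  rw [map_sum, map_sum]
  have key := sum_range_shift (N := s ^ (κ + 1))
    (F := fun t => wrap (s ^ (κ + 1)) (m + s ^ κ) (y * X ^ (t * d))) (fun t =>
      wrap_mul_X_pow_congr (by rw [add_mul, Nat.add_mul_mod_self_left]) _ _) t₀
  rw [← key]
  refine Finset.sum_congr rfl fun t _ => ?_
  rw [← wrap_mul_X_pow _ m (s ^ κ), mul_assoc, ← pow_add]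
  refine wrap_mul_X_pow_congr ?_ _ _
  rw [add_mul]
  exact Nat.ModEq.add_left _ ht₀

/-- The coefficient at `X ^ l` modulo the `s ^ (κ + 1)`-th cyclotomic polynomial, for `l < s ^ κ`:
the coefficients of `X ^ (s ^ (κ + 1)) - 1` are reduced by subtracting the top ones. -/
noncomputable def cycloCoeff (s κ l : ℕ) : P[X] →ₗ[P] P :=
  wrap (s ^ (κ + 1)) l - wrap (s ^ (κ + 1)) (l + (s - 1) * s ^ κ)

theorem cycloCoeff_geom_sum {s : ℕ} (hs : s.Prime) (κ d : ℕ) (hd : ¬ s ^ (κ + 1) ∣ d) (l : ℕ)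
    (y : P[X]) :
    cycloCoeff s κ l (∑ t ∈ Finset.range (s ^ (κ + 1)), y * X ^ (t * d)) = 0 := by
  rw [cycloCoeff, LinearMap.sub_apply, sub_eq_zero, eq_comm]
  generalize s - 1 = c
  induction c with
  | zero => simp
  | succ c ih => rw [Nat.succ_mul, ← add_assoc, wrap_geom_sum_add hs κ d hd, ih]

theorem cycloCoeff_geom_sum_of_dvd {s : ℕ} (κ d : ℕ) (hd : s ^ (κ + 1) ∣ d) (l : ℕ) (y : P[X]) :
    cycloCoeff s κ l (∑ t ∈ Finset.range (s ^ (κ + 1)), y * X ^ (t * d)) =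
      s ^ (κ + 1) • cycloCoeff s κ l y := by
  rw [map_sum]
  conv_rhs => rw [← Finset.card_range (s ^ (κ + 1))]
  rw [← Finset.sum_const]
  refine Finset.sum_congr rfl fun t _ => ?_
  obtain ⟨c, rfl⟩ := hd
  have h : ∀ i, wrap (s ^ (κ + 1)) i (y * X ^ (t * (s ^ (κ + 1) * c))) =
      wrap (s ^ (κ + 1)) i y := by
    intro i
    rw [wrap_mul_X_pow_congr (j' := 0), pow_zero, mul_one]
    rw [mul_left_comm, Nat.mul_mod_right, Nat.zero_mod]
  simp only [cycloCoeff, LinearMap.sub_apply, h]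

theorem cycloCoeff_eq_coeff {s κ l : ℕ} (hs : 2 ≤ s) {y : P[X]} (hy : y.natDegree < s ^ κ)
    (hl : l < s ^ κ) : cycloCoeff s κ l y = y.coeff l := by
  obtain ⟨c, rfl⟩ : ∃ c, s = c + 2 := ⟨s - 2, by omega⟩
  have h1 : (c + 2) ^ (κ + 1) = (c + 1) * (c + 2) ^ κ + (c + 2) ^ κ := by ring
  have h2 : (c + 2) ^ κ ≤ (c + 1) * (c + 2) ^ κ := Nat.le_mul_of_pos_left _ (Nat.succ_pos _)
  have h3 : y.natDegree < (c + 2) ^ (κ + 1) := by omega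
  rw [cycloCoeff, LinearMap.sub_apply, wrap_eq_coeff h3 (by omega),
    wrap_eq_coeff h3 (by simp only [Nat.add_succ_sub_one]; omega),
    coeff_eq_zero_of_natDegree_lt (n := l + _), sub_zero]
  simp only [Nat.add_succ_sub_one]; omega

/-- The inverse transform of the product of two transforms yields a multiple of the cyclic
convolution, modulo the cyclotomic polynomial. -/
theorem cycloCoeff_dft_mul_dft {s : ℕ} (hs : s.Prime) (κ e : ℕ) (v w : ℕ → P[X]) (l i : ℕ)
    (hi : i < s ^ (κ + 1)) :
    cycloCoeff s κ l (dft s (κ + 1) (s ^ (κ + 1) - 1)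
        (fun t => s ^ e • (dft s (κ + 1) 1 v t * dft s (κ + 1) 1 w t)) i) =
      s ^ (e + (κ + 1)) • cycloCoeff s κ l
        (∑ i₁ ∈ Finset.range (s ^ (κ + 1)), ∑ i₂ ∈ Finset.range (s ^ (κ + 1)),
          if (i₁ + i₂) % s ^ (κ + 1) = i then v i₁ * w i₂ else 0) := by
  set N := s ^ (κ + 1) with hN
  have h1 : dft s (κ + 1) (N - 1)
        (fun t => s ^ e • (dft s (κ + 1) 1 v t * dft s (κ + 1) 1 w t)) i =
      s ^ e • ∑ i₁ ∈ Finset.range N, ∑ i₂ ∈ Finset.range N, ∑ t ∈ Finset.range N,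
        (v i₁ * w i₂) * X ^ (t * (i₁ + i₂ + (N - 1) * i)) := by
    simp only [dft, ← hN]
    rw [Finset.smul_sum]
    have : ∀ t, s ^ e • ((∑ i₁ ∈ Finset.range N, v i₁ * X ^ (1 * i₁ * t)) *
        ∑ i₂ ∈ Finset.range N, w i₂ * X ^ (1 * i₂ * t)) * X ^ ((N - 1) * t * i) =
        ∑ i₁ ∈ Finset.range N, ∑ i₂ ∈ Finset.range N,
          s ^ e • ((v i₁ * w i₂) * X ^ (t * (i₁ + i₂ + (N - 1) * i))) := by
      intro t
      rw [Finset.sum_mul_sum, Finset.smul_sum, Finset.sum_mul]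
      refine Finset.sum_congr rfl fun i₁ _ => ?_
      rw [Finset.smul_sum, Finset.sum_mul]
      refine Finset.sum_congr rfl fun i₂ _ => ?_
      rw [smul_mul_assoc]
      congr 1
      rw [show t * (i₁ + i₂ + (N - 1) * i) = 1 * i₁ * t + 1 * i₂ * t + (N - 1) * t * i by ring,
        pow_add, pow_add]
      ring
    simp only [this]
    rw [Finset.sum_comm]
    refine Finset.sum_congr rfl fun i₁ _ => ?_
    rw [Finset.sum_comm, Finset.smul_sum]
    refine Finset.sum_congr rfl fun i₂ _ => ?_
    rw [Finset.smul_sum]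
  rw [h1, map_nsmul, map_sum, map_sum, pow_add, mul_smul]
  congr 1
  rw [Finset.smul_sum]
  refine Finset.sum_congr rfl fun i₁ _ => ?_
  rw [map_sum, map_sum, Finset.smul_sum]
  refine Finset.sum_congr rfl fun i₂ _ => ?_
  have hdvd : N ∣ i₁ + i₂ + (N - 1) * i ↔ (i₁ + i₂) % N = i := by
    have hpos : 0 < N := pow_pos hs.pos _
    rw [Nat.dvd_iff_mod_eq_zero]
    have h2 : (i₁ + i₂ + (N - 1) * i + i) % N = (i₁ + i₂) % N := by
      obtain ⟨m, hm⟩ : ∃ m, N = m + 1 := ⟨N - 1, by omega⟩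
      rw [hm, show i₁ + i₂ + (m + 1 - 1) * i + i = i₁ + i₂ + (m + 1) * i by simp; ring,
        Nat.add_mul_mod_self_left]
    constructor
    · intro h
      rw [← h2, Nat.add_mod, h, zero_add, Nat.mod_mod, Nat.mod_eq_of_lt hi]
    · intro h
      have h3 : i₁ + i₂ + (N - 1) * i + i ≡ 0 + i [MOD N] := by
        rw [Nat.ModEq, h2, h, zero_add, Nat.mod_eq_of_lt hi]
      exact Nat.ModEq.add_right_cancel' i h3
  split_ifs with h
  · exact cycloCoeff_geom_sum_of_dvd κ _ (hdvd.2 h) l _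
  · rw [cycloCoeff_geom_sum hs κ _ (fun h' => h (hdvd.1 h')), map_zero, smul_zero]

/-- The `i`-th block of `L` coefficients of the remainder of `f` modulo `X ^ N - 1`. -/
noncomputable def block (N L : ℕ) (f : P[X]) (i : ℕ) : P[X] :=
  ∑ l ∈ Finset.range L, monomial l (if i * L + l < N then wrap N (i * L + l) f else 0)

theorem natDegree_block (N : ℕ) {L : ℕ} (hL : 0 < L) (f : P[X]) (i : ℕ) :
    (block N L f i).natDegree < L := by
  have : (block N L f i).natDegree ≤ L - 1 := by
    refine natDegree_sum_le_of_forall_le _ _ fun l hl => ?_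
    exact (natDegree_monomial_le _).trans (by have := Finset.mem_range.1 hl; omega)
  omega

theorem coeffs_block {N L M : ℕ} (hLM : L ≤ M) (f : P[X]) (i : ℕ) :
    coeffs M (block N L f i) ⊆ coeffs N f ∪ {0} := by
  rintro _ ⟨m, rfl⟩
  simp only [block, map_sum, wrap_monomial]
  have hmem : ∀ l, (if i * L + l < N then wrap N (i * L + l) f else 0) ∈ coeffs N f ∪ {0} := by
    intro l
    split_ifs
    · exact Or.inl (wrap_mem_coeffs _ _ _)
    · exact Or.inr rfl
  by_cases hm : m % M < L
  · rw [Finset.sum_eq_single (m % M)]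
    · rw [Nat.mod_mod, if_pos rfl]; exact hmem _
    · intro l hl hlm
      have hl' := Finset.mem_range.1 hl
      rw [Nat.mod_eq_of_lt (hl'.trans_le hLM), if_neg hlm]
    · intro h; exact absurd (Finset.mem_range.2 hm) h
  · right
    refine Finset.sum_eq_zero fun l hl => ?_
    have hl' := Finset.mem_range.1 hl
    rw [Nat.mod_eq_of_lt (hl'.trans_le hLM), if_neg]
    rintro rfl
    exact hm hl'

theorem wrap_sum_block {N L M : ℕ} (hN : 0 < N) (h : N ≤ M * L) (f : P[X]) (n : ℕ) :
    wrap N n (∑ i ∈ Finset.range M, block N L f i * X ^ (i * L)) = wrap N n f := by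
  have h1 : ∑ i ∈ Finset.range M, block N L f i * X ^ (i * L) =
      ∑ m ∈ Finset.range (M * L), monomial m (if m < N then wrap N m f else 0) := by
    rw [sum_range_mul]
    refine Finset.sum_congr rfl fun i _ => ?_
    rw [block, Finset.sum_mul]
    refine Finset.sum_congr rfl fun l _ => ?_
    rw [monomial_mul_X_pow, add_comm l]
  rw [h1, map_sum, Finset.sum_eq_single (n % N)]
  · rw [wrap_monomial, Nat.mod_mod, if_pos rfl, if_pos (Nat.mod_lt _ hN), wrap_mod]
  · intro m _ hm
    rw [wrap_monomial]
    split_ifs with h2 h3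
    · rw [Nat.mod_eq_of_lt h3] at h2; exact absurd h2 hm
    · rfl
    · rfl
  · intro h2
    exact absurd (Finset.mem_range.2 ((Nat.mod_lt _ hN).trans_le h)) h2

/-- The coefficients of a cyclic convolution, in terms of the convolution of the sequences of
blocks. -/
theorem wrap_mul_eq_sum_block {N L M : ℕ} (hN : 0 < N) (hL : 0 < L) (h : N ≤ M * L)
    (hM : N ∣ M * L) (f g : P[X]) (n : ℕ) :
    wrap N n (f * g) = ∑ i ∈ Finset.range M, ∑ l ∈ Finset.range (2 * L),
      if (i * L + l) % N = n % N then
        (∑ i₁ ∈ Finset.range M, ∑ i₂ ∈ Finset.range M,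
          if (i₁ + i₂) % M = i then block N L f i₁ * block N L g i₂ else 0).coeff l else 0 := by
  have hM0 : 0 < M := Nat.pos_of_ne_zero fun h0 => by subst h0; omega
  have hdeg : ∀ i₁ i₂, (block N L f i₁ * block N L g i₂).natDegree ≤ 2 * L - 1 := by
    intro i₁ i₂
    have h1 := natDegree_block N hL f i₁
    have h2 := natDegree_block N hL g i₂
    have h3 := natDegree_mul_le (p := block N L f i₁) (q := block N L g i₂)
    omega
  have h1 : wrap N n (f * g) = wrap N n ((∑ i ∈ Finset.range M, block N L f i * X ^ (i * L)) *
      ∑ i ∈ Finset.range M, block N L g i * X ^ (i * L)) := by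
    rw [wrap_mul hN, wrap_mul hN]
    simp only [wrap_sum_block hN h]
  have h2 : ∀ i, ∑ l ∈ Finset.range (2 * L), (if (i * L + l) % N = n % N then
        (∑ i₁ ∈ Finset.range M, ∑ i₂ ∈ Finset.range M,
          if (i₁ + i₂) % M = i then block N L f i₁ * block N L g i₂ else 0).coeff l else 0) =
      wrap N n ((∑ i₁ ∈ Finset.range M, ∑ i₂ ∈ Finset.range M,
          if (i₁ + i₂) % M = i then block N L f i₁ * block N L g i₂ else 0) * X ^ (i * L)) := by
    intro i
    have hd : (∑ i₁ ∈ Finset.range M, ∑ i₂ ∈ Finset.range M,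
        if (i₁ + i₂) % M = i then block N L f i₁ * block N L g i₂ else 0).natDegree <
        2 * L := by
      have : (∑ i₁ ∈ Finset.range M, ∑ i₂ ∈ Finset.range M,
        if (i₁ + i₂) % M = i then block N L f i₁ * block N L g i₂ else 0).natDegree ≤
        2 * L - 1 := by
        refine natDegree_sum_le_of_forall_le _ _ fun i₁ _ =>
          natDegree_sum_le_of_forall_le _ _ fun i₂ _ => ?_
        split_ifs
        · exact hdeg _ _
        · simp
      omega
    conv_rhs => rw [as_sum_range' _ _ hd]
    rw [Finset.sum_mul, map_sum]
    refine Finset.sum_congr rfl fun l _ => ?_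
    rw [monomial_mul_X_pow, wrap_monomial, add_comm l]
  simp only [h2]
  rw [h1, Finset.sum_mul_sum]
  simp only [Finset.sum_mul, map_sum]
  conv_rhs => rw [Finset.sum_comm]
  refine Finset.sum_congr rfl fun i₁ _ => ?_
  conv_rhs => rw [Finset.sum_comm]
  refine Finset.sum_congr rfl fun i₂ _ => ?_
  rw [Finset.sum_eq_single ((i₁ + i₂) % M)]
  · rw [if_pos rfl, show block N L f i₁ * X ^ (i₁ * L) * (block N L g i₂ * X ^ (i₂ * L)) =
      block N L f i₁ * block N L g i₂ * X ^ ((i₁ + i₂) * L) by ring]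
    refine wrap_mul_X_pow_congr ?_ _ _
    conv_lhs => rw [← Nat.mod_add_div (i₁ + i₂) M]
    obtain ⟨c, hc⟩ := hM
    rw [add_mul, show M * ((i₁ + i₂) / M) * L = N * (c * ((i₁ + i₂) / M)) by
      rw [mul_right_comm, hc]; ring, Nat.add_mul_mod_self_left]
  · intro i _ hi
    rw [if_neg (Ne.symm hi), zero_mul, map_zero]
  · intro h3; exact absurd (Finset.mem_range.2 (Nat.mod_lt _ hM0)) h3

end Cyclic

end SLPInterp

namespace SLPInterp

open Polynomial

section Convolution

variable {P : Type u} [CommRing P]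

/-- Sums over the fibres of a map cost one addition for each element, and one zero for each fibre.
-/
theorem Cost.fiberSums {ι : Type v} [DecidableEq ι] (s : Finset ι) (N : ℕ) (π : ι → ℕ) (y : ι → P)
    {S : Set P} (hπ : ∀ i ∈ s, π i < N) (hy : ∀ i ∈ s, y i ∈ S) :
    Cost S (s.card + N) (⋃ n ∈ Finset.range N, {∑ i ∈ s with π i = n, y i}) := by
  have h := Cost.biUnion (Finset.range N) (S := S)
    (c := fun n => (s.filter fun i => π i = n).card + 1)
    (T := fun n => {∑ i ∈ s with π i = n, y i})
    (fun n _ => Cost.sum _ _ fun i hi => hy i (Finset.mem_filter.1 hi).1)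
  refine h.le (le_of_eq ?_)
  rw [Finset.sum_add_distrib, Finset.sum_const, Finset.card_range, smul_eq_mul, mul_one,
    ← Finset.card_eq_sum_card_fiberwise]
  intro i hi
  exact Finset.mem_coe.2 (Finset.mem_range.2 (hπ i hi))

/-- A multiple, by the factor `s ^ e`, of the product of two polynomials modulo `X ^ (s ^ k) - 1`
can be computed with `c` operations. -/
def ConvCost (s k c e : ℕ) : Prop :=
  ∀ (P : Type u) [CommRing P] (f g : P[X]),
    Cost (coeffs (s ^ k) f ∪ coeffs (s ^ k) g) c (coeffs (s ^ k) (s ^ e • (f * g)))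

theorem ConvCost.le {s k c c' e : ℕ} (h : ConvCost.{u} s k c e) (hc : c ≤ c') :
    ConvCost.{u} s k c' e :=
  fun P _ f g => (h P f g).le hc

/-- The multiplication by the definition, which serves as the base of the recursion. -/
theorem convCost_schoolbook {s : ℕ} (hs : 0 < s) (k : ℕ) :
    ConvCost.{u} s k (2 * (s ^ k * s ^ k) + s ^ k) 0 := by
  intro P _ f g
  set N := s ^ k with hN
  have hN0 : 0 < N := pow_pos hs _
  rw [pow_zero, one_smul]
  have h1 : Cost (coeffs N f ∪ coeffs N g) (N * N)
      (⋃ x ∈ Finset.range N ×ˢ Finset.range N, {wrap N x.1 f * wrap N x.2 g}) := by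
    have := Cost.biUnion_const (Finset.range N ×ˢ Finset.range N)
      (S := coeffs N f ∪ coeffs N g) (c := 1)
      (T := fun x => {wrap N x.1 f * wrap N x.2 g}) (fun x _ =>
        Cost.mul (Or.inl (wrap_mem_coeffs _ _ _)) (Or.inr (wrap_mem_coeffs _ _ _)))
    simpa using this
  have h2 := Cost.fiberSums (Finset.range N ×ˢ Finset.range N) N (fun x => (x.1 + x.2) % N)
    (fun x => wrap N x.1 f * wrap N x.2 g)
    (S := ⋃ x ∈ Finset.range N ×ˢ Finset.range N, {wrap N x.1 f * wrap N x.2 g})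
    (fun x _ => Nat.mod_lt _ hN0) (fun x hx => Set.mem_biUnion hx rfl)
  refine (h1.trans h2).mono subset_rfl ?_ ?_
  · rw [Finset.card_product, Finset.card_range]; omega
  · refine (coeffs_eq_biUnion hN0 _).trans (Set.iUnion₂_mono fun n hn => ?_)
    rw [Set.singleton_subset_singleton, wrap_mul hN0, Finset.sum_filter, Finset.sum_product]
    simp only [Nat.mod_eq_of_lt (Finset.mem_range.1 hn)]

theorem cost_cycloCoeff {s κ : ℕ} (l : ℕ) (f : P[X]) :
    Cost (coeffs (s ^ (κ + 1)) f) 1 {cycloCoeff s κ l f} := by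
  rw [cycloCoeff, LinearMap.sub_apply]
  exact Cost.sub (wrap_mem_coeffs _ _ _) (wrap_mem_coeffs _ _ _)

/-- One level of the Schönhage recursion: `f` and `g` are cut into blocks of length `s ^ a`, and the
sequences of blocks are convolved by the Fourier transform of length `s ^ (κ + 1)` over the
polynomials modulo `X ^ (s ^ (κ + 1)) - 1`, where `X` is a root of unity. -/
theorem ConvCost.step {s : ℕ} (hs : s.Prime) {κ a k c e : ℕ} (ha : a + 1 ≤ κ) (hk : k ≤ a + κ + 1)
    (h : ConvCost.{u} s (κ + 1) c e) :
    ConvCost.{u} s k (1 + 3 * ((κ + 1) * (s ^ (κ + 1) * (2 * s * s ^ (κ + 1)))) +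
      s ^ (κ + 1) * c + 2 * (s ^ (κ + 1) * (2 * s ^ a)) + s ^ k) (e + (κ + 1)) := by
  intro P _ f g
  set N := s ^ k with hN
  set M := s ^ (κ + 1) with hM
  set L := s ^ a with hL
  set F := (κ + 1) * (M * (2 * s * M)) with hF
  have hN0 : 0 < N := pow_pos hs.pos _
  have hM0 : 0 < M := pow_pos hs.pos _
  have hL0 : 0 < L := pow_pos hs.pos _
  have hdvd : N ∣ M * L := by
    rw [hM, hL, ← pow_add]; exact pow_dvd_pow _ (by omega)
  have hle : N ≤ M * L := Nat.le_of_dvd (Nat.mul_pos hM0 hL0) hdvd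
  have hLM : L ≤ M := Nat.pow_le_pow_right hs.pos (by omega)
  -- The products of two blocks are short enough to be determined by their remainders modulo the
  -- cyclotomic polynomial, whose degree is at least `s ^ κ`.
  have hLq : 2 * L ≤ s ^ κ := by
    calc 2 * L ≤ s * L := Nat.mul_le_mul_right _ hs.two_le
      _ = s ^ (a + 1) := by rw [hL, pow_succ']
      _ ≤ s ^ κ := Nat.pow_le_pow_right hs.pos ha
  set V := dft s (κ + 1) 1 (block N L f)
  set W := dft s (κ + 1) 1 (block N L g)
  set Z : ℕ → P[X] := fun t => s ^ e • (V t * W t) with hZ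
  set U := dft s (κ + 1) (M - 1) Z with hU
  have c0 : Cost (coeffs N f ∪ coeffs N g) 1 ((coeffs N f ∪ coeffs N g) ∪ {0}) :=
    (Cost.zero _).keep
  have c1 : Cost ((coeffs N f ∪ coeffs N g) ∪ {0}) F (⋃ t, coeffs M (V t)) := by
    refine (cost_dft hM0 hs.pos (κ + 1) 1 (block N L f) (by rw [one_mul])).mono_left ?_
    refine Set.iUnion₂_subset fun i _ => (coeffs_block hLM f i).trans ?_
    exact Set.union_subset_union_left _ Set.subset_union_left
  have c2 : Cost ((coeffs N f ∪ coeffs N g) ∪ {0}) F (⋃ t, coeffs M (W t)) := by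
    refine (cost_dft hM0 hs.pos (κ + 1) 1 (block N L g) (by rw [one_mul])).mono_left ?_
    refine Set.iUnion₂_subset fun i _ => (coeffs_block hLM g i).trans ?_
    exact Set.union_subset_union_left _ Set.subset_union_right
  -- The products of the values of the transforms are computed by the assumption for `κ + 1`.
  have c3 : Cost ((⋃ t, coeffs M (V t)) ∪ ⋃ t, coeffs M (W t)) (M * c)
      (⋃ t ∈ Finset.range M, coeffs M (Z t)) := by
    have := Cost.biUnion_const (Finset.range M)
      (S := (⋃ t, coeffs M (V t)) ∪ ⋃ t, coeffs M (W t)) (c := c)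
      (T := fun t => coeffs M (Z t)) (fun t _ => (h P (V t) (W t)).mono_left
        (Set.union_subset_union (Set.subset_iUnion (fun t => coeffs M (V t)) t)
          (Set.subset_iUnion (fun t => coeffs M (W t)) t)))
    rwa [Finset.card_range] at this
  have c4 : Cost (⋃ t ∈ Finset.range M, coeffs M (Z t)) F (⋃ t, coeffs M (U t)) :=
    cost_dft hM0 hs.pos (κ + 1) (M - 1) Z (Dvd.intro_left _ rfl)
  have c5 : Cost (⋃ t, coeffs M (U t)) (M * (2 * L))
      (⋃ x ∈ Finset.range M ×ˢ Finset.range (2 * L), {cycloCoeff s κ x.2 (U x.1)}) := by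
    have := Cost.biUnion_const (Finset.range M ×ˢ Finset.range (2 * L))
      (S := ⋃ t, coeffs M (U t)) (c := 1)
      (T := fun x => {cycloCoeff s κ x.2 (U x.1)}) (fun x _ =>
        (cost_cycloCoeff x.2 (U x.1)).mono_left (Set.subset_iUnion (fun t => coeffs M (U t)) x.1))
    simpa using this
  -- Neighbouring products of blocks overlap; the overlapping coefficients are added.
  have c6 := Cost.fiberSums (Finset.range M ×ˢ Finset.range (2 * L)) N
    (fun x => (x.1 * L + x.2) % N) (fun x => cycloCoeff s κ x.2 (U x.1))
    (S := ⋃ x ∈ Finset.range M ×ˢ Finset.range (2 * L), {cycloCoeff s κ x.2 (U x.1)})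
    (fun x _ => Nat.mod_lt _ hN0) (fun x hx => Set.mem_biUnion hx rfl)
  refine ((((c0.trans (c1.union c2)).trans c3).trans c4).trans (c5.trans c6)).mono
    subset_rfl ?_ ?_
  · rw [Finset.card_product, Finset.card_range, Finset.card_range]
    ring_nf; omega
  · refine (coeffs_eq_biUnion hN0 _).trans (Set.iUnion₂_mono fun n hn => ?_)
    rw [Set.singleton_subset_singleton, map_nsmul, wrap_mul_eq_sum_block hN0 hL0 hle hdvd,
      Finset.sum_filter, Finset.sum_product, Finset.smul_sum]
    refine Finset.sum_congr rfl fun i hi => ?_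
    rw [Finset.smul_sum]
    refine Finset.sum_congr rfl fun l hl => ?_
    rw [Nat.mod_eq_of_lt (Finset.mem_range.1 hn)]
    split_ifs
    · rw [hU, hZ, cycloCoeff_dft_mul_dft hs κ e _ _ l i (Finset.mem_range.1 hi)]
      congr 1
      rw [cycloCoeff_eq_coeff hs.two_le]
      · refine lt_of_lt_of_le ?_ hLq
        have : ∀ i₁ i₂, (block N L f i₁ * block N L g i₂).natDegree ≤ 2 * L - 1 := by
          intro i₁ i₂
          have h1 := natDegree_block N hL0 f i₁
          have h2 := natDegree_block N hL0 g i₂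
          have h3 := natDegree_mul_le (p := block N L f i₁) (q := block N L g i₂)
          omega
        refine lt_of_le_of_lt (natDegree_sum_le_of_forall_le (n := 2 * L - 1) _ _ fun i₁ _ =>
          natDegree_sum_le_of_forall_le _ _ fun i₂ _ => ?_) (by omega)
        split_ifs
        · exact this _ _
        · simp
      · exact (Finset.mem_range.1 hl).trans_le hLq
    · simp

/-- Each level of the recursion halves the exponent `k - 3` and multiplies the cost per coefficient
by at most `s ^ 3 ≤ 27`, so that the cost remains linear up to powers of `k`. -/
theorem exists_convCost {s : ℕ} (hs : s.Prime) (hs3 : s ≤ 3) (k : ℕ) :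
    ∃ e ≤ 6 * k, ConvCost.{u} s k (s ^ k * (60 * (k + 1) * 64 ^ (k - 3).size)) e := by
  induction k using Nat.strong_induction_on with
  | _ k ih =>
    rcases Nat.lt_or_ge k 4 with hk | hk
    · refine ⟨0, Nat.zero_le _, (convCost_schoolbook hs.pos k).le ?_⟩
      have h1 : s ^ k ≤ 27 := by
        calc s ^ k ≤ 3 ^ k := Nat.pow_le_pow_left hs3 k
          _ ≤ 3 ^ 3 := Nat.pow_le_pow_right (by norm_num) (by omega)
          _ = 27 := by norm_num
      have h2 : k - 3 = 0 := by omega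
      rw [h2, Nat.size_zero, pow_zero, mul_one]
      calc 2 * (s ^ k * s ^ k) + s ^ k = s ^ k * (2 * s ^ k + 1) := by ring
        _ ≤ s ^ k * (60 * (k + 1)) := Nat.mul_le_mul_left _ (by omega)
    -- Blocks of length `s ^ (κ - 1)` suffice, as `s ^ k ≤ s ^ (κ - 1) * s ^ (κ + 1)`, and
    -- `κ + 1 - 3` is half of `k - 3`.
    · obtain ⟨κ, hκ⟩ : ∃ κ, (k + 3) / 2 = κ + 1 := ⟨(k + 3) / 2 - 1, by omega⟩
      obtain ⟨e, he, hc⟩ := ih (κ + 1) (by omega)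
      refine ⟨e + (κ + 1), by omega,
        (hc.step hs (a := κ - 1) (k := k) (by omega) (by omega)).le ?_⟩
      set M := s ^ (κ + 1) with hM
      set N := s ^ k with hN
      have hMM : M * M ≤ 27 * N := by
        rw [hM, ← pow_add]
        calc s ^ (κ + 1 + (κ + 1)) ≤ s ^ (3 + k) := Nat.pow_le_pow_right hs.pos (by omega)
          _ = s ^ 3 * N := pow_add _ _ _
          _ ≤ 27 * N := Nat.mul_le_mul_right _ (by
            calc s ^ 3 ≤ 3 ^ 3 := Nat.pow_le_pow_left hs3 3
              _ = 27 := by norm_num)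
      have hL : 2 * s ^ (κ - 1) ≤ M := by
        calc 2 * s ^ (κ - 1) ≤ s * s ^ (κ - 1) := Nat.mul_le_mul_right _ hs.two_le
          _ = s ^ (κ - 1 + 1) := by rw [pow_succ']
          _ ≤ M := Nat.pow_le_pow_right hs.pos (by omega)
      have hN0 : 0 < N := pow_pos hs.pos _
      have hsize : (k - 3).size = (κ + 1 - 3).size + 1 := by
        have h1 : Nat.bit (decide ((k - 3) % 2 = 1)) (κ + 1 - 3) = k - 3 := by
          rw [Nat.bit_val]
          rcases Nat.mod_two_eq_zero_or_one (k - 3) with h | h <;> simp [h] <;> omega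
        have h2 := Nat.size_bit (b := decide ((k - 3) % 2 = 1)) (n := κ + 1 - 3)
          (by rw [h1]; omega)
        rw [h1] at h2
        exact h2
      rw [hsize, pow_succ]
      set E := 64 ^ (κ + 1 - 3).size
      have hE : 1 ≤ E := Nat.one_le_pow _ _ (by norm_num)
      have hκk : κ + 1 ≤ k := by omega
      have a1 : (κ + 1) * (M * (2 * s * M)) ≤ k * (6 * (27 * N)) := by
        calc (κ + 1) * (M * (2 * s * M)) = (κ + 1) * ((2 * s) * (M * M)) := by ring
          _ ≤ k * ((2 * 3) * (27 * N)) := by gcongr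
          _ = k * (6 * (27 * N)) := by ring
      have a2 : M * (M * (60 * (κ + 1 + 1) * E)) ≤ (27 * N) * (60 * (k + 1) * E) := by
        calc M * (M * (60 * (κ + 1 + 1) * E)) = (M * M) * (60 * (κ + 1 + 1) * E) := by ring
          _ ≤ _ := by gcongr
      have a3 : M * (2 * s ^ (κ - 1)) ≤ 27 * N := (Nat.mul_le_mul_left _ hL).trans hMM
      have a4 : k * N ≤ N * (k + 1) * E := by
        calc k * N ≤ (k + 1) * N * 1 := by nlinarith
          _ ≤ (k + 1) * N * E := Nat.mul_le_mul_left _ hE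
          _ = _ := by ring
      have a5 : N ≤ N * (k + 1) * E := by
        calc N = N * 1 * 1 := by ring
          _ ≤ N * (k + 1) * E := by gcongr; omega
      nlinarith

/-- The product modulo `X ^ m - 1`, as a map on coefficient vectors. -/
def cyclicConv {m : ℕ} (a b : Fin m → P) (k : Fin m) : P :=
  ∑ i : Fin m, ∑ j : Fin m, if ((i : ℕ) + (j : ℕ)) % m = (k : ℕ) then a i * b j else 0

/-- Bézout's identity with natural coefficients. -/
theorem exists_bezout {x y : ℕ} (hx : 0 < x) (hy : 0 < y) (h : x.Coprime y) :
    ∃ u v, u ≤ y ∧ v ≤ x ∧ u * x = v * y + 1 := by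
  rcases Nat.lt_or_ge 1 y with hy1 | hy1
  · obtain ⟨u, hu, hux⟩ := Nat.exists_mul_mod_eq_one_of_coprime h hy1
    refine ⟨u, x * u / y, hu.le, ?_, ?_⟩
    · calc x * u / y ≤ x * y / y := Nat.div_le_div_right (Nat.mul_le_mul_left _ hu.le)
        _ = x := Nat.mul_div_cancel _ hy
    · have := Nat.div_add_mod (x * u) y
      rw [hux, mul_comm y] at this
      rw [mul_comm u]
      exact this.symm
  · have : y = 1 := by omega
    subst this
    exact ⟨1, x - 1, le_rfl, Nat.sub_le _ _, by omega⟩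

/-- The polynomial with the given vector of coefficients. -/
noncomputable def ofVec {m : ℕ} (a : Fin m → P) : P[X] := ∑ i : Fin m, monomial (i : ℕ) (a i)

theorem natDegree_ofVec {m : ℕ} (hm : 0 < m) (a : Fin m → P) : (ofVec a).natDegree < m := by
  have : (ofVec a).natDegree ≤ m - 1 :=
    natDegree_sum_le_of_forall_le _ _ fun i _ => (natDegree_monomial_le _).trans (by omega)
  omega

theorem wrap_ofVec {m N : ℕ} (hmN : m ≤ N) (a : Fin m → P) (n : ℕ) :
    wrap N n (ofVec a) = if h : n % N < m then a ⟨n % N, h⟩ else 0 := by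
  rw [ofVec, map_sum]
  simp only [wrap_monomial]
  split_ifs with h
  · rw [Finset.sum_eq_single ⟨n % N, h⟩]
    · simp
    · intro i _ hi
      rw [if_neg]
      intro h2
      rw [Nat.mod_eq_of_lt (i.2.trans_le hmN)] at h2
      exact hi (Fin.ext h2)
    · intro h2; exact absurd (Finset.mem_univ _) h2
  · refine Finset.sum_eq_zero fun i _ => ?_
    rw [if_neg]
    intro h2
    rw [Nat.mod_eq_of_lt (i.2.trans_le hmN)] at h2
    exact h (h2 ▸ i.2)

theorem coeffs_ofVec {m N : ℕ} (hmN : m ≤ N) (a : Fin m → P) :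
    coeffs N (ofVec a) ⊆ Set.range a ∪ {0} := by
  rintro _ ⟨n, rfl⟩
  simp only [wrap_ofVec hmN]
  split_ifs with h
  · exact Or.inl ⟨_, rfl⟩
  · exact Or.inr rfl

theorem wrap_ofVec_mul {m : ℕ} (a b : Fin m → P) (k : Fin m) :
    wrap m k (ofVec a * ofVec b) = cyclicConv a b k := by
  have hm : 0 < m := k.pos
  have hw : ∀ (c : Fin m → P) (i : Fin m), wrap m i (ofVec c) = c i := by
    intro c i
    rw [wrap_ofVec le_rfl, dif_pos (by rw [Nat.mod_eq_of_lt i.2]; exact i.2)]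
    simp [Nat.mod_eq_of_lt i.2]
  rw [wrap_mul hm, Finset.sum_range, cyclicConv]
  refine Finset.sum_congr rfl fun i _ => ?_
  rw [Finset.sum_range]
  refine Finset.sum_congr rfl fun j _ => ?_
  rw [hw, hw, Nat.mod_eq_of_lt k.2]

/-- The coefficients of the product of two polynomials of length `m`, up to a power of `s`: there is
no wrapping modulo `X ^ (s ^ k) - 1` if `2 m ≤ s ^ k`. -/
theorem exists_cost_smul_coeff {s : ℕ} (hs : s.Prime) (hs3 : s ≤ 3) {m : ℕ} (hm : 0 < m) :
    ∃ e ≤ 12 * m.size, ∀ (P : Type u) [CommRing P] (a b : Fin m → P),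
      Cost (Set.range a ∪ Set.range b) (1 + 6 * 60 * 3 * 5 ^ 6 * m * m.size ^ 7)
        (⋃ n ∈ Finset.range (2 * m), {s ^ e • (ofVec a * ofVec b).coeff n}) := by
  set k := Nat.clog s (2 * m) with hk
  have hsz : 1 ≤ m.size := Nat.size_pos.2 hm
  have hkm : k ≤ m.size + 1 := by
    refine (Nat.clog_anti_left (by norm_num) hs.two_le).trans (Nat.clog_le_of_le_pow ?_)
    have := Nat.lt_size_self m
    rw [pow_succ]; omega
  have h1 : 2 * m ≤ s ^ k := Nat.le_pow_clog hs.one_lt _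
  have h2 : s ^ k ≤ 6 * m := by
    have h3 : s ^ (k - 1) < 2 * m := Nat.pow_pred_clog_lt_self hs.one_lt (by omega)
    have h4 : 0 < k := Nat.clog_pos hs.one_lt (by omega)
    calc s ^ k = s * s ^ (k - 1) := by rw [← pow_succ']; congr 1; omega
      _ ≤ 3 * (2 * m) := Nat.mul_le_mul hs3 h3.le
      _ = 6 * m := by ring
  obtain ⟨e, he, hc⟩ := exists_convCost.{u} hs hs3 k
  refine ⟨e, by omega, fun P _ a b => ?_⟩
  have c0 : Cost (Set.range a ∪ Set.range b) 1 ((Set.range a ∪ Set.range b) ∪ {0}) :=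
    (Cost.zero _).keep
  have c1 := (hc P (ofVec a) (ofVec b)).mono_left
    (S' := (Set.range a ∪ Set.range b) ∪ {0}) (Set.union_subset
      ((coeffs_ofVec (by omega) a).trans
        (Set.union_subset_union_left _ Set.subset_union_left))
      ((coeffs_ofVec (by omega) b).trans
        (Set.union_subset_union_left _ Set.subset_union_right)))
  refine (c0.trans c1).mono subset_rfl (Nat.add_le_add_left ?_ _) ?_
  · have h5 : 64 ^ (k - 3).size ≤ (5 * m.size) ^ 6 := by
      have h6 : 2 ^ (k - 3).size ≤ 5 * m.size := by
        rcases Nat.eq_zero_or_pos (k - 3) with h | h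
        · rw [h]; simp; omega
        · have h7 : 2 ^ ((k - 3).size - 1) ≤ k - 3 :=
            Nat.lt_size.1 (by have := Nat.size_pos.2 h; omega)
          have h8 : 0 < (k - 3).size := Nat.size_pos.2 h
          calc 2 ^ (k - 3).size = 2 * 2 ^ ((k - 3).size - 1) := by
                rw [← pow_succ']; congr 1; omega
            _ ≤ 5 * m.size := by omega
      calc 64 ^ (k - 3).size = (2 ^ (k - 3).size) ^ 6 := by
            rw [← pow_mul, mul_comm, pow_mul]; norm_num
        _ ≤ _ := Nat.pow_le_pow_left h6 6
    calc s ^ k * (60 * (k + 1) * 64 ^ (k - 3).size)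
        ≤ 6 * m * (60 * (3 * m.size) * (5 * m.size) ^ 6) := by gcongr; omega
      _ = _ := by ring
  · refine Set.iUnion₂_subset fun n hn => ?_
    have hn' := Finset.mem_range.1 hn
    rw [Set.singleton_subset_iff]
    refine ⟨n, ?_⟩
    dsimp only
    rw [map_nsmul, wrap_eq_coeff _ (by omega)]
    have h3 := natDegree_mul_le (p := ofVec a) (q := ofVec b)
    have h4 := natDegree_ofVec hm a
    have h5 := natDegree_ofVec hm b
    omega

/-- The cyclic convolution of length `m` without divisions: the product is a linear combination of
its multiples by a power of two and by a power of three. -/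
theorem exists_cost_cyclicConv : ∃ C r : ℕ, ∀ (m : ℕ), 0 < m → ∀ (P : Type u) [CommRing P]
    (a b : Fin m → P), Cost (Set.range a ∪ Set.range b) (C * (m * (m.size) ^ r))
      (Set.range (cyclicConv a b)) := by
  refine ⟨2 * (6 * 60 * 3 * 5 ^ 6) + 200, 7, fun m hm => ?_⟩
  obtain ⟨e₂, he₂, h₂⟩ := exists_cost_smul_coeff.{u} Nat.prime_two (by norm_num) hm
  obtain ⟨e₃, he₃, h₃⟩ := exists_cost_smul_coeff.{u} Nat.prime_three le_rfl hm
  obtain ⟨x, y, hx, hy, hxy⟩ := exists_bezout (x := 2 ^ e₂) (y := 3 ^ e₃)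
    (by positivity) (by positivity) (Nat.Coprime.pow _ _ (by norm_num))
  intro P _ a b
  have hsz : 1 ≤ m.size := Nat.size_pos.2 hm
  have hxs : x.size ≤ 25 * m.size := by
    refine Nat.size_le.2 (lt_of_le_of_lt hx ?_)
    calc 3 ^ e₃ ≤ 4 ^ e₃ := Nat.pow_le_pow_left (by norm_num) _
      _ = 2 ^ (2 * e₃) := by rw [show (4 : ℕ) = 2 ^ 2 by norm_num, ← pow_mul]
      _ < 2 ^ (25 * m.size) := Nat.pow_lt_pow_right (by norm_num) (by omega)
  have hys : y.size ≤ 25 * m.size := by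
    refine Nat.size_le.2 (lt_of_le_of_lt hy ?_)
    exact Nat.pow_lt_pow_right (by norm_num) (by omega)
  set c := fun n => (ofVec a * ofVec b).coeff n with hc
  have c1 : Cost (Set.range a ∪ Set.range b)
      ((1 + 6 * 60 * 3 * 5 ^ 6 * m * m.size ^ 7) + (1 + 6 * 60 * 3 * 5 ^ 6 * m * m.size ^ 7) +
        ((3 * x.size + 1) + (3 * y.size + 1)))
      (((⋃ n ∈ Finset.range (2 * m), {2 ^ e₂ • c n}) ∪ ⋃ n ∈ Finset.range (2 * m), {3 ^ e₃ • c n}) ∪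
        ({(x : P)} ∪ {(y : P)})) :=
    ((h₂ P a b).union (h₃ P a b)).union ((Cost.natCast _ x).union (Cost.natCast _ y))
  have c2 : Cost (((⋃ n ∈ Finset.range (2 * m), {2 ^ e₂ • c n}) ∪
      ⋃ n ∈ Finset.range (2 * m), {3 ^ e₃ • c n}) ∪ ({(x : P)} ∪ {(y : P)})) (2 * m * 3)
      (⋃ n ∈ Finset.range (2 * m), {c n}) := by
    have := Cost.biUnion_const (Finset.range (2 * m))
      (S := ((⋃ n ∈ Finset.range (2 * m), {2 ^ e₂ • c n}) ∪
        ⋃ n ∈ Finset.range (2 * m), {3 ^ e₃ • c n}) ∪ ({(x : P)} ∪ {(y : P)}))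
      (c := 3) (T := fun n => {c n}) (fun n hn => by
        have h4 : c n = (x : P) * (2 ^ e₂ • c n) - (y : P) * (3 ^ e₃ • c n) := by
          have h5 : ((x * 2 ^ e₂ : ℕ) : P) = ((y * 3 ^ e₃ + 1 : ℕ) : P) := by rw [hxy]
          rw [nsmul_eq_mul, nsmul_eq_mul, ← mul_assoc, ← mul_assoc, ← Nat.cast_mul,
            ← Nat.cast_mul, h5]
          push_cast
          ring
        rw [h4]
        refine Cost.sub' (c := 1) (d := 1) (Cost.mul ?_ ?_) (Cost.mul ?_ ?_)
        · exact Or.inr (Or.inl rfl)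
        · exact Or.inl (Or.inl (Set.mem_biUnion hn rfl))
        · exact Or.inr (Or.inr rfl)
        · exact Or.inl (Or.inr (Set.mem_biUnion hn rfl)))
    rwa [Finset.card_range] at this
  have c3 := Cost.fiberSums (Finset.range (2 * m)) m (fun n => n % m) c
    (S := ⋃ n ∈ Finset.range (2 * m), {c n})
    (fun n _ => Nat.mod_lt _ hm) (fun n hn => Set.mem_biUnion hn rfl)
  refine ((c1.trans c2).trans c3).mono subset_rfl ?_ ?_
  · rw [Finset.card_range]
    have h4 : m ≤ m * m.size ^ 7 := Nat.le_mul_of_pos_right _ (by positivity)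
    have h5 : m.size ≤ m * m.size ^ 7 := by
      calc m.size = 1 * m.size ^ 1 := by ring
        _ ≤ m * m.size ^ 7 := Nat.mul_le_mul hm (Nat.pow_le_pow_right hsz (by norm_num))
    have h6 : 6 * 60 * 3 * 5 ^ 6 * m * m.size ^ 7 = 16875000 * (m * m.size ^ 7) := by ring
    rw [h6]
    generalize m * m.size ^ 7 = z at *
    omega
  · rintro _ ⟨k, rfl⟩
    refine Set.mem_biUnion (Finset.mem_range.2 k.2) ?_
    have hdeg : (ofVec a * ofVec b).natDegree < 2 * m := by
      have h3 := natDegree_mul_le (p := ofVec a) (q := ofVec b)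
      have h4 := natDegree_ofVec hm a
      have h5 := natDegree_ofVec hm b
      omega
    rw [Set.mem_singleton_iff, ← wrap_ofVec_mul, wrap_eq_sum hdeg, Finset.sum_filter,
      Nat.mod_eq_of_lt k.2]

end Convolution

end SLPInterp

namespace SLPInterp

/-! ### Boolean circuits for integer arithmetic -/

section Circuits

variable {X : Type u}

/-- The binary digit at position `i` of a natural number that depends on the inputs. -/
def bit (F : X → ℕ) (i : ℕ) : X → ZMod 2 := fun x => ((F x / 2 ^ i : ℕ) : ZMod 2)

/-- The `k` lowest binary digits. -/
def Bits (k : ℕ) (F : X → ℕ) : Set (X → ZMod 2) := {b | ∃ i < k, b = bit F i}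

theorem bit_mem_Bits {k i : ℕ} (h : i < k) (F : X → ℕ) : bit F i ∈ Bits k F := ⟨i, h, rfl⟩

theorem Bits_mono {k l : ℕ} (h : k ≤ l) (F : X → ℕ) : Bits k F ⊆ Bits l F := by
  rintro _ ⟨i, hi, rfl⟩; exact ⟨i, hi.trans_le h, rfl⟩

theorem Bits_zero (F : X → ℕ) : Bits 0 F = ∅ := by
  ext b; simp [Bits]

theorem Bits_succ (k : ℕ) (F : X → ℕ) : Bits (k + 1) F = Bits k F ∪ {bit F k} := by
  ext b
  simp only [Bits, Set.mem_ofPred_eq, Set.mem_union, Set.mem_singleton_iff]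
  constructor
  · rintro ⟨i, hi, rfl⟩
    rcases Nat.lt_succ_iff_lt_or_eq.1 hi with h | rfl
    · exact Or.inl ⟨i, h, rfl⟩
    · exact Or.inr rfl
  · rintro (⟨i, hi, rfl⟩ | rfl)
    · exact ⟨i, by omega, rfl⟩
    · exact ⟨k, by omega, rfl⟩

theorem Bits_subset_iff {k : ℕ} {F : X → ℕ} {S : Set (X → ZMod 2)} :
    Bits k F ⊆ S ↔ ∀ i < k, bit F i ∈ S := by
  constructor
  · intro h i hi; exact h ⟨i, hi, rfl⟩
  · rintro h _ ⟨i, hi, rfl⟩; exact h i hi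

theorem Cost.bits_of_forall {k c : ℕ} {F : X → ℕ} {S : Set (X → ZMod 2)}
    (h : ∀ i < k, Cost S c {bit F i}) : Cost S (k * c) (Bits k F) := by
  have := Cost.biUnion_const (Finset.range k) (S := S) (c := c) (T := fun i => {bit F i})
    (fun i hi => h i (Finset.mem_range.1 hi))
  rw [Finset.card_range] at this
  refine this.mono_right (Bits_subset_iff.2 fun i hi => ?_)
  exact Set.mem_biUnion (Finset.mem_range.2 hi) rfl

theorem natCast_zmod_two (a : ℕ) : (a : ZMod 2) = if a % 2 = 1 then 1 else 0 := by
  rw [← ZMod.natCast_mod]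
  rcases Nat.mod_two_eq_zero_or_one a with h | h <;> simp [h]

theorem bit_apply (F : X → ℕ) (i : ℕ) (x : X) :
    bit F i x = if (F x).testBit i then 1 else 0 := by
  rw [bit, natCast_zmod_two, Nat.testBit_eq_decide_div_mod_eq]
  simp

theorem bit_congr {F G : X → ℕ} {i j : ℕ} (h : ∀ x, (F x).testBit i = (G x).testBit j) :
    bit F i = bit G j := by
  funext x; rw [bit_apply, bit_apply, h]

theorem bit_eq_zero {F : X → ℕ} {i : ℕ} (h : ∀ x, (F x).testBit i = false) : bit F i = 0 := by
  funext x; rw [bit_apply, h]; simp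

theorem bit_eq_zero_of_lt {F : X → ℕ} {i : ℕ} (h : ∀ x, F x < 2 ^ i) : bit F i = 0 :=
  bit_eq_zero fun x => Nat.testBit_lt_two_pow (h x)

theorem Bits_mod (k : ℕ) (F : X → ℕ) : Bits k (fun x => F x % 2 ^ k) = Bits k F := by
  have : ∀ i < k, bit (fun x => F x % 2 ^ k) i = bit F i := fun i hi =>
    bit_congr fun x => by rw [Nat.testBit_mod_two_pow]; simp [hi]
  ext b
  constructor
  · rintro ⟨i, hi, rfl⟩; exact ⟨i, hi, this i hi⟩
  · rintro ⟨i, hi, rfl⟩; exact ⟨i, hi, (this i hi).symm⟩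

theorem Bits_congr {k : ℕ} {F G : X → ℕ} (h : ∀ x, F x % 2 ^ k = G x % 2 ^ k) :
    Bits k F = Bits k G := by
  rw [← Bits_mod k F, ← Bits_mod k G]
  simp only [h]

theorem Bits_extend {k : ℕ} {F : X → ℕ} (h : ∀ x, F x < 2 ^ k) (l : ℕ) :
    Bits l F ⊆ Bits k F ∪ {0} := by
  rintro _ ⟨i, hi, rfl⟩
  rcases Nat.lt_or_ge i k with hik | hik
  · exact Or.inl ⟨i, hik, rfl⟩
  · exact Or.inr (bit_eq_zero_of_lt fun x => (h x).trans_le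
      (Nat.pow_le_pow_right (by norm_num) hik))

/-- The carry into position `i` in the addition of `F`, `G` and a carry `C` into position `0`. -/
def carry (F G C : X → ℕ) (i : ℕ) : X → ZMod 2 :=
  bit (fun x => F x + G x + C x) i - bit F i - bit G i

/-- The full adder: the carry out of a position is the majority of the two digits and the carry into
it, which is a polynomial over `ZMod 2`. -/
theorem carry_step (a b c q : ℕ) (hq : 0 < q) (hc : c ≤ 1) :
    (((a + b + c) / (q * 2) : ℕ) : ZMod 2) - ((a / (q * 2) : ℕ) : ZMod 2) -
      ((b / (q * 2) : ℕ) : ZMod 2) =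
    ((a / q : ℕ) : ZMod 2) * ((b / q : ℕ) : ZMod 2) +
      (((a / q : ℕ) : ZMod 2) + ((b / q : ℕ) : ZMod 2)) *
        ((((a + b + c) / q : ℕ) : ZMod 2) - ((a / q : ℕ) : ZMod 2) - ((b / q : ℕ) : ZMod 2)) := by
  rw [← Nat.div_div_eq_div_mul, ← Nat.div_div_eq_div_mul, ← Nat.div_div_eq_div_mul]
  have h : (a + b + c) / q = a / q + b / q ∨ (a + b + c) / q = a / q + b / q + 1 := by
    have h1 := Nat.div_add_mod a q
    have h2 := Nat.div_add_mod b q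
    have h3 := Nat.mod_lt a hq
    have h4 := Nat.mod_lt b hq
    have h5 : a + b + c = (a % q + b % q + c) + q * (a / q + b / q) := by
      rw [mul_add]; omega
    have h6 : (a + b + c) / q = (a % q + b % q + c) / q + (a / q + b / q) := by
      conv_lhs => rw [h5]
      exact Nat.add_mul_div_left _ _ hq
    have h7 : (a % q + b % q + c) / q < 2 := by
      rw [Nat.div_lt_iff_lt_mul hq]; omega
    generalize (a % q + b % q + c) / q = t at *
    omega
  generalize (a + b + c) / q = s at h
  generalize a / q = A at *
  generalize b / q = B at *
  obtain ⟨a', ha | ha⟩ : ∃ a', A = 2 * a' ∨ A = 2 * a' + 1 := ⟨A / 2, by omega⟩ <;>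
  obtain ⟨b', hb | hb⟩ : ∃ b', B = 2 * b' ∨ B = 2 * b' + 1 := ⟨B / 2, by omega⟩ <;>
  rcases h with h | h <;> subst ha hb h
  all_goals
    have hA1 : (2 * a') / 2 = a' := by omega
    have hA2 : (2 * a' + 1) / 2 = a' := by omega
    have hB1 : (2 * b') / 2 = b' := by omega
    have hB2 : (2 * b' + 1) / 2 = b' := by omega
    have h1 : (2 * a' + 2 * b') / 2 = a' + b' := by omega
    have h2 : (2 * a' + 2 * b' + 1) / 2 = a' + b' := by omega
    have h3 : (2 * a' + (2 * b' + 1)) / 2 = a' + b' := by omega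
    have h4 : (2 * a' + (2 * b' + 1) + 1) / 2 = a' + b' + 1 := by omega
    have h5 : (2 * a' + 1 + 2 * b') / 2 = a' + b' := by omega
    have h6 : (2 * a' + 1 + 2 * b' + 1) / 2 = a' + b' + 1 := by omega
    have h7 : (2 * a' + 1 + (2 * b' + 1)) / 2 = a' + b' + 1 := by omega
    have h8 : (2 * a' + 1 + (2 * b' + 1) + 1) / 2 = a' + b' + 1 := by omega
    simp only [hA1, hA2, hB1, hB2, h1, h2, h3, h4, h5, h6, h7, h8]
    have h2' : (2 : ZMod 2) = 0 := rfl
    push_cast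
    simp only [h2']
    ring_nf
    try simp only [h2', mul_zero, add_zero]
    try rfl

theorem carry_succ {F G C : X → ℕ} (hC : ∀ x, C x ≤ 1) (i : ℕ) :
    carry F G C (i + 1) = bit F i * bit G i + (bit F i + bit G i) * carry F G C i := by
  funext x
  simp only [carry, bit, Pi.sub_apply, Pi.add_apply, Pi.mul_apply, pow_succ]
  exact carry_step _ _ _ _ (by positivity) (hC x)

/-- The ripple carry adder. -/
theorem cost_addCarry (k : ℕ) (F G C : X → ℕ) (hC : ∀ x, C x ≤ 1) :
    Cost (Bits k F ∪ Bits k G ∪ {bit C 0}) (6 * k)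
      (Bits k (fun x => F x + G x + C x) ∪ {carry F G C k}) := by
  induction k with
  | zero =>
    refine Cost.of_subset ?_ _
    rw [Bits_zero, Set.empty_union, Set.singleton_subset_iff]
    right
    rw [Set.mem_singleton_iff]
    funext x
    simp only [carry, bit, Pi.sub_apply, pow_zero, Nat.div_one, Nat.cast_add]
    ring
  | succ k ih =>
    set S := Bits (k + 1) F ∪ Bits (k + 1) G ∪ {bit C 0} with hS
    have h1 : Cost S (6 * k) (Bits k (fun x => F x + G x + C x) ∪ {carry F G C k}) :=
      ih.mono_left (Set.union_subset_union_left _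
        (Set.union_subset_union (Bits_mono (Nat.le_succ _) _) (Bits_mono (Nat.le_succ _) _)))
    set T := S ∪ (Bits k (fun x => F x + G x + C x) ∪ {carry F G C k}) with hT
    have hF : bit F k ∈ T := Or.inl (Or.inl (Or.inl (bit_mem_Bits (Nat.lt_succ_self _) _)))
    have hG : bit G k ∈ T := Or.inl (Or.inl (Or.inr (bit_mem_Bits (Nat.lt_succ_self _) _)))
    have hc : carry F G C k ∈ T := Or.inr (Or.inr rfl)
    have h2 : Cost T 4 {carry F G C (k + 1)} := by
      rw [carry_succ hC]
      exact (Cost.mul hF hG).add' ((Cost.add hF hG).mul' (Cost.mem hc))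
    have h3 : Cost T 2 {bit (fun x => F x + G x + C x) k} := by
      have : bit (fun x => F x + G x + C x) k = bit F k + bit G k + carry F G C k := by
        rw [carry]; ring
      rw [this]
      exact (Cost.add hF hG).add' (Cost.mem hc)
    have h4 : Cost T 0 (Bits k (fun x => F x + G x + C x)) :=
      Cost.of_subset (fun b hb => Or.inr (Or.inl hb)) _
    refine (h1.then ((h4.union h3).union h2)).mono subset_rfl (by omega) ?_
    rw [Bits_succ]

variable {S : Set (X → ZMod 2)}

theorem Cost.natAdd {k c d : ℕ} {F G : X → ℕ} (hF : Cost S c (Bits k F))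
    (hG : Cost S d (Bits k G)) : Cost S (c + d + 1 + 6 * k) (Bits k fun x => F x + G x) := by
  have h0 : Cost S 1 {bit (fun _ : X => 0) 0} := by
    rw [bit_eq_zero_of_lt (by simp)]; exact Cost.zero _
  refine ((hF.union hG).union h0).trans ((cost_addCarry k F G (fun _ => 0) (by simp)).mono_right ?_)
  simp only [add_zero]
  exact Set.subset_union_left

theorem Bits_compl_mem {k : ℕ} {G : X → ℕ} (hG : ∀ x, G x < 2 ^ k) :
    ∀ i < k, bit (fun x => 2 ^ k - (G x + 1)) i = 1 - bit G i := by
  intro i hi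
  funext x
  rw [bit_apply, Pi.sub_apply, bit_apply, Nat.testBit_two_pow_sub_succ (hG x)]
  simp only [hi, decide_true, Bool.true_and, Pi.one_apply]
  cases (G x).testBit i <;> simp

theorem Cost.compl {k d : ℕ} {G : X → ℕ} (hlt : ∀ x, G x < 2 ^ k) (hG : Cost S d (Bits k G)) :
    Cost S (d + 2 * k) (Bits k fun x => 2 ^ k - (G x + 1)) := by
  refine hG.trans ((Cost.bits_of_forall (c := 2) fun i hi => ?_).le (by omega))
  rw [Bits_compl_mem hlt i hi]
  exact (Cost.one _).sub' (Cost.mem (bit_mem_Bits hi _))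

/-- Subtraction as addition of the two's complement; the carry tells whether `G ≤ F`. -/
theorem Cost.subCarry {k c d : ℕ} {F G : X → ℕ} (hFlt : ∀ x, F x < 2 ^ k)
    (hGlt : ∀ x, G x < 2 ^ k) (hF : Cost S c (Bits k F)) (hG : Cost S d (Bits k G)) :
    Cost S (c + d + 1 + 8 * k) (Bits k (fun x => 2 ^ k + F x - G x) ∪
      {fun x => if F x < G x then 0 else 1}) := by
  have h0 : Cost S 1 {bit (fun _ : X => 1) 0} := by
    have : bit (fun _ : X => 1) 0 = 1 := by funext x; simp [bit]
    rw [this]; exact Cost.one _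
  have h1 := ((hF.union (hG.compl hGlt)).union h0).trans
    (cost_addCarry k F (fun x => 2 ^ k - (G x + 1)) (fun _ => 1) (by simp))
  have h2 : (fun x => F x + (2 ^ k - (G x + 1)) + 1) = fun x => 2 ^ k + F x - G x := by
    funext x; have := hGlt x; omega
  have h3 : carry F (fun x => 2 ^ k - (G x + 1)) (fun _ => 1) k =
      fun x => if F x < G x then 0 else 1 := by
    rw [carry, bit_eq_zero_of_lt hFlt, bit_eq_zero_of_lt (F := fun x => 2 ^ k - (G x + 1))
      (fun x => by have := hGlt x; omega), sub_zero, sub_zero, h2]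
    funext x
    have h4 := hFlt x
    have h5 := hGlt x
    simp only [bit]
    split_ifs with h
    · rw [Nat.div_eq_of_lt (by omega)]; simp
    · have : (2 ^ k + F x - G x) / 2 ^ k = 1 :=
        Nat.div_eq_of_lt_le (by omega) (by omega)
      rw [this]; simp
  rw [h2, h3] at h1
  exact h1.le (by omega)

theorem Cost.natSubOfLe {k c d : ℕ} {F G : X → ℕ} (hFlt : ∀ x, F x < 2 ^ k)
    (hGF : ∀ x, G x ≤ F x) (hF : Cost S c (Bits k F)) (hG : Cost S d (Bits k G)) :
    Cost S (c + d + 1 + 8 * k) (Bits k fun x => F x - G x) := by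
  refine (hF.subCarry hFlt (fun x => (hGF x).trans_lt (hFlt x)) hG).mono_right ?_
  refine subset_trans (le_of_eq (Bits_congr fun x => ?_)) Set.subset_union_left
  rw [Nat.add_sub_assoc (hGF x), Nat.add_mod_left]

theorem Cost.natLt {k c d : ℕ} {F G : X → ℕ} (hFlt : ∀ x, F x < 2 ^ k)
    (hGlt : ∀ x, G x < 2 ^ k) (hF : Cost S c (Bits k F)) (hG : Cost S d (Bits k G)) :
    Cost S (c + d + 3 + 8 * k) {fun x => if F x < G x then 1 else 0} := by
  have h := ((Cost.one S).sub' ((hF.subCarry hFlt hGlt hG).mono_right Set.subset_union_right))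
  have h2 : (1 - fun x => if F x < G x then (0 : ZMod 2) else 1) =
      fun x => if F x < G x then 1 else 0 := by
    funext x
    simp only [Pi.sub_apply, Pi.one_apply]
    split_ifs <;> simp
  rw [h2] at h
  exact h.le (by omega)

/-- The choice between two numbers according to a condition given as a bit. -/
theorem Cost.select {k c d e : ℕ} {F G : X → ℕ} {p : X → Prop} [DecidablePred p]
    (hp : Cost S e {fun x => if p x then (1 : ZMod 2) else 0})
    (hF : Cost S c (Bits k F)) (hG : Cost S d (Bits k G)) :
    Cost S (e + c + d + 3 * k) (Bits k fun x => if p x then F x else G x) := by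
  refine ((hp.union hF).union hG).trans ((Cost.bits_of_forall (c := 3) fun i hi => ?_).le
    (by omega))
  have h : bit (fun x => if p x then F x else G x) i =
      (fun x => if p x then (1 : ZMod 2) else 0) * (bit F i - bit G i) + bit G i := by
    funext x
    simp only [bit, Pi.add_apply, Pi.mul_apply, Pi.sub_apply]
    split_ifs <;> simp
  rw [h]
  have hF' : bit F i ∈ {fun x => if p x then (1 : ZMod 2) else 0} ∪ Bits k F ∪ Bits k G :=
    Or.inl (Or.inr (bit_mem_Bits hi _))
  have hG' : bit G i ∈ {fun x => if p x then (1 : ZMod 2) else 0} ∪ Bits k F ∪ Bits k G :=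
    Or.inr (bit_mem_Bits hi _)
  have hp' : (fun x => if p x then (1 : ZMod 2) else 0) ∈
      ({fun x => if p x then (1 : ZMod 2) else 0} ∪ Bits k F ∪ Bits k G : Set (X → ZMod 2)) :=
    Or.inl (Or.inl rfl)
  exact ((Cost.mem hp').mul' (Cost.sub hF' hG')).add' (Cost.mem hG')

theorem Cost.natConstZero (k : ℕ) : Cost S 1 (Bits k fun _ : X => 0) := by
  refine (Cost.zero S).mono_right (Bits_subset_iff.2 fun i _ => ?_)
  exact bit_eq_zero_of_lt (by simp)

/-- Long multiplication modulo `2 ^ k`. -/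
theorem cost_longMul (k : ℕ) (F G : X → ℕ) :
    Cost (Bits k F ∪ Bits k G) (k * (7 * k + 2) + 1) (Bits k fun x => F x * G x) := by
  set S := Bits k F ∪ Bits k G
  suffices H : ∀ j ≤ k, Cost S (j * (7 * k + 2) + 1) (Bits k fun x => F x * (G x % 2 ^ j)) by
    refine (H k le_rfl).mono_right (le_of_eq (Bits_congr fun x => ?_))
    rw [Nat.mul_mod, Nat.mul_mod (F x) (G x % 2 ^ k), Nat.mod_mod]
  intro j hj
  induction j with
  | zero =>
    simp only [pow_zero, Nat.mod_one, mul_zero]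
    exact (Cost.natConstZero k).le (by omega)
  | succ j ih =>
    have h1 : Cost S (1 + k) (Bits k fun x => 2 ^ j * (F x * (G x / 2 ^ j % 2))) := by
      refine (Cost.zero S).then ((Cost.bits_of_forall (c := 1) fun i hi => ?_).le (by omega))
      rcases Nat.lt_or_ge i j with hij | hij
      · rw [bit_eq_zero fun x => by rw [Nat.testBit_two_pow_mul]; simp; omega]
        have h0 : (0 : X → ZMod 2) ∈ (S ∪ {0} : Set (X → ZMod 2)) := Or.inr rfl
        exact (Cost.mem h0).le (by omega)
      · have : bit (fun x => 2 ^ j * (F x * (G x / 2 ^ j % 2))) i = bit F (i - j) * bit G j := by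
          funext x
          rw [Pi.mul_apply, bit_apply, bit_apply, bit_apply, Nat.testBit_two_pow_mul,
            Nat.testBit_eq_decide_div_mod_eq (x := G x)]
          rcases Nat.mod_two_eq_zero_or_one (G x / 2 ^ j) with h | h <;> simp [h, hij]
        rw [this]
        have hF' : bit F (i - j) ∈ (S ∪ {0} : Set (X → ZMod 2)) := Or.inl (Or.inl (bit_mem_Bits (by omega) _))
        have hG' : bit G j ∈ (S ∪ {0} : Set (X → ZMod 2)) := Or.inl (Or.inr (bit_mem_Bits (by omega) _))
        exact Cost.mul hF' hG'
    refine ((ih (by omega)).natAdd h1).mono subset_rfl ?_ (le_of_eq ?_)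
    · linarith
    · congr 1
      funext x
      rw [Nat.mod_pow_succ]
      ring

/-- Computations in the ring `ZMod (2 ^ k)` are simulated by Boolean circuits. -/
theorem Cost.simulateBits (k : ℕ) {A B : Set (X → ZMod (2 ^ k))} {c : ℕ} (h : Cost A c B) :
    Cost (⋃ a ∈ A, Bits k fun x => (a x).val) (c * (k * (7 * k + 10) + 2))
      (⋃ a ∈ B, Bits k fun x => (a x).val) := by
  have hval : ∀ (a : X → ZMod (2 ^ k)) x, (a x).val < 2 ^ k := fun a x => ZMod.val_lt _
  refine Cost.simulate (fun a : X → ZMod (2 ^ k) => Bits k fun x => (a x).val) _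
    ?_ ?_ ?_ ?_ ?_ h
  · refine (Cost.natConstZero k).mono subset_rfl (by omega) ?_
    simp
  · refine ((Cost.zero _).union (Cost.one _)).mono subset_rfl (by omega) ?_
    refine Bits_subset_iff.2 fun i hi => ?_
    simp only [Pi.one_apply, ZMod.val_one_eq_one_mod]
    have h1 : bit (fun _ : X => 1 % 2 ^ k) i = bit (fun _ : X => 1) i :=
      bit_congr fun x => by rw [Nat.testBit_mod_two_pow]; simp [hi]
    rw [h1]
    rcases Nat.eq_zero_or_pos i with rfl | h0
    · right; funext x; simp [bit]
    · left
      exact bit_eq_zero_of_lt fun _ => Nat.one_lt_two_pow h0.ne'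
  · intro a b
    have := Cost.natAdd (S := Bits k (fun x => (a x).val) ∪ Bits k fun x => (b x).val)
      (Cost.of_subset Set.subset_union_left 0) (Cost.of_subset Set.subset_union_right 0)
    refine this.mono subset_rfl (by nlinarith) (le_of_eq (Bits_congr fun x => ?_))
    rw [Pi.add_apply, ZMod.val_add, Nat.mod_mod]
  · intro a b
    have := Cost.subCarry (S := Bits k (fun x => (a x).val) ∪ Bits k fun x => (b x).val)
      (hval a) (hval b)
      (Cost.of_subset Set.subset_union_left 0) (Cost.of_subset Set.subset_union_right 0)
    refine (this.mono_right Set.subset_union_left).mono subset_rfl (by nlinarith)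
      (le_of_eq (Bits_congr fun x => ?_))
    have hx : ((a - b) x).val % 2 ^ k = (2 ^ k + (a x).val - (b x).val) % 2 ^ k := by
      have h1 : (((a - b) x).val : ZMod (2 ^ k)) =
          ((2 ^ k + (a x).val - (b x).val : ℕ) : ZMod (2 ^ k)) := by
        rw [Nat.cast_sub (by have := hval b x; omega)]
        rw [Nat.cast_add, ZMod.natCast_zmod_val, ZMod.natCast_zmod_val, ZMod.natCast_zmod_val,
          ZMod.natCast_self, zero_add, Pi.sub_apply]
      exact (ZMod.natCast_eq_natCast_iff' _ _ _).1 h1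
    exact hx
  · intro a b
    refine (cost_longMul k (fun x => (a x).val) (fun x => (b x).val)).mono subset_rfl
      (by nlinarith) (le_of_eq (Bits_congr fun x => ?_))
    rw [Pi.mul_apply, ZMod.val_mul, Nat.mod_mod]

end Circuits

end SLPInterp

namespace SLPInterp

/-! ### Quasi-linear functions -/

/-- Bounded by a power of the logarithm. -/
def PolyLog (f : ℕ → ℕ) : Prop := ∃ C r : ℕ, ∀ w, f w ≤ C * (w.size + 1) ^ r

/-- Linear up to a power of the logarithm. -/
def QuasiLin (f : ℕ → ℕ) : Prop := ∃ C r : ℕ, ∀ w, f w ≤ C * ((w + 1) * (w.size + 1) ^ r)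

theorem QuasiLin.mono {f g : ℕ → ℕ} (hg : QuasiLin g) (h : ∀ w, f w ≤ g w) : QuasiLin f := by
  obtain ⟨C, r, hC⟩ := hg; exact ⟨C, r, fun w => (h w).trans (hC w)⟩

theorem PolyLog.const (c : ℕ) : PolyLog fun _ => c := ⟨c, 0, fun w => by simp⟩

theorem PolyLog.size : PolyLog Nat.size := ⟨1, 1, fun w => by simp⟩

theorem PolyLog.add {f g : ℕ → ℕ} (hf : PolyLog f) (hg : PolyLog g) :
    PolyLog fun w => f w + g w := by
  obtain ⟨C, r, hC⟩ := hf
  obtain ⟨C', r', hC'⟩ := hg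
  refine ⟨C + C', r + r', fun w => ?_⟩
  have h1 : (w.size + 1) ^ r ≤ (w.size + 1) ^ (r + r') :=
    Nat.pow_le_pow_right (Nat.succ_pos _) (by omega)
  have h2 : (w.size + 1) ^ r' ≤ (w.size + 1) ^ (r + r') :=
    Nat.pow_le_pow_right (Nat.succ_pos _) (by omega)
  calc f w + g w ≤ C * (w.size + 1) ^ r + C' * (w.size + 1) ^ r' := Nat.add_le_add (hC w) (hC' w)
    _ ≤ C * (w.size + 1) ^ (r + r') + C' * (w.size + 1) ^ (r + r') := by gcongr
    _ = _ := by ring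

theorem PolyLog.mul {f g : ℕ → ℕ} (hf : PolyLog f) (hg : PolyLog g) :
    PolyLog fun w => f w * g w := by
  obtain ⟨C, r, hC⟩ := hf
  obtain ⟨C', r', hC'⟩ := hg
  refine ⟨C * C', r + r', fun w => ?_⟩
  calc f w * g w ≤ (C * (w.size + 1) ^ r) * (C' * (w.size + 1) ^ r') :=
        Nat.mul_le_mul (hC w) (hC' w)
    _ = _ := by ring

theorem PolyLog.pow {f : ℕ → ℕ} (hf : PolyLog f) (k : ℕ) : PolyLog fun w => f w ^ k := by
  induction k with
  | zero => simpa using PolyLog.const 1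
  | succ k ih => simpa only [pow_succ] using ih.mul hf

theorem PolyLog.quasiLin {f : ℕ → ℕ} (hf : PolyLog f) : QuasiLin f := by
  obtain ⟨C, r, hC⟩ := hf
  refine ⟨C, r, fun w => (hC w).trans (Nat.mul_le_mul_left _ ?_)⟩
  exact Nat.le_mul_of_pos_left _ (Nat.succ_pos _)

theorem QuasiLin.id : QuasiLin fun w => w := ⟨1, 0, fun w => by simp⟩

theorem QuasiLin.add {f g : ℕ → ℕ} (hf : QuasiLin f) (hg : QuasiLin g) :
    QuasiLin fun w => f w + g w := by
  obtain ⟨C, r, hC⟩ := hf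
  obtain ⟨C', r', hC'⟩ := hg
  refine ⟨C + C', r + r', fun w => ?_⟩
  have h1 : (w.size + 1) ^ r ≤ (w.size + 1) ^ (r + r') :=
    Nat.pow_le_pow_right (Nat.succ_pos _) (by omega)
  have h2 : (w.size + 1) ^ r' ≤ (w.size + 1) ^ (r + r') :=
    Nat.pow_le_pow_right (Nat.succ_pos _) (by omega)
  calc f w + g w ≤ C * ((w + 1) * (w.size + 1) ^ r) + C' * ((w + 1) * (w.size + 1) ^ r') :=
        Nat.add_le_add (hC w) (hC' w)
    _ ≤ C * ((w + 1) * (w.size + 1) ^ (r + r')) + C' * ((w + 1) * (w.size + 1) ^ (r + r')) := by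
        gcongr
    _ = _ := by ring

theorem QuasiLin.mul {f g : ℕ → ℕ} (hf : QuasiLin f) (hg : PolyLog g) :
    QuasiLin fun w => f w * g w := by
  obtain ⟨C, r, hC⟩ := hf
  obtain ⟨C', r', hC'⟩ := hg
  refine ⟨C * C', r + r', fun w => ?_⟩
  calc f w * g w ≤ (C * ((w + 1) * (w.size + 1) ^ r)) * (C' * (w.size + 1) ^ r') :=
        Nat.mul_le_mul (hC w) (hC' w)
    _ = _ := by ring

theorem size_mul_le (a b : ℕ) : (a * b).size ≤ a.size + b.size := by
  rw [Nat.size_le, pow_add]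
  exact Nat.mul_lt_mul'' (Nat.lt_size_self a) (Nat.lt_size_self b)

theorem size_linear_le (a b w : ℕ) : (a * w + b).size + 1 ≤ ((a + b).size + 1) * (w.size + 1) := by
  have h : (a * w + b).size ≤ (a + b).size + w.size := by
    rcases Nat.eq_zero_or_pos w with rfl | hw
    · simpa using Nat.size_le_size (Nat.le_add_left b a)
    · refine (Nat.size_le_size ?_).trans (size_mul_le (a + b) w)
      nlinarith
  nlinarith [Nat.zero_le ((a + b).size * w.size)]

theorem PolyLog.comp_linear {f : ℕ → ℕ} (hf : PolyLog f) (a b : ℕ) :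
    PolyLog fun w => f (a * w + b) := by
  obtain ⟨C, r, hC⟩ := hf
  refine ⟨C * ((a + b).size + 1) ^ r, r, fun w => (hC _).trans ?_⟩
  calc C * ((a * w + b).size + 1) ^ r ≤ C * (((a + b).size + 1) * (w.size + 1)) ^ r := by
        gcongr; exact size_linear_le a b w
    _ = _ := by rw [mul_pow]; ring

theorem QuasiLin.comp_linear {f : ℕ → ℕ} (hf : QuasiLin f) (a b : ℕ) :
    QuasiLin fun w => f (a * w + b) := by
  obtain ⟨C, r, hC⟩ := hf
  refine ⟨C * (a + b + 1) * ((a + b).size + 1) ^ r, r, fun w => (hC _).trans ?_⟩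
  calc C * ((a * w + b + 1) * ((a * w + b).size + 1) ^ r)
      ≤ C * (((a + b + 1) * (w + 1)) * (((a + b).size + 1) * (w.size + 1)) ^ r) := by
        gcongr
        · nlinarith
        · exact size_linear_le a b w
    _ = _ := by rw [mul_pow]; ring

/-! ### Fast multiplication of integers -/

theorem sum_digits_div (b : ℕ → ℕ) (hb : ∀ n, b n ≤ 1) {i m : ℕ} (hi : i < m) :
    (∑ n ∈ Finset.range m, 2 ^ n * b n) / 2 ^ i % 2 = b i := by
  induction m generalizing b i with
  | zero => omega
  | succ m ih =>
    have h : ∑ n ∈ Finset.range (m + 1), 2 ^ n * b n =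
        b 0 + 2 * ∑ n ∈ Finset.range m, 2 ^ n * b (n + 1) := by
      rw [Finset.sum_range_succ', Finset.mul_sum, add_comm]
      simp [pow_succ', mul_assoc]
    rw [h]
    have h0 := hb 0
    rcases i with _ | i
    · rw [pow_zero, Nat.div_one]; omega
    · rw [pow_succ', ← Nat.div_div_eq_div_mul]
      have : (b 0 + 2 * ∑ n ∈ Finset.range m, 2 ^ n * b (n + 1)) / 2 =
          ∑ n ∈ Finset.range m, 2 ^ n * b (n + 1) := by omega
      rw [this]
      exact ih (fun n => b (n + 1)) (fun n => hb _) (by omega)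

theorem sum_digits (a k : ℕ) : ∑ i ∈ Finset.range k, 2 ^ i * (a / 2 ^ i % 2) = a % 2 ^ k := by
  induction k with
  | zero => simp [Nat.mod_one]
  | succ k ih => rw [Finset.sum_range_succ, ih, Nat.mod_pow_succ]

/-- The coefficient of index `n` of the cyclic convolution of length `m` of the digits of `a` and
`b`. -/
def digitConv (m a b n : ℕ) : ℕ :=
  ∑ i ∈ Finset.range m, ∑ j ∈ Finset.range m,
    if (i + j) % m = n then (a / 2 ^ i % 2) * (b / 2 ^ j % 2) else 0

theorem digitConv_le (m a b n : ℕ) : digitConv m a b n ≤ m := by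
  unfold digitConv
  calc ∑ i ∈ Finset.range m, ∑ j ∈ Finset.range m,
      (if (i + j) % m = n then (a / 2 ^ i % 2) * (b / 2 ^ j % 2) else 0)
      ≤ ∑ i ∈ Finset.range m, 1 := by
        refine Finset.sum_le_sum fun i _ => ?_
        calc ∑ j ∈ Finset.range m,
              (if (i + j) % m = n then (a / 2 ^ i % 2) * (b / 2 ^ j % 2) else 0)
            ≤ ∑ j ∈ Finset.range m, if (i + j) % m = n then 1 else 0 := by
              refine Finset.sum_le_sum fun j _ => ?_
              split_ifs
              · have h1 : a / 2 ^ i % 2 ≤ 1 := by omega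
                have h2 : b / 2 ^ j % 2 ≤ 1 := by omega
                exact Nat.mul_le_mul h1 h2
              · exact le_rfl
          _ = ((Finset.range m).filter fun j => (i + j) % m = n).card := by simp
          _ ≤ 1 := by
              refine Finset.card_le_one.2 fun j hj j' hj' => ?_
              simp only [Finset.mem_filter, Finset.mem_range] at hj hj'
              have h1 : i + j ≡ i + j' [MOD m] := hj.2.trans hj'.2.symm
              have h2 := Nat.ModEq.add_left_cancel' i h1
              rwa [Nat.ModEq, Nat.mod_eq_of_lt hj.1, Nat.mod_eq_of_lt hj'.1] at h2
    _ = m := by simp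

/-- With `2 w` positions there is no wrapping, so the convolution of the digits evaluates to the
product. -/
theorem sum_digitConv {w a b : ℕ} (ha : a < 2 ^ w) (hb : b < 2 ^ w) :
    ∑ n ∈ Finset.range (2 * w), 2 ^ n * digitConv (2 * w) a b n = a * b := by
  have hz : ∀ {c i : ℕ}, c < 2 ^ w → w ≤ i → c / 2 ^ i % 2 = 0 := by
    intro c i hc hi
    rw [Nat.div_eq_of_lt (hc.trans_le (Nat.pow_le_pow_right (by norm_num) hi))]
  have hs : ∀ {c : ℕ}, c < 2 ^ w →
      ∑ i ∈ Finset.range (2 * w), 2 ^ i * (c / 2 ^ i % 2) = c := by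
    intro c hc
    rw [sum_digits, Nat.mod_eq_of_lt (hc.trans_le (Nat.pow_le_pow_right (by norm_num) (by omega)))]
  conv_rhs => rw [← hs ha, ← hs hb, Finset.sum_mul_sum]
  unfold digitConv
  simp only [Finset.mul_sum]
  rw [Finset.sum_comm]
  refine Finset.sum_congr rfl fun i hi => ?_
  rw [Finset.sum_comm]
  refine Finset.sum_congr rfl fun j hj => ?_
  have hi' := Finset.mem_range.1 hi
  have hj' := Finset.mem_range.1 hj
  rcases Nat.lt_or_ge i w with hiw | hiw
  · rcases Nat.lt_or_ge j w with hjw | hjw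
    · rw [Finset.sum_eq_single (i + j)]
      · rw [Nat.mod_eq_of_lt (by omega), if_pos rfl, pow_add]; ring
      · intro n _ hn
        rw [Nat.mod_eq_of_lt (by omega), if_neg (Ne.symm hn), mul_zero]
      · intro h; exact absurd (Finset.mem_range.2 (by omega)) h
    · simp [hz hb hjw]
  · simp [hz ha hiw]

/-- Integer multiplication by the cyclic convolution of the digits over `ZMod (2 ^ k)`, followed by
the addition of the `k` numbers formed by the digits of the coefficients of equal weight. -/
theorem exists_cost_natMul : ∃ μ : ℕ → ℕ, QuasiLin μ ∧ ∀ (X : Type u) (w : ℕ) (F G : X → ℕ),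
    (∀ x, F x < 2 ^ w) → (∀ x, G x < 2 ^ w) →
    Cost (Bits w F ∪ Bits w G) (μ w) (Bits (2 * w) fun x => F x * G x) := by
  obtain ⟨C, r, hC⟩ := exists_cost_cyclicConv.{u}
  refine ⟨fun w => 1 + (C * ((2 * w) * (2 * w).size ^ r)) * ((2 * w).size * (7 * (2 * w).size + 10) + 2)
    + ((2 * w).size * (12 * w + 2) + 1), ?_, ?_⟩
  · have hk : PolyLog fun w => (2 * w).size := PolyLog.size.comp_linear 2 0
    have h1 : QuasiLin fun w : ℕ => 2 * w := QuasiLin.id.comp_linear 2 0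
    have h2 : QuasiLin fun w : ℕ => 12 * w + 2 := QuasiLin.id.comp_linear 12 2
    have h3 := (((h1.mul (hk.pow r)).mul (PolyLog.const C)).mul
      ((hk.mul (((PolyLog.const 7).mul hk).add (PolyLog.const 10))).add (PolyLog.const 2)))
    have h4 := ((PolyLog.const 1).quasiLin.add h3).add ((h2.mul hk).add (PolyLog.const 1).quasiLin)
    refine h4.mono fun w => le_of_eq ?_
    ring
  intro X w F G hF hG
  rcases Nat.eq_zero_or_pos w with rfl | hw
  · rw [mul_zero, Bits_zero (fun x => F x * G x)]
    exact Cost.of_subset (Set.empty_subset _) _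
  set m := 2 * w with hm
  set k := m.size with hk
  have hm0 : 0 < m := by omega
  have hk0 : 0 < k := Nat.size_pos.2 hm0
  -- The coefficients of the convolution are at most `m`, hence determined modulo `2 ^ k`.
  have hmk : m < 2 ^ k := Nat.lt_size_self m
  set a : Fin m → X → ZMod (2 ^ k) := fun i x => ((F x / 2 ^ (i : ℕ) % 2 : ℕ) : ZMod (2 ^ k))
  set b : Fin m → X → ZMod (2 ^ k) := fun i x => ((G x / 2 ^ (i : ℕ) % 2 : ℕ) : ZMod (2 ^ k))
  set c : ℕ → X → ℕ := fun n x => digitConv m (F x) (G x) n with hc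
  have hdig : ∀ (H : X → ℕ), (∀ x, H x < 2 ^ w) → ∀ i : ℕ,
      Bits k (fun x => ((H x / 2 ^ i % 2 : ℕ) : ZMod (2 ^ k)).val) ⊆ Bits w H ∪ {0} := by
    intro H hH i
    have h1 : (fun x => ((H x / 2 ^ i % 2 : ℕ) : ZMod (2 ^ k)).val) =
        fun x => H x / 2 ^ i % 2 := by
      funext x
      rw [ZMod.val_natCast, Nat.mod_eq_of_lt]
      have : 2 ^ 1 ≤ 2 ^ k := Nat.pow_le_pow_right (by norm_num) hk0
      omega
    rw [h1]
    rintro _ ⟨j, hj, rfl⟩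
    rcases Nat.eq_zero_or_pos j with rfl | hj0
    · have h2 : bit (fun x => H x / 2 ^ i % 2) 0 = bit H i := by
        funext x
        simp only [bit, pow_zero, Nat.div_one]
        rw [ZMod.natCast_mod]
      rw [h2]
      rcases Nat.lt_or_ge i w with hi | hi
      · exact Or.inl (bit_mem_Bits hi _)
      · exact Or.inr (bit_eq_zero_of_lt fun x => (hH x).trans_le
          (Nat.pow_le_pow_right (by norm_num) hi))
    · refine Or.inr (bit_eq_zero_of_lt fun x => ?_)
      have : 2 ^ 1 ≤ 2 ^ j := Nat.pow_le_pow_right (by norm_num) hj0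
      omega
  have c1 : Cost (Bits w F ∪ Bits w G) 1 ((Bits w F ∪ Bits w G) ∪ {0}) := (Cost.zero _).keep
  have c2 : Cost ((Bits w F ∪ Bits w G) ∪ {0})
      ((C * ((2 * w) * (2 * w).size ^ r)) * (k * (7 * k + 10) + 2))
      (⋃ n ∈ Finset.range m, Bits k (c n)) := by
    refine (Cost.simulateBits k (hC m hm0 (X → ZMod (2 ^ k)) a b)).mono ?_ le_rfl ?_
    · refine Set.iUnion₂_subset fun y hy => ?_
      rcases hy with ⟨i, rfl⟩ | ⟨i, rfl⟩
      · exact (hdig F hF i).trans (Set.union_subset_union_left _ Set.subset_union_left)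
      · exact (hdig G hG i).trans (Set.union_subset_union_left _ Set.subset_union_right)
    · refine Set.iUnion₂_subset fun n hn => ?_
      have hn' := Finset.mem_range.1 hn
      refine subset_trans (le_of_eq ?_)
        (Set.subset_biUnion_of_mem (Set.mem_range_self (⟨n, hn'⟩ : Fin m)))
      congr 1
      funext x
      have h1 : cyclicConv a b ⟨n, hn'⟩ x = (c n x : ZMod (2 ^ k)) := by
        simp only [hc, digitConv, Finset.sum_range, cyclicConv, Finset.sum_apply]
        push_cast
        refine Finset.sum_congr rfl fun i _ => Finset.sum_congr rfl fun j _ => ?_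
        split_ifs
        · simp [a, b]
        · rfl
      rw [h1, ZMod.val_natCast, Nat.mod_eq_of_lt]
      exact (digitConv_le _ _ _ _).trans_lt hmk
  have c3 : Cost (⋃ n ∈ Finset.range m, Bits k (c n)) (k * (12 * w + 2) + 1)
      (Bits (2 * w) fun x => F x * G x) := by
    set T := ⋃ n ∈ Finset.range m, Bits k (c n)
    set D : ℕ → X → ℕ := fun l x => ∑ n ∈ Finset.range m, 2 ^ n * (c n x / 2 ^ l % 2) with hD
    have hfin : (fun x => F x * G x) = fun x => ∑ l ∈ Finset.range k, 2 ^ l * D l x := by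
      funext x
      rw [← sum_digitConv (hF x) (hG x)]
      simp only [hD, Finset.mul_sum]
      rw [Finset.sum_comm]
      refine Finset.sum_congr rfl fun n _ => ?_
      have h1 : c n x = ∑ l ∈ Finset.range k, 2 ^ l * (c n x / 2 ^ l % 2) := by
        rw [sum_digits, Nat.mod_eq_of_lt ((digitConv_le _ _ _ _).trans_lt hmk)]
      conv_lhs => rw [show digitConv (2 * w) (F x) (G x) n = c n x from rfl, h1, Finset.mul_sum]
      exact Finset.sum_congr rfl fun l _ => by ring
    rw [hfin]
    suffices H : ∀ j ≤ k, Cost (T ∪ {0}) (j * (12 * w + 1))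
        (Bits m fun x => ∑ l ∈ Finset.range j, 2 ^ l * D l x) by
      exact ((Cost.zero T).then (H k le_rfl)).le (by nlinarith)
    intro j hj
    induction j with
    | zero =>
      refine Cost.of_subset (Bits_subset_iff.2 fun i _ => Or.inr ?_) _
      exact bit_eq_zero_of_lt (by simp)
    | succ j ih =>
      have h1 : Cost (T ∪ {0}) 0 (Bits m fun x => 2 ^ j * D j x) := by
        refine Cost.of_subset (Bits_subset_iff.2 fun i hi => ?_) _
        rcases Nat.lt_or_ge i j with hij | hij
        · refine Or.inr (bit_eq_zero fun x => ?_)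
          rw [Nat.testBit_two_pow_mul]; simp; omega
        · refine Or.inl (Set.mem_biUnion (x := i - j) (Finset.mem_coe.2
            (Finset.mem_range.2 (by omega))) ⟨j, by omega, ?_⟩)
          refine bit_congr fun x => ?_
          rw [Nat.testBit_two_pow_mul]
          simp only [ge_iff_le, hij, decide_true, Bool.true_and]
          rw [Nat.testBit_eq_decide_div_mod_eq, Nat.testBit_eq_decide_div_mod_eq, hD]
          dsimp only
          rw [sum_digits_div (fun n => c n x / 2 ^ j % 2) (fun n => by omega) (by omega)]
      have h2 := (ih (by omega)).natAdd h1
      simp only [Finset.sum_range_succ]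
      exact h2.le (by rw [hm]; linarith)
  refine ((c1.trans c2).trans c3).le (le_of_eq ?_)
  rfl

end SLPInterp

namespace SLPInterp

/-! ### Division by Newton's iteration -/

/-- A step of Newton's iteration for the approximation `x` of `V / G`. -/
def newtonStep (V G x : ℕ) : ℕ := x * (2 * V - G * x) / V

/-- The iteration starts from a power of two that is at least half of `V / G`. -/
def newton (v G : ℕ) : ℕ → ℕ
  | 0 => 2 ^ (v - G.size)
  | t + 1 => newtonStep (2 ^ v) G (newton v G t)

/-- A step does not exceed `V / G`, and squares the relative error, up to the rounding. -/
theorem newtonStep_spec {V G x : ℕ} (hV : 0 < V) (hx : G * x ≤ V) :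
    G * newtonStep V G x ≤ V ∧
      V * (V - G * newtonStep V G x) ≤ (V - G * x) ^ 2 + G * V := by
  unfold newtonStep
  set y := x * (2 * V - G * x) / V with hy
  obtain ⟨E, hE⟩ : ∃ E, V = G * x + E := ⟨V - G * x, by omega⟩
  have hE2 : V - G * x = E := by omega
  have hE3 : 2 * V - G * x = V + E := by omega
  rw [hE3] at hy
  have h1 : V * y ≤ x * (V + E) := by rw [hy]; exact Nat.mul_div_le _ _
  have h2 : x * (V + E) < V * y + V := by
    rw [hy]
    have := Nat.lt_div_mul_add (a := x * (V + E)) hV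
    linarith
  have h3 : G * x * (V + E) + E * E = V * V := by
    have : G * x = V - E := by omega
    have h4 : E ≤ V := by omega
    zify [h4] at this ⊢
    rw [this]; ring
  have h4 : V * (G * y) ≤ V * V := by nlinarith
  have h5 : G * y ≤ V := Nat.le_of_mul_le_mul_left h4 hV
  refine ⟨h5, ?_⟩
  rw [hE2]
  have h6 : G * (x * (V + E)) ≤ G * (V * y + V) := Nat.mul_le_mul_left _ h2.le
  zify [h5] at *
  nlinarith

/-- The relative error at the start is at most one half. -/
theorem newton_zero_spec {v G : ℕ} (hG : 0 < G) (hv : G.size ≤ v) :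
    G * newton v G 0 ≤ 2 ^ v ∧ 2 * (2 ^ v - G * newton v G 0) ≤ 2 ^ v := by
  have hσ : 0 < G.size := Nat.size_pos.2 hG
  have h1 : G < 2 ^ G.size := Nat.lt_size_self G
  have h2 : 2 ^ (G.size - 1) ≤ G := Nat.lt_size.1 (by omega)
  have h3 : 2 ^ v = 2 ^ G.size * 2 ^ (v - G.size) := by rw [← pow_add]; congr 1; omega
  have h4 : 2 ^ G.size = 2 * 2 ^ (G.size - 1) := by rw [← pow_succ']; congr 1; omega
  simp only [newton]
  have h5 : G * 2 ^ (v - G.size) ≤ 2 ^ v := by rw [h3]; exact Nat.mul_le_mul_right _ h1.le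
  refine ⟨h5, ?_⟩
  have h6 : 2 ^ v ≤ 2 * (G * 2 ^ (v - G.size)) := by
    rw [h3, h4, mul_assoc]
    exact Nat.mul_le_mul_left _ (Nat.mul_le_mul_right _ h2)
  omega

theorem newton_le {v G : ℕ} (hG : 0 < G) (hv : G.size ≤ v) (t : ℕ) : G * newton v G t ≤ 2 ^ v := by
  induction t with
  | zero => exact (newton_zero_spec hG hv).1
  | succ t ih => exact (newtonStep_spec (by positivity) ih).1

/-- The number of correct digits is doubled in each step. -/
theorem newton_error {w G : ℕ} (hG : 0 < G) (hw : G < 2 ^ w) (t : ℕ) :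
    2 ^ (2 * w + 4) - G * newton (2 * w + 4) G (t + 1) ≤
      2 ^ (2 * w + 4 - 2 ^ (t + 1)) + 4 * G := by
  set v := 2 * w + 4 with hv
  have hsz : G.size ≤ v := by have := Nat.size_le.2 hw; omega
  have hV : 0 < 2 ^ v := by positivity
  induction t with
  | zero =>
    have h1 := newton_zero_spec hG hsz
    have h2 := (newtonStep_spec hV h1.1).2
    change 2 ^ v - G * newtonStep (2 ^ v) G (newton v G 0) ≤ _
    have h3 : 2 ^ v = 4 * 2 ^ (v - 2) := by
      rw [show (4 : ℕ) = 2 ^ 2 by norm_num, ← pow_add]; congr 1; omega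
    refine Nat.le_of_mul_le_mul_left (h2.trans ?_) hV
    set E := 2 ^ v - G * newton v G 0
    have h4 : E ≤ 2 * 2 ^ (v - 2) := by omega
    have h5 : E ^ 2 ≤ (2 * 2 ^ (v - 2)) ^ 2 := Nat.pow_le_pow_left h4 2
    rw [zero_add, pow_one, h3]
    nlinarith
  | succ t ih =>
    have h2 := (newtonStep_spec hV (newton_le hG hsz (t + 1))).2
    change 2 ^ v - G * newtonStep (2 ^ v) G (newton v G (t + 1)) ≤ _
    refine Nat.le_of_mul_le_mul_left (h2.trans ?_) hV
    set E := 2 ^ v - G * newton v G (t + 1)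
    set d := 2 ^ (v - 2 ^ (t + 1)) with hd
    have h3 : d * d ≤ 2 ^ v * 2 ^ (v - 2 ^ (t + 1 + 1)) := by
      rw [hd, ← pow_add, ← pow_add, pow_succ 2 (t + 1)]
      refine Nat.pow_le_pow_right (by norm_num) ?_
      omega
    have h4 : 4 * d ≤ 2 ^ v := by
      rw [hd, show (4 : ℕ) = 2 ^ 2 by norm_num, ← pow_add]
      refine Nat.pow_le_pow_right (by norm_num) ?_
      have : 2 ≤ 2 ^ (t + 1) := by
        calc 2 = 2 ^ 1 := by norm_num
          _ ≤ 2 ^ (t + 1) := Nat.pow_le_pow_right (by norm_num) (by omega)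
      omega
    have h5 : 16 * G ≤ 2 ^ v := by
      have : 2 ^ v = 2 ^ w * 2 ^ w * 16 := by rw [hv]; ring
      have h6 : 1 ≤ 2 ^ w := Nat.one_le_two_pow
      nlinarith
    have h6 : E ^ 2 ≤ (d + 4 * G) ^ 2 := Nat.pow_le_pow_left ih 2
    nlinarith [Nat.mul_le_mul_left G h4, Nat.mul_le_mul_left G h5]

/-- The truncated product of `F` by the approximate inverse of `G` is at most `1` off. -/
theorem newton_quotient {w F G t : ℕ} (hG : 0 < G) (hF : F < 2 ^ w) (hGw : G < 2 ^ w)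
    (ht : 2 * w + 4 ≤ 2 ^ (t + 1)) :
    G * (F * newton (2 * w + 4) G (t + 1) / 2 ^ (2 * w + 4)) ≤ F ∧
      F < G * (F * newton (2 * w + 4) G (t + 1) / 2 ^ (2 * w + 4)) + 2 * G := by
  set v := 2 * w + 4 with hv
  have hsz : G.size ≤ v := by have := Nat.size_le.2 hGw; omega
  have hV : 0 < 2 ^ v := by positivity
  have h1 := newton_error hG hGw t
  have h2 := newton_le hG hsz (t + 1)
  rw [← hv, Nat.sub_eq_zero_of_le ht, pow_zero] at h1
  set x := newton v G (t + 1)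
  set q := F * x / 2 ^ v with hq
  have h3 : 2 ^ v * q ≤ F * x := Nat.mul_div_le _ _
  have h4 : F * x < 2 ^ v * q + 2 ^ v := by
    have := Nat.lt_div_mul_add (a := F * x) hV
    rw [hq]; linarith
  have h5 : 16 * F ≤ 2 ^ v := by
    have : 2 ^ v = 2 ^ w * 2 ^ w * 16 := by rw [hv]; ring
    have h6 : 1 ≤ 2 ^ w := Nat.one_le_two_pow
    nlinarith
  have h6 : 2 ^ v ≤ G * x + 5 * G := by omega
  constructor
  · refine Nat.le_of_mul_le_mul_left (?_ : 2 ^ v * _ ≤ 2 ^ v * _) hV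
    nlinarith
  · refine Nat.lt_of_mul_lt_mul_left (a := 2 ^ v) ?_
    nlinarith [Nat.mul_le_mul_left F h6, Nat.mul_le_mul_left G h5, Nat.mul_lt_mul_of_pos_left h4 hG]

section Circuits

variable {X : Type u} {S : Set (X → ZMod 2)}

/-- The circuit for the first approximation: `2 ^ i ≤ G` is decided for all `i` from above. -/
theorem cost_newton_zero {w v : ℕ} (hv : w ≤ v) {G : X → ℕ} (hG : ∀ x, 0 < G x)
    (hGw : ∀ x, G x < 2 ^ w) (z : ℕ) :
    Cost (Bits w G) (1 + w * 4 + w) (Bits z fun x => newton v (G x) 0) := by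
  set h : ℕ → X → ZMod 2 := fun i x => if 2 ^ i ≤ G x then 1 else 0 with hh
  have hstep : ∀ i, h i = h (i + 1) + bit G i - h (i + 1) * bit G i := by
    intro i
    funext x
    simp only [hh, Pi.sub_apply, Pi.add_apply, Pi.mul_apply, bit]
    have hp : (2 : ℕ) ^ (i + 1) = 2 ^ i * 2 := pow_succ 2 i
    by_cases h1 : 2 ^ (i + 1) ≤ G x
    · rw [if_pos h1, if_pos (by omega)]; ring
    · rw [if_neg h1]
      by_cases h2 : 2 ^ i ≤ G x
      · have : G x / 2 ^ i = 1 := Nat.div_eq_of_lt_le (by omega) (by omega)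
        rw [if_pos h2, this]; simp
      · rw [if_neg h2, Nat.div_eq_of_lt (by omega)]; simp
  have hw : h w = 0 := by
    funext x; simp only [hh, Pi.zero_apply]; rw [if_neg (by have := hGw x; omega)]
  have h1 : ∀ j ≤ w, Cost (Bits w G) (1 + j * 4) (⋃ i ∈ Finset.Icc (w - j) w, {h i}) := by
    intro j hj
    induction j with
    | zero =>
      simp only [Nat.sub_zero, Finset.Icc_self, Finset.mem_singleton, Set.iUnion_iUnion_eq_left, hw]
      exact Cost.zero _
    | succ j ih =>
      set U := Bits w G ∪ ⋃ i ∈ Finset.Icc (w - j) w, {h i} with hU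
      obtain ⟨i, hi⟩ : ∃ i, w - j = i + 1 := ⟨w - j - 1, by omega⟩
      have m1 : h (i + 1) ∈ U :=
        Or.inr (Set.mem_biUnion (x := i + 1) (Finset.mem_coe.2 (Finset.mem_Icc.2 (by omega))) rfl)
      have m2 : bit G i ∈ U := Or.inl (bit_mem_Bits (by omega) _)
      have h2 : Cost U 3 {h i} := by
        rw [hstep]
        exact (Cost.add m1 m2).sub' (Cost.mul m1 m2)
      have h3 : Cost U 0 (⋃ i ∈ Finset.Icc (w - j) w, {h i}) :=
        Cost.of_subset Set.subset_union_right _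
      refine ((ih (by omega)).then (h3.union h2)).mono subset_rfl (by omega) ?_
      refine Set.iUnion₂_subset fun l hl => ?_
      have hl' := Finset.mem_Icc.1 hl
      rw [Set.singleton_subset_iff]
      rcases Nat.lt_or_ge l (w - j) with hlt | hge
      · right
        have : l = i := by omega
        rw [this]; rfl
      · left
        exact Set.mem_biUnion (x := l) (Finset.mem_coe.2 (Finset.mem_Icc.2 (by omega))) rfl
  set U := ⋃ i ∈ Finset.Icc (w - w) w, {h i} with hU
  have m : ∀ i ≤ w, h i ∈ U := fun i hi =>
    Set.mem_biUnion (x := i) (Finset.mem_coe.2 (Finset.mem_Icc.2 (by omega))) rfl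
  have h2 : Cost U w (⋃ i ∈ Finset.range w, {h i - h (i + 1)}) := by
    have := Cost.biUnion_const (Finset.range w) (S := U) (c := 1) (T := fun i => {h i - h (i + 1)})
      (fun i hi => by
        have hi' := Finset.mem_range.1 hi
        exact Cost.sub (m i (by omega)) (m (i + 1) (by omega)))
    rw [Finset.card_range, mul_one] at this
    exact this
  have h3 : Cost U w (U ∪ ⋃ i ∈ Finset.range w, {h i - h (i + 1)}) := h2.keep
  refine ((h1 w le_rfl).trans h3).mono_right (Bits_subset_iff.2 fun p _ => ?_)
  by_cases hp : p < v ∧ v - 1 - p < w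
  · right
    refine Set.mem_biUnion (x := v - 1 - p) (Finset.mem_coe.2 (Finset.mem_range.2 hp.2)) ?_
    rw [Set.mem_singleton_iff]
    funext x
    rw [bit_apply]
    simp only [newton, Nat.testBit_two_pow, hh, Pi.sub_apply]
    have hsz : (G x).size ≤ w := Nat.size_le.2 (hGw x)
    have hs0 : 0 < (G x).size := Nat.size_pos.2 (hG x)
    have e1 : 2 ^ (v - 1 - p) ≤ G x ↔ v - 1 - p < (G x).size := Nat.lt_size.symm
    have e2 : 2 ^ (v - 1 - p + 1) ≤ G x ↔ v - 1 - p + 1 < (G x).size := Nat.lt_size.symm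
    simp only [e1, e2, decide_eq_true_eq]
    by_cases h4 : v - (G x).size = p
    · rw [if_pos h4, if_pos (by omega), if_neg (by omega)]; simp
    · rw [if_neg h4]
      by_cases h5 : v - 1 - p < (G x).size
      · rw [if_pos h5, if_pos (by omega)]; simp
      · rw [if_neg h5, if_neg (by omega)]; simp
  · left
    rw [bit_eq_zero fun x => ?_, ← hw]
    · exact m w le_rfl
    · have hsz : (G x).size ≤ w := Nat.size_le.2 (hGw x)
      have hs0 : 0 < (G x).size := Nat.size_pos.2 (hG x)
      simp only [newton, Nat.testBit_two_pow, decide_eq_false_iff_not]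
      omega

/-- Shifting right only renames the digits. -/
theorem Bits_div_subset {k l s : ℕ} (h : k + s ≤ l) (F : X → ℕ) :
    Bits k (fun x => F x / 2 ^ s) ⊆ Bits l F := by
  rintro _ ⟨i, hi, rfl⟩
  refine ⟨i + s, by omega, bit_congr fun x => ?_⟩
  rw [Nat.testBit_div_two_pow]

theorem Cost.extendBits {k d : ℕ} {F : X → ℕ} (h : ∀ x, F x < 2 ^ k) (hF : Cost S d (Bits k F))
    (l : ℕ) : Cost S (d + 1) (Bits l F) :=
  (hF.union (Cost.zero S)).mono_right (Bits_extend h l)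

end Circuits

/-- Division with remainder by Newton's iteration with full precision: as the number of correct
digits is doubled in each step, a logarithmic number of multiplications suffices. -/
theorem exists_cost_natDivMod : ∃ μ : ℕ → ℕ, QuasiLin μ ∧ ∀ (X : Type u) (w : ℕ) (F G : X → ℕ),
    (∀ x, F x < 2 ^ w) → (∀ x, G x < 2 ^ w) → (∀ x, 0 < G x) →
    Cost (Bits w F ∪ Bits w G) (μ w)
      (Bits w (fun x => F x / G x) ∪ Bits w fun x => F x % G x) := by
  obtain ⟨M, hM, hmul⟩ := exists_cost_natMul.{u}
  refine ⟨fun w => (1 + w * 4 + w) + 2 + (2 * w + 4).size * (2 * M (2 * w + 6) + 8 * (2 * w + 6) + 3)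
    + (2 * M (2 * w + 6) + 60 * (2 * w + 6) + 30), ?_, ?_⟩
  · have hM' : QuasiLin fun w => M (2 * w + 6) := hM.comp_linear 2 6
    have hz : QuasiLin fun w : ℕ => 2 * w + 6 := QuasiLin.id.comp_linear 2 6
    have hl : PolyLog fun w : ℕ => (2 * w + 4).size := PolyLog.size.comp_linear 2 4
    have h1 : QuasiLin fun w : ℕ => 5 * w + 33 := QuasiLin.id.comp_linear 5 33
    have h2 := ((hM'.mul (PolyLog.const 2)).add (hz.mul (PolyLog.const 8))).add
      (PolyLog.const 3).quasiLin
    have h3 := (hM'.mul (PolyLog.const 2)).add (hz.mul (PolyLog.const 60))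
    refine ((h1.add (h2.mul hl)).add h3).mono fun w => le_of_eq ?_
    ring
  intro X w F G hF hG hG0
  set v := 2 * w + 4 with hv
  -- All numbers are handled with `z` digits, so that `2 * 2 ^ v` fits.
  set z := 2 * w + 6 with hz
  have hwz : 2 ^ w ≤ 2 ^ z := Nat.pow_le_pow_right (by norm_num) (by omega)
  have hvz : 4 * 2 ^ v = 2 ^ z := by
    rw [show (4 : ℕ) = 2 ^ 2 by norm_num, ← pow_add]; congr 1; omega
  have hsz : ∀ x, (G x).size ≤ v := fun x => by have := Nat.size_le.2 (hG x); omega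
  set t := (2 * w + 4).size with ht
  set S := Bits w F ∪ Bits w G with hS
  have cF : Cost S 1 (Bits z F) := by
    have := Cost.extendBits (S := S) hF (Cost.of_subset Set.subset_union_left 0) z
    exact this
  have cG : Cost S 1 (Bits z G) := by
    have := Cost.extendBits (S := S) hG (Cost.of_subset Set.subset_union_right 0) z
    exact this
  set S₁ := Bits z F ∪ Bits z G with hS₁
  have hFz : ∀ x, F x < 2 ^ z := fun x => (hF x).trans_le hwz
  have hGz : ∀ x, G x < 2 ^ z := fun x => (hG x).trans_le hwz
  have hxlt : ∀ j x, newton v (G x) j < 2 ^ z := by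
    intro j x
    have h1 := newton_le (hG0 x) (hsz x) j
    have h2 : newton v (G x) j ≤ G x * newton v (G x) j := Nat.le_mul_of_pos_left _ (hG0 x)
    have h3 : 0 < 2 ^ v := by positivity
    omega
  have c1 : ∀ j, Cost S₁ ((1 + w * 4 + w) + j * (2 * M z + 8 * z + 3))
      (Bits z fun x => newton v (G x) j) := by
    intro j
    induction j with
    | zero =>
      exact ((cost_newton_zero (by omega) hG0 hG z).mono_left
        ((Bits_mono (by omega) _).trans Set.subset_union_right)).le (by omega)
    | succ j ih =>
      set x' : X → ℕ := fun x => newton v (G x) j with hx'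
      have a1 : Cost (S₁ ∪ Bits z x') (M z) (Bits z fun x => G x * x' x) := by
        refine (hmul X z G x' hGz (hxlt j)).mono ?_ le_rfl (Bits_mono (by omega) _)
        exact Set.union_subset (fun b hb => Or.inl (Or.inr hb)) Set.subset_union_right
      have a2 : Cost (S₁ ∪ Bits z x') 2 (Bits z fun _ : X => 2 * 2 ^ v) := by
        refine ((Cost.zero _).union (Cost.one _)).mono_right (Bits_subset_iff.2 fun i _ => ?_)
        have : (fun _ : X => 2 * 2 ^ v) = fun _ => 2 ^ (v + 1) := by
          funext _; exact (pow_succ' 2 v).symm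
        rw [this]
        by_cases hi : v + 1 = i
        · right; funext x; rw [bit_apply, Nat.testBit_two_pow]; simp [hi]
        · left; refine bit_eq_zero fun x => ?_
          rw [Nat.testBit_two_pow]; simp [hi]
      have a3 : Cost (S₁ ∪ Bits z x') (2 + M z + 1 + 8 * z)
          (Bits z fun x => 2 * 2 ^ v - G x * x' x) := by
        refine Cost.natSubOfLe (fun x => ?_) (fun x => ?_) a2 a1
        · have : 0 < 2 ^ v := by positivity
          omega
        · have : G x * x' x ≤ 2 ^ v := newton_le (hG0 x) (hsz x) j
          omega
      have a4 : Cost ((S₁ ∪ Bits z x') ∪ Bits z fun x => 2 * 2 ^ v - G x * x' x) (M z)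
          (Bits z fun x => x' x * (2 * 2 ^ v - G x * x' x) / 2 ^ v) := by
        refine (hmul X z x' (fun x => 2 * 2 ^ v - G x * x' x) (hxlt j) (fun x => ?_)).mono ?_
          le_rfl (Bits_div_subset (by omega) _)
        · have : 0 < 2 ^ v := by positivity
          omega
        · exact Set.union_subset (fun b hb => Or.inl (Or.inr hb)) Set.subset_union_right
      refine (ih.then (a3.then a4)).mono subset_rfl ?_ ?_
      · linarith
      · exact subset_rfl
  have htv : 2 * w + 4 ≤ 2 ^ (t - 1 + 1) := by
    have h1 := Nat.lt_size_self (2 * w + 4)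
    have h2 : 0 < (2 * w + 4).size := Nat.size_pos.2 (by omega)
    rw [Nat.sub_add_cancel h2]; omega
  have ht0 : t - 1 + 1 = t := Nat.sub_add_cancel (Nat.size_pos.2 (by omega))
  rw [ht0] at htv
  have hquot := fun x => newton_quotient (t := t - 1) (hG0 x) (hF x) (hG x) (by rw [ht0]; exact htv)
  simp only [ht0, ← hv] at hquot
  set y : X → ℕ := fun x => newton v (G x) t with hy
  set q₀ : X → ℕ := fun x => F x * y x / 2 ^ v with hq₀
  have hq₀lt : ∀ x, q₀ x < 2 ^ z := fun x => by
    have h1 : q₀ x ≤ G x * q₀ x := Nat.le_mul_of_pos_left _ (hG0 x)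
    exact (h1.trans (hquot x).1).trans_lt (hFz x)
  have c2 : Cost (S₁ ∪ Bits z y) (M z) (Bits z q₀) := by
    refine (hmul X z F y hFz (hxlt t)).mono ?_ le_rfl (Bits_div_subset (by omega) _)
    exact Set.union_subset (fun b hb => Or.inl (Or.inl hb)) Set.subset_union_right
  set S₂ := (S₁ ∪ Bits z y) ∪ Bits z q₀ with hS₂
  have d1 : Cost S₂ (M z) (Bits z fun x => G x * q₀ x) := by
    refine (hmul X z G q₀ hGz hq₀lt).mono ?_ le_rfl (Bits_mono (by omega) _)
    exact Set.union_subset (fun b hb => Or.inl (Or.inl (Or.inr hb))) Set.subset_union_right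
  have dF : Cost S₂ 0 (Bits z F) := Cost.of_subset (fun b hb => Or.inl (Or.inl (Or.inl hb))) _
  have dG : Cost S₂ 0 (Bits z G) := Cost.of_subset (fun b hb => Or.inl (Or.inl (Or.inr hb))) _
  have dq : Cost S₂ 0 (Bits z q₀) := Cost.of_subset Set.subset_union_right _
  have d2 : Cost S₂ (0 + M z + 1 + 8 * z) (Bits z fun x => F x - G x * q₀ x) :=
    Cost.natSubOfLe hFz (fun x => (hquot x).1) dF d1
  set r₀ : X → ℕ := fun x => F x - G x * q₀ x with hr₀
  set S₃ := S₂ ∪ Bits z r₀ with hS₃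
  have er : Cost S₃ 0 (Bits z r₀) := Cost.of_subset Set.subset_union_right _
  have eG : Cost S₃ 0 (Bits z G) := dG.mono_left Set.subset_union_left
  have eq : Cost S₃ 0 (Bits z q₀) := dq.mono_left Set.subset_union_left
  have hr₀lt : ∀ x, r₀ x < 2 ^ z := fun x => (Nat.sub_le _ _).trans_lt (hFz x)
  -- The quotient is too small by at most one: it is corrected if the remainder is not below `G`.
  have e1 : Cost S₃ (3 + 8 * z) {fun x => if r₀ x < G x then (1 : ZMod 2) else 0} :=
    (Cost.natLt hr₀lt hGz er eG).le (by omega)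
  have e2 : Cost S₃ (1 + 8 * z) (Bits z fun x => 2 ^ z + r₀ x - G x) :=
    ((Cost.subCarry hr₀lt hGz er eG).mono_right Set.subset_union_left).le (by omega)
  have e3 := Cost.select e1 er e2
  have eone : Cost S₃ 1 {bit (fun _ : X => 1) 0} := by
    have : bit (fun _ : X => 1) 0 = 1 := by funext x; simp [bit]
    rw [this]; exact Cost.one _
  have e4 : Cost S₃ (6 * z + 2) (Bits z fun x => q₀ x + 1) := by
    have h1 : Cost S₃ 2 (Bits z fun _ : X => 1) := by
      refine ((Cost.zero _).union (Cost.one _)).mono_right (Bits_subset_iff.2 fun i _ => ?_)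
      rcases Nat.eq_zero_or_pos i with rfl | h0
      · right; funext x; simp [bit]
      · left; exact bit_eq_zero_of_lt fun _ => Nat.one_lt_two_pow h0.ne'
    have h2 : Cost S₃ 1 (Bits z fun _ : X => 0) := Cost.natConstZero z
    have h3 := ((eq.union h2).union eone).trans (cost_addCarry z q₀ (fun _ => 0) (fun _ => 1)
      (fun _ => le_rfl))
    refine (h3.mono_right Set.subset_union_left).le (by omega)
  have e5 := Cost.select e1 eq e4
  have hdiv : ∀ x, F x / G x = if r₀ x < G x then q₀ x else q₀ x + 1 := by
    intro x
    have h1 := hquot x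
    change G x * q₀ x ≤ F x ∧ F x < G x * q₀ x + 2 * G x at h1
    have h2 : r₀ x = F x - G x * q₀ x := rfl
    split_ifs with h
    · exact Nat.div_eq_of_lt_le (by rw [mul_comm]; omega)
        (by rw [Nat.succ_mul, mul_comm]; omega)
    · exact Nat.div_eq_of_lt_le (by rw [Nat.succ_mul, mul_comm]; omega)
        (by rw [Nat.succ_mul, Nat.succ_mul, mul_comm]; omega)
  have hmod : ∀ x, F x % G x = if r₀ x < G x then r₀ x else r₀ x - G x := by
    intro x
    have h1 := Nat.div_add_mod (F x) (G x)
    rw [hdiv x] at h1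
    have h0 := (hquot x).1
    change G x * q₀ x ≤ F x at h0
    have h2 : r₀ x = F x - G x * q₀ x := rfl
    split_ifs at h1 ⊢ with h
    · omega
    · rw [mul_add, mul_one] at h1; omega
  have e6 : Cost S₃ (40 * z + 20) (Bits w (fun x => F x / G x) ∪ Bits w fun x => F x % G x) := by
    refine (e5.union e3).mono subset_rfl (by omega) (Set.union_subset_union ?_ ?_)
    · simp only [hdiv]
      exact Bits_mono (by omega) _
    · refine (Bits_mono (show w ≤ z by omega) _).trans (le_of_eq (Bits_congr fun x => ?_))
      rw [hmod x]
      split_ifs with h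
      · rfl
      · rw [Nat.add_sub_assoc (by omega), Nat.add_mod_left]
  refine ((cF.union cG).trans (((c1 t).then (c2.then (d2.then e6))))).mono subset_rfl ?_ subset_rfl
  dsimp only
  rw [← ht, ← hz]
  generalize t * (2 * M z + 8 * z + 3) = y
  omega

end SLPInterp

namespace SLPInterp

/-! ### Quasi-linear arithmetic routines -/

theorem ofBits_ofFn (l h : ℕ) :
    ofBits (List.ofFn fun i : Fin l => ((h / 2 ^ (i : ℕ) : ℕ) : ZMod 2)) = h % 2 ^ l := by
  induction l generalizing h with
  | zero => simp [ofBits, Nat.mod_one]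
  | succ l ih =>
    rw [List.ofFn_succ, ofBits]
    have h1 : (fun i : Fin l => ((h / 2 ^ ((i.succ : Fin (l + 1)) : ℕ) : ℕ) : ZMod 2)) =
        fun i : Fin l => ((h / 2 / 2 ^ (i : ℕ) : ℕ) : ZMod 2) := by
      funext i
      rw [Fin.val_succ, pow_succ', Nat.div_div_eq_div_mul]
    rw [h1, ih, ZMod.val_natCast, pow_succ', Nat.mod_mul]
    simp

/-- A computation with the digits of two numbers, uniform in all pairs of numbers that satisfy
`valid`, is a circuit. -/
theorem exists_circuit (w l c : ℕ) (valid : ℕ → ℕ → Prop) (fn : ℕ → ℕ → ℕ)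
    (hfn : ∀ a b, a < 2 ^ w → b < 2 ^ w → valid a b → fn a b < 2 ^ l)
    (h : ∀ (X : Type) (F G : X → ℕ), (∀ x, F x < 2 ^ w) → (∀ x, G x < 2 ^ w) →
      (∀ x, valid (F x) (G x)) →
      Cost (Bits w F ∪ Bits w G) c (Bits l fun x => fn (F x) (G x))) :
    ∃ p : Program (w + w), p.cost ≤ w + w + c ∧ ∀ a b, a < 2 ^ w → b < 2 ^ w → valid a b →
      ofBits (p.eval (Fin.append (toBits w a) (toBits w b))) = fn a b := by
  -- One computation in the ring of functions on all admissible pairs serves all inputs at once.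
  let X := {p : ℕ × ℕ // p.1 < 2 ^ w ∧ p.2 < 2 ^ w ∧ valid p.1 p.2}
  let x : Fin (w + w) → X → ZMod 2 := fun i p => Fin.append (toBits w p.1.1) (toBits w p.1.2) i
  have hc := h X (fun p => p.1.1) (fun p => p.1.2) (fun p => p.2.1) (fun p => p.2.2.1)
    (fun p => p.2.2.2)
  have hx : (Bits w (fun p : X => p.1.1) ∪ Bits w fun p : X => p.1.2) ⊆ Set.range x := by
    refine Set.union_subset (Bits_subset_iff.2 fun i hi => ⟨Fin.castAdd w ⟨i, hi⟩, ?_⟩)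
      (Bits_subset_iff.2 fun i hi => ⟨Fin.natAdd w ⟨i, hi⟩, ?_⟩)
    · funext p; simp only [x, Fin.append_left]; rfl
    · funext p; simp only [x, Fin.append_right]; rfl
  have hr : Set.range (fun i : Fin l => bit (fun p : X => fn p.1.1 p.1.2) i) ⊆
      Bits l fun p : X => fn p.1.1 p.1.2 := by
    rintro _ ⟨i, rfl⟩; exact bit_mem_Bits i.2 _
  obtain ⟨p, hp, hpe⟩ := ((hc.mono_left hx).mono_right hr).exists_program
  refine ⟨p, hp, fun a b ha hb hab => ?_⟩
  have h1 := p.map_eval (Pi.evalRingHom (fun _ : X => ZMod 2) ⟨(a, b), ha, hb, hab⟩) x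
  rw [hpe, List.map_ofFn] at h1
  have h2 : (fun i => (Pi.evalRingHom (fun _ : X => ZMod 2) ⟨(a, b), ha, hb, hab⟩) (x i)) =
      Fin.append (toBits w a) (toBits w b) := rfl
  rw [h2] at h1
  rw [← h1]
  exact (ofBits_ofFn l (fn a b)).trans (Nat.mod_eq_of_lt (hfn a b ha hb hab))

section

variable {X : Type u} {S : Set (X → ZMod 2)}

theorem Cost.natTest {c : ℕ} {p : X → Prop} [DecidablePred p]
    (h : Cost S c {fun x => if p x then (1 : ZMod 2) else 0}) :
    Cost S c (Bits 1 fun x => if p x then 1 else 0) := by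
  refine h.mono_right (Bits_subset_iff.2 fun i hi => ?_)
  obtain rfl : i = 0 := by omega
  rw [Set.mem_singleton_iff]
  funext x
  simp only [bit, pow_zero, Nat.div_one]
  split_ifs <;> simp

end

/-- The operands for which an operation has to be correct. -/
def NatOp.Valid (op : NatOp) (_ b : ℕ) : Prop := (op = NatOp.div ∨ op = NatOp.mod) → b ≠ 0

theorem exists_circuits : ∃ μ : ℕ → ℕ, QuasiLin μ ∧ ∀ (op : NatOp) (w : ℕ),
    ∃ p : Program (w + w), p.cost ≤ μ w ∧ ∀ a b, a < 2 ^ w → b < 2 ^ w → op.Valid a b →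
      ofBits (p.eval (Fin.append (toBits w a) (toBits w b))) = op.fn a b := by
  obtain ⟨M, hM, hmul⟩ := exists_cost_natMul.{0}
  obtain ⟨Q, hQ, hdiv⟩ := exists_cost_natDivMod.{0}
  refine ⟨fun w => w + w + (M w + Q w + (30 * w + 20)), ?_, fun op w => ?_⟩
  · exact (QuasiLin.id.add QuasiLin.id).add
      ((hM.add hQ).add (QuasiLin.id.comp_linear 30 20))
  suffices H : ∃ l, (∀ a b, a < 2 ^ w → b < 2 ^ w → op.Valid a b → op.fn a b < 2 ^ l) ∧
      ∀ (X : Type) (F G : X → ℕ), (∀ x, F x < 2 ^ w) → (∀ x, G x < 2 ^ w) →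
      (∀ x, op.Valid (F x) (G x)) → Cost (Bits w F ∪ Bits w G) (M w + Q w + (30 * w + 20))
        (Bits l fun x => op.fn (F x) (G x)) by
    obtain ⟨l, h1, h2⟩ := H
    exact exists_circuit w l _ op.Valid op.fn h1 h2
  have hw1 : 2 ^ (w + 1) = 2 * 2 ^ w := pow_succ' 2 w
  cases op with
  | add =>
    refine ⟨w + 1, fun a b ha hb _ => ?_, fun X F G hF hG _ => ?_⟩
    · simp only [NatOp.fn]; omega
    · have h1 := Cost.extendBits (S := Bits w F ∪ Bits w G) hF
        (Cost.of_subset Set.subset_union_left 0) (w + 1)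
      have h2 := Cost.extendBits (S := Bits w F ∪ Bits w G) hG
        (Cost.of_subset Set.subset_union_right 0) (w + 1)
      exact (h1.natAdd h2).le (by omega)
  | sub =>
    refine ⟨w, fun a b ha hb _ => ?_, fun X F G hF hG _ => ?_⟩
    · simp only [NatOp.fn]; omega
    · have h1 : Cost (Bits w F ∪ Bits w G) 0 (Bits w F) := Cost.of_subset Set.subset_union_left 0
      have h2 : Cost (Bits w F ∪ Bits w G) 0 (Bits w G) := Cost.of_subset Set.subset_union_right 0
      have h3 := Cost.select (Cost.natLt hF hG h1 h2) (Cost.natConstZero w)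
        ((Cost.subCarry hF hG h1 h2).mono_right Set.subset_union_left)
      refine h3.mono subset_rfl (by omega) (le_of_eq (Bits_congr fun x => ?_))
      simp only [NatOp.fn]
      split_ifs with h
      · rw [Nat.sub_eq_zero_of_le h.le]
      · rw [Nat.add_sub_assoc (by omega), Nat.add_mod_left]
  | mul =>
    refine ⟨2 * w, fun a b ha hb _ => ?_, fun X F G hF hG _ => ?_⟩
    · simp only [NatOp.fn]
      rw [two_mul, pow_add]
      exact Nat.mul_lt_mul'' ha hb
    · exact (hmul X w F G hF hG).le (by omega)
  | div =>
    refine ⟨w, fun a b ha hb _ => ?_, fun X F G hF hG hv => ?_⟩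
    · exact (Nat.div_le_self a b).trans_lt ha
    · exact ((hdiv X w F G hF hG fun x => Nat.pos_of_ne_zero (hv x (Or.inl rfl))).mono_right
        Set.subset_union_left).le (by omega)
  | mod =>
    refine ⟨w, fun a b ha hb _ => ?_, fun X F G hF hG hv => ?_⟩
    · exact (Nat.mod_le a b).trans_lt ha
    · exact ((hdiv X w F G hF hG fun x => Nat.pos_of_ne_zero (hv x (Or.inr rfl))).mono_right
        Set.subset_union_right).le (by omega)
  | lt =>
    refine ⟨1, fun a b ha hb _ => ?_, fun X F G hF hG _ => ?_⟩
    · simp only [NatOp.fn]; split_ifs <;> norm_num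
    · have h1 : Cost (Bits w F ∪ Bits w G) 0 (Bits w F) := Cost.of_subset Set.subset_union_left 0
      have h2 : Cost (Bits w F ∪ Bits w G) 0 (Bits w G) := Cost.of_subset Set.subset_union_right 0
      exact (Cost.natLt hF hG h1 h2).natTest.le (by omega)
  | eq =>
    refine ⟨1, fun a b ha hb _ => ?_, fun X F G hF hG _ => ?_⟩
    · simp only [NatOp.fn]; split_ifs <;> norm_num
    · have h1 : Cost (Bits w F ∪ Bits w G) 0 (Bits w F) := Cost.of_subset Set.subset_union_left 0
      have h2 : Cost (Bits w F ∪ Bits w G) 0 (Bits w G) := Cost.of_subset Set.subset_union_right 0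
      -- Two numbers are equal if neither of them is smaller than the other one.
      have h3 := ((Cost.one _).sub' (Cost.natLt hF hG h1 h2)).mul'
        ((Cost.one _).sub' (Cost.natLt hG hF h2 h1))
      have h4 : (1 - fun x => if F x < G x then (1 : ZMod 2) else 0) *
          (1 - fun x => if G x < F x then (1 : ZMod 2) else 0) =
          fun x => if F x = G x then 1 else 0 := by
        funext x
        simp only [Pi.mul_apply, Pi.sub_apply, Pi.one_apply]
        rcases lt_trichotomy (F x) (G x) with h | h | h
        · simp [h, h.ne]
        · simp [h]
        · simp [h, h.ne']
      rw [h4] at h3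
      exact h3.natTest.le (by omega)

/-- A program that multiplies the generic polynomials, whose coefficients are indeterminates, works
over every commutative ring. -/
theorem exists_convProgram : ∃ μ : ℕ → ℕ, QuasiLin μ ∧ ∀ m : ℕ, ∃ p : Program (m + m),
    p.cost ≤ μ m ∧ ∀ (A : Type u) [CommRing A], 0 < m → ∀ a b : Fin m → A,
      p.eval (Fin.append a b) = List.ofFn (cyclicConv a b) := by
  obtain ⟨C, r, hC⟩ := exists_cost_cyclicConv.{0}
  refine ⟨fun m => m + m + C * (m * m.size ^ r), ?_, fun m => ?_⟩
  · refine ((QuasiLin.id.add QuasiLin.id).add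
      ((QuasiLin.id.mul (PolyLog.size.pow r)).mul (PolyLog.const C))).mono fun w => le_of_eq ?_
    ring
  rcases Nat.eq_zero_or_pos m with rfl | hm
  · exact ⟨⟨[], []⟩, by simp [Program.cost], fun A _ h => absurd h (lt_irrefl _)⟩
  let P := MvPolynomial (Fin (m + m)) ℤ
  have h := hC m hm P (fun i => MvPolynomial.X (Fin.castAdd m i))
    (fun i => MvPolynomial.X (Fin.natAdd m i))
  have hx : (Set.range (fun i : Fin m => (MvPolynomial.X (Fin.castAdd m i) : P)) ∪
      Set.range fun i : Fin m => (MvPolynomial.X (Fin.natAdd m i) : P)) ⊆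
      Set.range (MvPolynomial.X : Fin (m + m) → P) := by
    rintro _ (⟨i, rfl⟩ | ⟨i, rfl⟩)
    · exact ⟨_, rfl⟩
    · exact ⟨_, rfl⟩
  obtain ⟨p, hp, hpe⟩ := (h.mono_left hx).exists_program
  refine ⟨p, hp, fun A _ _ a b => ?_⟩
  let φ : P →+* A := MvPolynomial.eval₂Hom (Int.castRingHom A) (Fin.append a b)
  have h1 := p.map_eval φ MvPolynomial.X
  have h2 : (fun i => φ (MvPolynomial.X i)) = Fin.append a b := by
    funext i; exact MvPolynomial.eval₂_X _ _ _
  rw [h2, hpe, List.map_ofFn] at h1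
  rw [← h1]
  congr 1
  funext k
  simp only [Function.comp, cyclicConv, map_sum]
  refine Finset.sum_congr rfl fun i _ => Finset.sum_congr rfl fun j _ => ?_
  split_ifs
  · rw [map_mul, show φ (MvPolynomial.X (Fin.castAdd m i)) = _ from congrFun h2 _,
      show φ (MvPolynomial.X (Fin.natAdd m j)) = _ from congrFun h2 _, Fin.append_left,
      Fin.append_right]
  · exact map_zero φ

/-- There are correct arithmetic routines of quasi-linear cost. -/
theorem exists_arith : ∃ 𝔸 : Arith, Arith.Correct.{u} 𝔸 ∧ ∃ μ : ℕ → ℕ, QuasiLin μ ∧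
    (∀ m, (𝔸.conv m).cost ≤ μ m) ∧ ∀ op w, (𝔸.circ op w).cost ≤ μ w := by
  obtain ⟨μ, hμ, hconv⟩ := exists_convProgram.{u}
  obtain ⟨ν, hν, hcirc⟩ := exists_circuits
  choose conv hcost heval using hconv
  choose circ hcost' heval' using hcirc
  refine ⟨⟨conv, circ⟩, ⟨fun A _ m hm a b => heval m A hm a b, ?_⟩, fun w => μ w + ν w,
    hμ.add hν, fun m => (hcost m).trans (Nat.le_add_right _ _),
    fun op w => (hcost' op w).trans (Nat.le_add_left _ _)⟩
  intro op w a b ha hb hv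
  exact heval' op w a b ha hb hv

end SLPInterp

namespace SLPInterp

/-! ### Values and costs of counted computations -/

namespace Timed

variable {α : Type u} {β : Type v}

@[simp] theorem pure_val (a : α) : (pure a).val = a := rfl
@[simp] theorem pure_ringOps (a : α) : (pure a).ringOps = 0 := rfl
@[simp] theorem pure_bitOps (a : α) : (pure a).bitOps = 0 := rfl
@[simp] theorem bind_val (x : Timed α) (f : α → Timed β) : (x.bind f).val = (f x.val).val := rfl
@[simp] theorem bind_ringOps (x : Timed α) (f : α → Timed β) :
    (x.bind f).ringOps = x.ringOps + (f x.val).ringOps := rfl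
@[simp] theorem bind_bitOps (x : Timed α) (f : α → Timed β) :
    (x.bind f).bitOps = x.bitOps + (f x.val).bitOps := rfl

@[simp] theorem mapL_val (f : α → Timed β) (l : List α) :
    (mapL f l).val = l.map fun a => (f a).val := by
  induction l with
  | nil => rfl
  | cons a l ih => simp [mapL, ih]

theorem mapL_ringOps_le {f : α → Timed β} {l : List α} {c : ℕ}
    (h : ∀ a ∈ l, (f a).ringOps ≤ c) : (mapL f l).ringOps ≤ l.length * c := by
  induction l with
  | nil => simp [mapL]
  | cons a l ih =>
    have h1 := h a (by simp)
    have h2 := ih fun b hb => h b (by simp [hb])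
    simp only [mapL, bind_ringOps, pure_ringOps, List.length_cons, Nat.succ_mul]
    omega

theorem mapL_bitOps_le {f : α → Timed β} {l : List α} {c : ℕ}
    (h : ∀ a ∈ l, (f a).bitOps ≤ c) : (mapL f l).bitOps ≤ l.length * c := by
  induction l with
  | nil => simp [mapL]
  | cons a l ih =>
    have h1 := h a (by simp)
    have h2 := ih fun b hb => h b (by simp [hb])
    simp only [mapL, bind_bitOps, pure_bitOps, List.length_cons, Nat.succ_mul]
    omega

@[simp] theorem filterL_val (f : α → Timed Bool) (l : List α) :
    (filterL f l).val = l.filter fun a => (f a).val := by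
  induction l with
  | nil => rfl
  | cons a l ih => simp [filterL, ih, List.filter_cons]

theorem filterL_ringOps_le {f : α → Timed Bool} {l : List α} {c : ℕ}
    (h : ∀ a ∈ l, (f a).ringOps ≤ c) : (filterL f l).ringOps ≤ l.length * c := by
  induction l with
  | nil => simp [filterL]
  | cons a l ih =>
    have h1 := h a (by simp)
    have h2 := ih fun b hb => h b (by simp [hb])
    simp only [filterL, bind_ringOps, pure_ringOps, List.length_cons, Nat.succ_mul]
    omega

theorem filterL_bitOps_le {f : α → Timed Bool} {l : List α} {c : ℕ}
    (h : ∀ a ∈ l, (f a).bitOps ≤ c) : (filterL f l).bitOps ≤ l.length * c := by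
  induction l with
  | nil => simp [filterL]
  | cons a l ih =>
    have h1 := h a (by simp)
    have h2 := ih fun b hb => h b (by simp [hb])
    simp only [filterL, bind_bitOps, pure_bitOps, List.length_cons, Nat.succ_mul]
    omega

@[simp] theorem foldL_val (f : β → α → Timed β) (b : β) (l : List α) :
    (foldL f b l).val = l.foldl (fun b a => (f b a).val) b := by
  induction l generalizing b with
  | nil => rfl
  | cons a l ih => simp [foldL, ih]

/-- The costs of a fold whose intermediate results satisfy the invariant `I`. -/
theorem foldL_ringOps_le (I : β → Prop) {f : β → α → Timed β} {l : List α} {c : ℕ}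
    (h : ∀ b, I b → ∀ a ∈ l, (f b a).ringOps ≤ c ∧ I (f b a).val) {b : β} (hb : I b) :
    (foldL f b l).ringOps ≤ l.length * c := by
  induction l generalizing b with
  | nil => simp [foldL]
  | cons a l ih =>
    have h1 := h b hb a (by simp)
    have h2 := ih (fun b hb a ha => h b hb a (by simp [ha])) h1.2
    simp only [foldL, bind_ringOps, List.length_cons, Nat.succ_mul]
    omega

theorem foldL_bitOps_le (I : β → Prop) {f : β → α → Timed β} {l : List α} {c : ℕ}
    (h : ∀ b, I b → ∀ a ∈ l, (f b a).bitOps ≤ c ∧ I (f b a).val) {b : β} (hb : I b) :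
    (foldL f b l).bitOps ≤ l.length * c := by
  induction l generalizing b with
  | nil => simp [foldL]
  | cons a l ih =>
    have h1 := h b hb a (by simp)
    have h2 := ih (fun b hb a ha => h b hb a (by simp [ha])) h1.2
    simp only [foldL, bind_bitOps, List.length_cons, Nat.succ_mul]
    omega

theorem foldl_invariant (I : β → Prop) {f : β → α → β} {l : List α}
    (h : ∀ b, I b → ∀ a ∈ l, I (f b a)) {b : β} (hb : I b) : I (l.foldl f b) := by
  induction l generalizing b with
  | nil => exact hb
  | cons a l ih =>
    exact ih (fun b hb a ha => h b hb a (by simp [ha])) (h b hb a (by simp))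

end Timed

open Timed

@[simp] theorem natOp_val (𝔸 : Arith) (op : NatOp) (a b : ℕ) : (natOp 𝔸 op a b).val = op.fn a b :=
  rfl
@[simp] theorem natOp_ringOps (𝔸 : Arith) (op : NatOp) (a b : ℕ) : (natOp 𝔸 op a b).ringOps = 0 :=
  rfl
@[simp] theorem natTest_ringOps (𝔸 : Arith) (op : NatOp) (a b : ℕ) :
    (natTest 𝔸 op a b).ringOps = 0 := rfl

@[simp] theorem natTest_lt_val (𝔸 : Arith) (a b : ℕ) : (natTest 𝔸 .lt a b).val = decide (a < b) := by
  by_cases h : a < b <;> simp [natTest, NatOp.fn, h]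

@[simp] theorem natTest_eq_val (𝔸 : Arith) (a b : ℕ) : (natTest 𝔸 .eq a b).val = decide (a = b) := by
  by_cases h : a = b <;> simp [natTest, NatOp.fn, h]

/-- `B` is a monotone bound for the cost of the circuits of width `w`. -/
structure CircBound (𝔸 : Arith) (B : ℕ → ℕ) : Prop where
  mono : Monotone B
  cost_le : ∀ op w, (𝔸.circ op w).cost ≤ B w

section

variable {𝔸 : Arith} {B : ℕ → ℕ}

theorem CircBound.natOp_le (hB : CircBound 𝔸 B) {op : NatOp} {a b w : ℕ} (ha : a.size ≤ w)
    (hb : b.size ≤ w) : (natOp 𝔸 op a b).bitOps ≤ B w :=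
  (hB.cost_le op _).trans (hB.mono (max_le ha hb))

theorem CircBound.natTest_le (hB : CircBound 𝔸 B) {op : NatOp} {a b w : ℕ} (ha : a.size ≤ w)
    (hb : b.size ≤ w) : (natTest 𝔸 op a b).bitOps ≤ B w :=
  hB.natOp_le ha hb

theorem size_le_of_le {a b w : ℕ} (h : a ≤ b) (hb : b.size ≤ w) : a.size ≤ w :=
  (Nat.size_le_size h).trans hb

/-! ### Powers -/

@[simp] theorem powNat_val (b k : ℕ) : (powNat 𝔸 b k).val = b ^ k := by
  induction k with
  | zero => rfl
  | succ k ih => simp [powNat, ih, NatOp.fn, pow_succ]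

@[simp] theorem powNat_ringOps (b k : ℕ) : (powNat 𝔸 b k).ringOps = 0 := by
  induction k with
  | zero => rfl
  | succ k ih => simp [powNat, ih]

theorem powNat_bitOps_le (hB : CircBound 𝔸 B) {b k w : ℕ} (hb : 0 < b) (h : (b ^ k).size ≤ w) :
    (powNat 𝔸 b k).bitOps ≤ k * B w := by
  induction k with
  | zero => simp [powNat]
  | succ k ih =>
    have h1 : (b ^ k).size ≤ w :=
      size_le_of_le (Nat.pow_le_pow_right hb (Nat.le_succ k)) h
    have h2 : b.size ≤ w := by
      refine size_le_of_le ?_ h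
      calc b = b ^ 1 := (pow_one b).symm
        _ ≤ b ^ (k + 1) := Nat.pow_le_pow_right hb (by omega)
    have h3 := ih h1
    have h4 := hB.natOp_le (op := .mul) (a := (powNat 𝔸 b k).val) (by rw [powNat_val]; exact h1) h2
    simp only [powNat, bind_bitOps, Nat.succ_mul]
    omega

/-! ### Finding primes -/

theorem trialDivision_val (m : ℕ) (hm : 2 ≤ m) (fuel d : ℕ) (hd : 2 ≤ d)
    (hfuel : m < (d + fuel) * (d + fuel)) (h : ∀ e, 2 ≤ e → e < d → ¬ e ∣ m) :
    (trialDivision 𝔸 m fuel d).val = decide m.Prime := by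
  have hprime : ∀ d, m < d * d → (∀ e, 2 ≤ e → e < d → ¬ e ∣ m) → m.Prime := by
    intro d hlt h
    by_contra hcon
    have h1 := Nat.minFac_sq_le_self (by omega) hcon
    have h2 : m.minFac < d := by
      by_contra h3
      push Not at h3
      nlinarith
    exact h _ (Nat.minFac_prime (by omega)).two_le h2 (Nat.minFac_dvd m)
  induction fuel generalizing d with
  | zero => simp [trialDivision, hprime d (by simpa using hfuel) h]
  | succ fuel ih =>
    simp only [trialDivision, bind_val, natOp_val, natTest_lt_val, NatOp.fn]
    by_cases h1 : m < d * d
    · simp [h1, hprime d h1 h]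
    · simp only [h1, decide_false, Bool.false_eq_true, if_false, bind_val, natTest_eq_val,
        natOp_val, NatOp.fn]
      by_cases h2 : m % d = 0
      · have h3 : ¬ m.Prime := by
          intro hp
          rcases (Nat.dvd_prime hp).1 (Nat.dvd_of_mod_eq_zero h2) with h4 | h4
          · omega
          · subst h4; nlinarith
        simp [h2, h3]
      · simp only [bind_val, h2, decide_false, Bool.false_eq_true, if_false,
          natOp_val, NatOp.fn]
        refine ih (d + 1) (by omega) ?_ ?_
        · rw [show d + 1 + fuel = d + (fuel + 1) by ring]; exact hfuel
        · intro e he hed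
          rcases Nat.lt_succ_iff_lt_or_eq.1 hed with h3 | rfl
          · exact h e he h3
          · exact fun h4 => h2 (Nat.mod_eq_zero_of_dvd h4)

@[simp] theorem trialDivision_ringOps (m fuel d : ℕ) : (trialDivision 𝔸 m fuel d).ringOps = 0 := by
  induction fuel generalizing d with
  | zero => rfl
  | succ fuel ih =>
    simp only [trialDivision, bind_ringOps, natOp_ringOps, natTest_ringOps]
    split_ifs <;> simp
    split_ifs <;> simp [ih]

/-- Trial division stops at the square root. -/
theorem trialDivision_bitOps_le (hB : CircBound 𝔸 B) (m fuel d : ℕ) (hd : d ≤ Nat.sqrt m + 1) :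
    (trialDivision 𝔸 m fuel d).bitOps ≤ (Nat.sqrt m + 2 - d) * (5 * B (m.size + 4)) := by
  induction fuel generalizing d with
  | zero => simp [trialDivision]
  | succ fuel ih =>
    have hsq : Nat.sqrt m * Nat.sqrt m ≤ m := Nat.sqrt_le m
    have hsm : Nat.sqrt m ≤ m := Nat.sqrt_le_self m
    have hdd : d * d ≤ 3 * m + 1 := by nlinarith
    have hsz : ∀ a, a ≤ 3 * m + 1 → a.size ≤ m.size + 4 := by
      intro a ha
      rw [Nat.size_le]
      have h1 := Nat.lt_size_self m
      rw [pow_add]; omega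
    have o1 := hB.natOp_le (op := .mul) (hsz d (by omega)) (hsz d (by omega))
    have o2 := hB.natTest_le (op := .lt) (hsz m (by omega)) (hsz (d * d) hdd)
    have o3 := hB.natOp_le (op := .mod) (hsz m (by omega)) (hsz d (by omega))
    have o4 := hB.natTest_le (op := .eq) (a := (natOp 𝔸 .mod m d).val) (b := 0)
      (hsz _ ((Nat.mod_le _ _).trans (by omega))) (hsz 0 (by omega))
    have o5 := hB.natOp_le (op := .add) (hsz d (by omega)) (hsz 1 (by omega))
    have hpos : Nat.sqrt m + 2 - d = (Nat.sqrt m + 2 - (d + 1)) + 1 := by omega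
    rw [hpos, Nat.succ_mul]
    simp only [trialDivision, bind_bitOps, natOp_val, natTest_lt_val, NatOp.fn]
    by_cases h1 : m < d * d
    · simp only [h1, decide_true, if_true, pure_bitOps]; omega
    · have hd' : d ≤ Nat.sqrt m := Nat.le_sqrt.2 (by omega)
      have h2 := ih (d + 1) (by omega)
      simp only [h1, decide_false, Bool.false_eq_true, if_false, bind_bitOps, natTest_eq_val,
        natOp_val, NatOp.fn] at *
      by_cases h3 : m % d = 0
      · simp only [h3, decide_true, if_true, pure_bitOps] at *; omega
      · simp only [h3, decide_false, Bool.false_eq_true, if_false, bind_bitOps, natOp_val,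
          NatOp.fn] at *
        omega

theorem nextPrime_val {m p : ℕ} (fuel : ℕ) (hm : 2 ≤ m) (hp : p.Prime) (hmp : m ≤ p)
    (hfuel : p < m + fuel) (h : ∀ q, m ≤ q → q < p → ¬ q.Prime) :
    (nextPrime 𝔸 fuel m).val = p := by
  induction fuel generalizing m with
  | zero => omega
  | succ fuel ih =>
    have ht : (trialDivision 𝔸 m m 2).val = decide m.Prime :=
      trialDivision_val m hm m 2 le_rfl (by nlinarith) (by omega)
    simp only [nextPrime, bind_val, ht]
    rcases Nat.lt_or_ge m p with h1 | h1
    · simp only [h m le_rfl h1, decide_false, Bool.false_eq_true, if_false, bind_val, natOp_val,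
        NatOp.fn]
      exact ih (by omega) (by omega) (by omega) fun q hq hqp => h q (by omega) hqp
    · have : m = p := le_antisymm hmp h1
      subst this
      simp [hp]

@[simp] theorem nextPrime_ringOps (fuel m : ℕ) : (nextPrime 𝔸 fuel m).ringOps = 0 := by
  induction fuel generalizing m with
  | zero => rfl
  | succ fuel ih =>
    simp only [nextPrime, bind_ringOps, trialDivision_ringOps]
    split_ifs <;> simp [ih]

theorem nextPrime_bitOps_le (hB : CircBound 𝔸 B) {m p Q : ℕ} (fuel : ℕ) (hm : 2 ≤ m)
    (hp : p.Prime) (hmp : m ≤ p) (hQ : p ≤ Q) :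
    (nextPrime 𝔸 fuel m).bitOps ≤
      (p + 1 - m) * ((Nat.sqrt Q + 1) * (5 * B (Q.size + 4))) := by
  induction fuel generalizing m with
  | zero => simp [nextPrime]
  | succ fuel ih =>
    have ht : (trialDivision 𝔸 m m 2).val = decide m.Prime :=
      trialDivision_val m hm m 2 le_rfl (by nlinarith) (by omega)
    have hs1 : 1 ≤ Nat.sqrt m := Nat.sqrt_pos.2 (by omega)
    have hs : Nat.sqrt m ≤ Nat.sqrt Q := Nat.sqrt_le_sqrt (by omega)
    have hsz : m.size ≤ Q.size := Nat.size_le_size (by omega)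
    have hb : B (m.size + 4) ≤ B (Q.size + 4) := hB.mono (by omega)
    have hc := trialDivision_bitOps_le hB m m 2 (by omega)
    have hc' : (trialDivision 𝔸 m m 2).bitOps ≤ Nat.sqrt Q * (5 * B (Q.size + 4)) :=
      hc.trans (Nat.mul_le_mul (by omega) (by omega))
    have hX : (Nat.sqrt Q + 1) * (5 * B (Q.size + 4)) =
      Nat.sqrt Q * (5 * B (Q.size + 4)) + 5 * B (Q.size + 4) := by ring
    have hpos : p + 1 - m = (p - m) + 1 := by omega
    rw [hpos, Nat.succ_mul]
    simp only [nextPrime, bind_bitOps, ht]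
    by_cases h1 : m.Prime
    · simp only [h1, decide_true, if_true, pure_bitOps]; omega
    · have hmp' : m < p := lt_of_le_of_ne hmp fun h => h1 (h ▸ hp)
      have h2 := ih (m := m + 1) (by omega) (by omega)
      have h3 : p + 1 - (m + 1) = p - m := by omega
      rw [h3] at h2
      have o1 := hB.natOp_le (op := .add) (a := m) (b := 1) (w := Q.size + 4) (by omega)
        (by rw [Nat.size_one]; omega)
      simp only [h1, decide_false, Bool.false_eq_true, if_false, bind_bitOps, natOp_val, NatOp.fn]
      omega

theorem nth_prime_count {m : ℕ} (hm : 2 ≤ m) :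
    m ≤ Nat.nth Nat.Prime (Nat.count Nat.Prime m) ∧
      Nat.nth Nat.Prime (Nat.count Nat.Prime m) < m + m ∧
      ∀ q, m ≤ q → q < Nat.nth Nat.Prime (Nat.count Nat.Prime m) → ¬ q.Prime := by
  refine ⟨Nat.le_nth_count Nat.infinite_setOfPred_prime m, ?_, ?_⟩
  · obtain ⟨p, hp, h1, h2⟩ := Nat.exists_prime_lt_and_le_two_mul (m - 1) (by omega)
    have h3 : Nat.nth Nat.Prime (Nat.count Nat.Prime m) ≤ p := by
      rw [← Nat.nth_count hp]
      exact Nat.nth_monotone Nat.infinite_setOfPred_prime (Nat.count_monotone _ (by omega))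
    omega
  · intro q hmq hq hqp
    have h1 := Nat.count_monotone Nat.Prime hmq
    have h2 : Nat.nth Nat.Prime (Nat.count Nat.Prime m) ≤ q :=
      (Nat.nth_monotone Nat.infinite_setOfPred_prime h1).trans_eq (Nat.nth_count hqp)
    omega

theorem primesFrom_val (N m : ℕ) (hm : 2 ≤ m) : (primesFrom 𝔸 N m).val =
    (List.range N).map fun i => Nat.nth Nat.Prime (Nat.count Nat.Prime m + i) := by
  induction N generalizing m with
  | zero => rfl
  | succ N ih =>
    obtain ⟨h1, h2, h3⟩ := nth_prime_count hm
    set p := Nat.nth Nat.Prime (Nat.count Nat.Prime m) with hp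
    have hv : (nextPrime 𝔸 m m).val = p :=
      nextPrime_val m hm (Nat.prime_nth_prime _) h1 h2 h3
    have hc : Nat.count Nat.Prime (p + 1) = Nat.count Nat.Prime m + 1 := by
      rw [hp]; exact Nat.count_nth_succ_of_infinite Nat.infinite_setOfPred_prime _
    simp only [primesFrom, bind_val, hv, natOp_val, NatOp.fn, pure_val]
    rw [ih (p + 1) (by omega), hc, List.range_succ_eq_map, List.map_cons, List.map_map]
    congr 1
    refine List.map_congr_left fun i _ => ?_
    simp only [Function.comp]
    congr 1
    omega

@[simp] theorem primesFrom_ringOps (N m : ℕ) : (primesFrom 𝔸 N m).ringOps = 0 := by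
  induction N generalizing m with
  | zero => rfl
  | succ N ih => simp [primesFrom, ih]

theorem primesFrom_bitOps_le (hB : CircBound 𝔸 B) {Q : ℕ} (N m : ℕ) (hm : 2 ≤ m)
    (hQ : ∀ i < N, Nat.nth Nat.Prime (Nat.count Nat.Prime m + i) ≤ Q) :
    (primesFrom 𝔸 N m).bitOps ≤ (Q + 1 - m) * ((Nat.sqrt Q + 1) * (5 * B (Q.size + 4))) +
      N * B (Q.size + 4) := by
  induction N generalizing m with
  | zero => simp [primesFrom]
  | succ N ih =>
    obtain ⟨h1, h2, h3⟩ := nth_prime_count hm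
    have hpQ := hQ 0 (by omega)
    rw [add_zero] at hpQ
    set p := Nat.nth Nat.Prime (Nat.count Nat.Prime m) with hp
    have hv : (nextPrime 𝔸 m m).val = p :=
      nextPrime_val m hm (Nat.prime_nth_prime _) h1 h2 h3
    have hc : Nat.count Nat.Prime (p + 1) = Nat.count Nat.Prime m + 1 := by
      rw [hp]; exact Nat.count_nth_succ_of_infinite Nat.infinite_setOfPred_prime _
    have h4 := ih (p + 1) (by omega) (fun i hi => by
      rw [hc, add_assoc, add_comm 1]; exact hQ (i + 1) (by omega))
    have h5 := nextPrime_bitOps_le hB m hm (Nat.prime_nth_prime _) h1 hpQ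
    rw [← hp] at h5
    have hps : p.size ≤ Q.size := Nat.size_le_size hpQ
    have o1 := hB.natOp_le (op := .add) (a := p) (b := 1) (w := Q.size + 4) (by omega)
      (by rw [Nat.size_one]; omega)
    simp only [primesFrom, bind_bitOps, hv, natOp_val, NatOp.fn, pure_bitOps]
    have h6 : Q + 1 - m = (p + 1 - m) + (Q + 1 - (p + 1)) := by omega
    rw [h6]
    generalize (Nat.sqrt Q + 1) * (5 * B (Q.size + 4)) = X at h4 h5 ⊢
    rw [Nat.add_mul, Nat.succ_mul]
    omega

/-- The initial segment found by `primesUpTo`, described by the products of its own initial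
segments. -/
theorem primesUpTo_val (D acc : ℕ) (ps : List ℕ) :
    ∃ K ≤ ps.length, (primesUpTo 𝔸 D acc ps).val = ps.take K ∧
      (∀ i < K, acc * (ps.take i).prod < D) ∧ (K < ps.length → D ≤ acc * (ps.take K).prod) := by
  induction ps generalizing acc with
  | nil => exact ⟨0, le_rfl, rfl, by simp, by simp⟩
  | cons p ps ih =>
    by_cases h : acc < D
    · obtain ⟨K, hK, h1, h2, h3⟩ := ih (acc * p)
      refine ⟨K + 1, by simpa using hK, ?_, ?_, ?_⟩
      · simp [primesUpTo, h, NatOp.fn, h1]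
      · intro i hi
        rcases i with _ | i
        · simpa using h
        · have := h2 i (by omega)
          simpa [mul_assoc] using this
      · intro hlt
        have := h3 (by simpa using hlt)
        simpa [mul_assoc] using this
    · exact ⟨0, by simp, by simp [primesUpTo, h], by simp, by simpa using h⟩

@[simp] theorem primesUpTo_ringOps (D acc : ℕ) (ps : List ℕ) :
    (primesUpTo 𝔸 D acc ps).ringOps = 0 := by
  induction ps generalizing acc with
  | nil => rfl
  | cons p ps ih =>
    simp only [primesUpTo, bind_ringOps, natTest_ringOps]
    split_ifs <;> simp [ih]

theorem primesUpTo_bitOps_le (hB : CircBound 𝔸 B) {D acc w : ℕ} {ps : List ℕ} {Q : ℕ}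
    (hD : (D * Q).size ≤ w) (hQ : 0 < Q) (hps : ∀ p ∈ ps, p ≤ Q) (hacc : acc ≤ D * Q)
    (hD0 : 0 < D) :
    (primesUpTo 𝔸 D acc ps).bitOps ≤
      ((primesUpTo 𝔸 D acc ps).val.length * 2 + 1) * B w := by
  induction ps generalizing acc with
  | nil => simp [primesUpTo]
  | cons p ps ih =>
    have hDw : D.size ≤ w := size_le_of_le (Nat.le_mul_of_pos_right _ hQ) hD
    have hQw : Q.size ≤ w := size_le_of_le (Nat.le_mul_of_pos_left _ hD0) hD
    have o1 := hB.natTest_le (op := .lt) (size_le_of_le hacc hD) hDw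
    by_cases h : acc < D
    · have hp := hps p (by simp)
      have o2 := hB.natOp_le (op := .mul) (size_le_of_le hacc hD) (size_le_of_le hp hQw)
      have h3 := ih (acc := acc * p) (fun q hq => hps q (by simp [hq]))
        (Nat.mul_le_mul h.le hp)
      simp only [primesUpTo, bind_bitOps, natTest_lt_val, h, decide_true, if_true, natOp_val,
        NatOp.fn, pure_bitOps, bind_val, pure_val, List.length_cons]
      rw [show ((primesUpTo 𝔸 D (acc * p) ps).val.length + 1) * 2 + 1 =
        ((primesUpTo 𝔸 D (acc * p) ps).val.length * 2 + 1) + 2 by ring, Nat.add_mul]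
      omega
    · simp only [primesUpTo, bind_bitOps, natTest_lt_val, h, decide_false, Bool.false_eq_true,
        if_false, pure_bitOps, bind_val, pure_val, List.length_nil]
      omega

end

end SLPInterp

namespace SLPInterp

open Timed

section

variable {𝔸 : Arith} {B : ℕ → ℕ}

namespace Timed

variable {α : Type u} {β : Type v}

/-- The computation `x` has the result `a` and costs at most `r` ring operations and `b` bit
operations. -/
structure Costs (x : Timed α) (a : α) (r b : ℕ) : Prop where
  val_eq : x.val = a
  ringOps_le : x.ringOps ≤ r
  bitOps_le : x.bitOps ≤ b

theorem Costs.bind {x : Timed α} {a : α} {r b : ℕ} (hx : Costs x a r b) {f : α → Timed β} {c : β}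
    {r' b' : ℕ} (hf : Costs (f a) c r' b') : Costs (x.bind f) c (r + r') (b + b') := by
  obtain ⟨rfl, h1, h2⟩ := hx
  exact ⟨hf.val_eq, Nat.add_le_add h1 hf.ringOps_le, Nat.add_le_add h2 hf.bitOps_le⟩

theorem Costs.pure (a : α) : Costs (Timed.pure a) a 0 0 := ⟨rfl, le_rfl, le_rfl⟩

theorem Costs.mono {x : Timed α} {a : α} {r b r' b' : ℕ} (hx : Costs x a r b) (hr : r ≤ r')
    (hb : b ≤ b') : Costs x a r' b' :=
  ⟨hx.val_eq, hx.ringOps_le.trans hr, hx.bitOps_le.trans hb⟩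

theorem Costs.mapL {f : α → Timed β} {l : List α} {f' : α → β} {r b : ℕ}
    (h : ∀ a ∈ l, Costs (f a) (f' a) r b) :
    Costs (Timed.mapL f l) (l.map f') (l.length * r) (l.length * b) :=
  ⟨by rw [mapL_val]; exact List.map_congr_left fun a ha => (h a ha).val_eq,
    mapL_ringOps_le fun a ha => (h a ha).ringOps_le,
    mapL_bitOps_le fun a ha => (h a ha).bitOps_le⟩

theorem Costs.filterL {f : α → Timed Bool} {l : List α} {f' : α → Bool} {r b : ℕ}
    (h : ∀ a ∈ l, Costs (f a) (f' a) r b) :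
    Costs (Timed.filterL f l) (l.filter f') (l.length * r) (l.length * b) :=
  ⟨by rw [filterL_val]; exact List.filter_congr fun a ha => (h a ha).val_eq,
    filterL_ringOps_le fun a ha => (h a ha).ringOps_le,
    filterL_bitOps_le fun a ha => (h a ha).bitOps_le⟩

theorem Costs.foldL_cons {f : β → α → Timed β} {b c d : β} {a : α} {l : List α} {r k r' k' : ℕ}
    (h : Costs (f b a) c r k) (h' : Costs (Timed.foldL f c l) d r' k') :
    Costs (Timed.foldL f b (a :: l)) d (r + r') (k + k') :=
  Costs.bind (f := fun b => Timed.foldL f b l) h h'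

end Timed

theorem CircBound.costs_natOp (hB : CircBound 𝔸 B) (op : NatOp) {a b w : ℕ} (ha : a.size ≤ w)
    (hb : b.size ≤ w) : Costs (natOp 𝔸 op a b) (op.fn a b) 0 (B w) :=
  ⟨rfl, le_rfl, hB.natOp_le ha hb⟩

/-! ### Product and remainder trees -/

theorem size_prod_le (ps : List ℕ) : ps.prod.size ≤ (ps.map Nat.size).sum + 1 := by
  rw [Nat.size_le]
  induction ps with
  | nil => simp
  | cons p ps ih =>
    have h1 := Nat.lt_size_self p
    simp only [List.prod_cons, List.map_cons, List.sum_cons]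
    calc p * ps.prod < 2 ^ p.size * 2 ^ ((ps.map Nat.size).sum + 1) :=
          Nat.mul_lt_mul_of_lt_of_lt h1 ih
      _ = _ := by rw [← pow_add, add_assoc]

@[simp] theorem prodTree_val (depth : ℕ) (ps : List ℕ) : (prodTree 𝔸 depth ps).val = ps.prod := by
  induction depth generalizing ps with
  | zero => simp [prodTree, NatOp.fn, List.prod_eq_foldl]
  | succ depth ih =>
    simp only [prodTree, bind_val, ih, natOp_val, NatOp.fn]
    rw [← List.prod_append, List.take_append_drop]

@[simp] theorem prodTree_ringOps (depth : ℕ) (ps : List ℕ) : (prodTree 𝔸 depth ps).ringOps = 0 := by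
  induction depth generalizing ps with
  | zero =>
    have := foldL_ringOps_le (fun _ => True) (f := fun x p => natOp 𝔸 .mul x p) (l := ps) (c := 0)
      (fun _ _ _ _ => ⟨le_rfl, trivial⟩) (b := 1) trivial
    simpa [prodTree] using this
  | succ depth ih => simp [prodTree, ih]

theorem sum_map_take_drop (ps : List ℕ) (k : ℕ) :
    ((ps.take k).map Nat.size).sum + ((ps.drop k).map Nat.size).sum = (ps.map Nat.size).sum := by
  rw [← List.sum_append, ← List.map_append, List.take_append_drop]

/-- With circuits of linear cost up to width `W`, a product tree costs little more than the total
size of its leaves on each of its levels. -/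
theorem prodTree_bitOps_le (hB : CircBound 𝔸 B) {β W : ℕ} (hβ : ∀ w ≤ W, B w ≤ β * (w + 1))
    (depth : ℕ) (ps : List ℕ) (hlen : ps.length ≤ 2 ^ depth)
    (hW : (ps.map Nat.size).sum + 1 ≤ W) :
    (prodTree 𝔸 depth ps).bitOps + 2 * β ≤
      (depth + 1) * (β * (ps.map Nat.size).sum) + 2 ^ (depth + 1) * (2 * β) := by
  induction depth generalizing ps with
  | zero =>
    match ps, hlen with
    | [], _ => simp [prodTree, foldL]; omega
    | [p], _ =>
      simp only [List.map_cons, List.map_nil, List.sum_cons, List.sum_nil, add_zero] at hW ⊢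
      have h1 := hB.natOp_le (op := .mul) (a := 1) (b := p) (w := p.size + 1)
        (by rw [Nat.size_one]; omega) (by omega)
      have h2 := hβ (p.size + 1) hW
      simp only [prodTree, foldL, bind_bitOps, pure_bitOps]
      have h3 : β * (p.size + 1 + 1) = β * p.size + 2 * β := by ring
      omega
    | _ :: _ :: _, h => simp at h
  | succ depth ih =>
    have hs := sum_map_take_drop ps (ps.length / 2)
    have hp := pow_succ 2 depth
    have h1 := ih (ps.take (ps.length / 2)) (by rw [List.length_take]; omega) (by omega)
    have h2 := ih (ps.drop (ps.length / 2)) (by rw [List.length_drop]; omega) (by omega)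
    have z1 := size_prod_le (ps.take (ps.length / 2))
    have z2 := size_prod_le (ps.drop (ps.length / 2))
    have h3 := hB.natOp_le (op := .mul) (a := (ps.take (ps.length / 2)).prod)
      (b := (ps.drop (ps.length / 2)).prod) (w := (ps.map Nat.size).sum + 1)
      (by omega) (by omega)
    have h4 := hβ _ hW
    simp only [prodTree, bind_bitOps, prodTree_val]
    generalize ((ps.take (ps.length / 2)).map Nat.size).sum = s₁ at *
    generalize ((ps.drop (ps.length / 2)).map Nat.size).sum = s₂ at *
    generalize (ps.map Nat.size).sum = s at *
    subst hs
    have e1 : (depth + 1 + 1) * (β * (s₁ + s₂)) = (depth + 1) * (β * s₁) + (depth + 1) * (β * s₂) +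
      β * (s₁ + s₂) := by ring
    have e2 : β * (s₁ + s₂ + 1 + 1) = β * (s₁ + s₂) + 2 * β := by ring
    have e3 : 2 ^ (depth + 1 + 1) * (2 * β) = 2 ^ (depth + 1) * (2 * β) + 2 ^ (depth + 1) * (2 * β) :=
      by ring
    rw [e1, e3]
    omega

@[simp] theorem remTree_ringOps (depth e : ℕ) (ps : List ℕ) :
    (remTree 𝔸 depth e ps).ringOps = 0 := by
  induction depth generalizing ps e with
  | zero =>
    have := mapL_ringOps_le (f := fun p => natOp 𝔸 .mod e p) (l := ps) (c := 0) fun _ _ => le_rfl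
    simpa [remTree] using this
  | succ depth ih => simp [remTree, ih]

@[simp] theorem remTree_val (depth e : ℕ) (ps : List ℕ) :
    (remTree 𝔸 depth e ps).val = ps.map fun p => e % p := by
  induction depth generalizing ps e with
  | zero => simp [remTree, NatOp.fn]
  | succ depth ih =>
    simp only [remTree, bind_val, ih, natOp_val, NatOp.fn, prodTree_val, pure_val]
    rw [← List.map_append, List.take_append_drop]
    refine List.map_congr_left fun p hp => ?_
    exact Nat.mod_mod_of_dvd _ (List.dvd_prod hp)

/-- A remainder tree costs little more than the total size of the moduli for each level of the tree
and of its product trees, if the number `e` itself is reduced at the root only. -/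
theorem remTree_bitOps_le (hB : CircBound 𝔸 B) {β W σ : ℕ} (hβ : ∀ w ≤ W, B w ≤ β * (w + 1))
    (depth e : ℕ) (ps : List ℕ) (hps : ∀ p ∈ ps, 0 < p) (hlen : ps.length ≤ 2 ^ depth)
    (he : e.size ≤ σ) (hW : σ + (ps.map Nat.size).sum + 1 ≤ W)
    (hW' : 2 * (ps.map Nat.size).sum + 2 ≤ W) :
    (remTree 𝔸 depth e ps).bitOps + 3 * β ≤ β * σ +
      (depth + 1) * (depth + 8) * (β * (ps.map Nat.size).sum) +
      2 ^ depth * ((4 * depth + 4) * β) := by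
  induction depth generalizing ps e σ with
  | zero =>
    match ps, hlen with
    | [], _ => simp [remTree, mapL]; omega
    | [p], _ =>
      simp only [List.map_cons, List.map_nil, List.sum_cons, List.sum_nil, add_zero] at hW ⊢
      have h1 := hB.natOp_le (op := .mod) (a := e) (b := p) (w := σ + p.size)
        (by omega) (by omega)
      have h2 := hβ (σ + p.size) (by omega)
      simp only [remTree, mapL, bind_bitOps, pure_bitOps]
      have h3 : β * (σ + p.size + 1) = β * σ + β * p.size + β := by ring
      omega
    | _ :: _ :: _, h => simp at h
  | succ depth ih =>
    have hs := sum_map_take_drop ps (ps.length / 2)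
    have hp := pow_succ 2 depth
    have hpos : 0 < ps.prod := List.prod_pos hps
    have z0 := size_prod_le ps
    have hr : (e % ps.prod).size ≤ (ps.map Nat.size).sum + 1 :=
      (Nat.size_le_size (Nat.mod_lt _ hpos).le).trans z0
    have h0 := prodTree_bitOps_le hB hβ (depth + 1) ps hlen (by omega)
    have h3 := hB.natOp_le (op := .mod) (a := e) (b := ps.prod)
      (w := σ + (ps.map Nat.size).sum + 1) (by omega) (by omega)
    have h4 := hβ _ hW
    have h1 := ih (e % ps.prod) (ps.take (ps.length / 2)) (fun p h => hps p (List.mem_of_mem_take h))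
      (by rw [List.length_take]; omega) hr (by omega) (by omega)
    have h2 := ih (e % ps.prod) (ps.drop (ps.length / 2)) (fun p h => hps p (List.mem_of_mem_drop h))
      (by rw [List.length_drop]; omega) hr (by omega) (by omega)
    simp only [remTree, bind_bitOps, prodTree_val, natOp_val, NatOp.fn, pure_bitOps, add_zero]
    generalize ((ps.take (ps.length / 2)).map Nat.size).sum = s₁ at *
    generalize ((ps.drop (ps.length / 2)).map Nat.size).sum = s₂ at *
    generalize (ps.map Nat.size).sum = s at *
    generalize 2 ^ depth = P at *
    have e3 : 2 ^ (depth + 1 + 1) = 4 * P := by rw [pow_succ, hp]; ring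
    rw [e3] at h0
    rw [hp]
    have e4 : (depth + 1) * (depth + 8) * (β * s₁) + (depth + 1) * (depth + 8) * (β * s₂) =
      (depth + 1) * (depth + 8) * (β * s) := by rw [← hs]; ring
    linarith [Nat.zero_le (depth * (β * s)), Nat.zero_le (β * s)]

@[simp] theorem residues_val (e : ℕ) (ps : List ℕ) :
    (residues 𝔸 e ps).val = ps.map fun p => e % p := remTree_val _ _ _

@[simp] theorem residues_ringOps (e : ℕ) (ps : List ℕ) : (residues 𝔸 e ps).ringOps = 0 :=
  remTree_ringOps _ _ _

theorem residues_bitOps_le (hB : CircBound 𝔸 B) {β W σ s z : ℕ} (hβ : ∀ w ≤ W, B w ≤ β * (w + 1))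
    (e : ℕ) (ps : List ℕ) (hps : ∀ p ∈ ps, 0 < p) (he : e.size ≤ σ)
    (hs : (ps.map Nat.size).sum ≤ s) (hz : ps.length.size ≤ z)
    (hW : σ + s + 1 ≤ W) (hW' : 2 * s + 2 ≤ W) :
    (residues 𝔸 e ps).bitOps ≤ β * σ + (z + 1) * (z + 8) * (β * s) +
      (2 * ps.length + 1) * ((4 * z + 4) * β) := by
  have h := remTree_bitOps_le hB hβ ps.length.size e ps hps (Nat.lt_size_self _).le he (by omega)
    (by omega)
  have h2 : 2 ^ ps.length.size ≤ 2 * ps.length + 1 := by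
    rcases Nat.eq_zero_or_pos ps.length with h0 | h0
    · simp [h0]
    · obtain ⟨k, hk⟩ : ∃ k, ps.length.size = k + 1 :=
        ⟨_, (Nat.succ_pred_eq_of_pos (Nat.size_pos.2 h0)).symm⟩
      have h3 : 2 ^ k ≤ ps.length := Nat.lt_size.1 (by omega)
      rw [hk, pow_succ]; omega
  refine (Nat.le_add_right _ _).trans (h.trans ?_)
  gcongr

/-! ### Chinese remaindering -/

/-- The search ends at the first solution of the congruence. -/
theorem findDigit_val {x M e q : ℕ} (fuel t : ℕ)
    (h : ∃ t' , t ≤ t' ∧ t' < t + fuel ∧ (x + M * t') % q = e) :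
    (x + M * (findDigit 𝔸 x M e q fuel t).val) % q = e ∧
      (findDigit 𝔸 x M e q fuel t).val < t + fuel := by
  induction fuel generalizing t with
  | zero => obtain ⟨t', h1, h2, -⟩ := h; omega
  | succ fuel ih =>
    simp only [findDigit, bind_val, natOp_val, natTest_eq_val, NatOp.fn]
    by_cases h1 : (x + M * t) % q = e
    · simp [h1]
    · simp only [h1, decide_false, Bool.false_eq_true, if_false, bind_val, natOp_val, NatOp.fn]
      have := ih (t + 1) (by
        obtain ⟨t', h2, h3, h4⟩ := h
        refine ⟨t', ?_, by omega, h4⟩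
        rcases h2.eq_or_lt with rfl | h5
        · exact absurd h4 h1
        · exact h5)
      exact ⟨this.1, by omega⟩

@[simp] theorem findDigit_ringOps (x M e q fuel t : ℕ) :
    (findDigit 𝔸 x M e q fuel t).ringOps = 0 := by
  induction fuel generalizing t with
  | zero => rfl
  | succ fuel ih =>
    simp only [findDigit, bind_ringOps, natOp_ringOps, natTest_ringOps]
    split_ifs <;> simp [ih]

theorem findDigit_bitOps_le (hB : CircBound 𝔸 B) {x M e q w : ℕ} (hx : x < q) (hM : M < q)
    (he : e < q) (hw : 2 * q.size + 1 ≤ w) (fuel t : ℕ) (ht : t + fuel ≤ q) :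
    (findDigit 𝔸 x M e q fuel t).bitOps ≤ fuel * (5 * B w) := by
  have hsz : ∀ a, a ≤ q + q * q → a.size ≤ w := by
    intro a ha
    have h1 := Nat.lt_size_self q
    have h2 : a < 2 ^ (2 * q.size + 1) := by
      have h3 : 2 ^ (2 * q.size + 1) = 2 * (2 ^ q.size * 2 ^ q.size) := by
        rw [pow_succ, two_mul, pow_add]; ring
      have h4 : (q + 1) * (q + 1) ≤ 2 ^ q.size * 2 ^ q.size := Nat.mul_le_mul h1 h1
      rw [h3]
      nlinarith
    exact (Nat.size_le.2 h2).trans hw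
  induction fuel generalizing t with
  | zero => simp [findDigit]
  | succ fuel ih =>
    have hMt : M * t ≤ q * q := Nat.mul_le_mul hM.le (by omega)
    have o1 := hB.natOp_le (op := .mul) (hsz M (by nlinarith)) (hsz t (by nlinarith))
    have o2 := hB.natOp_le (op := .add) (hsz x (by omega)) (hsz (M * t) (by omega))
    have o3 := hB.natOp_le (op := .mod) (hsz (x + M * t) (by omega)) (hsz q (by omega))
    have o4 := hB.natTest_le (op := .eq)
      (hsz ((x + M * t) % q) ((Nat.mod_le _ _).trans (by omega))) (hsz e (by nlinarith))
    have o5 := hB.natOp_le (op := .add) (hsz t (by nlinarith)) (hsz 1 (by nlinarith))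
    have h2 := ih (t + 1) (by omega)
    rw [Nat.succ_mul]
    simp only [findDigit, bind_bitOps, natOp_val, natTest_eq_val, NatOp.fn]
    by_cases h1 : (x + M * t) % q = e
    · simp only [h1, decide_true, if_true, pure_bitOps] at o4 ⊢; omega
    · simp only [h1, decide_false, Bool.false_eq_true, if_false, bind_bitOps, natOp_val,
        NatOp.fn] at o4 ⊢
      omega

theorem exists_digit {x M e q : ℕ} (hq : 0 < q) (he : e < q) (hM : Nat.Coprime M q) :
    ∃ t, t < q ∧ (x + M * t) % q = e := by
  have : NeZero q := ⟨hq.ne'⟩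
  refine ⟨(((e : ZMod q) - x) * (M : ZMod q)⁻¹).val, ZMod.val_lt _, ?_⟩
  have h : ((x + M * (((e : ZMod q) - x) * (M : ZMod q)⁻¹).val : ℕ) : ZMod q) = (e : ℕ) := by
    push_cast
    rw [ZMod.natCast_zmod_val, mul_left_comm, ZMod.coe_mul_inv_eq_one _ hM]
    ring
  have := (ZMod.natCast_eq_natCast_iff' _ _ _).1 h
  rwa [Nat.mod_eq_of_lt he] at this

theorem chineseRem_digit {x M e q : ℕ} (hq : 0 < q) (he : e < q) (hM : Nat.Coprime M q) :
    (x + M * (findDigit 𝔸 (x % q) (M % q) e q q 0).val) % q = e ∧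
      (findDigit 𝔸 (x % q) (M % q) e q q 0).val < q := by
  obtain ⟨t, h1, h2⟩ := exists_digit (x := x) hq he hM
  have key : ∀ t, (x % q + M % q * t) % q = (x + M * t) % q := fun t => by
    rw [Nat.add_mod, Nat.mul_mod]; simp [Nat.add_mod, Nat.mul_mod]
  have := findDigit_val (𝔸 := 𝔸) (x := x % q) (M := M % q) (e := e) (q := q) q 0
    ⟨t, Nat.zero_le _, by omega, by rw [key]; exact h2⟩
  rw [key] at this
  simpa using this

theorem chineseRem_val (l : List (ℕ × ℕ)) (x M : ℕ) (hx : x < M)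
    (hl : ∀ c ∈ l, c.1 < c.2 ∧ Nat.Coprime M c.2)
    (hp : (l.map Prod.snd).Pairwise Nat.Coprime) :
    (chineseRem 𝔸 l x M).val < M * (l.map Prod.snd).prod ∧
      (chineseRem 𝔸 l x M).val % M = x ∧ ∀ c ∈ l, (chineseRem 𝔸 l x M).val % c.2 = c.1 := by
  induction l generalizing x M with
  | nil => simpa [chineseRem] using ⟨hx, Nat.mod_eq_of_lt hx⟩
  | cons c l ih =>
    obtain ⟨e, q⟩ := c
    obtain ⟨he, hM⟩ := hl (e, q) (by simp)
    simp only at he hM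
    have hd := chineseRem_digit (𝔸 := 𝔸) (x := x) (by omega) he hM
    simp only [List.map_cons, List.pairwise_cons] at hp
    simp only [chineseRem, bind_val, natOp_val, NatOp.fn]
    set t := (findDigit 𝔸 (x % q) (M % q) e q q 0).val
    have hlt : x + M * t < M * q := by
      have : M * (t + 1) ≤ M * q := Nat.mul_le_mul_left _ hd.2
      rw [Nat.mul_succ] at this; omega
    obtain ⟨h1, h2, h3⟩ := ih (x + M * t) (M * q) hlt
      (fun c hc => ⟨(hl c (by simp [hc])).1, Nat.Coprime.mul_left (hl c (by simp [hc])).2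
        (hp.1 _ (List.mem_map_of_mem hc))⟩) hp.2
    refine ⟨by simpa [mul_assoc] using h1, ?_, ?_⟩
    · rw [← Nat.mod_mod_of_dvd _ (dvd_mul_right M q), h2, Nat.add_mul_mod_self_left,
        Nat.mod_eq_of_lt hx]
    · intro c hc
      rcases List.mem_cons.1 hc with rfl | hc
      · simp only
        rw [← Nat.mod_mod_of_dvd _ (dvd_mul_left q M), h2, hd.1]
      · exact h3 c hc

@[simp] theorem chineseRem_ringOps (l : List (ℕ × ℕ)) (x M : ℕ) :
    (chineseRem 𝔸 l x M).ringOps = 0 := by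
  induction l generalizing x M with
  | nil => rfl
  | cons c l ih => simp [chineseRem, ih]

theorem chineseRem_bitOps_le (hB : CircBound 𝔸 B) {w w' q : ℕ} (l : List (ℕ × ℕ)) (x M : ℕ)
    (hx : x < M) (hl : ∀ c ∈ l, c.1 < c.2 ∧ Nat.Coprime M c.2)
    (hp : (l.map Prod.snd).Pairwise Nat.Coprime) (hw : (M * (l.map Prod.snd).prod).size ≤ w)
    (hq : ∀ c ∈ l, c.2 ≤ q) (hw' : 2 * q.size + 1 ≤ w') :
    (chineseRem 𝔸 l x M).bitOps ≤ l.length * (5 * B w + q * (5 * B w')) := by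
  induction l generalizing x M with
  | nil => simp [chineseRem]
  | cons c l ih =>
    obtain ⟨e, p⟩ := c
    obtain ⟨he, hM⟩ := hl (e, p) (by simp)
    have hpq := hq (e, p) (by simp)
    simp only at he hM hpq
    have hp0 : 0 < p := by omega
    have hd := chineseRem_digit (𝔸 := 𝔸) (x := x) (by omega) he hM
    simp only [List.map_cons, List.pairwise_cons] at hp
    have hpos : 0 < (l.map Prod.snd).prod := List.prod_pos fun b hb => by
      obtain ⟨c, hc, rfl⟩ := List.mem_map.1 hb
      have := (hl c (by simp [hc])).1
      omega
    have hw2 : (M * p * (l.map Prod.snd).prod).size ≤ w := by simpa [mul_assoc] using hw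
    have hMp : (M * p).size ≤ w := size_le_of_le (Nat.le_mul_of_pos_right _ hpos) hw2
    have hMw : M.size ≤ w := size_le_of_le (Nat.le_mul_of_pos_right _ hp0) hMp
    have hpw : p.size ≤ w := size_le_of_le (Nat.le_mul_of_pos_left _ (by omega)) hMp
    have hps : p.size ≤ q.size := Nat.size_le_size hpq
    have hf := findDigit_bitOps_le hB (x := x % p) (M := M % p) (e := e) (q := p) (w := w')
      (Nat.mod_lt _ hp0) (Nat.mod_lt _ hp0) he (by omega) p 0 (by omega)
    have hf' : p * (5 * B w') ≤ q * (5 * B w') := Nat.mul_le_mul_right _ hpq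
    simp only [chineseRem, bind_bitOps, natOp_val, NatOp.fn]
    set t := (findDigit 𝔸 (x % p) (M % p) e p p 0).val
    have hlt : x + M * t < M * p := by
      have : M * (t + 1) ≤ M * p := Nat.mul_le_mul_left _ hd.2
      rw [Nat.mul_succ] at this; omega
    have h1 := ih (x + M * t) (M * p) hlt
      (fun c hc => ⟨(hl c (by simp [hc])).1, Nat.Coprime.mul_left (hl c (by simp [hc])).2
        (hp.1 _ (List.mem_map_of_mem hc))⟩) hp.2 hw2 fun c hc => hq c (by simp [hc])
    have o1 := hB.natOp_le (op := .mod) (size_le_of_le hx.le hMw) hpw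
    have o2 := hB.natOp_le (op := .mod) hMw hpw
    have o3 := hB.natOp_le (op := .mul) hMw (size_le_of_le hd.2.le hpw)
    have o4 := hB.natOp_le (op := .add) (size_le_of_le hx.le hMw)
      (size_le_of_le (a := M * t) (by omega) hMp)
    have o5 := hB.natOp_le (op := .mul) hMw hpw
    rw [List.length_cons, Nat.succ_mul]
    omega

/-! ### Digits and bounds -/

@[simp] theorem expand_val (D k d : ℕ) :
    (expand 𝔸 D k d).val = (List.range k).map fun i => d / D ^ i % D := by
  induction k generalizing d with
  | zero => rfl
  | succ k ih =>
    simp only [expand, bind_val, natOp_val, NatOp.fn, ih, pure_val, List.range_succ_eq_map,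
      List.map_cons, List.map_map, pow_zero, Nat.div_one]
    congr 1
    refine List.map_congr_left fun i _ => ?_
    simp [pow_succ', Nat.div_div_eq_div_mul]

@[simp] theorem expand_ringOps (D k d : ℕ) : (expand 𝔸 D k d).ringOps = 0 := by
  induction k generalizing d with
  | zero => rfl
  | succ k ih => simp [expand, ih]

theorem expand_bitOps_le (hB : CircBound 𝔸 B) {D w : ℕ} (hD : D.size ≤ w) (k d : ℕ)
    (hd : d.size ≤ w) : (expand 𝔸 D k d).bitOps ≤ k * (2 * B w) := by
  induction k generalizing d with
  | zero => simp [expand]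
  | succ k ih =>
    have o1 := hB.natOp_le (op := .mod) hd hD
    have o2 := hB.natOp_le (op := .div) hd hD
    have h := ih (d / D) (size_le_of_le (Nat.div_le_self _ _) hd)
    rw [Nat.succ_mul]
    simp only [expand, bind_bitOps, natOp_val, NatOp.fn, pure_bitOps]
    omega

/-- The number `N₁` of primes that are bad for an exponent, plus one. -/
def numBad (T D : ℕ) : ℕ := max 1 (Nat.clog 2 (D ^ (T - 1)))

/-- The number `N₂` of votes that a candidate term needs. -/
def numVotes (T D : ℕ) : ℕ := Nat.clog 2 (D ^ T)

/-- The number `N` of primes that are used. -/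
def numPrimes (T D : ℕ) : ℕ := max (4 * numBad T D) (numBad T D + numVotes T D - 1)

@[simp] theorem bounds_val (T D : ℕ) :
    (bounds 𝔸 T D).val = (numBad T D, numVotes T D, numPrimes T D) := by
  have h1 : ∀ c : ℕ, (if c < 1 then 1 else c) = max 1 c := fun c => by split_ifs <;> omega
  have h2 : ∀ a b : ℕ, (if a < b then b else a) = max a b := fun a b => by split_ifs <;> omega
  simp only [bounds, bind_val, natOp_val, NatOp.fn, powNat_val, ceilLog, natTest_lt_val,
    decide_eq_true_eq, h1, h2, pure_val, numBad, numVotes, numPrimes]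

@[simp] theorem bounds_ringOps (T D : ℕ) : (bounds 𝔸 T D).ringOps = 0 := by
  simp [bounds, ceilLog]

theorem clog_le_size (n : ℕ) : Nat.clog 2 n ≤ n.size :=
  Nat.clog_le_of_le_pow (Nat.lt_size_self n).le

theorem size_le_self (n : ℕ) : n.size ≤ n := Nat.size_le.2 Nat.lt_two_pow_self

theorem bounds_bitOps_le (hB : CircBound 𝔸 B) {T D w : ℕ} (hD : 0 < D) (hw : (D ^ T).size ≤ w)
    (hT : T.size ≤ w) : (bounds 𝔸 T D).bitOps ≤ (2 * T + 6) * B (w + 4) + 2 * w := by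
  have hw1 : 1 ≤ w := by
    have : 0 < (D ^ T).size := Nat.size_pos.2 (by positivity)
    omega
  have hx1 : (D ^ (T - 1)).size ≤ w :=
    size_le_of_le (Nat.pow_le_pow_right (by omega) (by omega)) hw
  have hc1 : Nat.clog 2 (D ^ (T - 1)) ≤ w := (clog_le_size _).trans hx1
  have hc2 : numVotes T D ≤ w := (clog_le_size _).trans hw
  have hN1 : numBad T D ≤ w := max_le hw1 hc1
  have hsz : ∀ a, a ≤ 4 * w → a.size ≤ w + 4 := by
    intro a ha
    have h1 : w < 2 ^ w := Nat.lt_two_pow_self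
    rw [Nat.size_le, pow_add]
    omega
  have hif : ∀ c : ℕ, (if c < 1 then 1 else c) = max 1 c := fun c => by split_ifs <;> omega
  have o1 := hB.natOp_le (op := .sub) (a := T) (b := 1) (w := w + 4) (by omega)
    (hsz 1 (by omega))
  have o2 := powNat_bitOps_le (𝔸 := 𝔸) hB (b := D) (k := T - 1) (w := w + 4) (by omega) (by omega)
  have o3 := powNat_bitOps_le (𝔸 := 𝔸) hB (b := D) (k := T) (w := w + 4) (by omega) (by omega)
  have o4 := hB.natTest_le (op := .lt) (hsz (Nat.clog 2 (D ^ (T - 1))) (by omega))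
    (hsz 1 (by omega))
  have o5 := hB.natOp_le (op := .mul) (hsz 4 (by omega)) (hsz (numBad T D) (by omega))
  have o6 := hB.natOp_le (op := .add) (hsz (numBad T D) (by omega)) (hsz (numVotes T D) (by omega))
  have o7 := hB.natOp_le (op := .sub) (hsz (numBad T D + numVotes T D) (by omega))
    (hsz 1 (by omega))
  have o8 := hB.natTest_le (op := .lt) (hsz (4 * numBad T D) (by omega))
    (hsz (numBad T D + numVotes T D - 1) (by omega))
  have e1 : (2 * T + 6) * B (w + 4) = T * B (w + 4) + T * B (w + 4) + 6 * B (w + 4) := by ring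
  have e2 : (T - 1) * B (w + 4) ≤ T * B (w + 4) := Nat.mul_le_mul_right _ (by omega)
  simp only [bounds, bind_bitOps, natOp_val, NatOp.fn, powNat_val, ceilLog, natTest_lt_val,
    decide_eq_true_eq, hif, pure_bitOps]
  simp only [numBad, numVotes] at *
  omega

end

end SLPInterp

namespace SLPInterp

open Timed

/-! ### The sizes of the primes -/

theorem size_sq_le {x : ℕ} (hx : 0 < x) : x.size ^ 2 ≤ 4 * x := by
  obtain ⟨s, hs⟩ : ∃ s, x.size = s + 1 :=
    ⟨_, (Nat.succ_pred_eq_of_pos (Nat.size_pos.2 hx)).symm⟩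
  have h1 : 2 ^ s ≤ x := Nat.lt_size.1 (by omega)
  have h2 : ∀ s, (s + 1) ^ 2 ≤ 4 * 2 ^ s := by
    intro s
    induction s with
    | zero => norm_num
    | succ s ih =>
      rcases Nat.lt_or_ge s 2 with h | h
      · interval_cases s <;> norm_num
      · rw [pow_succ 2 s]; nlinarith
  rw [hs]
  exact (h2 s).trans (Nat.mul_le_mul_left _ h1)

/-- Chebyshev's bound: `2 ^ x ≤ (x + 1) lcm(1, …, x)`, and the `lcm` is at most `x ^ (i + 1)` if
there are `i + 1` primes up to `x`. -/
theorem nth_prime_le_mul_size (i : ℕ) :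
    Nat.nth Nat.Prime i ≤ (i + 2) * (Nat.nth Nat.Prime i).size := by
  set x := Nat.nth Nat.Prime i with hx
  have hxp : x.Prime := Nat.prime_nth_prime i
  have h1 := Chebyshev.two_pow_le_mul_lcmUpto x
  have hcard : (Nat.primesLE x).card = i + 1 := by
    rw [Nat.primesLE_card_eq_primeCounting]
    rw [Nat.primeCounting, Nat.primeCounting', hx]
    exact Nat.count_nth_succ_of_infinite Nat.infinite_setOfPred_prime _
  have h2 : Nat.lcmUpto x ≤ x ^ (i + 1) := by
    rw [Nat.lcmUpto_eq_prod_pow_log, ← hcard]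
    exact Finset.prod_le_pow_card _ _ _ fun p _ => Nat.pow_log_le_self p hxp.ne_zero
  have h3 : x + 1 ≤ 2 ^ x.size := Nat.lt_size_self x
  have h4 : 2 ^ x ≤ 2 ^ ((i + 2) * x.size) := by
    calc 2 ^ x ≤ (x + 1) * Nat.lcmUpto x := h1
      _ ≤ 2 ^ x.size * (2 ^ x.size) ^ (i + 1) :=
        Nat.mul_le_mul h3 (h2.trans (Nat.pow_le_pow_left (by omega) _))
      _ = 2 ^ ((i + 2) * x.size) := by rw [← pow_succ', ← pow_mul]; ring_nf
  exact (Nat.pow_le_pow_iff_right (by norm_num)).1 h4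

/-- The bound `(N + 1) (2 size (N + 1) + 2)` for the first `N` primes. -/
def primeBound (N : ℕ) : ℕ := (N + 1) * (2 * (N + 1).size + 2)

theorem primeBound_mono : Monotone primeBound := fun a b h => by
  have := Nat.size_le_size (Nat.succ_le_succ h)
  exact Nat.mul_le_mul (by omega) (by simp only [Nat.succ_eq_add_one] at this; omega)

theorem nth_prime_le (i : ℕ) : Nat.nth Nat.Prime i ≤ primeBound (i + 1) := by
  have h := nth_prime_le_mul_size i
  set x := Nat.nth Nat.Prime i with hx
  have hx0 : 0 < x := (Nat.prime_nth_prime i).pos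
  have hs0 : 0 < x.size := Nat.size_pos.2 hx0
  have h1 := size_sq_le hx0
  have h2 : x.size ≤ 4 * (i + 2) := by nlinarith
  have h3 : x.size ≤ 2 * (i + 2).size + 2 := by
    rw [Nat.size_le]
    have h4 := Nat.lt_size_self (i + 2)
    calc x ≤ (i + 2) * (4 * (i + 2)) := h.trans (Nat.mul_le_mul_left _ h2)
      _ < 2 ^ (i + 2).size * (4 * 2 ^ (i + 2).size) := by
        apply Nat.mul_lt_mul_of_lt_of_lt h4; omega
      _ = _ := by rw [pow_add, two_mul, pow_add]; ring
  exact h.trans (Nat.mul_le_mul_left _ h3)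

/-- The list of the first `N` primes. -/
noncomputable def firstPrimes (N : ℕ) : List ℕ := (List.range N).map (Nat.nth Nat.Prime)

@[simp] theorem length_firstPrimes (N : ℕ) : (firstPrimes N).length = N := by simp [firstPrimes]

theorem prime_of_mem_firstPrimes {N p : ℕ} (h : p ∈ firstPrimes N) : p.Prime := by
  obtain ⟨i, -, rfl⟩ := List.mem_map.1 h
  exact Nat.prime_nth_prime i

theorem le_of_mem_firstPrimes {N p : ℕ} (h : p ∈ firstPrimes N) : p ≤ primeBound N := by
  obtain ⟨i, hi, rfl⟩ := List.mem_map.1 h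
  exact (nth_prime_le i).trans (primeBound_mono (List.mem_range.1 hi))

theorem nodup_firstPrimes (N : ℕ) : (firstPrimes N).Nodup :=
  List.nodup_range.map (Nat.nth_injective Nat.infinite_setOfPred_prime)

theorem take_firstPrimes (k N : ℕ) : (firstPrimes N).take k = firstPrimes (min k N) := by
  simp [firstPrimes, ← List.map_take, List.take_range]

theorem two_pow_le_prod_firstPrimes (N : ℕ) : 2 ^ N ≤ (firstPrimes N).prod := by
  have := List.pow_card_le_prod (l := firstPrimes N) (n := 2) fun p hp =>
    (prime_of_mem_firstPrimes hp).two_le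
  simpa using this

theorem pairwise_coprime_firstPrimes (N : ℕ) : (firstPrimes N).Pairwise Nat.Coprime := by
  refine (nodup_firstPrimes N).imp_of_mem ?_
  intro p q hp hq hpq
  exact (Nat.coprime_primes (prime_of_mem_firstPrimes hp) (prime_of_mem_firstPrimes hq)).2 hpq

section

variable {𝔸 : Arith} {B : ℕ → ℕ}

theorem primesFrom_two_val (N : ℕ) : (primesFrom 𝔸 N 2).val = firstPrimes N := by
  rw [primesFrom_val N 2 le_rfl]
  have : Nat.count Nat.Prime 2 = 0 := by decide
  simp [this, firstPrimes]

theorem primesFrom_two_bitOps_le (hB : CircBound 𝔸 B) {N Q : ℕ} (hQ : primeBound N ≤ Q) :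
    (primesFrom 𝔸 N 2).bitOps ≤ Q * ((Nat.sqrt Q + 1) * (5 * B (Q.size + 4))) +
      N * B (Q.size + 4) := by
  have : Nat.count Nat.Prime 2 = 0 := by decide
  refine (primesFrom_bitOps_le hB (Q := Q) N 2 le_rfl fun i hi => ?_).trans ?_
  · rw [this, zero_add]
    exact ((nth_prime_le i).trans (primeBound_mono hi)).trans hQ
  · gcongr; omega

/-- The primes used for Chinese remaindering: their number is at most `log₂ D`, and their product
exceeds `D` by at most the last factor. -/
theorem primesUpTo_firstPrimes (D N : ℕ) :
    ∃ K, (primesUpTo 𝔸 D 1 (firstPrimes N)).val = firstPrimes K ∧ K ≤ N ∧ K ≤ Nat.clog 2 D ∧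
      (D ≤ 2 ^ N → D ≤ (firstPrimes K).prod) ∧ (firstPrimes K).prod ≤ (D + 1) * primeBound K := by
  obtain ⟨K, hK, h1, h2, h3⟩ := primesUpTo_val (𝔸 := 𝔸) D 1 (firstPrimes N)
  rw [length_firstPrimes] at hK
  have ht : ∀ i ≤ N, (firstPrimes N).take i = firstPrimes i := fun i hi => by
    rw [take_firstPrimes, min_eq_left hi]
  refine ⟨K, by rw [h1, ht K hK], hK, ?_, ?_, ?_⟩
  · rcases K with _ | K
    · omega
    · have h4 := h2 K (by omega)
      rw [ht K (by omega), one_mul] at h4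
      have h5 := (two_pow_le_prod_firstPrimes K).trans_lt h4
      exact (Nat.lt_clog_iff_pow_lt (by norm_num)).2 h5
  · intro hN
    rcases hK.lt_or_eq with h4 | rfl
    · have h5 := h3 (by simpa using h4)
      rwa [ht K hK, one_mul] at h5
    · exact hN.trans (two_pow_le_prod_firstPrimes K)
  · rcases K with _ | K
    · simp [firstPrimes, primeBound]; omega
    · have h4 := h2 K (by omega)
      rw [ht K (by omega), one_mul] at h4
      have h5 : (firstPrimes (K + 1)).prod = (firstPrimes K).prod * Nat.nth Nat.Prime K := by
        simp [firstPrimes, List.range_succ]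
      rw [h5]
      exact Nat.mul_le_mul (by omega) (nth_prime_le K)

end

end SLPInterp

namespace SLPInterp

open Timed Polynomial

section

variable {R : Type u} [CommRing R]

/-! ### Sparse polynomials modulo `X ^ m - 1` -/

theorem wrap_eq_sum_support (m i : ℕ) (f : R[X]) :
    wrap m i f = ∑ d ∈ f.support with d % m = i % m, f.coeff d := by
  conv_lhs => rw [f.as_sum_support, map_sum]
  rw [Finset.sum_filter]
  exact Finset.sum_congr rfl fun d _ => wrap_monomial _ _ _ _

theorem exists_of_wrap_ne_zero {m i : ℕ} {f : R[X]} (h : wrap m i f ≠ 0) :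
    ∃ d ∈ f.support, d % m = i % m := by
  rw [wrap_eq_sum_support] at h
  obtain ⟨d, hd, -⟩ := Finset.exists_ne_zero_of_sum_ne_zero h
  exact ⟨d, (Finset.mem_filter.1 hd).1, (Finset.mem_filter.1 hd).2⟩

theorem wrap_eq_coeff_of_unique {m e : ℕ} {f : R[X]}
    (h : ∀ d ∈ f.support, d % m = e % m → d = e) : wrap m e f = f.coeff e := by
  rw [wrap_eq_sum_support, Finset.sum_eq_single e]
  · intro d hd hde
    rw [Finset.mem_filter] at hd
    exact absurd (h d hd.1 hd.2) hde
  · intro he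
    by_contra hne
    exact he (Finset.mem_filter.2 ⟨Polynomial.mem_support_iff.2 hne, rfl⟩)

/-- The exponents of the terms of `f` modulo `X ^ m - 1`. -/
noncomputable def wrapSupport (m : ℕ) (f : R[X]) : Finset ℕ := by
  classical exact (Finset.range m).filter fun i => wrap m i f ≠ 0

theorem mem_wrapSupport {m i : ℕ} {f : R[X]} : i ∈ wrapSupport m f ↔ i < m ∧ wrap m i f ≠ 0 := by
  simp [wrapSupport]

theorem wrapSupport_subset (m : ℕ) (f : R[X]) :
    wrapSupport m f ⊆ f.support.image fun d => d % m := by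
  intro i hi
  obtain ⟨h1, h2⟩ := mem_wrapSupport.1 hi
  obtain ⟨d, hd, h3⟩ := exists_of_wrap_ne_zero h2
  exact Finset.mem_image.2 ⟨d, hd, h3.trans (Nat.mod_eq_of_lt h1)⟩

theorem card_wrapSupport_le (m : ℕ) (f : R[X]) : (wrapSupport m f).card ≤ f.support.card :=
  (Finset.card_le_card (wrapSupport_subset m f)).trans Finset.card_image_le

/-- The list of the coefficients of `f` modulo `X ^ m - 1`. -/
noncomputable def wrapVec (m : ℕ) (f : R[X]) : List R := (List.range m).map fun i => wrap m i f

@[simp] theorem length_wrapVec (m : ℕ) (f : R[X]) : (wrapVec m f).length = m := by simp [wrapVec]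

theorem getElem_wrapVec {m i : ℕ} {f : R[X]} (h : i < (wrapVec m f).length) :
    (wrapVec m f)[i] = wrap m i f := by simp [wrapVec]

theorem getD_wrapVec {m i : ℕ} (f : R[X]) (h : i < m) : (wrapVec m f).getD i 0 = wrap m i f := by
  rw [List.getD_eq_getElem _ _ (by simpa using h), getElem_wrapVec]

theorem wrapVec_congr_iff {m : ℕ} {f : R[X]} {v : List R} :
    v = wrapVec m f ↔ v.length = m ∧ ∀ i (h : i < v.length), v[i] = wrap m i f := by
  constructor
  · rintro rfl
    exact ⟨length_wrapVec _ _, fun i h => getElem_wrapVec h⟩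
  · rintro ⟨h1, h2⟩
    refine List.ext_getElem (by simp [h1]) fun i h3 h4 => ?_
    rw [h2 i h3, getElem_wrapVec]

/-- The sum of a list of terms. -/
noncomputable def polyOf (h : List (ℕ × R)) : R[X] := (h.map fun t => monomial t.1 t.2).sum

theorem polyOf_append (h h' : List (ℕ × R)) : polyOf (h ++ h') = polyOf h + polyOf h' := by
  simp [polyOf]

theorem subAt_wrapVec {m : ℕ} (f : R[X]) (e : ℕ) (a : R) :
    (subAt (wrapVec m f) (e % m) a).val = wrapVec m (f - monomial e a) := by
  rw [wrapVec_congr_iff]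
  refine ⟨by simp [subAt], fun i h => ?_⟩
  have hi : i < m := by simpa [subAt] using h
  simp only [subAt, List.getElem_modify, getElem_wrapVec, map_sub, wrap_monomial,
    Nat.mod_eq_of_lt hi]
  split_ifs <;> simp

section

variable {𝔸 : Arith} {B : ℕ → ℕ}

theorem subPoly_val {m : ℕ} (f : R[X]) (h : List (ℕ × R)) :
    (subPoly 𝔸 m (wrapVec m f) h).val = wrapVec m (f - polyOf h) := by
  induction h generalizing f with
  | nil => simp [subPoly, polyOf]
  | cons t h ih =>
    have h1 := ih (f - monomial t.1 t.2)
    simp only [subPoly, foldL_val, List.foldl_cons, bind_val, natOp_val, NatOp.fn] at h1 ⊢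
    rw [subAt_wrapVec, h1]
    congr 1
    simp [polyOf, sub_sub]

theorem subPoly_ringOps_le (m : ℕ) (v : List R) (h : List (ℕ × R)) :
    (subPoly 𝔸 m v h).ringOps ≤ h.length := by
  have := foldL_ringOps_le (fun _ => True)
    (f := fun (v : List R) (t : ℕ × R) => (natOp 𝔸 .mod t.1 m).bind fun r => subAt v r t.2)
    (l := h) (c := 1) (fun _ _ _ _ => ⟨le_rfl, trivial⟩) (b := v) trivial
  simpa [subPoly] using this

theorem subPoly_bitOps_le (hB : CircBound 𝔸 B) {w m : ℕ} (hm : 0 < m) (hmw : m.size ≤ w)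
    (v : List R) (h : List (ℕ × R)) (hh : ∀ t ∈ h, t.1.size ≤ w) :
    (subPoly 𝔸 m v h).bitOps ≤ h.length * (B w + m.size) := by
  refine foldL_bitOps_le (fun _ => True) (fun v _ t ht => ⟨?_, trivial⟩) trivial
  have h1 := hB.natOp_le (op := .mod) (hh t ht) hmw
  have h2 : (t.1 % m).size ≤ m.size := Nat.size_le_size (Nat.mod_lt _ hm).le
  simp only [bind_bitOps, natOp_val, NatOp.fn, subAt]
  omega

variable [DecidableEq R]

theorem countTerms_val_eq (v : List R) :
    (countTerms 𝔸 v).val = v.countP fun a => decide (a ≠ 0) := by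
  have h : ∀ k, (v.foldl (fun (k : ℕ) (a : R) => if a = 0 then k else k + 1) k) =
      k + v.countP fun a => decide (a ≠ 0) := by
    induction v with
    | nil => simp
    | cons a v ih =>
      intro k
      rw [List.foldl_cons, ih, List.countP_cons]
      by_cases h : a = 0 <;> simp [h]; omega
  simp only [countTerms, foldL_val, bind_val]
  rw [← zero_add (v.countP _), ← h 0]
  congr 1
  funext k a
  by_cases h : a = 0 <;> simp [h, NatOp.fn]

theorem countTerms_val (m : ℕ) (f : R[X]) :
    (countTerms 𝔸 (wrapVec m f)).val = (wrapSupport m f).card := by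
  rw [countTerms_val_eq, wrapVec, List.countP_map, List.countP_eq_length_filter]
  have h : wrapSupport m f = ((List.range m).filter
      ((fun a : R => decide (a ≠ 0)) ∘ fun i => wrap m i f)).toFinset := by
    ext i; simp [mem_wrapSupport]
  rw [h, List.toFinset_card_of_nodup (List.nodup_range.filter _)]

theorem countTerms_ringOps_le (v : List R) : (countTerms 𝔸 v).ringOps ≤ v.length := by
  have := foldL_ringOps_le (fun _ => True)
    (f := fun (k : ℕ) (a : R) => Timed.bind ⟨decide (a = 0), 1, 0⟩ fun (z : Bool) =>
      if z then pure k else natOp 𝔸 .add k 1)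
    (l := v) (c := 1) (fun k _ a _ => ⟨by by_cases h : a = 0 <;> simp [h], trivial⟩) (b := 0) trivial
  simpa [countTerms] using this

theorem countTerms_bitOps_le (hB : CircBound 𝔸 B) {w : ℕ} (v : List R)
    (hw : (v.countP fun a => decide (a ≠ 0)).size ≤ w) (hw1 : 1 ≤ w) :
    (countTerms 𝔸 v).bitOps ≤ (v.countP fun a => decide (a ≠ 0)) * B w := by
  suffices h : ∀ k, (k + v.countP fun a => decide (a ≠ 0)).size ≤ w →
      (foldL (fun (k : ℕ) (a : R) => Timed.bind ⟨decide (a = 0), 1, 0⟩ fun (z : Bool) =>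
        if z then pure k else natOp 𝔸 .add k 1) k v).bitOps ≤
      (v.countP fun a => decide (a ≠ 0)) * B w from h 0 (by simpa using hw)
  clear hw
  induction v with
  | nil => intro k _; simp [foldL]
  | cons a v ih =>
    intro k hk
    by_cases h : a = 0
    · simpa [foldL, h] using ih k (by simpa [h] using hk)
    · rw [List.countP_cons_of_pos (by simpa using h)] at hk ⊢
      have h1 := ih (k + 1) (by rwa [add_right_comm])
      have o1 := hB.natOp_le (op := .add) (a := k) (b := 1) (size_le_of_le (by omega) hk)
        (by rw [Nat.size_one]; exact hw1)
      rw [Nat.succ_mul]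
      simp only [foldL, bind_bitOps, bind_val, h, decide_false, Bool.false_eq_true, if_false,
        natOp_val, NatOp.fn]
      omega

theorem sparse_val (m : ℕ) (f : R[X]) : (sparse (wrapVec m f)).val =
    ((List.range m).filter fun i => decide (wrap m i f ≠ 0)).map fun i => (i, wrap m i f) := by
  simp only [sparse, wrapVec]
  have h : ((List.range m).map fun i => wrap m i f).zipIdx =
      (List.range m).map fun i => (wrap m i f, i) := by
    refine List.ext_getElem (by simp) fun i h1 h2 => by simp
  rw [h, List.filter_map, List.map_map]
  rfl

theorem mem_sparse {m e : ℕ} {f : R[X]} {a : R} :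
    (e, a) ∈ (sparse (wrapVec m f)).val ↔ e < m ∧ wrap m e f = a ∧ a ≠ 0 := by
  rw [sparse_val]
  simp only [List.mem_map, List.mem_filter, List.mem_range, decide_eq_true_eq, Prod.mk.injEq]
  constructor
  · rintro ⟨i, ⟨h1, h2⟩, rfl, rfl⟩; exact ⟨h1, rfl, h2⟩
  · rintro ⟨h1, rfl, h2⟩; exact ⟨e, ⟨h1, h2⟩, rfl, rfl⟩

theorem nodup_sparse (m : ℕ) (f : R[X]) : ((sparse (wrapVec m f)).val.map Prod.fst).Nodup := by
  rw [sparse_val, List.map_map]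
  simpa [Function.comp_def] using List.nodup_range.filter _

theorem length_sparse (m : ℕ) (f : R[X]) :
    (sparse (wrapVec m f)).val.length = (wrapSupport m f).card := by
  rw [sparse_val, List.length_map]
  have h : wrapSupport m f = ((List.range m).filter
      fun i => decide (wrap m i f ≠ 0)).toFinset := by
    ext i; simp [mem_wrapSupport]
  rw [h, List.toFinset_card_of_nodup (List.nodup_range.filter _)]

theorem sparse_ringOps (m : ℕ) (f : R[X]) : (sparse (wrapVec m f)).ringOps = m := by
  simp [sparse]

theorem sparse_bitOps_le (m : ℕ) (f : R[X]) :
    (sparse (wrapVec m f)).bitOps ≤ f.support.card * m.size := by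
  have h : (sparse (wrapVec m f)).bitOps =
      ((sparse (wrapVec m f)).val.map fun t => t.1.size).sum := rfl
  rw [h]
  refine (List.sum_le_card_nsmul _ m.size ?_).trans ?_
  · intro x hx
    obtain ⟨⟨e, a⟩, ht, rfl⟩ := List.mem_map.1 hx
    exact Nat.size_le_size (mem_sparse.1 ht).1.le
  · rw [List.length_map, length_sparse, smul_eq_mul]
    exact Nat.mul_le_mul_right _ (card_wrapSupport_le m f)

/-- Subtracting `a x ^ r` lowers the number of terms if and only if `a` is the coefficient there. -/
theorem lowersCount_val (v : List R) (r : ℕ) (a : R) :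
    (lowersCount v r a).val = decide (v.getD r 0 ≠ 0 ∧ v.getD r 0 = a) := by
  simp only [lowersCount, sub_eq_zero]
  generalize v.getD r 0 = c
  by_cases h1 : c = a
  · subst h1
    by_cases h2 : c = 0 <;> simp [h2]
  · by_cases h2 : c = 0 <;> simp [h1, h2]

end

/-- `l` lists the terms of the univariate polynomial `g`, each of them exactly once. -/
def IsTermList (l : List (ℕ × R)) (g : R[X]) : Prop :=
  l.Nodup ∧ ∀ e c, (e, c) ∈ l ↔ g.coeff e = c ∧ c ≠ 0

theorem isTermList_nil : IsTermList ([] : List (ℕ × R)) 0 :=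
  ⟨List.nodup_nil, fun e c => by
    simp only [List.not_mem_nil, coeff_zero, false_iff, not_and, not_not]; exact fun h => h.symm⟩

/-- The coefficients of the sum of some of the terms of `g`. -/
theorem coeff_polyOf {g : R[X]} {s : List (ℕ × R)} (hs : s.Nodup)
    (h : ∀ t ∈ s, g.coeff t.1 = t.2) (e : ℕ) :
    (polyOf s).coeff e = if e ∈ s.map Prod.fst then g.coeff e else 0 := by
  induction s with
  | nil => simp [polyOf]
  | cons t s ih =>
    have h1 := ih (List.nodup_cons.1 hs).2 fun t ht => h t (by simp [ht])
    have h2 : polyOf (t :: s) = monomial t.1 t.2 + polyOf s := by simp [polyOf]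
    rw [h2, coeff_add, coeff_monomial, h1]
    have h3 := h t (by simp)
    by_cases h4 : t.1 = e
    · subst h4
      have h5 : t.1 ∉ s.map Prod.fst := by
        intro hm
        obtain ⟨t', ht', h6⟩ := List.mem_map.1 hm
        have h7 : t' = t := Prod.ext h6 (by rw [← h t' (by simp [ht']), h6, h3])
        exact (List.nodup_cons.1 hs).1 (h7 ▸ ht')
      simp [h5, h3]
    · have h8 : (e ∈ (t :: s).map Prod.fst) ↔ e ∈ s.map Prod.fst := by
        simp only [List.map_cons, List.mem_cons, or_iff_right_iff_imp]
        exact fun h => absurd h.symm h4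
      simp only [h8, h4, if_false, zero_add]

theorem map_fst_nodup {g : R[X]} {s : List (ℕ × R)} (hs : s.Nodup)
    (h : ∀ t ∈ s, g.coeff t.1 = t.2) : (s.map Prod.fst).Nodup :=
  hs.map_on fun t ht t' ht' hh => Prod.ext hh (by rw [← h t ht, ← h t' ht', hh])

/-- After the subtraction of some of its terms, a polynomial consists of the other terms. -/
theorem support_sub_polyOf {g : R[X]} {s : List (ℕ × R)} (hs : s.Nodup)
    (h : ∀ t ∈ s, g.coeff t.1 = t.2) :
    (g - polyOf s).support = g.support \ (s.map Prod.fst).toFinset := by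
  ext e
  rw [Polynomial.mem_support_iff, coeff_sub, coeff_polyOf hs h, Finset.mem_sdiff,
    Polynomial.mem_support_iff, List.mem_toFinset]
  split_ifs with h1 <;> simp [h1]

theorem card_support_sub_polyOf {g : R[X]} {s : List (ℕ × R)} (hs : s.Nodup)
    (h : ∀ t ∈ s, g.coeff t.1 = t.2 ∧ t.2 ≠ 0) :
    (g - polyOf s).support.card + s.length = g.support.card := by
  have h1 : ∀ t ∈ s, g.coeff t.1 = t.2 := fun t ht => (h t ht).1
  have h2 : (s.map Prod.fst).toFinset ⊆ g.support := by
    intro e he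
    obtain ⟨t, ht, rfl⟩ := List.mem_map.1 (List.mem_toFinset.1 he)
    rw [Polynomial.mem_support_iff, h1 t ht]
    exact (h t ht).2
  have h3 : (s.map Prod.fst).toFinset.card = s.length := by
    rw [List.toFinset_card_of_nodup (map_fst_nodup hs h1), List.length_map]
  rw [support_sub_polyOf hs h1, Finset.card_sdiff_of_subset h2, h3]
  have := Finset.card_le_card h2
  omega

theorem IsTermList.append {g : R[X]} {s r : List (ℕ × R)} (hs : s.Nodup)
    (h : ∀ t ∈ s, g.coeff t.1 = t.2 ∧ t.2 ≠ 0) (hr : IsTermList r (g - polyOf s)) :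
    IsTermList (s ++ r) g := by
  have h1 : ∀ t ∈ s, g.coeff t.1 = t.2 := fun t ht => (h t ht).1
  have hmem : ∀ e c, (e, c) ∈ r ↔ e ∉ s.map Prod.fst ∧ g.coeff e = c ∧ c ≠ 0 := by
    intro e c
    rw [hr.2, coeff_sub, coeff_polyOf hs h1]
    split_ifs with h2
    · simp only [sub_self, h2, not_true, false_and, iff_false, not_and, not_not]
      exact fun h => h.symm
    · simp [h2]
  refine ⟨List.nodup_append.2 ⟨hs, hr.1, ?_⟩, fun e c => ?_⟩
  · rintro ⟨e, c⟩ ht t' ht' rfl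
    exact ((hmem e c).1 ht').1 (List.mem_map_of_mem (f := Prod.fst) ht)
  · rw [List.mem_append, hmem]
    constructor
    · rintro (h2 | h2)
      · exact h _ h2
      · exact h2.2
    · intro h2
      by_cases h3 : e ∈ s.map Prod.fst
      · obtain ⟨t, ht, rfl⟩ := List.mem_map.1 h3
        have h4 : t = (t.1, c) := Prod.ext rfl (by rw [← h1 t ht]; exact h2.1)
        exact Or.inl (h4 ▸ ht)
      · exact Or.inr ⟨h3, h2⟩

theorem IsTermList.length_eq {l : List (ℕ × R)} {g : R[X]} (h : IsTermList l g) :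
    l.length = g.support.card := by
  have h1 : ∀ t ∈ l, g.coeff t.1 = t.2 := fun t ht => ((h.2 t.1 t.2).1 ht).1
  have h2 : (l.map Prod.fst).toFinset = g.support := by
    ext e
    rw [List.mem_toFinset, Polynomial.mem_support_iff, List.mem_map]
    constructor
    · rintro ⟨t, ht, rfl⟩
      have := (h.2 t.1 t.2).1 ht
      rw [this.1]; exact this.2
    · intro he
      exact ⟨(e, g.coeff e), (h.2 _ _).2 ⟨rfl, he⟩, rfl⟩
  rw [← h2, List.toFinset_card_of_nodup (map_fst_nodup h.1 h1), List.length_map]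

end

end SLPInterp

namespace SLPInterp

open Timed Polynomial

section

variable {R : Type u} [CommRing R]

/-! ### The Kronecker substitution -/

/-- The substitution `X_i ↦ X ^ (D ^ i)`. -/
noncomputable def kron (n D : ℕ) : MvPolynomial (Fin n) R →+* R[X] :=
  MvPolynomial.eval₂Hom Polynomial.C fun i => X ^ D ^ (i : ℕ)

/-- The exponent that a monomial is mapped to. -/
def kronExp {n : ℕ} (D : ℕ) (e : Fin n → ℕ) : ℕ := ∑ i, e i * D ^ (i : ℕ)

theorem kron_eq_sum {n : ℕ} (D : ℕ) (f : MvPolynomial (Fin n) R) :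
    kron n D f = ∑ e ∈ f.support, monomial (kronExp D e) (f.coeff e) := by
  rw [kron, MvPolynomial.coe_eval₂Hom, MvPolynomial.eval₂_eq']
  refine Finset.sum_congr rfl fun e _ => ?_
  rw [← Polynomial.C_mul_X_pow_eq_monomial]
  congr 1
  simp only [← pow_mul]
  rw [Finset.prod_pow_eq_pow_sum]
  congr 1
  exact Finset.sum_congr rfl fun i _ => mul_comm _ _

theorem kronExp_lt {n D : ℕ} {e : Fin n → ℕ} (he : ∀ i, e i < D) : kronExp D e < D ^ n := by
  have := (finFunctionFinEquiv (m := D) (n := n) fun i => ⟨e i, he i⟩).2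
  rwa [finFunctionFinEquiv_apply] at this

theorem kronExp_digit {n D : ℕ} {e : Fin n → ℕ} (he : ∀ i, e i < D) (i : Fin n) :
    kronExp D e / D ^ (i : ℕ) % D = e i := by
  have h := congrFun (finFunctionFinEquiv.symm_apply_apply
    (fun i => (⟨e i, he i⟩ : Fin D))) i
  have h2 := congrArg Fin.val h
  rw [finFunctionFinEquiv_symm_apply_val] at h2
  rw [finFunctionFinEquiv_apply] at h2
  exact h2

theorem lt_of_totalDegree_lt {n D : ℕ} {f : MvPolynomial (Fin n) R} (hf : f.totalDegree < D)
    {e : Fin n →₀ ℕ} (he : e ∈ f.support) (i : Fin n) : e i < D := by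
  have h1 := MvPolynomial.le_totalDegree he
  have h2 : e i ≤ e.sum fun _ k => k := by
    rcases Nat.eq_zero_or_pos (e i) with h0 | h0
    · omega
    · exact Finset.single_le_sum (f := fun i => e i) (fun _ _ => Nat.zero_le _)
        (Finsupp.mem_support_iff.2 h0.ne')
  omega

theorem coeff_kron {n D : ℕ} {f : MvPolynomial (Fin n) R} (hf : f.totalDegree < D)
    {e : Fin n →₀ ℕ} (he : ∀ i, e i < D) : (kron n D f).coeff (kronExp D e) = f.coeff e := by
  rw [kron_eq_sum, finsetSum_coeff, Finset.sum_eq_single e]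
  · rw [coeff_monomial, if_pos rfl]
  · intro e' he' hne
    rw [coeff_monomial, if_neg]
    intro h
    refine hne (Finsupp.ext fun i => ?_)
    rw [← kronExp_digit he i, ← h, kronExp_digit (lt_of_totalDegree_lt hf he') i]
  · intro h
    rw [coeff_monomial, if_pos rfl, MvPolynomial.notMem_support_iff.1 h]

theorem exists_of_mem_support_kron {n D d : ℕ} {f : MvPolynomial (Fin n) R}
    (h : d ∈ (kron n D f).support) : ∃ e ∈ f.support, kronExp D e = d := by
  rw [kron_eq_sum, Polynomial.mem_support_iff, finsetSum_coeff] at h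
  obtain ⟨e, he, h1⟩ := Finset.exists_ne_zero_of_sum_ne_zero h
  refine ⟨e, he, ?_⟩
  by_contra h2
  rw [coeff_monomial, if_neg h2] at h1
  exact h1 rfl

theorem lt_of_mem_support_kron {n D d : ℕ} {f : MvPolynomial (Fin n) R} (hf : f.totalDegree < D)
    (h : d ∈ (kron n D f).support) : d < D ^ n := by
  obtain ⟨e, he, rfl⟩ := exists_of_mem_support_kron h
  exact kronExp_lt (lt_of_totalDegree_lt hf he)

theorem card_support_kron_le {n : ℕ} (D : ℕ) (f : MvPolynomial (Fin n) R) :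
    (kron n D f).support.card ≤ f.support.card := by
  classical
  refine (Finset.card_le_card fun d hd => ?_).trans
    (Finset.card_image_le (s := f.support) (f := fun e => kronExp D e))
  obtain ⟨e, he, h⟩ := exists_of_mem_support_kron hd
  exact Finset.mem_image.2 ⟨e, he, h⟩

/-- The expansion of the exponents turns the terms of the Kronecker substitution into those of the
polynomial itself. -/
theorem IsTermList.listsTerms {n D : ℕ} {f : MvPolynomial (Fin n) R} (hf : f.totalDegree < D)
    {l : List (ℕ × R)} (h : IsTermList l (kron n D f)) :
    ListsTerms (l.map fun t => ((fun i : Fin n => t.1 / D ^ (i : ℕ) % D), t.2)) f := by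
  have key : ∀ t ∈ l, ∃ e ∈ f.support, kronExp D e = t.1 ∧ f.coeff e = t.2 ∧
      (fun i : Fin n => t.1 / D ^ (i : ℕ) % D) = e := by
    intro t ht
    obtain ⟨h1, h2⟩ := (h.2 t.1 t.2).1 ht
    obtain ⟨e, he, h3⟩ := exists_of_mem_support_kron (Polynomial.mem_support_iff.2 (h1 ▸ h2))
    have hlt := lt_of_totalDegree_lt hf he
    refine ⟨e, he, h3, ?_, ?_⟩
    · rw [← coeff_kron hf hlt, h3, h1]
    · funext i; rw [← h3, kronExp_digit hlt]
  refine ⟨h.1.map_on ?_, fun e c => ?_⟩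
  · intro t ht t' ht' hh
    obtain ⟨e, -, h1, -, h3⟩ := key t ht
    obtain ⟨e', -, h1', -, h3'⟩ := key t' ht'
    rw [Prod.mk.injEq, h3, h3'] at hh
    exact Prod.ext (by rw [← h1, ← h1', hh.1]) hh.2
  · rw [List.mem_map]
    constructor
    · rintro ⟨t, ht, hte⟩
      obtain ⟨e', he', -, h2, h3⟩ := key t ht
      rw [Prod.mk.injEq, h3] at hte
      have h4 : e' = e := DFunLike.coe_injective hte.1
      subst h4
      exact ⟨h2.trans hte.2, ((h.2 t.1 t.2).1 ht).2 |> fun h5 => hte.2 ▸ h5⟩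
    · rintro ⟨h1, h2⟩
      have he : e ∈ f.support := MvPolynomial.mem_support_iff.2 (h1 ▸ h2)
      have hlt := lt_of_totalDegree_lt hf he
      refine ⟨(kronExp D e, c), (h.2 _ _).2 ⟨by rw [coeff_kron hf hlt, h1], h2⟩, ?_⟩
      rw [Prod.mk.injEq]
      exact ⟨funext fun i => kronExp_digit hlt i, rfl⟩

/-! ### Probes -/

variable {𝔸 : Arith} {B : ℕ → ℕ}

@[simp] theorem powersMod_val {m : ℕ} (d k r : ℕ) (hr : r % m = r) :
    (powersMod 𝔸 d m k r).val = (List.range k).map fun i => r * d ^ i % m := by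
  induction k generalizing r with
  | zero => rfl
  | succ k ih =>
    simp only [powersMod, bind_val, natOp_val, NatOp.fn, pure_val]
    rw [ih _ (Nat.mod_mod _ _), List.range_succ_eq_map, List.map_cons, List.map_map, pow_zero,
      mul_one, hr]
    congr 1
    refine List.map_congr_left fun i _ => ?_
    simp only [Function.comp, Nat.succ_eq_add_one, pow_succ']
    rw [Nat.mul_mod, Nat.mod_mod, ← Nat.mul_mod, mul_assoc]

@[simp] theorem powersMod_ringOps (d m k r : ℕ) : (powersMod 𝔸 d m k r).ringOps = 0 := by
  induction k generalizing r with
  | zero => rfl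
  | succ k ih => simp [powersMod, ih]

theorem powersMod_bitOps_le (hB : CircBound 𝔸 B) {d m w : ℕ} (hm : 0 < m) (hd : d ≤ m)
    (hw : 2 * m.size ≤ w) (k r : ℕ) (hr : r ≤ m) :
    (powersMod 𝔸 d m k r).bitOps ≤ k * (2 * B w) := by
  induction k generalizing r with
  | zero => simp [powersMod]
  | succ k ih =>
    have h1 : r.size ≤ m.size := Nat.size_le_size hr
    have h2 : d.size ≤ m.size := Nat.size_le_size hd
    have h3 : (r * d).size ≤ 2 * m.size := by
      rw [Nat.size_le, two_mul, pow_add]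
      exact (Nat.mul_le_mul hr hd).trans_lt
        (Nat.mul_lt_mul_of_lt_of_lt (Nat.lt_size_self m) (Nat.lt_size_self m))
    have o1 := hB.natOp_le (op := .mul) (a := r) (b := d) (w := w) (by omega) (by omega)
    have o2 := hB.natOp_le (op := .mod) (a := r * d) (b := m) (w := w) (by omega) (by omega)
    have h := ih (r * d % m) (Nat.mod_lt _ hm).le
    rw [Nat.succ_mul]
    simp only [powersMod, bind_bitOps, natOp_val, NatOp.fn, pure_bitOps]
    omega

theorem monomialVec_eq {m : ℕ} (d : ℕ) (c : R) :
    monomialVec m (d % m) c = wrapVec m (monomial d c) := by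
  refine List.map_congr_left fun i hi => ?_
  rw [wrap_monomial, Nat.mod_eq_of_lt (List.mem_range.1 hi)]
  simp only [eq_comm]

/-- One step of a probe computes the coefficients of the result of one instruction. -/
theorem probeStep_val (hA : Arith.Correct.{u} 𝔸) {n : ℕ} {m D : ℕ} (hm : 0 < m) {es : List ℕ}
    (hes : es = (List.range n).map fun i => D ^ i % m) (mem : List (MvPolynomial (Fin n) R))
    (I : Instr R n) (hI : I.RefsBelow mem.length) :
    (probeStep 𝔸 m es (mem.map fun f => wrapVec m (kron n D f)) I).val =
      wrapVec m (kron n D (I.eval MvPolynomial.C MvPolynomial.X mem)) := by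
  have hget : ∀ j, j < mem.length →
      (mem.map fun f => wrapVec m (kron n D f)).getD j [] = wrapVec m (kron n D (mem.getD j 0)) := by
    intro j hj
    rw [List.getD_eq_getElem _ _ (by simpa using hj), List.getElem_map,
      List.getD_eq_getElem _ _ hj]
  cases I with
  | const c =>
    have h := monomialVec_eq (m := m) 0 c
    rw [Nat.zero_mod] at h
    simp only [probeStep, Instr.eval, h, kron, MvPolynomial.coe_eval₂Hom, MvPolynomial.eval₂_C]
    rfl
  | var i =>
    have h1 : es.getD i 0 = D ^ (i : ℕ) % m := by
      rw [hes, List.getD_eq_getElem _ _ (by simp), List.getElem_map, List.getElem_range]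
    simp only [probeStep, Instr.eval, h1, monomialVec_eq, kron, MvPolynomial.coe_eval₂Hom,
      MvPolynomial.eval₂_X, X_pow_eq_monomial]
  | add j k =>
    simp only [probeStep, Instr.eval, hget j hI.1, hget k hI.2, map_add]
    rw [wrapVec_congr_iff]
    refine ⟨by simp, fun i h => ?_⟩
    simp [getElem_wrapVec]
  | sub j k =>
    simp only [probeStep, Instr.eval, hget j hI.1, hget k hI.2, map_sub]
    rw [wrapVec_congr_iff]
    refine ⟨by simp, fun i h => ?_⟩
    simp [getElem_wrapVec]
  | mul j k =>
    simp only [probeStep, Instr.eval, hget j hI.1, hget k hI.2, map_mul]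
    set f := kron n D (mem.getD j 0)
    set g := kron n D (mem.getD k 0)
    have happ : (fun i : Fin (m + m) => (wrapVec m f ++ wrapVec m g).getD (i : ℕ) 0) =
        Fin.append (fun i : Fin m => wrap m i f) (fun i : Fin m => wrap m i g) := by
      funext i
      refine Fin.addCases (fun i => ?_) (fun i => ?_) i
      · rw [Fin.append_left, List.getD_append _ _ _ _ (by simp)]
        exact getD_wrapVec f i.2
      · rw [Fin.append_right, List.getD_append_right _ _ _ _ (by simp)]
        simp only [Fin.val_natAdd, length_wrapVec, Nat.add_sub_cancel_left]
        exact getD_wrapVec g i.2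
    rw [happ, hA.conv_eval R m hm, wrapVec_congr_iff]
    refine ⟨by simp, fun i h => ?_⟩
    have hi : i < m := by simpa using h
    rw [List.getElem_ofFn, wrap_mul hm, Finset.sum_range]
    refine Finset.sum_congr rfl fun a _ => ?_
    rw [Finset.sum_range]
    simp [Nat.mod_eq_of_lt hi]

theorem probe_fold_val (hA : Arith.Correct.{u} 𝔸) {n : ℕ} {m D : ℕ} (hm : 0 < m) {es : List ℕ}
    (hes : es = (List.range n).map fun i => D ^ i % m) (code : List (Instr R n))
    (hwf : ∀ (l : ℕ) (h : l < code.length), (code[l]'h).RefsBelow l) :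
    code.foldl (fun (mem : List (List R)) I => mem ++ [(probeStep 𝔸 m es mem I).val]) [] =
      (Instr.run MvPolynomial.C MvPolynomial.X code).map fun f => wrapVec m (kron n D f) := by
  induction code using List.reverseRecOn with
  | nil => rfl
  | append_singleton code I ih =>
    have h1 := ih fun l h => by
      have := hwf l (by simp; omega)
      rwa [List.getElem_append_left h] at this
    have h2 : I.RefsBelow (Instr.run MvPolynomial.C MvPolynomial.X code :
        List (MvPolynomial (Fin n) R)).length := by
      rw [Instr.length_run]
      have := hwf code.length (by simp)
      rwa [List.getElem_concat_length rfl] at this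
    rw [List.foldl_append, List.foldl_cons, List.foldl_nil, h1, Instr.run_append_singleton,
      probeStep_val hA hm hes _ I h2, List.map_append, List.map_singleton]

theorem kroneckerProbe_val (hA : Arith.Correct.{u} 𝔸) {n : ℕ} (S : SLP R n) (D : ℕ) {m : ℕ}
    (hm : 0 < m) : (kroneckerProbe 𝔸 S D m).val = wrapVec m (kron n D S.poly) := by
  have hes : (powersMod 𝔸 (D % m) m n (1 % m)).val = (List.range n).map fun i => D ^ i % m := by
    rw [powersMod_val _ _ _ (Nat.mod_mod _ _)]
    refine List.map_congr_left fun i _ => ?_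
    rw [Nat.mul_mod, Nat.mod_mod, ← Nat.mul_mod, one_mul, ← Nat.pow_mod]
  simp only [kroneckerProbe, bind_val, natOp_val, NatOp.fn, foldL_val, pure_val]
  rw [probe_fold_val hA hm hes S.code S.wf, SLP.poly]
  have hne : (Instr.run MvPolynomial.C MvPolynomial.X S.code : List (MvPolynomial (Fin n) R)) ≠ [] := by
    rw [← List.length_pos_iff, Instr.length_run]
    exact List.length_pos_iff.2 S.code_ne_nil
  rw [List.getLastD_eq_getLast?, List.getLastD_eq_getLast?, List.getLast?_map,
    List.getLast?_eq_some_getLast hne]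
  rfl

theorem kroneckerProbe_ringOps_le {n : ℕ} (S : SLP R n) (D m : ℕ) :
    (kroneckerProbe 𝔸 S D m).ringOps ≤ S.size * (m + (𝔸.conv m).cost) := by
  simp only [kroneckerProbe, bind_ringOps, natOp_ringOps, powersMod_ringOps, pure_ringOps, zero_add,
    add_zero]
  refine foldL_ringOps_le (fun _ => True) (fun mem _ I _ => ⟨?_, trivial⟩) trivial
  cases I <;> simp [probeStep]

theorem kroneckerProbe_bitOps_le (hB : CircBound 𝔸 B) {n : ℕ} (S : SLP R n) {D m w w' : ℕ}
    (hm : 0 < m) (hD : D.size ≤ w) (hmw : m.size ≤ w) (hw' : 2 * m.size ≤ w') :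
    (kroneckerProbe 𝔸 S D m).bitOps ≤ 2 * B w + n * (2 * B w') := by
  have hfold : ∀ (es : List ℕ), (foldL (fun (mem : List (List R)) (I : Instr R n) =>
      (probeStep 𝔸 m es mem I).bind fun v => pure (mem ++ [v])) [] S.code).bitOps ≤ 0 := by
    intro es
    refine (foldL_bitOps_le (fun _ => True) (c := 0) (fun mem _ I _ => ⟨?_, trivial⟩)
      trivial).trans (by simp)
    cases I <;> simp [probeStep]
  have hm1 : 0 < m.size := Nat.size_pos.2 hm
  have o1 := hB.natOp_le (op := .mod) hD hmw
  have o2 := hB.natOp_le (op := .mod) (a := 1) (b := m) (w := w) (by rw [Nat.size_one]; omega) hmw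
  have o3 := powersMod_bitOps_le (𝔸 := 𝔸) hB (d := D % m) hm (Nat.mod_lt _ hm).le hw' n (1 % m)
    (Nat.mod_lt _ hm).le
  have o4 := hfold (powersMod 𝔸 (D % m) m n (1 % m)).val
  simp only [kroneckerProbe, bind_bitOps, natOp_val, NatOp.fn, pure_bitOps]
  omega

end

end SLPInterp

namespace SLPInterp

open Polynomial

/-! ### Collisions of exponents modulo primes -/

/-- The primes modulo which a number `e < D` collides with a member of `E` divide a product of `#E`
nonzero numbers smaller than `D`, so there are fewer than `log₂ (D ^ #E)` of them. -/
theorem card_colliding_primes_lt {D e k : ℕ} {E S : Finset ℕ} (hD : 2 ≤ D) (hk : 0 < k)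
    (hE : E.card ≤ k) (he : e < D) (hED : ∀ d ∈ E, d < D) (heE : e ∉ E) (hS : ∀ p ∈ S, p.Prime)
    (hcol : ∀ p ∈ S, ∃ d ∈ E, d % p = e % p) : S.card < Nat.clog 2 (D ^ k) := by
  rw [Nat.lt_clog_iff_pow_lt (by norm_num)]
  have hpow : D ^ E.card ≤ D ^ k := Nat.pow_le_pow_right (by omega) hE
  rcases E.eq_empty_or_nonempty with rfl | hne
  · have : S = ∅ := Finset.eq_empty_of_forall_notMem fun p hp => by simpa using hcol p hp
    rw [this]
    simpa using Nat.one_lt_pow hk.ne' (by omega)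
  · set Z := ∏ d ∈ E, ((d : ℤ) - e).natAbs with hZ
    have hpos : ∀ d ∈ E, 0 < ((d : ℤ) - e).natAbs := fun d hd => by
      have : d ≠ e := fun h => heE (h ▸ hd)
      omega
    have hZD : Z < D ^ E.card := by
      rw [← Finset.prod_const]
      exact Finset.prod_lt_prod_of_nonempty hpos (fun d hd => by have := hED d hd; omega) hne
    have hdvd : ∏ p ∈ S, p ∣ Z := by
      refine Finset.prod_primes_dvd _ (fun p hp => (hS p hp).prime) fun p hp => ?_
      obtain ⟨d, hd, h⟩ := hcol p hp
      refine dvd_trans ?_ (Finset.dvd_prod_of_mem _ hd)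
      have h1 : (p : ℤ) ∣ (d : ℤ) - e :=
        (Int.modEq_iff_dvd.1 ((Int.natCast_modEq_iff.2 h).symm))
      exact Int.natCast_dvd.1 h1
    have h2 : 2 ^ S.card ≤ ∏ p ∈ S, p :=
      Finset.pow_card_le_prod S _ 2 fun p hp => (hS p hp).two_le
    have h3 : ∏ p ∈ S, p ≤ Z := Nat.le_of_dvd (Finset.prod_pos hpos) hdvd
    omega

theorem card_colliding_primes_lt_numBad {D e T : ℕ} {E S : Finset ℕ}
    (hE : E.card + 1 ≤ T) (he : e < D) (hED : ∀ d ∈ E, d < D) (heE : e ∉ E)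
    (hS : ∀ p ∈ S, p.Prime) (hcol : ∀ p ∈ S, ∃ d ∈ E, d % p = e % p) :
    S.card < numBad T D := by
  rcases E.eq_empty_or_nonempty with rfl | ⟨d, hd⟩
  · have : S = ∅ := Finset.eq_empty_of_forall_notMem fun p hp => by simpa using hcol p hp
    rw [this]
    exact lt_of_lt_of_le Nat.zero_lt_one (le_max_left _ _)
  · have h1 : 2 ≤ D := by
      have h2 := hED d hd
      have h3 : d ≠ e := fun h => heE (h ▸ hd)
      omega
    have h2 : 0 < E.card := Finset.card_pos.2 ⟨d, hd⟩
    exact (card_colliding_primes_lt h1 (k := T - 1) (by omega) (by omega) he hED heE hS hcol).trans_le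
      (le_max_right _ _)

section

variable {R : Type u} [CommRing R]

/-- A term of `g` is seen modulo all but fewer than `N₁` primes. -/
theorem le_card_votes_of_term {g : R[X]} {D T e V : ℕ} {P Q : Finset ℕ}
    (hT : g.support.card ≤ T) (hD : ∀ d ∈ g.support, d < D) (he : e ∈ g.support)
    (hP : ∀ p ∈ P, p.Prime) (hQ : Q ⊆ P) (hcard : numBad T D + V ≤ P.card + 1)
    (hvote : ∀ p ∈ P, wrap p e g = g.coeff e → p ∈ Q) : V ≤ Q.card := by
  have h1 : (P \ Q).card < numBad T D := by
    refine card_colliding_primes_lt_numBad (E := g.support.erase e) (e := e) ?_ (hD e he)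
      (fun d hd => hD d (Finset.mem_of_mem_erase hd)) (Finset.notMem_erase _ _)
      (fun p hp => hP p (Finset.mem_sdiff.1 hp).1) fun p hp => ?_
    · rw [Finset.card_erase_add_one he]; exact hT
    · rw [Finset.mem_sdiff] at hp
      by_contra hcon
      push Not at hcon
      refine hp.2 (hvote p hp.1 (wrap_eq_coeff_of_unique fun d hd hde => ?_))
      by_contra hne
      exact hcon d (Finset.mem_erase.2 ⟨hne, hd⟩) hde
  rw [Finset.card_sdiff_of_subset hQ] at h1
  have := Finset.card_le_card hQ
  omega

/-- A wrong candidate `a X ^ e` is confirmed by fewer than `N₂` primes. -/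
theorem card_votes_lt_of_not_term {g : R[X]} {D T e : ℕ} {a : R} {Q : Finset ℕ} (hD2 : 2 ≤ D)
    (hT0 : 0 < T) (hT : g.support.card ≤ T) (hD : ∀ d ∈ g.support, d < D) (he : e < D)
    (hea : g.coeff e ≠ a) (hQp : ∀ p ∈ Q, p.Prime) (hQ : ∀ p ∈ Q, wrap p e g = a) :
    Q.card < numVotes T D := by
  refine card_colliding_primes_lt (E := g.support.erase e) (e := e) hD2 hT0
    ((Finset.card_erase_le).trans hT) he (fun d hd => hD d (Finset.mem_of_mem_erase hd))
    (Finset.notMem_erase _ _) hQp fun p hp => ?_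
  by_contra hcon
  push Not at hcon
  refine hea ?_
  rw [← hQ p hp]
  refine (wrap_eq_coeff_of_unique fun d hd hde => ?_).symm
  by_contra hne
  exact hcon d (Finset.mem_erase.2 ⟨hne, hd⟩) hde

/-- The exponents of `g` that do not collide with any other modulo `p`. -/
def isolated (p : ℕ) (g : R[X]) : Finset ℕ :=
  g.support.filter fun e => ∀ d ∈ g.support, d % p = e % p → d = e

theorem isolated_subset (p : ℕ) (g : R[X]) : isolated p g ⊆ g.support := Finset.filter_subset _ _

theorem wrap_of_isolated {p e : ℕ} {g : R[X]} (h : e ∈ isolated p g) :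
    wrap p e g = g.coeff e ∧ g.coeff e ≠ 0 := by
  obtain ⟨h1, h2⟩ := Finset.mem_filter.1 h
  exact ⟨wrap_eq_coeff_of_unique h2, Polynomial.mem_support_iff.1 h1⟩

theorem card_isolated_le {p : ℕ} (hp : 0 < p) (g : R[X]) :
    (isolated p g).card ≤ (wrapSupport p g).card := by
  refine Finset.card_le_card_of_injOn (fun e => e % p) (fun e he => ?_) fun e he d hd h => ?_
  · rw [Finset.mem_coe, mem_wrapSupport]
    have h1 := wrap_of_isolated he
    rw [wrap_mod, h1.1]
    exact ⟨Nat.mod_lt _ hp, h1.2⟩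
  · exact (Finset.mem_filter.1 hd).2 e (Finset.mem_filter.1 he).1 h

/-- Each term modulo `X ^ p - 1` comes from an isolated exponent or from at least two others. -/
theorem two_mul_card_wrapSupport_le (p : ℕ) (g : R[X]) :
    2 * (wrapSupport p g).card ≤ (isolated p g).card + g.support.card := by
  have h1 : wrapSupport p g ⊆ (isolated p g).image (fun d => d % p) ∪
      (g.support \ isolated p g).image fun d => d % p := by
    rw [← Finset.image_union, Finset.union_sdiff_of_subset (isolated_subset p g)]
    exact wrapSupport_subset p g
  have h2 := (Finset.card_le_card h1).trans (Finset.card_union_le _ _)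
  have h3 : ((isolated p g).image fun d => d % p).card ≤ (isolated p g).card := Finset.card_image_le
  have h4 : 2 * ((g.support \ isolated p g).image fun d => d % p).card ≤
      (g.support \ isolated p g).card := by
    refine Finset.mul_card_image_le_card _ _ fun a ha => ?_
    obtain ⟨e, he, rfl⟩ := Finset.mem_image.1 ha
    obtain ⟨he1, he2⟩ := Finset.mem_sdiff.1 he
    have h5 : ∃ d ∈ g.support, d % p = e % p ∧ d ≠ e := by
      by_contra hcon
      push Not at hcon
      exact he2 (Finset.mem_filter.2 ⟨he1, hcon⟩)
    obtain ⟨d, hd, hde, hne⟩ := h5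
    have h6 : d ∉ isolated p g := fun h =>
      hne ((Finset.mem_filter.1 h).2 e he1 hde.symm).symm
    refine Finset.one_lt_card.2 ⟨e, ?_, d, ?_, hne.symm⟩
    · exact Finset.mem_filter.2 ⟨he, rfl⟩
    · exact Finset.mem_filter.2 ⟨Finset.mem_sdiff.2 ⟨hd, h6⟩, hde⟩
  have h7 : (isolated p g).card ≤ g.support.card := Finset.card_le_card (isolated_subset p g)
  rw [Finset.card_sdiff_of_subset (isolated_subset p g)] at h4
  omega

/-- Among `4 N₁` primes there is one modulo which fewer than a quarter of the exponents collide. -/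
theorem exists_few_collisions {g : R[X]} {D T : ℕ} {P : Finset ℕ} (hg : g ≠ 0)
    (hT : g.support.card ≤ T) (hD : ∀ d ∈ g.support, d < D)
    (hP : ∀ p ∈ P, p.Prime) (hcard : 4 * numBad T D ≤ P.card) :
    ∃ p ∈ P, 4 * (g.support \ isolated p g).card < g.support.card := by
  by_contra hcon
  push Not at hcon
  have hpos : 0 < g.support.card := Finset.card_pos.2 (Polynomial.support_nonempty.2 hg)
  -- The pairs of a prime and an exponent that collides modulo it are counted in two ways.
  have h1 : P.card * g.support.card ≤ ∑ p ∈ P, 4 * (g.support \ isolated p g).card := by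
    rw [← smul_eq_mul]; exact Finset.card_nsmul_le_sum P _ _ hcon
  have h2 : ∑ p ∈ P, (g.support \ isolated p g).card =
      ∑ e ∈ g.support, (P.filter fun p => e ∉ isolated p g).card := by
    simp only [Finset.card_eq_sum_ones, Finset.sum_filter, ← Finset.filter_notMem_eq_sdiff]
    rw [Finset.sum_comm]
  have h3 : ∀ e ∈ g.support, (P.filter fun p => e ∉ isolated p g).card ≤ numBad T D - 1 := by
    intro e he
    refine Nat.le_sub_one_of_lt (card_colliding_primes_lt_numBad (E := g.support.erase e) (e := e)
      ?_ (hD e he) (fun d hd => hD d (Finset.mem_of_mem_erase hd)) (Finset.notMem_erase _ _)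
      (fun p hp => hP p (Finset.mem_filter.1 hp).1) fun p hp => ?_)
    · rw [Finset.card_erase_add_one he]; exact hT
    · by_contra hcon
      push Not at hcon
      refine (Finset.mem_filter.1 hp).2 (Finset.mem_filter.2 ⟨he, fun d hd hde => ?_⟩)
      by_contra hne
      exact hcon d (Finset.mem_erase.2 ⟨hne, hd⟩) hde
  have h4 := Finset.sum_le_card_nsmul _ _ _ h3
  rw [← Finset.mul_sum, h2] at h1
  rw [smul_eq_mul] at h4
  have hN : 1 ≤ numBad T D := le_max_left _ _
  obtain ⟨k, hk⟩ : ∃ k, numBad T D = k + 1 := ⟨numBad T D - 1, by omega⟩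
  rw [hk] at h4 hcard
  have h5 : (4 * (k + 1)) * g.support.card ≤ P.card * g.support.card :=
    Nat.mul_le_mul_right _ hcard
  simp only [Nat.add_sub_cancel] at h4
  nlinarith

/-- Modulo a prime for which the number of terms is maximal, more than half of the exponents are
isolated. -/
theorem card_support_lt_two_mul_card_isolated {g : R[X]} {D T q : ℕ} {P : Finset ℕ} (hg : g ≠ 0)
    (hT : g.support.card ≤ T) (hD : ∀ d ∈ g.support, d < D)
    (hP : ∀ p ∈ P, p.Prime) (hcard : 4 * numBad T D ≤ P.card)
    (hq : ∀ p ∈ P, (wrapSupport p g).card ≤ (wrapSupport q g).card) :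
    g.support.card < 2 * (isolated q g).card := by
  -- More than three quarters of the exponents are isolated modulo `p`.  So there are as many terms
  -- modulo `p`, and at least as many modulo `q`.
  obtain ⟨p, hp, h1⟩ := exists_few_collisions hg hT hD hP hcard
  have h2 := card_isolated_le (hP p hp).pos g
  have h3 := hq p hp
  have h4 := two_mul_card_wrapSupport_le q g
  have h7 : (isolated p g).card ≤ g.support.card := Finset.card_le_card (isolated_subset p g)
  rw [Finset.card_sdiff_of_subset (isolated_subset p g)] at h1
  omega

end

end SLPInterp

namespace SLPInterp

open Timed Polynomial

section

variable {R : Type u} {𝔸 : Arith} {B : ℕ → ℕ}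

/-! ### Lifting of terms by Chinese remaindering -/

theorem liftResidues_val_some {p d : ℕ} {gs : List (ℕ × List (ℕ × R))} {es : List (ℕ × ℕ)}
    (h : (liftResidues 𝔸 p d gs).val = some es) (hq : ∀ x ∈ gs, 0 < x.1) :
    es.map Prod.snd = gs.map Prod.fst ∧ ∀ c ∈ es, c.1 < c.2 := by
  induction gs generalizing es with
  | nil =>
    simp only [liftResidues, pure_val, Option.some.injEq] at h
    subst h
    simp
  | cons x gs ih =>
    obtain ⟨q, g⟩ := x
    simp only [liftResidues, bind_val] at h
    split at h
    · simp only [bind_val, pure_val, Option.map_eq_some_iff, natOp_val, NatOp.fn] at h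
      obtain ⟨es', h1, rfl⟩ := h
      obtain ⟨h2, h3⟩ := ih h1 fun x hx => hq x (by simp [hx])
      refine ⟨by simp [h2], fun c hc => ?_⟩
      rcases List.mem_cons.1 hc with rfl | hc
      · exact Nat.mod_lt _ (hq (q, g) (by simp))
      · exact h3 c hc
    · simp at h

@[simp] theorem liftResidues_ringOps (p d : ℕ) (gs : List (ℕ × List (ℕ × R))) :
    (liftResidues 𝔸 p d gs).ringOps = 0 := by
  induction gs with
  | nil => rfl
  | cons x gs ih =>
    obtain ⟨q, g⟩ := x
    have h := filterL_ringOps_le (f := fun t : ℕ × R =>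
      (natOp 𝔸 .mod t.1 p).bind fun r => natTest 𝔸 .eq r d) (l := g) (c := 0) fun _ _ => le_rfl
    rw [mul_zero, Nat.le_zero] at h
    simp only [liftResidues, bind_ringOps, h, zero_add]
    split
    · simp only [bind_ringOps, natOp_ringOps, ih, pure_ringOps]
    · rfl

theorem liftResidues_bitOps_le (hB : CircBound 𝔸 B) {p d w t : ℕ} (hp : p.size ≤ w)
    (hd : d.size ≤ w) (gs : List (ℕ × List (ℕ × R))) (hq : ∀ x ∈ gs, x.1.size ≤ w)
    (hlen : ∀ x ∈ gs, x.2.length ≤ t) (he : ∀ x ∈ gs, ∀ y ∈ x.2, y.1.size ≤ w) :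
    (liftResidues 𝔸 p d gs).bitOps ≤ gs.length * (t * (2 * B w) + B w) := by
  induction gs with
  | nil => simp [liftResidues]
  | cons x gs ih =>
    obtain ⟨q, g⟩ := x
    have h1 : (filterL (fun t : ℕ × R =>
        (natOp 𝔸 .mod t.1 p).bind fun r => natTest 𝔸 .eq r d) g).bitOps ≤ g.length * (2 * B w) := by
      refine filterL_bitOps_le fun y hy => ?_
      have hyw := he (q, g) (by simp) y hy
      have o1 := hB.natOp_le (op := .mod) hyw hp
      have o2 := hB.natTest_le (op := .eq) (size_le_of_le (Nat.mod_le y.1 p) hyw) hd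
      simp only [bind_bitOps, natOp_val, NatOp.fn]
      omega
    have h2 : g.length * (2 * B w) ≤ t * (2 * B w) :=
      Nat.mul_le_mul_right _ (hlen (q, g) (by simp))
    have h3 := ih (fun x hx => hq x (by simp [hx])) (fun x hx => hlen x (by simp [hx]))
      fun x hx => he x (by simp [hx])
    rw [List.length_cons, Nat.succ_mul]
    simp only [liftResidues, bind_bitOps]
    split
    · rename_i y heq
      have hy : y ∈ g := by
        have : y ∈ (filterL (fun t : ℕ × R =>
          (natOp 𝔸 .mod t.1 p).bind fun r => natTest 𝔸 .eq r d) g).val := by rw [heq]; simp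
        rw [filterL_val] at this
        exact List.mem_of_mem_filter this
      have o1 : (natOp 𝔸 .mod y.1 q).bitOps ≤ B w :=
        hB.natOp_le (he (q, g) (by simp) y hy) (hq (q, g) (by simp))
      simp only [bind_bitOps, pure_bitOps]
      omega
    · simp only [pure_bitOps]
      omega

/-- The term that a term of `f` modulo `X ^ p - 1` is lifted to, if any. -/
def candidate (𝔸 : Arith) (gs : List (ℕ × List (ℕ × R))) (p D : ℕ) (t : ℕ × R) :
    Option (ℕ × R) :=
  (liftResidues 𝔸 p t.1 gs).val.bind fun es =>
    if (chineseRem 𝔸 es 0 1).val < D then some ((chineseRem 𝔸 es 0 1).val, t.2) else none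

theorem candidate_eq_some {gs : List (ℕ × List (ℕ × R))} {p D : ℕ} {t x : ℕ × R}
    (h : candidate 𝔸 gs p D t = some x) : x.1 < D ∧ x.2 = t.2 := by
  simp only [candidate, Option.bind_eq_some_iff] at h
  obtain ⟨es, -, h⟩ := h
  split_ifs at h with h1
  simp only [Option.some.injEq] at h
  subst h
  exact ⟨h1, rfl⟩

theorem length_le_of_candidates {gs : List (ℕ × List (ℕ × R))} {p D : ℕ} {f U : List (ℕ × R)}
    (hU : U.Nodup ∧ ∀ x ∈ U, ∃ t ∈ f, candidate 𝔸 gs p D t = some x) : U.length ≤ f.length := by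
  have h : U ⊆ f.filterMap (candidate 𝔸 gs p D) := fun x hx => by
    obtain ⟨t, ht, h⟩ := hU.2 x hx
    exact List.mem_filterMap.2 ⟨t, ht, h⟩
  exact (hU.1.subperm h).length_le.trans (List.length_filterMap_le _ _)

variable [DecidableEq R]

theorem termEq_val (t t' : ℕ × R) : (termEq 𝔸 t t').val = decide (t = t') := by
  obtain ⟨e, a⟩ := t
  obtain ⟨e', a'⟩ := t'
  by_cases h : e = e' <;> simp [termEq, h]

theorem insertTerm_val (U : List (ℕ × R)) (t : ℕ × R) :
    (insertTerm 𝔸 U t).val = if t ∈ U then U else U ++ [t] := by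
  simp only [insertTerm, bind_val, pure_val, filterL_val, termEq_val]
  by_cases h : t ∈ U
  · have : (U.filter fun a => decide (t = a)).isEmpty = false := by
      rw [Bool.eq_false_iff, ne_eq, List.isEmpty_iff]
      exact List.ne_nil_of_mem (List.mem_filter.2 ⟨h, by simp⟩)
    rw [this, if_pos h]; rfl
  · have : (U.filter fun a => decide (t = a)).isEmpty = true := by
      rw [List.isEmpty_iff, List.filter_eq_nil_iff]
      intro a ha hta
      exact h ((of_decide_eq_true hta) ▸ ha)
    rw [this, if_neg h]; rfl

theorem insertTerm_ringOps_le (U : List (ℕ × R)) (t : ℕ × R) :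
    (insertTerm 𝔸 U t).ringOps ≤ U.length := by
  simp only [insertTerm, bind_ringOps, pure_ringOps, add_zero]
  refine (filterL_ringOps_le (c := 1) fun a _ => ?_).trans_eq (mul_one _)
  simp only [termEq, bind_ringOps, natTest_ringOps]
  split_ifs <;> simp

theorem insertTerm_bitOps_le (hB : CircBound 𝔸 B) {w : ℕ} (U : List (ℕ × R)) (t : ℕ × R)
    (ht : t.1.size ≤ w) (hU : ∀ x ∈ U, x.1.size ≤ w) :
    (insertTerm 𝔸 U t).bitOps ≤ U.length * B w := by
  simp only [insertTerm, bind_bitOps, pure_bitOps, add_zero]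
  refine filterL_bitOps_le fun a ha => ?_
  have o1 := hB.natTest_le (op := .eq) ht (hU a ha)
  simp only [termEq, bind_bitOps]
  split_ifs <;> simpa using o1

/-- The union of a set of terms with a candidate, if there is one. -/
def addCandidate (U : List (ℕ × R)) : Option (ℕ × R) → List (ℕ × R)
  | none => U
  | some x => if x ∈ U then U else U ++ [x]

theorem uTerms_step_val (gs : List (ℕ × List (ℕ × R))) (p D : ℕ) (U : List (ℕ × R)) (t : ℕ × R) :
    ((liftResidues 𝔸 p t.1 gs).bind fun o =>
      match o with
      | none => pure U
      | some es =>
        (chineseRem 𝔸 es 0 1).bind fun β =>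
        (natTest 𝔸 .lt β D).bind fun b =>
        if b then insertTerm 𝔸 U (β, t.2) else pure U).val =
      addCandidate U (candidate 𝔸 gs p D t) := by
  simp only [bind_val, candidate]
  rcases (liftResidues 𝔸 p t.1 gs).val with _ | es
  · rfl
  · simp only [bind_val, natTest_lt_val, Option.bind_some]
    by_cases h : (chineseRem 𝔸 es 0 1).val < D
    · simp only [h, decide_true, if_true, insertTerm_val, addCandidate]
    · simp only [h, decide_false, Bool.false_eq_true, if_false, pure_val, addCandidate]

theorem uTerms_step_invariant {gs : List (ℕ × List (ℕ × R))} {p D : ℕ} {f U : List (ℕ × R)}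
    {t : ℕ × R} (ht : t ∈ f) (hU : U.Nodup ∧ ∀ x ∈ U, ∃ t ∈ f, candidate 𝔸 gs p D t = some x) :
    (addCandidate U (candidate 𝔸 gs p D t)).Nodup ∧
      ∀ x ∈ addCandidate U (candidate 𝔸 gs p D t), ∃ t ∈ f, candidate 𝔸 gs p D t = some x := by
  rcases hx : candidate 𝔸 gs p D t with _ | x
  · exact hU
  · simp only [addCandidate]
    split_ifs with h
    · exact hU
    · refine ⟨?_, fun y hy => ?_⟩
      · rw [List.nodup_append]
        refine ⟨hU.1, by simp, ?_⟩
        rintro a ha b hb rfl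
        rw [List.mem_singleton] at hb
        exact h (hb ▸ ha)
      · rcases List.mem_append.1 hy with hy | hy
        · exact hU.2 y hy
        · rw [List.mem_singleton] at hy
          exact ⟨t, ht, hy ▸ hx⟩

theorem uTerms_val_eq (gs : List (ℕ × List (ℕ × R))) (p D : ℕ) (f : List (ℕ × R)) :
    (uTerms 𝔸 f gs p D).val = f.foldl (fun U t => addCandidate U (candidate 𝔸 gs p D t)) [] := by
  rw [uTerms, foldL_val]
  congr 1
  funext U t
  exact uTerms_step_val gs p D U t

/-- The set `U`: the candidates, each of them once. -/
theorem uTerms_val (gs : List (ℕ × List (ℕ × R))) (p D : ℕ) (f : List (ℕ × R)) :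
    (uTerms 𝔸 f gs p D).val.Nodup ∧
      ∀ x, x ∈ (uTerms 𝔸 f gs p D).val ↔ ∃ t ∈ f, candidate 𝔸 gs p D t = some x := by
  rw [uTerms_val_eq]
  have h1 := foldl_invariant (l := f)
    (fun U => U.Nodup ∧ ∀ x ∈ U, ∃ t ∈ f, candidate 𝔸 gs p D t = some x)
    (fun U hU t ht => uTerms_step_invariant ht hU) (b := []) ⟨List.nodup_nil, by simp⟩
  refine ⟨h1.1, fun x => ⟨h1.2 x, ?_⟩⟩
  clear h1
  have h2 : ∀ (f U : List (ℕ × R)), (x ∈ U ∨ ∃ t ∈ f, candidate 𝔸 gs p D t = some x) →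
      x ∈ f.foldl (fun U t => addCandidate U (candidate 𝔸 gs p D t)) U := by
    intro f
    induction f with
    | nil => simp
    | cons t f ih =>
      intro U h
      refine ih _ ?_
      rcases h with h | ⟨t', ht', h⟩
      · left
        change x ∈ addCandidate U (candidate 𝔸 gs p D t)
        rcases candidate 𝔸 gs p D t with _ | y
        · exact h
        · simp only [addCandidate]
          split_ifs
          · exact h
          · exact List.mem_append_left _ h
      · rcases List.mem_cons.1 ht' with rfl | ht'
        · left
          simp only [h, addCandidate]
          split_ifs with h3
          · exact h3
          · simp
        · exact Or.inr ⟨t', ht', h⟩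
  exact fun h => h2 f [] (Or.inr h)

theorem length_uTerms_le (gs : List (ℕ × List (ℕ × R))) (p D : ℕ) (f : List (ℕ × R)) :
    (uTerms 𝔸 f gs p D).val.length ≤ f.length :=
  length_le_of_candidates ⟨(uTerms_val gs p D f).1, fun x hx => ((uTerms_val gs p D f).2 x).1 hx⟩

theorem uTerms_ringOps_le (gs : List (ℕ × List (ℕ × R))) (p D : ℕ) (f : List (ℕ × R)) :
    (uTerms 𝔸 f gs p D).ringOps ≤ f.length * f.length := by
  refine foldL_ringOps_le
    (fun U => U.Nodup ∧ ∀ x ∈ U, ∃ t ∈ f, candidate 𝔸 gs p D t = some x)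
    (fun U hU t ht => ⟨?_, ?_⟩) ⟨List.nodup_nil, by simp⟩
  · have hlen := length_le_of_candidates hU
    simp only [bind_ringOps, liftResidues_ringOps, zero_add]
    split
    · simp
    · simp only [bind_ringOps, chineseRem_ringOps, natTest_ringOps, zero_add]
      split_ifs
      · exact (insertTerm_ringOps_le _ _).trans hlen
      · simp
  · have h := uTerms_step_invariant ht hU
    rw [← uTerms_step_val gs p D U t] at h
    exact h

theorem uTerms_bitOps_le (hB : CircBound 𝔸 B) {p D w w₁ w₂ t q : ℕ}
    (gs : List (ℕ × List (ℕ × R))) (f : List (ℕ × R)) (hp : p.size ≤ w)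
    (hf : ∀ x ∈ f, x.1.size ≤ w) (hgs : ∀ x ∈ gs, 0 < x.1 ∧ x.1.size ≤ w ∧ x.1 ≤ q)
    (hlen : ∀ x ∈ gs, x.2.length ≤ t) (he : ∀ x ∈ gs, ∀ y ∈ x.2, y.1.size ≤ w)
    (hcop : (gs.map Prod.fst).Pairwise Nat.Coprime) (hD : D.size ≤ w₁)
    (hprod : (gs.map Prod.fst).prod.size ≤ w₁) (hw₂ : 2 * q.size + 1 ≤ w₂) :
    (uTerms 𝔸 f gs p D).bitOps ≤ f.length * (gs.length * (t * (2 * B w) + B w) +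
      gs.length * (5 * B w₁ + q * (5 * B w₂)) + B w₁ + f.length * B w₁) := by
  refine foldL_bitOps_le
    (fun U => U.Nodup ∧ ∀ x ∈ U, ∃ t ∈ f, candidate 𝔸 gs p D t = some x)
    (fun U hU t' ht' => ⟨?_, ?_⟩) ⟨List.nodup_nil, by simp⟩
  · have hUlen : U.length * B w₁ ≤ f.length * B w₁ :=
      Nat.mul_le_mul_right _ (length_le_of_candidates hU)
    have o1 := liftResidues_bitOps_le hB hp (hf t' ht') gs (fun x hx => (hgs x hx).2.1) hlen he
    simp only [bind_bitOps]
    split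
    · simp only [pure_bitOps]; omega
    · rename_i es hes
      obtain ⟨h1, h2⟩ := liftResidues_val_some hes fun x hx => (hgs x hx).1
      have hlen' : es.length = gs.length := by
        rw [← List.length_map (f := Prod.snd) (as := es), h1, List.length_map]
      have h3 : ∀ c ∈ es, c.1 < c.2 ∧ Nat.Coprime 1 c.2 := fun c hc => ⟨h2 c hc, by simp⟩
      have h4 : ∀ c ∈ es, c.2 ≤ q := fun c hc => by
        have : c.2 ∈ es.map Prod.snd := List.mem_map_of_mem hc
        rw [h1] at this
        obtain ⟨x, hx, h5⟩ := List.mem_map.1 this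
        rw [← h5]; exact (hgs x hx).2.2
      have o2 := chineseRem_bitOps_le hB es 0 1 (by omega) h3 (h1 ▸ hcop)
        (w := w₁) (by rw [one_mul, h1]; exact hprod) h4 hw₂
      rw [hlen'] at o2
      have h6 := (chineseRem_val (𝔸 := 𝔸) es 0 1 (by omega) h3 (h1 ▸ hcop)).1
      rw [one_mul, h1] at h6
      have h7 := size_le_of_le h6.le hprod
      have o3 := hB.natTest_le (op := .lt) h7 hD
      simp only [bind_bitOps]
      split_ifs
      · have o4 := insertTerm_bitOps_le hB U ((chineseRem 𝔸 es 0 1).val, t'.2) h7 fun x hx => by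
          obtain ⟨t, -, h⟩ := hU.2 x hx
          exact size_le_of_le (candidate_eq_some h).1.le hD
        omega
      · simp only [pure_bitOps]; omega
  · have h := uTerms_step_invariant ht' hU
    rw [← uTerms_step_val gs p D U t'] at h
    exact h

/-- The list of the polynomials `g` modulo `X ^ (p q) - 1`, with which terms modulo `X ^ p - 1` are
lifted. -/
noncomputable def liftData [CommRing R] (p : ℕ) (g : R[X]) (qs : List ℕ) :
    List (ℕ × List (ℕ × R)) :=
  qs.map fun q => (q, (sparse (wrapVec (p * q) g)).val)

theorem map_fst_liftData [CommRing R] (p : ℕ) (g : R[X]) (qs : List ℕ) :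
    (liftData p g qs).map Prod.fst = qs := by
  simp [liftData, Function.comp_def]

/-- An exponent that is isolated modulo `p` yields the only term modulo `X ^ (p q) - 1` in its
residue class modulo `p`. -/
theorem filter_sparse_of_isolated [CommRing R] {p q e : ℕ} {g : R[X]} (hp : 0 < p) (hq : 0 < q)
    (he : e ∈ isolated p g) :
    ((sparse (wrapVec (p * q) g)).val.filter fun t => decide (t.1 % p = e % p)) =
      [(e % (p * q), g.coeff e)] := by
  have huniq := (Finset.mem_filter.1 he).2
  have hmod : ∀ a, a % (p * q) % p = a % p := fun a => Nat.mod_mod_of_dvd _ (dvd_mul_right p q)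
  have hcoeff : wrap (p * q) e g = g.coeff e := by
    refine wrap_eq_coeff_of_unique fun d hd h => huniq d hd ?_
    rw [← hmod d, h, hmod]
  refine List.perm_singleton.1 ((List.perm_ext_iff_of_nodup ?_ (List.nodup_singleton _)).2 ?_)
  · exact (List.Nodup.of_map _ (nodup_sparse (p * q) g)).filter _
  · rintro ⟨b, a⟩
    rw [List.mem_filter, mem_sparse, List.mem_singleton, Prod.mk.injEq, decide_eq_true_eq]
    constructor
    · rintro ⟨⟨h1, h2, h3⟩, h4⟩
      obtain ⟨d, hd, h5⟩ := exists_of_wrap_ne_zero (h2 ▸ h3 : wrap (p * q) b g ≠ 0)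
      have h6 : d = e := huniq d hd (by rw [← hmod d, h5, hmod]; exact h4)
      subst h6
      rw [Nat.mod_eq_of_lt h1] at h5
      exact ⟨h5.symm, by rw [← h2, ← h5, wrap_mod, hcoeff]⟩
    · rintro ⟨rfl, rfl⟩
      refine ⟨⟨Nat.mod_lt _ (Nat.mul_pos hp hq), ?_, (wrap_of_isolated he).2⟩, hmod e⟩
      rw [wrap_mod, hcoeff]

theorem liftResidues_of_isolated [CommRing R] {p e : ℕ} {g : R[X]} (hp : 0 < p)
    (he : e ∈ isolated p g) (qs : List ℕ) (hq : ∀ q ∈ qs, 0 < q) :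
    (liftResidues 𝔸 p (e % p) (liftData p g qs)).val = some (qs.map fun q => (e % q, q)) := by
  induction qs with
  | nil => rfl
  | cons q qs ih =>
    have h := ih fun q' hq' => hq q' (by simp [hq'])
    have h1 := filter_sparse_of_isolated hp (hq q (by simp)) he
    simp only [liftData, List.map_cons] at h ⊢
    simp only [liftResidues, bind_val, filterL_val, natTest_eq_val, natOp_val, NatOp.fn, h1, h,
      pure_val, Option.map_some]
    rw [Nat.mod_mod_of_dvd _ (dvd_mul_left q p)]

/-- An isolated exponent is recovered. -/
theorem candidate_of_isolated [CommRing R] {p e D : ℕ} {g : R[X]} (hp : 0 < p)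
    (he : e ∈ isolated p g) {qs : List ℕ} (hq : ∀ q ∈ qs, 0 < q)
    (hcop : qs.Pairwise Nat.Coprime) (hD : D ≤ qs.prod) (heD : e < D) :
    candidate 𝔸 (liftData p g qs) p D (e % p, g.coeff e) = some (e, g.coeff e) := by
  have h1 : ((qs.map fun q => (e % q, q)).map Prod.snd) = qs := by simp [Function.comp_def]
  obtain ⟨h2, -, h3⟩ := chineseRem_val (𝔸 := 𝔸) (qs.map fun q => (e % q, q)) 0 1 (by omega)
    (fun c hc => by
      obtain ⟨q, hq', rfl⟩ := List.mem_map.1 hc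
      exact ⟨Nat.mod_lt _ (hq q hq'), by simp⟩) (h1.symm ▸ hcop)
  have h4 : (chineseRem 𝔸 (qs.map fun q => (e % q, q)) 0 1).val = e := by
    rw [one_mul, h1] at h2
    have h5 : (chineseRem 𝔸 (qs.map fun q => (e % q, q)) 0 1).val ≡ e [MOD qs.prod] := by
      rw [Nat.modEq_list_prod_iff hcop]
      intro i
      exact h3 (e % qs.get i, qs.get i) (List.mem_map.2 ⟨qs.get i, List.get_mem _ _, rfl⟩)
    exact Nat.ModEq.eq_of_lt_of_lt h5 h2 (by omega)
  simp only [candidate, liftResidues_of_isolated hp he qs hq, Option.bind_some, h4, heD, if_true]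

end

end SLPInterp

namespace SLPInterp

open Timed Polynomial

section

variable {R : Type u} [CommRing R] [DecidableEq R] {𝔸 : Arith} {B : ℕ → ℕ}

/-! ### The steps of one pass -/

/-- The polynomial `g` modulo `X ^ p - 1` for the first `N` primes `p`. -/
noncomputable def images (N : ℕ) (g : R[X]) : List (ℕ × List R) :=
  (firstPrimes N).map fun p => (p, wrapVec p g)

omit [DecidableEq R] in
theorem take_images (k N : ℕ) (g : R[X]) : (images N g).take k = images (min k N) g := by
  rw [images, ← List.map_take, take_firstPrimes, images]

omit [DecidableEq R] in
theorem map_fst_images (N : ℕ) (g : R[X]) : (images N g).map Prod.fst = firstPrimes N := by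
  simp [images, Function.comp_def]

theorem zip_map_take {α : Type u} {β : Type v} {γ : Type w} (f : α → β) (f' : α → γ) (k : ℕ)
    (l : List α) : ((l.take k).map f).zip (l.map f') = (l.take k).map fun a => (f a, f' a) := by
  induction l generalizing k with
  | nil => simp
  | cons a l ih =>
    cases k with
    | zero => simp
    | succ k => simpa using ih k

omit [DecidableEq R] in
theorem zip_images {k N : ℕ} (h : k ≤ N) (g : R[X]) (e : ℕ) :
    (images k g).zip ((firstPrimes N).map fun p => e % p) =
      (firstPrimes k).map fun p => ((p, wrapVec p g), e % p) := by
  have := zip_map_take (fun p => (p, wrapVec p g)) (fun p => e % p) k (firstPrimes N)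
  rwa [take_firstPrimes, min_eq_left h] at this

/-- The pair found by `selectMax` has the largest number of terms; if this is `0`, it need not
belong to a prime. -/
theorem costs_selectMax (hB : CircBound 𝔸 B) {N Q σ T : ℕ} {g : R[X]} (hT : g.support.card ≤ T)
    (hσ : T.size ≤ σ) (hσ1 : 1 ≤ σ) (hQ : ∀ p ∈ firstPrimes N, p ≤ Q) :
    ∃ best, Costs (selectMax 𝔸 (images N g)) best (N * Q) (N * ((T + 1) * B σ)) ∧
      (∀ p ∈ firstPrimes N, (wrapSupport p g).card ≤ best.1) ∧
      (best.1 = 0 ∨ ∃ p ∈ firstPrimes N, best = ((wrapSupport p g).card, p, wrapVec p g)) := by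
  suffices H : ∀ (l : List ℕ), (∀ p ∈ l, p ≤ Q) → ∀ b : ℕ × ℕ × List R, b.1 ≤ T → ∃ best,
      Costs (foldL (fun best pf =>
        (countTerms 𝔸 pf.2).bind fun c =>
        (natTest 𝔸 .lt best.1 c).bind fun b => pure (if b then (c, pf) else best)) b
        (l.map fun p => (p, wrapVec p g))) best (l.length * Q) (l.length * ((T + 1) * B σ)) ∧
      b.1 ≤ best.1 ∧ (∀ p ∈ l, (wrapSupport p g).card ≤ best.1) ∧
      (best = b ∨ ∃ p ∈ l, best = ((wrapSupport p g).card, p, wrapVec p g)) by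
    obtain ⟨best, h1, -, h2, h3⟩ := H (firstPrimes N) hQ (0, 0, []) (Nat.zero_le _)
    rw [length_firstPrimes] at h1
    refine ⟨best, h1, h2, h3.imp_left fun h => ?_⟩
    rw [h]
  intro l
  induction l with
  | nil => exact fun _ b _ => ⟨b, by simpa [foldL] using Costs.pure b, le_rfl, by simp, Or.inl rfl⟩
  | cons p l ih =>
    intro hl b hb
    have hc : (wrapSupport p g).card ≤ T := (card_wrapSupport_le p g).trans hT
    have hcount := countTerms_val (𝔸 := 𝔸) p g
    have h1 : Costs (countTerms 𝔸 (wrapVec p g)) (wrapSupport p g).card Q (T * B σ) := by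
      have h2 := countTerms_val_eq (𝔸 := 𝔸) (wrapVec p g)
      rw [hcount] at h2
      refine ⟨hcount, ?_, ?_⟩
      · have := countTerms_ringOps_le (𝔸 := 𝔸) (wrapVec p g)
        rw [length_wrapVec] at this
        exact this.trans (hl p (by simp))
      · have := countTerms_bitOps_le hB (wrapVec p g) (by rw [← h2]; exact size_le_of_le hc hσ) hσ1
        rw [← h2] at this
        exact this.trans (Nat.mul_le_mul_right _ hc)
    have h2 : Costs (natTest 𝔸 .lt b.1 (wrapSupport p g).card)
        (decide (b.1 < (wrapSupport p g).card)) 0 (B σ) :=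
      ⟨natTest_lt_val _ _ _, le_rfl,
        hB.natTest_le (size_le_of_le hb hσ) (size_le_of_le hc hσ)⟩
    have h3 : Costs ((countTerms 𝔸 (wrapVec p g)).bind fun c => (natTest 𝔸 .lt b.1 c).bind fun b' =>
        pure (if b' then (c, p, wrapVec p g) else b))
        (if decide (b.1 < (wrapSupport p g).card) then
          ((wrapSupport p g).card, p, wrapVec p g) else b) (Q + (0 + 0)) (T * B σ + (B σ + 0)) :=
      h1.bind (h2.bind (Costs.pure _))
    obtain ⟨best, h4, h5, h6, h7⟩ := ih (fun p hp => hl p (by simp [hp]))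
      (if decide (b.1 < (wrapSupport p g).card) then
      ((wrapSupport p g).card, p, wrapVec p g) else b) (by split_ifs; exacts [hc, hb])
    refine ⟨best, ?_, ?_, ?_, ?_⟩
    · refine (Costs.foldL_cons h3 h4).mono ?_ ?_
      · rw [List.length_cons, Nat.succ_mul]; omega
      · rw [List.length_cons, Nat.succ_mul, Nat.succ_mul]; omega
    · refine le_trans ?_ h5
      split_ifs with h
      · exact (of_decide_eq_true h).le
      · exact le_rfl
    · intro p' hp'
      rcases List.mem_cons.1 hp' with rfl | hp'
      · refine le_trans ?_ h5
        split_ifs with h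
        · exact le_rfl
        · exact not_lt.1 fun hlt => h (decide_eq_true hlt)
      · exact h6 p' hp'
    · rcases h7 with rfl | ⟨p', hp', h7⟩
      · split_ifs
        · exact Or.inr ⟨p, by simp, rfl⟩
        · exact Or.inl rfl
      · exact Or.inr ⟨p', by simp [hp'], h7⟩

/-- The primes, among the first `k`, modulo which `g` seems to have the term `a X ^ e`. -/
noncomputable def votes (k : ℕ) (g : R[X]) (t : ℕ × R) : Finset ℕ :=
  (firstPrimes k).toFinset.filter fun p => wrap p t.1 g ≠ 0 ∧ wrap p t.1 g = t.2

theorem mem_votes {k p : ℕ} {g : R[X]} {t : ℕ × R} :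
    p ∈ votes k g t ↔ p ∈ firstPrimes k ∧ wrap p t.1 g ≠ 0 ∧ wrap p t.1 g = t.2 := by
  simp [votes]

theorem votes_subset (k : ℕ) (g : R[X]) (t : ℕ × R) : votes k g t ⊆ (firstPrimes k).toFinset :=
  fun _ hp => List.mem_toFinset.2 (mem_votes.1 hp).1

/-- A candidate is accepted if at least `V` of the first `k` primes vote for it. -/
theorem costs_testTerm (hB : CircBound 𝔸 B) {k N V σ : ℕ} (g : R[X]) (t : ℕ × R) (hk : k ≤ N)
    (hV : V ≤ N) (hσ : N.size ≤ σ) (hσ1 : 1 ≤ σ) (hQ : ∀ p ∈ firstPrimes N, p.size ≤ σ) :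
    Costs (testTerm 𝔸 (images k g) V (t, (firstPrimes N).map fun p => t.1 % p))
      (decide (V ≤ (votes k g t).card)) (3 * N) (N * (σ + B σ) + B σ) := by
  set f : ℕ → (ℕ × List R) × ℕ → Timed ℕ := fun k x =>
    (lowersCount x.1.2 x.2 t.2).bind fun b => if b then natOp 𝔸 .add k 1 else pure k with hf
  have H : ∀ (l : List ℕ), l.Nodup → (∀ p ∈ l, p ∈ firstPrimes N) → ∀ c, c + l.length ≤ N →
      Costs (foldL f c (l.map fun p => ((p, wrapVec p g), t.1 % p)))
        (c + (l.toFinset ∩ votes N g t).card) (3 * l.length) (l.length * (σ + B σ)) := by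
    intro l
    induction l with
    | nil => intro _ _ c _; simpa [foldL] using Costs.pure c
    | cons p l ih =>
      intro hnd hl c hc
      rw [List.length_cons] at hc
      obtain ⟨hpl, hnd⟩ := List.nodup_cons.1 hnd
      have hp := prime_of_mem_firstPrimes (hl p (by simp))
      have hlt := Nat.mod_lt t.1 hp.pos
      have hv : (lowersCount (wrapVec p g) (t.1 % p) t.2).val = decide (p ∈ votes N g t) := by
        rw [lowersCount_val, getD_wrapVec _ hlt, wrap_mod, decide_eq_decide, mem_votes]
        exact ⟨fun h => ⟨hl p (by simp), h⟩, fun h => h.2⟩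
      have h1 : Costs (lowersCount (wrapVec p g) (t.1 % p) t.2) (decide (p ∈ votes N g t)) 3 σ :=
        ⟨hv, le_rfl, size_le_of_le hlt.le (hQ p (hl p (by simp)))⟩
      have h2 : Costs (f c ((p, wrapVec p g), t.1 % p)) (c + if p ∈ votes N g t then 1 else 0) 3
          (σ + B σ) := by
        refine (h1.bind (r' := 0) (b' := B σ) ?_).mono le_rfl le_rfl
        by_cases h : p ∈ votes N g t
        · simp only [h, decide_true, if_true]
          exact hB.costs_natOp .add (size_le_of_le (by omega) hσ) (by rw [Nat.size_one]; exact hσ1)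
        · simp only [h, decide_false, Bool.false_eq_true, if_false, add_zero]
          exact (Costs.pure c).mono le_rfl (Nat.zero_le _)
      have h3 := ih hnd (fun p hp => hl p (by simp [hp])) (c + if p ∈ votes N g t then 1 else 0)
        (by split_ifs <;> omega)
      have h4 := Costs.foldL_cons h2 h3
      have h5 : ((p :: l).toFinset ∩ votes N g t).card =
          (if p ∈ votes N g t then 1 else 0) + (l.toFinset ∩ votes N g t).card := by
        rw [List.toFinset_cons]
        split_ifs with h
        · rw [Finset.insert_inter_of_mem h, Finset.card_insert_of_notMem, add_comm]
          simp [hpl]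
        · rw [Finset.insert_inter_of_notMem h, zero_add]
      rw [h5, ← add_assoc]
      refine h4.mono ?_ ?_
      · rw [List.length_cons]; omega
      · rw [List.length_cons, Nat.succ_mul]; omega
  have hsub : ∀ p ∈ firstPrimes k, p ∈ firstPrimes N := fun p hp => by
    rw [← min_eq_left hk, ← take_firstPrimes] at hp
    exact List.mem_of_mem_take hp
  have hvotes : (firstPrimes k).toFinset ∩ votes N g t = votes k g t := by
    ext p
    rw [Finset.mem_inter, List.mem_toFinset, mem_votes, mem_votes]
    exact ⟨fun h => ⟨h.1, h.2.2⟩, fun h => ⟨h.1, hsub p h.1, h.2⟩⟩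
  have h1 := H (firstPrimes k) (nodup_firstPrimes k) hsub 0 (by rw [length_firstPrimes]; omega)
  rw [length_firstPrimes, hvotes, zero_add, ← zip_images hk] at h1
  have hcard : (votes k g t).card ≤ N := by
    refine (Finset.card_le_card (votes_subset k g t)).trans ((List.toFinset_card_le _).trans ?_)
    rwa [length_firstPrimes]
  have h2 : Costs (natTest 𝔸 .lt (votes k g t).card V) (decide ((votes k g t).card < V)) 0 (B σ) :=
    ⟨natTest_lt_val _ _ _, le_rfl,
      hB.natTest_le (size_le_of_le hcard hσ) (size_le_of_le hV hσ)⟩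
  have h3 : Costs (testTerm 𝔸 (images k g) V (t, (firstPrimes N).map fun p => t.1 % p))
      (!decide ((votes k g t).card < V)) (3 * k + (0 + 0)) (k * (σ + B σ) + (B σ + 0)) :=
    h1.bind (h2.bind (Costs.pure _))
  have h4 : (!decide ((votes k g t).card < V)) = decide (V ≤ (votes k g t).card) := by
    rw [← decide_not, decide_eq_decide, not_lt]
  rw [h4] at h3
  refine h3.mono (by omega) ?_
  have := Nat.mul_le_mul_right (σ + B σ) hk
  omega

omit [DecidableEq R] in
/-- The update of the images after new terms have been found. -/
theorem costs_update {N N' σ : ℕ} (hN : N' ≤ N) (hQ : ∀ p ∈ firstPrimes N, p.size ≤ σ)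
    (s : List (ℕ × R)) (g : R[X]) :
    Costs (foldL (fun (fs : List (ℕ × List R)) (c : (ℕ × R) × List ℕ) =>
      mapL (fun x : (ℕ × List R) × ℕ =>
        (subAt x.1.2 x.2 c.1.2).bind fun v => pure (x.1.1, v)) (fs.zip c.2))
      (images N' g) (s.map fun t => (t, (firstPrimes N).map fun p => t.1 % p)))
      (images N' (g - polyOf s)) (s.length * N) (s.length * (N * σ)) := by
  induction s generalizing g with
  | nil => simpa [foldL, polyOf] using Costs.pure (images N' g)
  | cons t s ih =>
    have hmem : ∀ p ∈ firstPrimes N', p ∈ firstPrimes N := fun p hp => by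
      rw [← min_eq_left hN, ← take_firstPrimes] at hp
      exact List.mem_of_mem_take hp
    have h1 : Costs (mapL (fun x : (ℕ × List R) × ℕ =>
        (subAt x.1.2 x.2 t.2).bind fun v => pure (x.1.1, v))
        ((images N' g).zip ((firstPrimes N).map fun p => t.1 % p)))
        (images N' (g - monomial t.1 t.2)) N (N * σ) := by
      rw [zip_images hN]
      have h2 := Costs.mapL (r := 1) (b := σ) (f := fun x : (ℕ × List R) × ℕ =>
          (subAt x.1.2 x.2 t.2).bind fun v => pure (x.1.1, v))
        (l := (firstPrimes N').map fun p => ((p, wrapVec p g), t.1 % p))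
        (f' := fun x => (x.1.1, (subAt x.1.2 x.2 t.2).val)) fun x hx => by
          obtain ⟨p, hp, rfl⟩ := List.mem_map.1 hx
          refine ⟨rfl, le_rfl, ?_⟩
          exact size_le_of_le (Nat.mod_lt _ (prime_of_mem_firstPrimes hp).pos).le (hQ p (hmem p hp))
      rw [List.length_map, length_firstPrimes, List.map_map] at h2
      refine ⟨?_, h2.ringOps_le.trans (by omega), h2.bitOps_le.trans (Nat.mul_le_mul_right _ hN)⟩
      rw [h2.val_eq]
      refine List.map_congr_left fun p _ => ?_
      simp only [Function.comp, subAt_wrapVec]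
    have h2 := Costs.foldL_cons (f := fun (fs : List (ℕ × List R)) (c : (ℕ × R) × List ℕ) =>
      mapL (fun x : (ℕ × List R) × ℕ =>
        (subAt x.1.2 x.2 c.1.2).bind fun v => pure (x.1.1, v)) (fs.zip c.2))
      (a := (t, (firstPrimes N).map fun p => t.1 % p)) h1 (ih (g - monomial t.1 t.2))
    have h3 : g - polyOf (t :: s) = g - monomial t.1 t.2 - polyOf s := by
      simp [polyOf, sub_sub]
    rw [h3]
    refine h2.mono ?_ ?_ <;> rw [List.length_cons, Nat.succ_mul] <;> omega

end

end SLPInterp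

namespace SLPInterp

open Timed Polynomial

section

variable {R : Type u} [CommRing R] [DecidableEq R] {𝔸 : Arith} {B : ℕ → ℕ}

/-! ### The loop -/

theorem numBad_mono {T T' D : ℕ} (hD : 0 < D) (h : T ≤ T') : numBad T D ≤ numBad T' D :=
  max_le_max le_rfl (Nat.clog_mono_right _ (Nat.pow_le_pow_right hD (by omega)))

theorem numVotes_mono {T T' D : ℕ} (hD : 0 < D) (h : T ≤ T') : numVotes T D ≤ numVotes T' D :=
  Nat.clog_mono_right _ (Nat.pow_le_pow_right hD h)

theorem numPrimes_mono {T T' D : ℕ} (hD : 0 < D) (h : T ≤ T') : numPrimes T D ≤ numPrimes T' D := by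
  have h1 := numBad_mono hD h
  have h2 := numVotes_mono hD h
  exact max_le_max (by omega) (by omega)

/-- Bounds for the quantities on which the cost of the interpolation depends: the numbers of terms
(`terms`), of primes (`primes`) and of primes for Chinese remaindering (`lifts`), the sizes of these
primes (`Q` and `q`), the widths of short and long integers, and the costs of a probe, of a
remainder tree and of the computation of `N₁, N₂, N`. -/
structure Budget where
  terms : ℕ
  primes : ℕ
  lifts : ℕ
  Q : ℕ
  q : ℕ
  short : ℕ
  long : ℕ
  probeRing : ℕ
  probeBit : ℕ
  residuesBit : ℕ
  boundsBit : ℕ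

/-- The budget is sufficient for the interpolation of `g` with exponents smaller than `D`. -/
structure Budget.Valid (b : Budget) (𝔸 : Arith) (B : ℕ → ℕ) (probe : ℕ → Timed (List R)) (D : ℕ)
    (qs : List ℕ) (g : R[X]) : Prop where
  circ : CircBound 𝔸 B
  pos : 0 < D
  lt_of_mem : ∀ d ∈ g.support, d < D
  card_le : g.support.card ≤ b.terms
  primes_le : numPrimes b.terms D ≤ b.primes
  le_Q : ∀ p ∈ firstPrimes b.primes, p ≤ b.Q
  lifts_le : qs.length ≤ b.lifts
  pos_of_mem : ∀ x ∈ qs, 0 < x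
  le_q : ∀ x ∈ qs, x ≤ b.q
  coprime : qs.Pairwise Nat.Coprime
  le_prod : g ≠ 0 → D ≤ qs.prod
  short_pos : 1 ≤ b.short
  size_mul_le : (b.Q * (b.q + 1)).size ≤ b.short
  size_terms_le : b.terms.size ≤ b.short
  size_primes_le : b.primes.size ≤ b.short
  size_q_le : 2 * b.q.size + 1 ≤ b.short
  short_le : b.short ≤ b.long
  size_le : D.size ≤ b.long
  size_prod_le : qs.prod.size ≤ b.long
  probe_costs : ∀ m, 0 < m → m ≤ b.Q * (b.q + 1) →
    Costs (probe m) (wrapVec m g) b.probeRing b.probeBit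
  residues_le : ∀ e < D, ∀ N ≤ b.primes, (residues 𝔸 e (firstPrimes N)).bitOps ≤ b.residuesBit
  bounds_le : ∀ T ≤ b.terms, (bounds 𝔸 T D).bitOps ≤ b.boundsBit

/-- The number of ring operations in one pass that is followed by `r` others. -/
def Budget.passRing (b : Budget) (r : ℕ) : ℕ :=
  b.primes * b.Q + (0 + (b.lifts * (0 + (b.probeRing + (b.terms + (b.Q * (b.q + 1) + 0)))) +
    (b.Q + (b.terms * b.terms + (b.terms * (0 + 0) + (b.terms * (3 * b.primes) +
      (0 + (0 + (b.terms * b.primes + r)))))))))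

/-- The number of bit operations in one pass that is followed by `k` others. -/
def Budget.passBit (b : Budget) (B : ℕ → ℕ) (k : ℕ) : ℕ :=
  b.primes * ((b.terms + 1) * B b.short) + (B b.short + (b.lifts * (B b.short + (b.probeBit +
    (b.terms * (B b.long + b.short) + (b.terms * b.short + 0)))) + (b.terms * b.short +
    (b.terms * (b.lifts * (b.terms * (2 * B b.short) + B b.short) +
      b.lifts * (5 * B b.long + b.q * (5 * B b.short)) + B b.long + b.terms * B b.long) +
    (b.terms * (b.residuesBit + 0) + (b.terms * (b.primes * (b.short + B b.short) + B b.short) +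
    (B b.short + (b.boundsBit + (b.terms * (b.primes * b.short) + k)))))))))

theorem Budget.passRing_eq (b : Budget) (r : ℕ) : b.passRing r = b.passRing 0 + r := by
  unfold Budget.passRing; omega

theorem Budget.passBit_eq (b : Budget) (B : ℕ → ℕ) (k : ℕ) :
    b.passBit B k = b.passBit B 0 + k := by
  unfold Budget.passBit; omega

variable {b : Budget} {probe : ℕ → Timed (List R)} {D : ℕ} {qs : List ℕ} {g₀ : R[X]}

omit [DecidableEq R] in
theorem Budget.Valid.size_prime_le (hv : b.Valid 𝔸 B probe D qs g₀) {p N : ℕ}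
    (hN : N ≤ b.primes) (hp : p ∈ firstPrimes N) : p ≤ b.Q ∧ p.size ≤ b.short := by
  have h1 : p ∈ firstPrimes b.primes := by
    rw [← min_eq_left hN, ← take_firstPrimes] at hp
    exact List.mem_of_mem_take hp
  refine ⟨hv.le_Q p h1, size_le_of_le ((hv.le_Q p h1).trans ?_) hv.size_mul_le⟩
  exact Nat.le_mul_of_pos_right _ (Nat.succ_pos _)

/-- If no term is left, the loop ends. -/
theorem uiLoop_of_eq_zero (hv : b.Valid 𝔸 B probe D qs g₀) {T : ℕ} (hT : T ≤ b.terms)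
    (h : List (ℕ × R)) (fuel N₁ N₂ : ℕ) :
    Costs (uiLoop 𝔸 probe D qs fuel T N₁ N₂ (images (numPrimes T D) (0 : R[X])) h) h (b.passRing 0)
      (b.passBit B 0) := by
  cases fuel with
  | zero => exact (Costs.pure h).mono (Nat.zero_le _) (Nat.zero_le _)
  | succ fuel =>
    have hN : numPrimes T D ≤ b.primes := (numPrimes_mono hv.pos hT).trans hv.primes_le
    obtain ⟨best, h1, -, h2⟩ := costs_selectMax hv.circ (N := numPrimes T D) (Q := b.Q)
      (g := (0 : R[X])) (T := b.terms) (by simp) hv.size_terms_le hv.short_pos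
      fun p hp => (hv.size_prime_le hN hp).1
    have h3 : best.1 = 0 := by
      rcases h2 with h2 | ⟨p, -, rfl⟩
      · exact h2
      · exact Nat.le_zero.1 ((card_wrapSupport_le p (0 : R[X])).trans_eq (by simp))
    have h4 : Costs (natTest 𝔸 .eq best.1 0) true 0 (B b.short) := by
      refine ⟨by simp [h3], le_rfl, hv.circ.natTest_le ?_ ?_⟩ <;> simp [h3]
    refine Costs.mono (r := numPrimes T D * b.Q + (0 + 0))
      (b := numPrimes T D * ((b.terms + 1) * B b.short) + (B b.short + 0)) ?_ ?_ ?_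
    · rw [uiLoop]
      exact Costs.bind h1 (Costs.bind h4 (Costs.pure h))
    · have := Nat.mul_le_mul_right b.Q hN
      unfold Budget.passRing; omega
    · have := Nat.mul_le_mul_right ((b.terms + 1) * B b.short) hN
      unfold Budget.passBit; omega

/-- A pass finds more than half of the terms, and nothing but terms. -/
theorem accepted_terms (hD0 : 0 < D) {g : R[X]} {T p N : ℕ} (hne : g ≠ 0)
    (hT : g.support.card ≤ T)
    (hD : ∀ d ∈ g.support, d < D) (hN : N = numPrimes T D) (hp : p ∈ firstPrimes N)
    (hmax : ∀ p' ∈ firstPrimes N, (wrapSupport p' g).card ≤ (wrapSupport p g).card)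
    (hqs : ∀ q ∈ qs, 0 < q) (hcop : qs.Pairwise Nat.Coprime) (hprod : D ≤ qs.prod)
    {acc : List (ℕ × R)}
    (hacc : acc = (uTerms 𝔸 (sparse (wrapVec p g)).val (liftData p g qs) p D).val.filter
      fun t => decide (numVotes T D ≤ (votes (numBad T D + numVotes T D - 1) g t).card)) :
    acc.Nodup ∧ (∀ t ∈ acc, g.coeff t.1 = t.2 ∧ t.2 ≠ 0) ∧ g.support.card < 2 * acc.length := by
  have hp0 := (prime_of_mem_firstPrimes hp).pos
  have hT0 : 0 < T :=
    lt_of_lt_of_le (Finset.card_pos.2 (Polynomial.support_nonempty.2 hne)) hT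
  obtain ⟨hU1, hU2⟩ := uTerms_val (𝔸 := 𝔸) (liftData p g qs) p D (sparse (wrapVec p g)).val
  have hnb : 1 ≤ numBad T D := le_max_left _ _
  set k := numBad T D + numVotes T D - 1 with hk
  have hprimes : ∀ k, ∀ p ∈ (firstPrimes k).toFinset, p.Prime := fun k p hp =>
    prime_of_mem_firstPrimes (List.mem_toFinset.1 hp)
  have hcard : ∀ k, (firstPrimes k).toFinset.card = k := fun k => by
    rw [List.toFinset_card_of_nodup (nodup_firstPrimes k), length_firstPrimes]
  refine ⟨hacc ▸ hU1.filter _, fun t ht => ?_, ?_⟩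
  · rw [hacc, List.mem_filter, hU2, decide_eq_true_eq] at ht
    obtain ⟨⟨⟨d, a⟩, hd, hc⟩, hvotes⟩ := ht
    obtain ⟨h1, h2⟩ := candidate_eq_some hc
    obtain ⟨h3, h4, h5⟩ := mem_sparse.1 hd
    simp only at h2
    refine ⟨?_, h2 ▸ h5⟩
    rcases Nat.lt_or_ge D 2 with hD1 | hD2
    · -- Here `g` is constant, `N₂` is `0`, and the constant term is the only candidate.
      have h6 : t.1 = 0 := by omega
      have h7 : ∀ d ∈ g.support, d = 0 := fun d hd => by have := hD d hd; omega
      obtain ⟨d', hd', h8⟩ := exists_of_wrap_ne_zero (h4 ▸ h5 : wrap p d g ≠ 0)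
      rw [h7 d' hd', Nat.zero_mod, Nat.mod_eq_of_lt h3] at h8
      rw [h6, h2, ← h4, ← h8]
      exact (wrap_eq_coeff_of_unique fun d hd _ => h7 d hd).symm
    · by_contra hne'
      have := card_votes_lt_of_not_term hD2 hT0 hT hD h1 hne' (Q := votes k g t)
        (fun p hp => hprimes k p (votes_subset k g t hp)) fun p hp => (mem_votes.1 hp).2.2
      omega
  -- All isolated exponents are recovered as candidates, and accepted.
  · have h1 : g.support.card < 2 * (isolated p g).card := by
      refine card_support_lt_two_mul_card_isolated (P := (firstPrimes N).toFinset) (D := D) (T := T)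
        hne hT hD (hprimes N) ?_ fun p' hp' => hmax p' (List.mem_toFinset.1 hp')
      rw [hcard, hN]
      exact le_max_left _ _
    have h2 : isolated p g ⊆ (acc.map Prod.fst).toFinset := by
      intro e he
      have hes := isolated_subset p g he
      have hw := wrap_of_isolated he
      rw [List.mem_toFinset, List.mem_map]
      refine ⟨(e, g.coeff e), ?_, rfl⟩
      rw [hacc, List.mem_filter, hU2, decide_eq_true_eq]
      refine ⟨⟨(e % p, g.coeff e), ?_, candidate_of_isolated hp0 he hqs hcop hprod (hD e hes)⟩, ?_⟩
      · rw [mem_sparse, wrap_mod]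
        exact ⟨Nat.mod_lt _ hp0, hw⟩
      · refine le_card_votes_of_term hT hD hes (hprimes k) (votes_subset k g _) ?_ ?_
        · rw [hcard]; omega
        · intro p' hp' hw'
          rw [mem_votes]
          exact ⟨List.mem_toFinset.1 hp', by rw [hw']; exact hw.2, hw'⟩
    have h3 := (Finset.card_le_card h2).trans (List.toFinset_card_le _)
    rw [List.length_map] at h3
    omega

/-- The cost of the polynomials `g` modulo `X ^ (p q) - 1`, obtained from probes of `g₀` by
subtracting the terms found before. -/
theorem Budget.Valid.costs_liftData (hv : b.Valid 𝔸 B probe D qs g₀) {h : List (ℕ × R)}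
    (hh : h.length ≤ b.terms) (hhD : ∀ t ∈ h, t.1 < D) {g : R[X]} (hg : g = g₀ - polyOf h)
    (hgt : g.support.card ≤ b.terms) {p : ℕ} (hp0 : 0 < p) (hpQ : p ≤ b.Q)
    (hpσ : p.size ≤ b.short) :
    Costs (mapL (fun q =>
      (natOp 𝔸 .mul p q).bind fun m =>
      (probe m).bind fun v =>
      (subPoly 𝔸 m v h).bind fun v' =>
      (sparse v').bind fun g => pure (q, g)) qs) (liftData p g qs)
      (b.lifts * (0 + (b.probeRing + (b.terms + (b.Q * (b.q + 1) + 0)))))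
      (b.lifts * (B b.short + (b.probeBit + (b.terms * (B b.long + b.short) +
        (b.terms * b.short + 0))))) := by
  have hB := hv.circ
  refine Costs.mono (Costs.mapL (f' := fun x => (x, (sparse (wrapVec (p * x) g)).val))
    fun x hx => ?_) (Nat.mul_le_mul_right _ hv.lifts_le) (Nat.mul_le_mul_right _ hv.lifts_le)
  have hx0 := hv.pos_of_mem x hx
  have hxq := hv.le_q x hx
  have hm0 : 0 < p * x := Nat.mul_pos hp0 hx0
  have hm : p * x ≤ b.Q * (b.q + 1) := Nat.mul_le_mul hpQ (by omega)
  have hmσ : (p * x).size ≤ b.short := size_le_of_le hm hv.size_mul_le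
  have hxσ : x.size ≤ b.short := size_le_of_le (Nat.le_mul_of_pos_left _ hp0) hmσ
  have c1 := hB.costs_natOp .mul hpσ hxσ
  have c2 := hv.probe_costs (p * x) hm0 hm
  have c3 : Costs (subPoly 𝔸 (p * x) (wrapVec (p * x) g₀) h) (wrapVec (p * x) g) b.terms
      (b.terms * (B b.long + b.short)) := by
    refine ⟨by rw [subPoly_val, hg], (subPoly_ringOps_le _ _ _).trans hh, ?_⟩
    refine (subPoly_bitOps_le hB hm0 (hmσ.trans hv.short_le) _ h fun t ht =>
      size_le_of_le (hhD t ht).le hv.size_le).trans ?_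
    exact Nat.mul_le_mul hh (by omega)
  have c4 : Costs (sparse (wrapVec (p * x) g)) (sparse (wrapVec (p * x) g)).val (b.Q * (b.q + 1))
      (b.terms * b.short) :=
    ⟨rfl, by rw [sparse_ringOps]; exact hm, (sparse_bitOps_le _ _).trans (Nat.mul_le_mul hgt hmσ)⟩
  exact c1.bind (c2.bind (c3.bind (c4.bind (Costs.pure _))))

/-- The cost of lifting the terms modulo `X ^ p - 1`. -/
theorem Budget.Valid.costs_uTerms (hv : b.Valid 𝔸 B probe D qs g₀) {g : R[X]}
    (hgt : g.support.card ≤ b.terms) {p : ℕ} (hp0 : 0 < p) (hpQ : p ≤ b.Q)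
    (hpσ : p.size ≤ b.short) :
    Costs (uTerms 𝔸 (sparse (wrapVec p g)).val (liftData p g qs) p D)
      (uTerms 𝔸 (sparse (wrapVec p g)).val (liftData p g qs) p D).val
      (b.terms * b.terms) (b.terms * (b.lifts * (b.terms * (2 * B b.short) + B b.short) +
      b.lifts * (5 * B b.long + b.q * (5 * B b.short)) + B b.long + b.terms * B b.long)) := by
  have hB := hv.circ
  have hflen : (sparse (wrapVec p g)).val.length ≤ b.terms := by
    rw [length_sparse]; exact (card_wrapSupport_le p g).trans hgt
  refine ⟨rfl, (uTerms_ringOps_le _ _ _ _).trans (Nat.mul_le_mul hflen hflen), ?_⟩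
  refine (uTerms_bitOps_le hB (w := b.short) (w₁ := b.long) (w₂ := b.short) (t := b.terms)
    (q := b.q) _ _ hpσ ?_ ?_ ?_ ?_ ?_ hv.size_le ?_ hv.size_q_le).trans ?_
  · rintro ⟨e, a⟩ hx
    exact size_le_of_le (mem_sparse.1 hx).1.le hpσ
  · intro x hx
    obtain ⟨y, hy, rfl⟩ := List.mem_map.1 hx
    refine ⟨hv.pos_of_mem y hy, size_le_of_le ?_ hv.size_mul_le, hv.le_q y hy⟩
    exact ((hv.le_q y hy).trans (Nat.le_succ _)).trans
      (Nat.le_mul_of_pos_left _ (lt_of_lt_of_le hp0 hpQ))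
  · intro x hx
    obtain ⟨y, -, rfl⟩ := List.mem_map.1 hx
    simp only [length_sparse]
    exact (card_wrapSupport_le _ g).trans hgt
  · intro x hx
    obtain ⟨y, hy, rfl⟩ := List.mem_map.1 hx
    rintro ⟨e, a⟩ hea
    refine size_le_of_le ((mem_sparse.1 hea).1.le.trans ?_) hv.size_mul_le
    exact Nat.mul_le_mul hpQ ((hv.le_q y hy).trans (Nat.le_succ _))
  · rw [map_fst_liftData]; exact hv.coprime
  · rw [map_fst_liftData]; exact hv.size_prod_le
  · have hlen : (liftData p g qs).length ≤ b.lifts := by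
      rw [liftData, List.length_map]; exact hv.lifts_le
    gcongr

/-- One pass of the loop finds a set `acc` of terms, more than half of those that are left. The
result and the cost of the loop are given in terms of those of the following passes. -/
theorem uiLoop_pass (hv : b.Valid 𝔸 B probe D qs g₀) {T : ℕ} (hT : T ≤ b.terms)
    {h : List (ℕ × R)} (hh : h.length ≤ b.terms) (hhD : ∀ t ∈ h, t.1 < D) {g : R[X]}
    (hg : g = g₀ - polyOf h) (hne : g ≠ 0) (hgT : g.support.card ≤ T) (hgD : ∀ d ∈ g.support, d < D)
    (hprod : D ≤ qs.prod) (fuel : ℕ) :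
    ∃ acc : List (ℕ × R), acc.Nodup ∧ (∀ t ∈ acc, g.coeff t.1 = t.2 ∧ t.2 ≠ 0) ∧
      g.support.card < 2 * acc.length ∧ ∀ v r k,
      Costs (uiLoop 𝔸 probe D qs fuel (T - acc.length) (numBad (T - acc.length) D)
        (numVotes (T - acc.length) D) (images (numPrimes (T - acc.length) D) (g - polyOf acc))
        (h ++ acc)) v r k →
      Costs (uiLoop 𝔸 probe D qs (fuel + 1) T (numBad T D) (numVotes T D)
        (images (numPrimes T D) g) h) v (b.passRing r) (b.passBit B k) := by
  have hB := hv.circ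
  set N := numPrimes T D with hNdef
  have hN : N ≤ b.primes := (numPrimes_mono hv.pos hT).trans hv.primes_le
  have hNσ : N.size ≤ b.short := size_le_of_le hN hv.size_primes_le
  have hnb : 1 ≤ numBad T D := le_max_left _ _
  have hkN : numBad T D + numVotes T D - 1 ≤ N := le_max_right _ _
  have hgt : g.support.card ≤ b.terms := hgT.trans hT
  obtain ⟨best, h1, hmax, h2⟩ := costs_selectMax hB (N := N) (Q := b.Q) hgt hv.size_terms_le
    hv.short_pos fun p hp => (hv.size_prime_le hN hp).1
  have hcard : ∀ k, (firstPrimes k).toFinset.card = k := fun k => by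
    rw [List.toFinset_card_of_nodup (nodup_firstPrimes k), length_firstPrimes]
  -- If no image had any term, then no exponent would be isolated.
  have hbest : best.1 ≠ 0 := by
    intro h0
    have hN4 : 4 * numBad T D ≤ N := le_max_left _ _
    have hmem : Nat.nth Nat.Prime 0 ∈ firstPrimes N :=
      List.mem_map.2 ⟨0, List.mem_range.2 (by omega), rfl⟩
    have h3 := card_support_lt_two_mul_card_isolated (P := (firstPrimes N).toFinset) (D := D)
      (T := T) (q := Nat.nth Nat.Prime 0) hne hgT hgD
      (fun p hp => prime_of_mem_firstPrimes (List.mem_toFinset.1 hp)) (by rw [hcard]; exact hN4)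
      fun p hp => ((hmax p (List.mem_toFinset.1 hp)).trans h0.le).trans (Nat.zero_le _)
    have h4 := card_isolated_le (prime_of_mem_firstPrimes hmem).pos g
    have h5 := hmax _ hmem
    omega
  obtain ⟨p, hp, hbp⟩ := h2.resolve_left hbest
  obtain ⟨hpQ, hpσ⟩ := hv.size_prime_le hN hp
  have hp0 := (prime_of_mem_firstPrimes hp).pos
  have hdone : Costs (natTest 𝔸 .eq best.1 0) false 0 (B b.short) := by
    refine ⟨by simp [hbest], le_rfl, hB.natTest_le ?_ (by simp)⟩
    rw [hbp]
    exact size_le_of_le ((card_wrapSupport_le p g).trans hgt) hv.size_terms_le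
  subst hbp
  have hgs := hv.costs_liftData hh hhD hg hgt hp0 hpQ hpσ
  have hf₀ : Costs (sparse (wrapVec p g)) (sparse (wrapVec p g)).val b.Q (b.terms * b.short) :=
    ⟨rfl, by rw [sparse_ringOps]; exact hpQ,
      (sparse_bitOps_le _ _).trans (Nat.mul_le_mul hgt hpσ)⟩
  have hflen : (sparse (wrapVec p g)).val.length ≤ b.terms := by
    rw [length_sparse]; exact (card_wrapSupport_le p g).trans hgt
  set U := (uTerms 𝔸 (sparse (wrapVec p g)).val (liftData p g qs) p D).val with hU
  have hUlen : U.length ≤ b.terms := (length_uTerms_le _ _ _ _).trans hflen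
  have hUD : ∀ t ∈ U, t.1 < D := fun t ht => by
    obtain ⟨x, -, h⟩ := ((uTerms_val (liftData p g qs) p D (sparse (wrapVec p g)).val).2 t).1 ht
    exact (candidate_eq_some h).1
  have hUc := hv.costs_uTerms hgt hp0 hpQ hpσ
  have hcands : Costs (mapL (fun t => (residues 𝔸 t.1 ((images N g).map Prod.fst)).bind fun rs =>
      pure (t, rs)) U) (U.map fun t => (t, (firstPrimes N).map fun p => t.1 % p))
      (b.terms * (0 + 0)) (b.terms * (b.residuesBit + 0)) := by
    refine Costs.mono (Costs.mapL (r := 0 + 0) (b := b.residuesBit + 0) fun t ht => ?_)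
      (Nat.mul_le_mul_right _ hUlen) (Nat.mul_le_mul_right _ hUlen)
    rw [map_fst_images]
    refine Costs.bind ⟨residues_val _ _, (residues_ringOps _ _).le, ?_⟩ (Costs.pure _)
    exact hv.residues_le t.1 (hUD t ht) N hN
  set acc := U.filter fun t =>
    decide (numVotes T D ≤ (votes (numBad T D + numVotes T D - 1) g t).card) with hacc
  obtain ⟨ha1, ha2, ha3⟩ := accepted_terms (𝔸 := 𝔸) hv.pos hne hgT hgD hNdef hp hmax hv.pos_of_mem
    hv.coprime hprod hacc
  refine ⟨acc, ha1, ha2, ha3, fun v r k hnext => ?_⟩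
  have hs : Costs (filterL (testTerm 𝔸 ((images N g).take (numBad T D + numVotes T D - 1))
      (numVotes T D)) (U.map fun t => (t, (firstPrimes N).map fun p => t.1 % p)))
      (acc.map fun t => (t, (firstPrimes N).map fun p => t.1 % p))
      (b.terms * (3 * b.primes)) (b.terms * (b.primes * (b.short + B b.short) + B b.short)) := by
    have h3 := Costs.filterL (f := testTerm 𝔸 ((images N g).take (numBad T D + numVotes T D - 1))
      (numVotes T D)) (l := U.map fun t => (t, (firstPrimes N).map fun p => t.1 % p))
      (f' := fun c => decide (numVotes T D ≤ (votes (numBad T D + numVotes T D - 1) g c.1).card))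
      (r := 3 * b.primes) (b := b.primes * (b.short + B b.short) + B b.short) fun c hc => by
        obtain ⟨t, -, rfl⟩ := List.mem_map.1 hc
        rw [take_images, min_eq_left hkN]
        refine (costs_testTerm hB g t hkN (by omega) hNσ hv.short_pos
          fun p hp => (hv.size_prime_le hN hp).2).mono (by omega) ?_
        gcongr
    rw [List.length_map, List.filter_map] at h3
    exact h3.mono (Nat.mul_le_mul_right _ hUlen) (Nat.mul_le_mul_right _ hUlen)
  have hacclen : acc.length ≤ b.terms := (List.length_filter_le _ _).trans hUlen
  have hsub : Costs (natOp 𝔸 .sub T (acc.map fun t =>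
      (t, (firstPrimes N).map fun p => t.1 % p)).length) (T - acc.length) 0 (B b.short) := by
    rw [List.length_map]
    exact hB.costs_natOp .sub (size_le_of_le hT hv.size_terms_le)
      (size_le_of_le hacclen hv.size_terms_le)
  have hbounds : Costs (bounds 𝔸 (T - acc.length) D) (numBad (T - acc.length) D,
      numVotes (T - acc.length) D, numPrimes (T - acc.length) D) 0 b.boundsBit :=
    ⟨bounds_val _ _, (bounds_ringOps _ _).le, hv.bounds_le _ (by omega)⟩
  have hN' : numPrimes (T - acc.length) D ≤ N := numPrimes_mono hv.pos (by omega)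
  have hupdate := costs_update hN' (fun p hp => (hv.size_prime_le hN hp).2) acc g
  rw [← min_eq_left hN', ← take_images] at hupdate
  have hupdate' := hupdate.mono (r' := b.terms * b.primes) (b' := b.terms * (b.primes * b.short))
    (Nat.mul_le_mul hacclen hN) (Nat.mul_le_mul hacclen (Nat.mul_le_mul_right _ hN))
  have hnext' : Costs (uiLoop 𝔸 probe D qs fuel (T - acc.length) (numBad (T - acc.length) D)
      (numVotes (T - acc.length) D) (images (min (numPrimes (T - acc.length) D) N)
        (g - polyOf acc)) (h ++ (acc.map fun t =>
      (t, (firstPrimes N).map fun p => t.1 % p)).map Prod.fst)) v r k := by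
    rw [min_eq_left hN', List.map_map]
    simpa [Function.comp_def] using hnext
  rw [uiLoop, Budget.passRing, Budget.passBit]
  refine Costs.bind (h1.mono (Nat.mul_le_mul_right _ hN) (Nat.mul_le_mul_right _ hN)) ?_
  refine Costs.bind hdone ?_
  rw [if_neg Bool.false_ne_true]
  dsimp only
  exact Costs.bind hgs (Costs.bind hf₀ (Costs.bind hUc (Costs.bind hcands (Costs.bind hs
    (Costs.bind hsub (Costs.bind hbounds (Costs.bind hupdate' hnext')))))))

end

end SLPInterp

namespace SLPInterp

open Timed Polynomial

section

variable {R : Type u} [CommRing R] [DecidableEq R] {𝔸 : Arith} {B : ℕ → ℕ}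
  {b : Budget} {probe : ℕ → Timed (List R)} {D : ℕ} {qs : List ℕ} {g₀ : R[X]}

/-- The loop lists the terms that are left, in at most `log₂ #g + 2` passes. -/
theorem costs_uiLoop (hv : b.Valid 𝔸 B probe D qs g₀) (fuel : ℕ) {T : ℕ} (hT : T ≤ b.terms)
    {h : List (ℕ × R)} (hhD : ∀ t ∈ h, t.1 < D) {g : R[X]} (hg : g = g₀ - polyOf h)
    (hlen : h.length + g.support.card ≤ b.terms) (hgT : g.support.card ≤ T)
    (hfuel : g.support.card ≤ fuel) (hgD : ∀ d ∈ g.support, d < D)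
    (hprod : g ≠ 0 → D ≤ qs.prod) :
    ∃ l, IsTermList l g ∧ Costs (uiLoop 𝔸 probe D qs fuel T (numBad T D) (numVotes T D)
      (images (numPrimes T D) g) h) (h ++ l) ((g.support.card.size + 1) * b.passRing 0)
      ((g.support.card.size + 1) * b.passBit B 0) := by
  induction fuel generalizing T h g with
  | zero =>
    have hg0 : g = 0 := Polynomial.card_support_eq_zero.1 (Nat.le_zero.1 hfuel)
    subst hg0
    refine ⟨[], isTermList_nil, ?_⟩
    rw [List.append_nil]
    simpa using uiLoop_of_eq_zero hv hT h 0 (numBad T D) (numVotes T D)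
  | succ fuel ih =>
    rcases eq_or_ne g 0 with hg0 | hne
    · subst hg0
      refine ⟨[], isTermList_nil, ?_⟩
      rw [List.append_nil]
      simpa using uiLoop_of_eq_zero hv hT h (fuel + 1) (numBad T D) (numVotes T D)
    · obtain ⟨acc, h1, h2, h3, h4⟩ := uiLoop_pass hv hT (by omega) hhD hg hne hgT hgD
        (hprod hne) fuel
      have h5 := card_support_sub_polyOf h1 h2
      have h6 : (g - polyOf acc).support ⊆ g.support := by
        rw [support_sub_polyOf h1 fun t ht => (h2 t ht).1]
        exact Finset.sdiff_subset
      obtain ⟨l, hl, hc⟩ := ih (T := T - acc.length) (h := h ++ acc) (g := g - polyOf acc)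
        (by omega)
        (fun t ht => by
          rcases List.mem_append.1 ht with ht | ht
          · exact hhD t ht
          · obtain ⟨h7, h8⟩ := h2 t ht
            exact hgD _ (Polynomial.mem_support_iff.2 (h7 ▸ h8)))
        (by rw [polyOf_append, hg, sub_sub]) (by rw [List.length_append]; omega) (by omega)
        (by omega) (fun d hd => hgD d (h6 hd)) fun _ => hprod hne
      refine ⟨acc ++ l, hl.append h1 h2, ?_⟩
      have h7 := h4 _ _ _ hc
      have hsize : (g - polyOf acc).support.card.size + 1 ≤ g.support.card.size := by
        have h8 : 0 < g.support.card.size :=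
          Nat.size_pos.2 (Finset.card_pos.2 (Polynomial.support_nonempty.2 hne))
        obtain ⟨s, hs⟩ : ∃ s, g.support.card.size = s + 1 := ⟨g.support.card.size - 1, by omega⟩
        have h9 := Nat.lt_size_self g.support.card
        rw [hs, pow_succ] at h9
        rw [hs, Nat.add_le_add_iff_right, Nat.size_le]
        omega
      rw [b.passRing_eq, b.passBit_eq, List.append_assoc] at h7
      refine h7.mono ?_ ?_
      · have h8 := Nat.mul_le_mul_right (b.passRing 0) hsize
        rw [Nat.succ_mul g.support.card.size]
        omega
      · have h8 := Nat.mul_le_mul_right (b.passBit B 0) hsize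
        rw [Nat.succ_mul g.support.card.size]
        omega

/-- UIPoly lists the terms of `g`. The probes modulo the polynomials `X ^ p - 1` have a bound `r` of
their own, smaller than that for the probes modulo `X ^ (p q) - 1`. -/
theorem costs_uiPoly {g : R[X]} (hqs : qs = (primesUpTo 𝔸 D 1 (firstPrimes b.primes)).val)
    (hv : b.Valid 𝔸 B probe D qs g) (hb : b.primes = numPrimes b.terms D) {r k₁ k₂ : ℕ}
    (hr : ∀ m, 0 < m → m ≤ b.Q → (probe m).ringOps ≤ r)
    (h₁ : (primesFrom 𝔸 b.primes 2).bitOps ≤ k₁)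
    (h₂ : (primesUpTo 𝔸 D 1 (firstPrimes b.primes)).bitOps ≤ k₂) :
    ∃ l, IsTermList l g ∧ Costs (uiPoly 𝔸 probe b.terms D) l
      (0 + (0 + (0 + (b.primes * (r + 0) + (b.terms.size + 1) * b.passRing 0))))
      (b.boundsBit + (k₁ + (k₂ + (b.primes * (b.probeBit + 0) +
        (b.terms.size + 1) * b.passBit B 0)))) := by
  have c1 : Costs (bounds 𝔸 b.terms D) (numBad b.terms D, numVotes b.terms D, b.primes) 0
      b.boundsBit := ⟨by rw [bounds_val, hb], (bounds_ringOps _ _).le, hv.bounds_le _ le_rfl⟩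
  have c2 : Costs (primesFrom 𝔸 b.primes 2) (firstPrimes b.primes) 0 k₁ :=
    ⟨primesFrom_two_val _, (primesFrom_ringOps _ _).le, h₁⟩
  have c3 : Costs (primesUpTo 𝔸 D 1 (firstPrimes b.primes)) qs 0 k₂ :=
    ⟨hqs.symm, (primesUpTo_ringOps _ _ _).le, h₂⟩
  have c4 : Costs (mapL (fun p => (probe p).bind fun v => pure (p, v)) (firstPrimes b.primes))
      (images b.primes g) (b.primes * (r + 0)) (b.primes * (b.probeBit + 0)) := by
    have := Costs.mapL (f := fun p => (probe p).bind fun v => pure (p, v))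
      (l := firstPrimes b.primes) (f' := fun p => (p, wrapVec p g)) fun p hp => by
      have h1 := (prime_of_mem_firstPrimes hp).pos
      have h2 := hv.le_Q p hp
      have h3 := hv.probe_costs p h1 (h2.trans (Nat.le_mul_of_pos_right _ (Nat.succ_pos _)))
      exact Costs.bind ⟨h3.val_eq, hr p h1 h2, h3.bitOps_le⟩ (Costs.pure _)
    rwa [length_firstPrimes] at this
  obtain ⟨l, hl, hc⟩ := costs_uiLoop hv b.terms (T := b.terms) le_rfl (h := []) (by simp) (g := g)
    (by simp [polyOf]) (by simpa using hv.card_le) hv.card_le hv.card_le hv.lt_of_mem hv.le_prod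
  refine ⟨l, hl, ?_⟩
  have hs : g.support.card.size ≤ b.terms.size := Nat.size_le_size hv.card_le
  rw [List.nil_append, ← hb] at hc
  have hc' := hc.mono (Nat.mul_le_mul_right (b.passRing 0) (Nat.succ_le_succ hs))
    (Nat.mul_le_mul_right (b.passBit B 0) (Nat.succ_le_succ hs))
  exact c1.bind (c2.bind (c3.bind (c4.bind hc')))

/-! ### The budget of the interpolation -/

/-- The sizes of integers and the costs of the auxiliary computations for a straight-line program of
size `L` in `n` variables, `T` terms, and degree smaller than `D`, when the circuits of width `w`
and the multiplication modulo `X ^ w - 1` have cost at most `B w`, and `β` is a bound for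
`B w / (w + 1)`. -/
def budget (B : ℕ → ℕ) (β L n T D : ℕ) : Budget :=
  let N := numPrimes T (D ^ n)
  let K := Nat.clog 2 (D ^ n)
  let Q := primeBound N
  let q := primeBound K
  let σ := (Q * (q + 1)).size + T.size + N.size + 2 * q.size + 1
  let ω := σ + ((D ^ n + 1) * (q + 1)).size + ((D ^ n + 1) * (Q + 1)).size + D.size
  let τ := ((D ^ n) ^ T).size + T.size
  { terms := T
    primes := N
    lifts := K
    Q := Q
    q := q
    short := σ
    long := ω
    probeRing := L * (Q * (q + 1) + B (Q * (q + 1)))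
    probeBit := 2 * B ω + n * (2 * B (2 * σ))
    residuesBit := β * ω + (σ + 1) * (σ + 8) * (β * (N * σ)) + (2 * N + 1) * ((4 * σ + 4) * β)
    boundsBit := (2 * T + 6) * B (τ + 4) + 2 * τ }

theorem primeBound_pos (N : ℕ) : 0 < primeBound N :=
  Nat.mul_pos (Nat.succ_pos _) (Nat.succ_pos _)

/-- The bound for the number of ring operations.  The first summand stands for the probes modulo the
polynomials `X ^ p - 1`, which are cheaper than those of the passes. -/
def totalRing (b : Budget) (B : ℕ → ℕ) (L : ℕ) : ℕ :=
  b.primes * (L * (b.Q + B b.Q)) + (b.terms.size + 1) * b.passRing 0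

/-- The bound for the number of bit operations. -/
def totalBit (b : Budget) (B : ℕ → ℕ) (n : ℕ) : ℕ :=
  n * B b.long + (b.boundsBit +
    ((b.Q * ((Nat.sqrt b.Q + 1) * (5 * B (b.Q.size + 4))) + b.primes * B (b.Q.size + 4)) +
    ((b.lifts * 2 + 1) * B b.long + (b.primes * b.probeBit +
      (b.terms.size + 1) * b.passBit B 0)))) + b.terms * (n * (2 * B b.long))

set_option maxHeartbeats 1000000 in
/-- MPolySIKron lists the terms of the given polynomial at the cost that is budgeted. -/
theorem costs_mPolySIKron (hA : Arith.Correct.{u} 𝔸) (hB : CircBound 𝔸 B)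
    (hconv : ∀ m, (𝔸.conv m).cost ≤ B m) {n : ℕ} (S : SLP R n) {T D β : ℕ}
    (hT : S.poly.support.card ≤ T) (hD : S.poly.totalDegree < D)
    (hβ : ∀ w ≤ 2 * ((budget B β S.size n T D).long + (budget B β S.size n T D).primes *
      (budget B β S.size n T D).short) + 2, B w ≤ β * (w + 1)) :
    ∃ l, ListsTerms l S.poly ∧ Costs (mPolySIKron 𝔸 S T D) l
      (totalRing (budget B β S.size n T D) B S.size) (totalBit (budget B β S.size n T D) B n) := by
  obtain ⟨b, hb⟩ : ∃ b, b = budget B β S.size n T D := ⟨_, rfl⟩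
  have hbT : b.terms = T := by rw [hb]; rfl
  have hbN : b.primes = numPrimes b.terms (D ^ n) := by rw [hb]; rfl
  have hbK : b.lifts = Nat.clog 2 (D ^ n) := by rw [hb]; rfl
  have hbQ : b.Q = primeBound b.primes := by rw [hb]; rfl
  have hbq : b.q = primeBound b.lifts := by rw [hb]; rfl
  have hshort : b.short = (b.Q * (b.q + 1)).size + b.terms.size + b.primes.size + 2 * b.q.size + 1 :=
    by rw [hb]; rfl
  have hlong : b.long = b.short + ((D ^ n + 1) * (b.q + 1)).size + ((D ^ n + 1) * (b.Q + 1)).size +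
    D.size := by rw [hb]; rfl
  have hbr : b.probeRing = S.size * (b.Q * (b.q + 1) + B (b.Q * (b.q + 1))) := by rw [hb]; rfl
  have hbb : b.probeBit = 2 * B b.long + n * (2 * B (2 * b.short)) := by rw [hb]; rfl
  have hbres : b.residuesBit = β * b.long + (b.short + 1) * (b.short + 8) *
    (β * (b.primes * b.short)) + (2 * b.primes + 1) * ((4 * b.short + 4) * β) := by rw [hb]; rfl
  have hbbd : b.boundsBit = (2 * b.terms + 6) * B (((D ^ n) ^ b.terms).size + b.terms.size + 4) +
    2 * (((D ^ n) ^ b.terms).size + b.terms.size) := by rw [hb]; rfl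
  rw [← hb] at hβ ⊢
  clear hb
  subst hbT
  have hD0 : 0 < D := by omega
  have hDn : 0 < D ^ n := Nat.pow_pos hD0
  set g : R[X] := kron n D S.poly with hg
  have hgD : ∀ d ∈ g.support, d < D ^ n := fun d hd => lt_of_mem_support_kron hD hd
  have hgT : g.support.card ≤ b.terms := (card_support_kron_le D S.poly).trans hT
  obtain ⟨K, hK, hKN, hKl, hprod, hprod'⟩ := primesUpTo_firstPrimes (𝔸 := 𝔸) (D ^ n) b.primes
  rw [← hbK] at hKl
  have hQ0 : 0 < b.Q := by rw [hbQ]; exact primeBound_pos _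
  have hq0 : 0 < b.q := by rw [hbq]; exact primeBound_pos _
  have hDsize : (D ^ n).size ≤ b.long := by
    have : (D ^ n).size ≤ ((D ^ n + 1) * (b.q + 1)).size := Nat.size_le_size
      ((Nat.le_succ _).trans (Nat.le_mul_of_pos_right _ (Nat.succ_pos _)))
    omega
  have hDsize' : D.size ≤ b.long := by omega
  have hprimes : ∀ N ≤ b.primes, ∀ p ∈ firstPrimes N, p ≤ b.Q := fun N hN p hp =>
    hbQ ▸ (le_of_mem_firstPrimes hp).trans (primeBound_mono hN)
  have hQσ : b.Q.size ≤ b.short := by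
    have : b.Q.size ≤ (b.Q * (b.q + 1)).size :=
      Nat.size_le_size (Nat.le_mul_of_pos_right _ (Nat.succ_pos _))
    omega
  have hv : b.Valid 𝔸 B (kroneckerProbe 𝔸 S D) (D ^ n) (firstPrimes K) g :=
    { circ := hB
      pos := hDn
      lt_of_mem := hgD
      card_le := hgT
      primes_le := hbN.ge
      le_Q := hprimes _ le_rfl
      lifts_le := by rw [length_firstPrimes]; exact hKl
      pos_of_mem := fun x hx => (prime_of_mem_firstPrimes hx).pos
      le_q := fun x hx => hbq ▸ (le_of_mem_firstPrimes hx).trans (primeBound_mono hKl)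
      coprime := pairwise_coprime_firstPrimes K
      le_prod := fun hne => by
        have hT0 : 0 < b.terms :=
          lt_of_lt_of_le (Finset.card_pos.2 (Polynomial.support_nonempty.2 hne)) hgT
        -- As `N` is at least `log₂ (D ^ n)`, the first `N` primes have a product of at least `D ^ n`.
        refine hprod ?_
        refine (Nat.le_pow_clog (by norm_num) _).trans (Nat.pow_le_pow_right (by norm_num) ?_)
        have h1 : Nat.clog 2 (D ^ n) ≤ numVotes b.terms (D ^ n) :=
          Nat.clog_mono_right _ (Nat.le_self_pow hT0.ne' _)
        have h2 : numBad b.terms (D ^ n) + numVotes b.terms (D ^ n) - 1 ≤ b.primes :=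
          hbN ▸ le_max_right _ _
        have h3 : 1 ≤ numBad b.terms (D ^ n) := le_max_left _ _
        omega
      short_pos := by omega
      size_mul_le := by omega
      size_terms_le := by omega
      size_primes_le := by omega
      size_q_le := by omega
      short_le := by omega
      size_le := hDsize
      size_prod_le := by
        have h1 : (firstPrimes K).prod ≤ (D ^ n + 1) * (b.q + 1) :=
          hprod'.trans (Nat.mul_le_mul_left _ (hbq ▸ (primeBound_mono hKl).trans (Nat.le_succ _)))
        have h2 := Nat.size_le_size h1
        omega
      probe_costs := fun m hm hmQ => by
        have hms : m.size ≤ b.short := by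
          have := Nat.size_le_size hmQ
          omega
        refine ⟨kroneckerProbe_val hA S D hm, (kroneckerProbe_ringOps_le S D m).trans ?_, ?_⟩
        · rw [hbr]
          exact Nat.mul_le_mul_left _ (Nat.add_le_add hmQ ((hconv m).trans (hB.mono hmQ)))
        · rw [hbb]
          exact kroneckerProbe_bitOps_le hB S hm hDsize' (by omega) (by omega)
      residues_le := fun e he N hN => by
        have hsum : ((firstPrimes N).map Nat.size).sum ≤ N * b.short := by
          refine (List.sum_le_card_nsmul _ b.short ?_).trans ?_
          · intro x hx
            obtain ⟨p, hp, rfl⟩ := List.mem_map.1 hx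
            exact size_le_of_le (hprimes N hN p hp) hQσ
          · rw [List.length_map, length_firstPrimes, smul_eq_mul]
        have hN' : N * b.short ≤ b.primes * b.short := Nat.mul_le_mul_right _ hN
        refine (residues_bitOps_le hB hβ e (firstPrimes N) (σ := b.long) (s := b.primes * b.short)
          (z := b.short) (fun p hp => (prime_of_mem_firstPrimes hp).pos) ?_ (by omega) ?_ (by omega)
          (by omega)).trans ?_
        · exact size_le_of_le he.le hDsize
        · rw [length_firstPrimes]
          have := Nat.size_le_size hN
          omega
        · rw [length_firstPrimes]
          rw [hbres]
          gcongr
      bounds_le := fun T' hT' => by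
        have h1 : ((D ^ n) ^ T').size ≤ ((D ^ n) ^ b.terms).size + b.terms.size :=
          (Nat.size_le_size (Nat.pow_le_pow_right hDn hT')).trans (Nat.le_add_right _ _)
        have h2 : T'.size ≤ ((D ^ n) ^ b.terms).size + b.terms.size :=
          (Nat.size_le_size hT').trans (Nat.le_add_left _ _)
        refine (bounds_bitOps_le hB hDn h1 h2).trans ?_
        have h3 : 2 * T' + 6 ≤ 2 * b.terms + 6 := by omega
        rw [hbbd]
        exact Nat.add_le_add_right (Nat.mul_le_mul_right _ h3) _ }
  have hupTo : (primesUpTo 𝔸 (D ^ n) 1 (firstPrimes b.primes)).bitOps ≤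
      (b.lifts * 2 + 1) * B b.long := by
    refine (primesUpTo_bitOps_le hB (Q := b.Q) (w := b.long) ?_ hQ0 (hprimes _ le_rfl) ?_ hDn).trans
      ?_
    · have : (D ^ n * b.Q).size ≤ ((D ^ n + 1) * (b.Q + 1)).size :=
        Nat.size_le_size (Nat.mul_le_mul (Nat.le_succ _) (Nat.le_succ _))
      omega
    · exact Nat.mul_pos hDn hQ0
    · rw [hK, length_firstPrimes]
      gcongr
  obtain ⟨l, hl, hc⟩ := costs_uiPoly hK.symm hv hbN (r := S.size * (b.Q + B b.Q))
    (fun m hm hmQ => (kroneckerProbe_ringOps_le S D m).trans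
      (Nat.mul_le_mul_left _ (Nat.add_le_add hmQ ((hconv m).trans (hB.mono hmQ)))))
    (primesFrom_two_bitOps_le hB hbQ.ge) hupTo
  have hlen : l.length ≤ b.terms := by rw [hl.length_eq]; exact hgT
  refine ⟨_, hl.listsTerms hD, ?_⟩
  have c1 : Costs (powNat 𝔸 D n) (D ^ n) 0 (n * B b.long) :=
    ⟨powNat_val _ _, (powNat_ringOps _ _).le, powNat_bitOps_le hB hD0 hDsize⟩
  have c2 : Costs (mapL (fun t : ℕ × R => (expand 𝔸 D n t.1).bind fun es =>
      pure ((fun i : Fin n => es.getD i 0), t.2)) l)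
      (l.map fun t => ((fun i : Fin n => t.1 / D ^ (i : ℕ) % D), t.2)) (l.length * 0)
      (l.length * (n * (2 * B b.long))) := by
    refine Costs.mapL fun t ht => ?_
    have htD : t.1 < D ^ n := by
      obtain ⟨h1, h2⟩ := (hl.2 t.1 t.2).1 ht
      exact hgD _ (Polynomial.mem_support_iff.2 (h1 ▸ h2))
    refine ⟨?_, by simp, ?_⟩
    · simp only [bind_val, expand_val, pure_val, Prod.mk.injEq, and_true]
      funext i
      rw [List.getD_eq_getElem _ _ (by simp)]
      simp
    · simp only [bind_bitOps, pure_bitOps, add_zero]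
      exact expand_bitOps_le hB hDsize' n t.1 (size_le_of_le htD.le hDsize)
  refine Costs.mono (c1.bind (hc.bind c2)) ?_ ?_
  · simp only [totalRing, zero_add, add_zero, mul_zero]
    exact le_rfl
  · have h1 : l.length * (n * (2 * B b.long)) ≤ b.terms * (n * (2 * B b.long)) :=
      Nat.mul_le_mul_right _ hlen
    simp only [totalBit, add_zero]
    omega

end

end SLPInterp

namespace SLPInterp

/-! ### Domination up to logarithmic factors -/

section

variable {ι : Type*} {w : ι → ℕ}

/-- `f` is at most `g`, up to a constant factor and a power of the bit length of `w`. -/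
def Soft (w f g : ι → ℕ) : Prop := ∃ C k : ℕ, ∀ i, f i ≤ C * (((w i).size + 1) ^ k * g i)

theorem Soft.of_le {f g : ι → ℕ} (h : ∀ i, f i ≤ g i) : Soft w f g :=
  ⟨1, 0, fun i => by simpa using h i⟩

theorem Soft.le_trans {f g h : ι → ℕ} (hf : Soft w f g) (hg : ∀ i, g i ≤ h i) : Soft w f h := by
  obtain ⟨C, k, hC⟩ := hf
  exact ⟨C, k, fun i => (hC i).trans (by gcongr; exact hg i)⟩

theorem Soft.mono {f f' g : ι → ℕ} (hf : Soft w f' g) (h : ∀ i, f i ≤ f' i) : Soft w f g := by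
  obtain ⟨C, k, hC⟩ := hf
  exact ⟨C, k, fun i => (h i).trans (hC i)⟩

theorem Soft.const (c : ℕ) {g : ι → ℕ} (hg : ∀ i, 1 ≤ g i) : Soft w (fun _ => c) g :=
  ⟨c, 0, fun i => by simpa using Nat.le_mul_of_pos_right c (hg i)⟩

theorem Soft.add {f f' g : ι → ℕ} (hf : Soft w f g) (hf' : Soft w f' g) :
    Soft w (fun i => f i + f' i) g := by
  obtain ⟨C, k, hC⟩ := hf
  obtain ⟨C', k', hC'⟩ := hf'
  refine ⟨C + C', k + k', fun i => ?_⟩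
  have h1 : ((w i).size + 1) ^ k ≤ ((w i).size + 1) ^ (k + k') :=
    Nat.pow_le_pow_right (Nat.succ_pos _) (Nat.le_add_right _ _)
  have h2 : ((w i).size + 1) ^ k' ≤ ((w i).size + 1) ^ (k + k') :=
    Nat.pow_le_pow_right (Nat.succ_pos _) (Nat.le_add_left _ _)
  rw [Nat.add_mul]
  exact Nat.add_le_add
    ((hC i).trans (Nat.mul_le_mul_left _ (Nat.mul_le_mul_right _ h1)))
    ((hC' i).trans (Nat.mul_le_mul_left _ (Nat.mul_le_mul_right _ h2)))

theorem Soft.mul {f f' g g' h : ι → ℕ} (hf : Soft w f g) (hf' : Soft w f' g')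
    (hh : ∀ i, g i * g' i ≤ h i) : Soft w (fun i => f i * f' i) h := by
  obtain ⟨C, k, hC⟩ := hf
  obtain ⟨C', k', hC'⟩ := hf'
  refine ⟨C * C', k + k', fun i => ?_⟩
  calc f i * f' i
      ≤ (C * (((w i).size + 1) ^ k * g i)) * (C' * (((w i).size + 1) ^ k' * g' i)) :=
        Nat.mul_le_mul (hC i) (hC' i)
    _ = C * C' * (((w i).size + 1) ^ (k + k') * (g i * g' i)) := by ring
    _ ≤ _ := by gcongr; exact hh i

theorem Soft.const_mul {f g : ι → ℕ} (c : ℕ) (hf : Soft w f g) : Soft w (fun i => c * f i) g :=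
  (Soft.const c (g := fun _ => 1) fun _ => le_rfl).mul hf fun _ => (one_mul _).le

theorem Soft.pow_one {f : ι → ℕ} (hf : Soft w f fun _ => 1) (r : ℕ) :
    Soft w (fun i => f i ^ r) fun _ => 1 := by
  induction r with
  | zero => exact .of_le fun _ => by simp
  | succ r ih => simpa only [pow_succ] using ih.mul hf fun _ => le_rfl

theorem size_pow_le (a k : ℕ) : (a ^ k).size ≤ k * a.size + 1 := by
  induction k with
  | zero => simp
  | succ k ih =>
    rw [pow_succ, Nat.succ_mul]
    exact (size_mul_le _ _).trans (by omega)

/-- A function that is polynomially bounded in `w` has a bit length that is logarithmic in `w`. -/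
theorem Soft.size {f g : ι → ℕ} (hf : Soft w f g) {j : ℕ} (hg : ∀ i, g i ≤ w i ^ j) :
    Soft w (fun i => (f i).size) fun _ => 1 := by
  obtain ⟨C, k, hC⟩ := hf
  refine ⟨C.size + k + 1 + j + 1, 1, fun i => ?_⟩
  have h1 := Nat.size_le_size ((hC i).trans
    (Nat.mul_le_mul_left _ (Nat.mul_le_mul_left _ (hg i))))
  have h2 := size_mul_le C (((w i).size + 1) ^ k * w i ^ j)
  have h3 := size_mul_le (((w i).size + 1) ^ k) (w i ^ j)
  have h4 := size_pow_le ((w i).size + 1) k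
  have h5 := size_pow_le (w i) j
  have h6 : k * ((w i).size + 1).size ≤ k * ((w i).size + 1) :=
    Nat.mul_le_mul_left _ (size_le_self _)
  have h7 : C.size ≤ C.size * ((w i).size + 1) := Nat.le_mul_of_pos_right _ (Nat.succ_pos _)
  simp only [_root_.pow_one, mul_one, Nat.add_mul, one_mul, Nat.mul_add] at *
  omega

theorem Soft.sqrt {f g : ι → ℕ} (hf : Soft w f fun i => g i * g i) :
    Soft w (fun i => Nat.sqrt (f i)) g := by
  obtain ⟨C, k, hC⟩ := hf
  refine ⟨C, k, fun i => ?_⟩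
  rw [← Nat.lt_succ_iff, Nat.sqrt_lt]
  set a := C * ((w i).size + 1) ^ k with ha
  have h1 : f i ≤ a * (g i * g i) := by rw [ha, mul_assoc]; exact hC i
  have h2 : C * (((w i).size + 1) ^ k * g i) = a * g i := by rw [ha, mul_assoc]
  rw [h2]
  have h3 : a * (g i * g i) ≤ a * a * (g i * g i) :=
    Nat.mul_le_mul_right _ (Nat.le_mul_self a)
  nlinarith

theorem Soft.quasiLin {B : ℕ → ℕ} (hB : QuasiLin B) {f g : ι → ℕ} (hf : Soft w f g)
    (h1 : ∀ i, 1 ≤ g i) {j : ℕ} (hg : ∀ i, g i ≤ w i ^ j) : Soft w (fun i => B (f i)) g := by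
  obtain ⟨C, r, hC⟩ := hB
  refine Soft.mono (Soft.const_mul C (Soft.mul (hf.add (Soft.const 1 h1))
    (((hf.size hg).add (Soft.const 1 fun _ => le_rfl)).pow_one r) fun i => (mul_one _).le))
    fun i => hC (f i)

theorem Soft.primeBound {f g : ι → ℕ} (hf : Soft w f g) (h1 : ∀ i, 1 ≤ g i) {j : ℕ}
    (hg : ∀ i, g i ≤ w i ^ j) : Soft w (fun i => primeBound (f i)) g := by
  have h2 := hf.add (Soft.const 1 h1)
  exact h2.mul (((h2.size hg).const_mul 2).add (Soft.const 2 fun _ => le_rfl))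
    fun i => (mul_one _).le

end

/-! ### The total cost -/

theorem clog_pow_le (D k : ℕ) : Nat.clog 2 (D ^ k) ≤ k * Nat.clog 2 D := by
  refine Nat.clog_le_of_le_pow ?_
  rw [mul_comm, pow_mul]
  exact Nat.pow_le_pow_left (Nat.le_pow_clog (by norm_num) D) k

theorem size_pow_le_clog (D k : ℕ) : (D ^ k).size ≤ k * Nat.clog 2 D + 1 := by
  rw [Nat.size_le, pow_succ, mul_comm k, pow_mul]
  have h := Nat.pow_le_pow_left (Nat.le_pow_clog (b := 2) (by norm_num) D) k
  have h1 : 0 < (2 ^ Nat.clog 2 D) ^ k := by positivity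
  omega

theorem numPrimes_le {T D W : ℕ} (hW : 1 ≤ W) (h : T * Nat.clog 2 D ≤ W) :
    numPrimes T D ≤ 4 * W := by
  have h1 : numVotes T D ≤ W := (clog_pow_le D T).trans h
  have h2 : numBad T D ≤ W := max_le hW ((clog_pow_le D (T - 1)).trans
    ((Nat.mul_le_mul_right _ (Nat.sub_le T 1)).trans h))
  exact max_le (by omega) (by omega)

section

variable {ι : Type*} {L n T D : ι → ℕ}

/-- The totals, up to logarithmic factors, in terms of the bound `M` for the bit length of the
exponents of the univariate polynomial and the bound `w = T M` for the number of primes. The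
hypothesis `hβ` expresses that `β` is logarithmic as soon as the largest width is quasi-linear in
`w`. -/
theorem soft_total {B : ℕ → ℕ} (hB : QuasiLin B) (β : ι → ℕ) (w M : ι → ℕ)
    (hM : M = fun i => n i * Nat.clog 2 (D i)) (hw : w = fun i => T i * M i)
    (hL1 : ∀ i, 1 ≤ L i) (hn1 : ∀ i, 1 ≤ n i) (hT1 : ∀ i, 1 ≤ T i) (hD2 : ∀ i, 2 ≤ D i)
    (hβ : Soft w (fun i => 2 * ((budget B 0 (L i) (n i) (T i) (D i)).long +
      (budget B 0 (L i) (n i) (T i) (D i)).primes *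
        (budget B 0 (L i) (n i) (T i) (D i)).short) + 2) w →
      Soft w β fun _ => 1) :
    Soft w (fun i => totalRing (budget B (β i) (L i) (n i) (T i) (D i)) B (L i))
        (fun i => L i * (w i * w i + w i * (M i * M i))) ∧
      Soft w (fun i => totalBit (budget B (β i) (L i) (n i) (T i) (D i)) B (n i))
        (fun i => w i * (T i + M i)) := by
  obtain ⟨b, hb⟩ : ∃ b : ι → Budget, ∀ i, b i = budget B (β i) (L i) (n i) (T i) (D i) :=
    ⟨_, fun _ => rfl⟩
  have hbT : ∀ i, (b i).terms = T i := fun i => by rw [hb]; rfl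
  have hbN : ∀ i, (b i).primes = numPrimes (T i) (D i ^ n i) := fun i => by rw [hb]; rfl
  have hbK : ∀ i, (b i).lifts = Nat.clog 2 (D i ^ n i) := fun i => by rw [hb]; rfl
  have hbQ : ∀ i, (b i).Q = primeBound ((b i).primes) := fun i => by rw [hb]; rfl
  have hbq : ∀ i, (b i).q = primeBound ((b i).lifts) := fun i => by rw [hb]; rfl
  have hbs : ∀ i, (b i).short = ((b i).Q * ((b i).q + 1)).size + (T i).size +
    (b i).primes.size + 2 * (b i).q.size + 1 := fun i => by rw [hb]; rfl
  have hbl : ∀ i, (b i).long = (b i).short + ((D i ^ n i + 1) * ((b i).q + 1)).size +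
    ((D i ^ n i + 1) * ((b i).Q + 1)).size + (D i).size := fun i => by rw [hb]; rfl
  have hbr : ∀ i, (b i).probeRing = L i * ((b i).Q * ((b i).q + 1) +
    B ((b i).Q * ((b i).q + 1))) := fun i => by rw [hb]; rfl
  have hbb : ∀ i, (b i).probeBit = 2 * B (b i).long + n i * (2 * B (2 * (b i).short)) :=
    fun i => by rw [hb]; rfl
  have hbres : ∀ i, (b i).residuesBit = β i * (b i).long + ((b i).short + 1) *
    ((b i).short + 8) * (β i * ((b i).primes * (b i).short)) +
    (2 * (b i).primes + 1) * ((4 * (b i).short + 4) * β i) := fun i => by rw [hb]; rfl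
  have hbbd : ∀ i, (b i).boundsBit = (2 * T i + 6) *
    B (((D i ^ n i) ^ T i).size + (T i).size + 4) +
    2 * (((D i ^ n i) ^ T i).size + (T i).size) := fun i => by rw [hb]; rfl
  have hβ' : Soft w (fun i => 2 * ((b i).long + (b i).primes * (b i).short) + 2) w →
      Soft w β fun _ => 1 := fun h => hβ (by
    refine h.mono fun i => le_of_eq ?_
    rw [hb]; rfl)
  simp only [← hb]
  clear hβ hb
  have hl1 : ∀ i, 1 ≤ Nat.clog 2 (D i) := fun i => Nat.clog_pos (by norm_num) (hD2 i)
  have hM' : ∀ i, M i = n i * Nat.clog 2 (D i) := fun i => by rw [hM]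
  have hw' : ∀ i, w i = T i * M i := fun i => by rw [hw]
  have hnM : ∀ i, n i ≤ M i := fun i => hM' i ▸ Nat.le_mul_of_pos_right _ (hl1 i)
  have hlM : ∀ i, Nat.clog 2 (D i) ≤ M i := fun i => hM' i ▸ Nat.le_mul_of_pos_left _ (hn1 i)
  have hM1 : ∀ i, 1 ≤ M i := fun i => (hn1 i).trans (hnM i)
  have hTw : ∀ i, T i ≤ w i := fun i => hw' i ▸ Nat.le_mul_of_pos_right _ (hM1 i)
  have hMw : ∀ i, M i ≤ w i := fun i => hw' i ▸ Nat.le_mul_of_pos_left _ (hT1 i)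
  have hw1 : ∀ i, 1 ≤ w i := fun i => (hT1 i).trans (hTw i)
  clear hM hw
  have one_le : ∀ i : ι, 1 ≤ (fun _ : ι => 1) i := fun _ => le_rfl
  have one_pow : ∀ i : ι, (fun _ : ι => 1) i ≤ w i ^ 0 := fun _ => le_rfl
  have hMp : ∀ i, M i ≤ w i ^ 1 := fun i => (hMw i).trans (pow_one _).ge
  have hwp : ∀ i, w i ≤ w i ^ 1 := fun i => (pow_one _).ge
  have hwMp : ∀ i, w i * M i ≤ w i ^ 2 := fun i =>
    (Nat.mul_le_mul_left _ (hMw i)).trans (sq _).ge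
  have hwM1 : ∀ i, 1 ≤ w i * M i := fun i => Nat.mul_pos (hw1 i) (hM1 i)
  have sN : Soft w (fun i => (b i).primes) w := by
    refine (Soft.const_mul 4 (Soft.of_le fun i => le_rfl)).mono fun i => ?_
    rw [hbN]
    refine numPrimes_le (hw1 i) ?_
    rw [hw', hM']
    exact Nat.mul_le_mul_left _ (clog_pow_le _ _)
  have sK : Soft w (fun i => (b i).lifts) M := Soft.of_le fun i => by
    rw [hbK, hM']; exact clog_pow_le _ _
  have sQ : Soft w (fun i => (b i).Q) w := by
    simp only [hbQ]; exact sN.primeBound hw1 hwp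
  have sq : Soft w (fun i => (b i).q) M := by
    simp only [hbq]; exact sK.primeBound hM1 hMp
  have sQq : Soft w (fun i => (b i).Q * ((b i).q + 1)) fun i => w i * M i :=
    sQ.mul (sq.add (.const 1 hM1)) fun i => le_rfl
  have sT : Soft w T T := .of_le fun _ => le_rfl
  have sTs : Soft w (fun i => (T i).size) fun _ => 1 := sT.size fun i => (hTw i).trans (hwp i)
  have sσ : Soft w (fun i => (b i).short) fun _ => 1 := by
    simp only [hbs]
    exact ((((sQq.size hwMp).add sTs).add (sN.size hwp)).add ((sq.size hMp).const_mul 2)).add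
      (.const 1 one_le)
  have sE : Soft w (fun i => (D i ^ n i + 1).size) M := by
    refine ((Soft.of_le (f := M) fun i => le_rfl).add (.const 3 hM1)).mono fun i => ?_
    have h1 : D i ^ n i + 1 ≤ D i ^ n i * 2 := by
      have : 0 < D i ^ n i := Nat.pow_pos (by have := hD2 i; omega)
      omega
    have h2 := size_pow_le_clog (D i) (n i)
    have h3 := (Nat.size_le_size h1).trans (size_mul_le _ _)
    have h4 : (2 : ℕ).size = 2 := by decide
    have h5 := hM' i
    omega
  have sE' : ∀ f : ι → ℕ, Soft w f w →
      Soft w (fun i => ((D i ^ n i + 1) * (f i + 1)).size) M := fun f hf =>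
    (sE.add (((hf.add (.const 1 hw1)).size hwp).le_trans hM1)).mono fun i => size_mul_le _ _
  have sω : Soft w (fun i => (b i).long) M := by
    simp only [hbl]
    refine (((sσ.le_trans hM1).add (sE' _ (sq.le_trans hMw))).add (sE' _ sQ)).add ?_
    refine ((Soft.of_le (f := M) fun i => le_rfl).add (.const 1 hM1)).mono fun i => ?_
    have h1 := size_pow_le_clog (D i) 1
    have h2 := hlM i
    rw [_root_.pow_one, one_mul] at h1
    omega
  have sβ : Soft w β fun _ => 1 := hβ' <| (((sω.le_trans hMw).add (sN.mul sσ fun i =>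
    (mul_one _).le)).const_mul 2).add (.const 2 hw1)
  have sτ : Soft w (fun i => ((D i ^ n i) ^ T i).size + (T i).size) w := by
    refine (((Soft.of_le (f := w) fun i => le_rfl).add (.const 1 hw1)).add
      (sTs.le_trans hw1)).mono fun i => Nat.add_le_add_right ?_ _
    have h1 := size_pow_le_clog (D i) (n i * T i)
    rw [pow_mul] at h1
    rw [hw', hM']
    refine h1.trans (le_of_eq ?_)
    ring
  have sBσ : Soft w (fun i => B (b i).short) fun _ => 1 := sσ.quasiLin hB one_le one_pow
  have sBσ2 : Soft w (fun i => B (2 * (b i).short)) fun _ => 1 :=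
    (sσ.const_mul 2).quasiLin hB one_le one_pow
  have sBω : Soft w (fun i => B (b i).long) M := sω.quasiLin hB hM1 hMp
  have sBτ : Soft w (fun i => B (((D i ^ n i) ^ T i).size + (T i).size + 4)) w :=
    (sτ.add (.const 4 hw1)).quasiLin hB hw1 hwp
  have sBQ4 : Soft w (fun i => B ((b i).Q.size + 4)) fun _ => 1 :=
    ((sQ.size hwp).add (.const 4 one_le)).quasiLin hB one_le one_pow
  have sn : Soft w n M := .of_le hnM
  have spr : Soft w (fun i => (b i).probeRing) fun i => L i * (w i * M i) := by
    simp only [hbr]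
    exact (Soft.of_le (f := L) fun i => le_rfl).mul (sQq.add (sQq.quasiLin hB hwM1 hwMp))
      fun i => le_rfl
  have spb : Soft w (fun i => (b i).probeBit) M := by
    simp only [hbb]
    exact (sBω.const_mul 2).add (sn.mul (sBσ2.const_mul 2) fun i => (mul_one _).le)
  have sres : Soft w (fun i => (b i).residuesBit) w := by
    simp only [hbres]
    refine ((sβ.mul sω fun i => (one_mul _).le.trans (hMw i)).add (Soft.mul
      (g := fun _ => 1) ?_ ?_ fun i => (one_mul _).le)).add (Soft.mul (g' := fun _ => 1) ?_ ?_
        fun i => (mul_one _).le)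
    · exact (sσ.add (.const 1 one_le)).mul (sσ.add (.const 8 one_le)) fun i => le_rfl
    · exact sβ.mul (sN.mul sσ fun i => (mul_one _).le) fun i => (one_mul _).le
    · exact (sN.const_mul 2).add (.const 1 hw1)
    · exact ((sσ.const_mul 4).add (.const 4 one_le)).mul sβ fun i => le_rfl
  have sbd : Soft w (fun i => (b i).boundsBit) fun i => T i * w i := by
    simp only [hbbd]
    refine (((sT.const_mul 2).add (.const 6 hT1)).mul sBτ fun i => le_rfl).add
      ((sτ.const_mul 2).le_trans fun i => Nat.le_mul_of_pos_left _ (hT1 i))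
  constructor
  · set G : ι → ℕ := fun i => L i * (w i * w i + w i * (M i * M i)) with hG
    have hww : ∀ i, L i * (w i * w i) ≤ G i := fun i => Nat.mul_le_mul_left _ (Nat.le_add_right _ _)
    have hwMM : ∀ i, L i * (w i * (M i * M i)) ≤ G i := fun i =>
      Nat.mul_le_mul_left _ (Nat.le_add_left _ _)
    have hww' : ∀ i, w i * w i ≤ G i := fun i =>
      (Nat.le_mul_of_pos_left _ (hL1 i)).trans (hww i)
    have hwG : ∀ i, w i ≤ G i := fun i => (Nat.le_mul_of_pos_left _ (hw1 i)).trans (hww' i)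
    have hTT : ∀ i, T i * T i ≤ G i := fun i => (Nat.mul_le_mul (hTw i) (hTw i)).trans (hww' i)
    have hTw' : ∀ i, T i * w i ≤ G i := fun i => (Nat.mul_le_mul_right _ (hTw i)).trans (hww' i)
    have h0 : Soft w (fun _ => 0) G := .of_le fun _ => Nat.zero_le _
    have h0' : Soft w (fun i => T i * 0) G := .of_le fun _ => Nat.zero_le _
    unfold totalRing Budget.passRing
    simp only [hbT, add_zero, zero_add]
    refine (sN.mul ((Soft.of_le (f := L) fun i => le_rfl).mul (sQ.add (sQ.quasiLin hB hw1 hwp))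
      fun i => le_rfl) fun i => (Nat.mul_left_comm _ _ _).le.trans (hww i)).add
      ((sTs.add (.const 1 one_le)).mul ?_ fun i => (one_mul _).le)
    refine (sN.mul sQ hww').add (Soft.add ?_ ((sQ.le_trans hwG).add ((sT.mul sT hTT).add
      (h0'.add ((sT.mul (sN.const_mul 3) hTw').add (sT.mul sN hTw'))))))
    refine sK.mul (g' := fun i => L i * (w i * M i)) (spr.add (Soft.add ?_ ?_)) fun i => ?_
    · exact sT.le_trans fun i => (hTw i).trans ((Nat.le_mul_of_pos_right _ (hM1 i)).trans
        (Nat.le_mul_of_pos_left _ (hL1 i)))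
    · exact sQq.le_trans fun i => Nat.le_mul_of_pos_left _ (hL1 i)
    · refine le_trans (le_of_eq ?_) (hwMM i)
      ring
  · set G : ι → ℕ := fun i => w i * (T i + M i) with hG
    have hwT : ∀ i, w i * T i ≤ G i := fun i => Nat.mul_le_mul_left _ (Nat.le_add_right _ _)
    have hwM : ∀ i, w i * M i ≤ G i := fun i => Nat.mul_le_mul_left _ (Nat.le_add_left _ _)
    have hTw' : ∀ i, T i * w i ≤ G i := fun i => (mul_comm _ _).le.trans (hwT i)
    have hMw' : ∀ i, M i * w i ≤ G i := fun i => (mul_comm _ _).le.trans (hwM i)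
    have hTT : ∀ i, T i * T i ≤ G i := fun i => (Nat.mul_le_mul_right _ (hTw i)).trans (hwT i)
    have hMM : ∀ i, M i * M i ≤ G i := fun i => (Nat.mul_le_mul_right _ (hMw i)).trans (hwM i)
    have hwG : ∀ i, w i ≤ G i := fun i => (Nat.le_mul_of_pos_right _ (hT1 i)).trans (hwT i)
    have hTG : ∀ i, T i ≤ G i := fun i => (hTw i).trans (hwG i)
    have hMG : ∀ i, M i ≤ G i := fun i => (hMw i).trans (hwG i)
    have h1G : ∀ i, 1 ≤ G i := fun i => (hw1 i).trans (hwG i)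
    have hTM : ∀ i, T i * M i ≤ G i := fun i => (hw' i).ge.trans (hwG i)
    have hMTM : ∀ i, M i * (T i * M i) ≤ G i := fun i => by rw [← hw']; exact hMw' i
    have sM : ∀ {f : ι → ℕ}, Soft w f (fun _ => 1) → Soft w f M := fun h => h.le_trans hM1
    have s5 : Soft w (fun i => (b i).primes * ((T i + 1) * B (b i).short)) G :=
      sN.mul ((sT.add (.const 1 hT1)).mul sBσ fun i => (mul_one _).le) hwT
    have sTσ : Soft w (fun i => T i * (b i).short) T := sT.mul sσ fun i => (mul_one _).le
    have hpass : Soft w (fun i => (b i).passBit B 0) G := by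
      unfold Budget.passBit
      simp only [hbT, add_zero]
      refine s5.add ((sBσ.le_trans h1G).add (Soft.add ?_ ((sTσ.le_trans hTG).add (Soft.add ?_
        ((sT.mul sres hTw').add (Soft.add ?_ ((sBσ.le_trans h1G).add
          ((sbd.le_trans hTw').add ?_))))))))
      · refine sK.mul (g' := fun i => T i * M i) ?_ hMTM
        have hMTM' : ∀ i, M i ≤ T i * M i := fun i => Nat.le_mul_of_pos_left _ (hT1 i)
        refine (((sM sBσ).le_trans hMTM').add ((spb.le_trans hMTM').add (Soft.add ?_ ?_)))
        · exact sT.mul (sBω.add (sM sσ)) fun i => le_rfl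
        · exact sTσ.le_trans fun i => Nat.le_mul_of_pos_right _ (hM1 i)
      · refine sT.mul (g' := fun i => M i * (T i + M i)) ?_ fun i => ?_
        · have hm : ∀ i, M i ≤ M i * (T i + M i) := fun i =>
            Nat.le_mul_of_pos_right _ ((hT1 i).trans (Nat.le_add_right _ _))
          refine ((Soft.add ?_ ?_).add (sBω.le_trans hm)).add
            (sT.mul sBω fun i => (mul_comm _ _).le.trans
              (Nat.mul_le_mul_left _ (Nat.le_add_right _ _)))
          · exact sK.mul ((sT.mul (sBσ.const_mul 2) fun i => (mul_one _).le).add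
              (sBσ.le_trans hT1)) fun i => Nat.mul_le_mul_left _ (Nat.le_add_right _ _)
          · exact sK.mul ((sBω.const_mul 5).add (sq.mul (sBσ.const_mul 5) fun i =>
              (mul_one _).le)) fun i => Nat.mul_le_mul_left _ (Nat.le_add_left _ _)
        · rw [hG, ← mul_assoc, ← hw']
      · exact sT.mul ((sN.mul (sσ.add sBσ) fun i => (mul_one _).le).add (sBσ.le_trans hw1)) hTw'
      · exact sT.mul (sN.mul sσ fun i => (mul_one _).le) hTw'
    unfold totalBit
    simp only [hbT]
    refine (sn.mul sBω hMM).add ((sbd.le_trans hTw').add ((Soft.add ?_ ?_).add (Soft.add ?_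
      (((sN.mul spb hwM).add ((sTs.add (.const 1 one_le)).mul hpass fun i => (one_mul _).le))))))
        |>.add ?_
    -- Finding the primes by trial division takes about `Q ^ (3 / 2)` operations, where `Q` is about
    -- `w = T M ≤ (T + M) ^ 2`.
    · have sqr : Soft w (fun i => Nat.sqrt (b i).Q) fun i => T i + M i :=
        (sQ.le_trans fun i => by rw [hw']; nlinarith [hT1 i]).sqrt
      exact sQ.mul ((sqr.add (.const 1 fun i => (hT1 i).trans (Nat.le_add_right _ _))).mul
        (sBQ4.const_mul 5) fun i => (mul_one _).le) fun i => le_rfl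
    · exact sN.mul sBQ4 fun i => (mul_one _).le.trans (hwG i)
    · exact ((((sK.mul (.const 2 one_le) fun i => (mul_one _).le).add (.const 1 hM1))).mul sBω hMM)
    · exact sT.mul (sn.mul (sBω.const_mul 2) fun i => le_rfl) fun i => by
        rw [← mul_assoc, ← hw']; exact hwM i

end

/-! ### Soft-Oh -/

theorem one_le_logb {ψ : ℝ} (hψ : 0 ≤ ψ) : 1 ≤ Real.logb 2 (3 + ψ) := by
  rw [Real.le_logb_iff_rpow_le (by norm_num) (by linarith), Real.rpow_one]
  linarith

theorem size_le_logb {w : ℕ} {ψ : ℝ} (hw : (w : ℝ) ≤ 2 * ψ) :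
    ((w.size + 1 : ℕ) : ℝ) ≤ 4 * Real.logb 2 (3 + ψ) := by
  have hψ : 0 ≤ ψ := by have : (0 : ℝ) ≤ w := Nat.cast_nonneg _; linarith
  have h1 := one_le_logb hψ
  rcases Nat.eq_zero_or_pos w with rfl | hw0
  · simp; linarith
  · have h2 : w.size - 1 < w.size := Nat.sub_lt (Nat.size_pos.2 hw0) one_pos
    rw [Nat.lt_size] at h2
    have h3 : ((w.size - 1 : ℕ) : ℝ) ≤ Real.logb 2 (2 * (3 + ψ)) := by
      rw [Real.le_logb_iff_rpow_le (by norm_num) (by linarith), Real.rpow_natCast]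
      have : ((2 ^ (w.size - 1) : ℕ) : ℝ) ≤ w := Nat.cast_le.2 h2
      push_cast at this
      linarith
    rw [Real.logb_mul (by norm_num) (by linarith), Real.logb_self_eq_one (by norm_num),
      Nat.cast_sub (Nat.size_pos.2 hw0)] at h3
    push_cast at h3 ⊢
    linarith

theorem softOh_mono {k k' : ℕ} (h : k ≤ k') {ψ : ℝ} (hψ : 0 ≤ ψ) : softOh k ψ ≤ softOh k' ψ :=
  mul_le_mul_of_nonneg_left (pow_le_pow_right₀ (one_le_logb hψ) h) hψ

theorem softOh_nonneg (k : ℕ) {ψ : ℝ} (hψ : 0 ≤ ψ) : 0 ≤ softOh k ψ :=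
  mul_nonneg hψ (pow_nonneg (zero_le_one.trans (one_le_logb hψ)) k)

/-- From bounds with bit lengths to bounds with real logarithms. -/
theorem le_softOh {x y w C k : ℕ} {ψ c : ℝ} (hx : x ≤ C * ((w.size + 1) ^ k * y))
    (hw : (w : ℝ) ≤ 2 * ψ) (hy : (y : ℝ) ≤ c * ψ) : (x : ℝ) ≤ C * 4 ^ k * c * softOh k ψ := by
  have hψ : 0 ≤ ψ := by have : (0 : ℝ) ≤ w := Nat.cast_nonneg _; linarith
  have h1 := size_le_logb hw
  have h2 : 0 ≤ Real.logb 2 (3 + ψ) := zero_le_one.trans (one_le_logb hψ)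
  calc (x : ℝ) ≤ ((C * ((w.size + 1) ^ k * y) : ℕ) : ℝ) := Nat.cast_le.2 hx
    _ = C * (((w.size + 1 : ℕ) : ℝ) ^ k * y) := by push_cast; ring
    _ ≤ C * ((4 * Real.logb 2 (3 + ψ)) ^ k * (c * ψ)) := by gcongr
    _ = C * 4 ^ k * c * softOh k ψ := by rw [softOh, mul_pow]; ring

theorem clog_le_two_mul_logb {D : ℕ} (hD : 2 ≤ D) :
    1 ≤ Real.logb 2 D ∧ (Nat.clog 2 D : ℝ) ≤ 2 * Real.logb 2 D := by
  have hD' : (2 : ℝ) ≤ D := by exact_mod_cast hD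
  have h1 : 1 ≤ Real.logb 2 D := by
    rwa [Real.le_logb_iff_rpow_le (by norm_num) (by linarith), Real.rpow_one]
  refine ⟨h1, ?_⟩
  have h2 : Nat.clog 2 D - 1 < Nat.clog 2 D :=
    Nat.sub_lt (Nat.clog_pos (by norm_num) hD) one_pos
  rw [Nat.lt_clog_iff_pow_lt (by norm_num)] at h2
  have h3 : ((Nat.clog 2 D - 1 : ℕ) : ℝ) ≤ Real.logb 2 D := by
    rw [Real.le_logb_iff_rpow_le (by norm_num) (by linarith), Real.rpow_natCast]
    exact_mod_cast h2.le
  rw [Nat.cast_sub (Nat.clog_pos (by norm_num) hD)] at h3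
  push_cast at h3
  linarith

end SLPInterp

namespace SLPInterp

open Timed

/-- The largest width to which the bound `B w ≤ β * (w + 1)` is applied. The fields of the budget
that it refers to do not depend on `β`. -/
def maxWidth (B : ℕ → ℕ) (L n T D : ℕ) : ℕ :=
  2 * ((budget B 0 L n T D).long + (budget B 0 L n T D).primes * (budget B 0 L n T D).short) + 2

/-- The budgeted totals are softly bounded as claimed. As `D ≥ 2`, the rounded logarithm in the
bounds exceeds `log₂ D` at most by the factor `2`. -/
theorem exists_softOh_total {B : ℕ → ℕ} (hB : QuasiLin B) (C r : ℕ) :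
    ∃ (A : ℝ) (k : ℕ), ∀ L n T D : ℕ, 1 ≤ L → 1 ≤ n → 1 ≤ T → 2 ≤ D →
      (totalRing (budget B (C * ((maxWidth B L n T D).size + 1) ^ r) L n T D) B L : ℝ) ≤
        A * softOh k ((L : ℝ) * (n : ℝ) ^ 2 * (T : ℝ) ^ 2 * Real.logb 2 (D : ℝ) ^ 2
          + (L : ℝ) * (n : ℝ) ^ 3 * (T : ℝ) * Real.logb 2 (D : ℝ) ^ 3) ∧
      (totalBit (budget B (C * ((maxWidth B L n T D).size + 1) ^ r) L n T D) B n : ℝ) ≤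
        A * softOh k ((n : ℝ) ^ 2 * (T : ℝ) * Real.logb 2 (D : ℝ) ^ 2
          + (n : ℝ) * (T : ℝ) ^ 2 * Real.logb 2 (D : ℝ)) := by
  have key := soft_total
    (ι := {x : ℕ × ℕ × ℕ × ℕ // 1 ≤ x.1 ∧ 1 ≤ x.2.1 ∧ 1 ≤ x.2.2.1 ∧ 2 ≤ x.2.2.2})
    (L := fun x => x.1.1) (n := fun x => x.1.2.1) (T := fun x => x.1.2.2.1)
    (D := fun x => x.1.2.2.2) hB
    (fun x => C * ((maxWidth B x.1.1 x.1.2.1 x.1.2.2.1 x.1.2.2.2).size + 1) ^ r) _ _ rfl rfl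
    (fun x => x.2.1) (fun x => x.2.2.1) (fun x => x.2.2.2.1) (fun x => x.2.2.2.2) fun h =>
      (((h.size (j := 1) fun i => (pow_one _).ge).add (.const 1 fun _ => le_rfl)).pow_one
        r).const_mul C
  obtain ⟨⟨C₁, k₁, h₁⟩, ⟨C₂, k₂, h₂⟩⟩ := key
  refine ⟨C₁ * 4 ^ k₁ * 8 + C₂ * 4 ^ k₂ * 8, k₁ + k₂, fun L n T D hL hn hT hD => ?_⟩
  have h₁ := h₁ ⟨(L, n, T, D), hL, hn, hT, hD⟩
  have h₂ := h₂ ⟨(L, n, T, D), hL, hn, hT, hD⟩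
  dsimp only at h₁ h₂
  obtain ⟨hl1, hl2⟩ := clog_le_two_mul_logb hD
  set l : ℕ := Nat.clog 2 D
  set lg : ℝ := Real.logb 2 D
  have hL' : (1 : ℝ) ≤ L := by exact_mod_cast hL
  have hn' : (1 : ℝ) ≤ n := by exact_mod_cast hn
  have hT' : (1 : ℝ) ≤ T := by exact_mod_cast hT
  have hl0 : (0 : ℝ) ≤ l := Nat.cast_nonneg _
  have hlg : (0 : ℝ) ≤ lg := by linarith
  have hw : ((T * (n * l) : ℕ) : ℝ) ≤ 2 * (T * (n * lg)) := by
    push_cast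
    calc (T : ℝ) * (n * l) ≤ T * (n * (2 * lg)) := by gcongr
      _ = _ := by ring
  have hv : 1 ≤ T * (n * lg) := by
    calc (1 : ℝ) = 1 * (1 * 1) := by norm_num
      _ ≤ T * (n * lg) := by gcongr
  set ψ₁ : ℝ := L * (n : ℝ) ^ 2 * (T : ℝ) ^ 2 * lg ^ 2 + L * (n : ℝ) ^ 3 * T * lg ^ 3 with hψ₁
  set ψ₂ : ℝ := (n : ℝ) ^ 2 * T * lg ^ 2 + n * (T : ℝ) ^ 2 * lg with hψ₂
  have e₁ : T * (n * lg) ≤ ψ₁ := by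
    have : T * (n * lg) ≤ L * (T * (n * lg)) * (T * (n * lg)) := by
      calc T * (n * lg) = 1 * (T * (n * lg)) * 1 := by ring
        _ ≤ _ := by gcongr
    have h0 : 0 ≤ L * (n : ℝ) ^ 3 * T * lg ^ 3 := by positivity
    rw [hψ₁]
    linarith
  have e₂ : T * (n * lg) ≤ ψ₂ := by
    have : T * (n * lg) ≤ T * (T * (n * lg)) :=
      le_mul_of_one_le_left (by linarith) hT'
    have h0 : 0 ≤ (n : ℝ) ^ 2 * T * lg ^ 2 := by positivity
    rw [hψ₂]
    linarith
  have f₁ : ((L * (T * (n * l) * (T * (n * l)) + T * (n * l) * (n * l * (n * l))) : ℕ) : ℝ) ≤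
      8 * ψ₁ := by
    push_cast
    calc (L : ℝ) * (T * (n * l) * (T * (n * l)) + T * (n * l) * (n * l * (n * l)))
        ≤ L * (T * (n * (2 * lg)) * (T * (n * (2 * lg))) +
          T * (n * (2 * lg)) * (n * (2 * lg) * (n * (2 * lg)))) := by gcongr
      _ = 4 * (L * (n : ℝ) ^ 2 * (T : ℝ) ^ 2 * lg ^ 2) + 8 * (L * (n : ℝ) ^ 3 * T * lg ^ 3) := by
        ring
      _ ≤ 8 * ψ₁ := by
        have h0 : 0 ≤ L * (n : ℝ) ^ 2 * (T : ℝ) ^ 2 * lg ^ 2 := by positivity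
        rw [hψ₁]
        linarith
  have f₂ : ((T * (n * l) * (T + n * l) : ℕ) : ℝ) ≤ 8 * ψ₂ := by
    push_cast
    calc (T : ℝ) * (n * l) * (T + n * l)
        ≤ T * (n * (2 * lg)) * (T + n * (2 * lg)) := by gcongr
      _ = 2 * (n * (T : ℝ) ^ 2 * lg) + 4 * ((n : ℝ) ^ 2 * T * lg ^ 2) := by ring
      _ ≤ 8 * ψ₂ := by
        have h0 : 0 ≤ n * (T : ℝ) ^ 2 * lg := by positivity
        have h3 : 0 ≤ (n : ℝ) ^ 2 * T * lg ^ 2 := by positivity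
        rw [hψ₂]
        linarith
  have p₁ : 0 ≤ ψ₁ := by linarith
  have p₂ : 0 ≤ ψ₂ := by linarith
  constructor
  · refine (le_softOh h₁ (hw.trans (by linarith)) f₁).trans ?_
    exact mul_le_mul (le_add_of_nonneg_right (by positivity))
      (softOh_mono (Nat.le_add_right _ _) p₁) (softOh_nonneg _ p₁) (by positivity)
  · refine (le_softOh h₂ (hw.trans (by linarith)) f₂).trans ?_
    exact mul_le_mul (le_add_of_nonneg_left (by positivity))
      (softOh_mono (Nat.le_add_left _ _) p₂) (softOh_nonneg _ p₂) (by positivity)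

end SLPInterp
theorem theorem4p5 :
    ∃ 𝔸 : SLPInterp.Arith, SLPInterp.Arith.Correct.{u} 𝔸 ∧ ∃ (C : ℝ) (k : ℕ),
      ∀ (R : Type u) [CommRing R] [DecidableEq R] (n T D : ℕ) (S : SLPInterp.SLP R n),
        S.poly.support.card ≤ T → S.poly.totalDegree < D →
        SLPInterp.ListsTerms (SLPInterp.mPolySIKron 𝔸 S T D).val S.poly ∧
        (1 ≤ n → 1 ≤ T → 2 ≤ D →
          ((SLPInterp.mPolySIKron 𝔸 S T D).ringOps : ℝ) ≤
            C * SLPInterp.softOh k ((S.size : ℝ) * (n : ℝ) ^ 2 * (T : ℝ) ^ 2 * Real.logb 2 (D : ℝ) ^ 2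
              + (S.size : ℝ) * (n : ℝ) ^ 3 * (T : ℝ) * Real.logb 2 (D : ℝ) ^ 3) ∧
          ((SLPInterp.mPolySIKron 𝔸 S T D).bitOps : ℝ) ≤
            C * SLPInterp.softOh k ((n : ℝ) ^ 2 * (T : ℝ) * Real.logb 2 (D : ℝ) ^ 2
              + (n : ℝ) * (T : ℝ) ^ 2 * Real.logb 2 (D : ℝ))) := by
  obtain ⟨𝔸, hA, μ, ⟨C₀, r, hμ⟩, hconv, hcirc⟩ := SLPInterp.exists_arith.{u}
  obtain ⟨C, k, hC⟩ := SLPInterp.exists_softOh_total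
    (B := fun w => C₀ * ((w + 1) * (w.size + 1) ^ r)) ⟨C₀, r, fun w => le_rfl⟩ C₀ r
  refine ⟨𝔸, hA, C, k, fun R _ _ n T D S hT hD => ?_⟩
  have hB : SLPInterp.CircBound 𝔸 fun w => C₀ * ((w + 1) * (w.size + 1) ^ r) :=
    { mono := fun a b h => by
        have := Nat.size_le_size h
        dsimp only
        gcongr
      cost_le := fun op w => (hcirc op w).trans (hμ w) }
  obtain ⟨l, hl, hc⟩ := SLPInterp.costs_mPolySIKron hA hB
    (fun m => (hconv m).trans (hμ m)) S hT hD
    (β := C₀ * ((SLPInterp.maxWidth (fun w => C₀ * ((w + 1) * (w.size + 1) ^ r))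
      S.size n T D).size + 1) ^ r)
    fun w hw => by
      have h1 := Nat.size_le_size hw
      calc C₀ * ((w + 1) * (w.size + 1) ^ r) = C₀ * (w.size + 1) ^ r * (w + 1) := by ring
        _ ≤ _ := Nat.mul_le_mul_right _
          (Nat.mul_le_mul_left _ (Nat.pow_le_pow_left (Nat.succ_le_succ h1) _))
  refine ⟨hc.val_eq ▸ hl, fun hn hT1 hD2 => ?_⟩
  have h := hC S.size n T D (List.length_pos_iff.2 S.code_ne_nil) hn hT1 hD2
  exact ⟨(Nat.cast_le.2 hc.ringOps_le).trans h.1, (Nat.cast_le.2 hc.bitOps_le).trans h.2⟩
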